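/- **Energy inequality for the sharp interface model of two-phase flow with soluble surfactant.** Setting. Let $d\in\{1,2,3\}$, let $I$ be an open time interval and $\Omega\subset\mathbb R^d$ open. Let $I\times\Omega$ be the disjoint union of two open sets $\Omega^{(1)},\Omega^{(2)}$ and of an evolving $C^2$ hypersurface $\Gamma$ separating them, with time slices $\Omega^{(i)}(t),\Gamma(t)$, unit normal $\nu$ of $\Gamma(t)$ pointing into $\Omega^{(2)}(t)$, normal velocity $u_\Gamma$ and mean curvature $\kappa=-\nabla_\Gamma\cdot\nu$. Write $[f]_1^2=f^{(2)}-f^{(1)}$ for jumps across $\Gamma$, $\partial_t^\bullet=\partial_t+v\cdot\nabla$, and $\nabla_\Gamma$, $\nabla_\Gamma\cdot$ for the surface gradient and divergence. Let $\overline\rho^{(i)}>0$ be constants, let $v$, the symmetric stress tensors $T^{(i)}$, the bulk surfactant densities $c^{(i)}$ and the fluxes $J_c^{(i)}$ be $C^1$ in $\Omega^{(i)}$ up to $\Gamma$ (from each side), and let the interfacial density $c^\Gamma$ and the tangential flux $J_\Gamma$ be $C^1$ on $\Gamma$. Let $G_1,G_2,\gamma$ be $C^2$ on open sets containing the values of $c^{(1)},c^{(2)},c^\Gamma$,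 with $G_i''>0$, $\gamma''>0$, and let $\sigma(s)=\gamma(s)-s\gamma'(s)$. Assume the balance laws $$\nabla\cdot v=0,\quad \overline\rho^{(i)}\partial_t^\bullet v=\nabla\cdot T^{(i)},\quad \partial_t^\bullet c^{(i)}+\nabla\cdot J_c^{(i)}=0\quad\text{in }\Omega^{(i)},\ i=1,2,$$ $$[v]_1^2=0,\quad v\cdot\nu=u_\Gamma,\quad \partial_t^\bullet c^\Gamma+c^\Gamma\nabla_\Gamma\cdot v=-\nabla_\Gamma\cdot J_\Gamma-[J_c]_1^2\cdot\nu\quad\text{on }\Gamma.$$ A material test volume is a family $V(t)\subset\Omega$, $t\in I$, transported by the flow of $v$. It is called regular at time $t$ if $V(t)$ is open, relatively compact in $\Omega$, and has piecewise $C^2$ boundary transversal to $\Gamma(t)$, in the following sense: near a boundary point in $\Omega^{(i)}(t)$ the set $V(t)$ is $\{\psi_1<0,\dots,\psi_k<0\}$ for $C^2$ functions vanishing at that point and having linearly independent gradients there; near a boundary point on $\Gamma(t)$ the same holds within $\Omega^{(i)}(t)\cup\Gamma(t)$ for each $i$ (with functions that may depend on $i$), the gradients being linearly independent together with $\nu$.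 Let $\nu_{ext}$ be the external unit normal of $V\cap\Omega^{(i)}$, $\mu$ the external unit co-normal of $V\cap\Gamma$ in $\Gamma$ (both defined almost everywhere on the boundary), and $v_\tau$ the tangential part of $v$ on $\Gamma$. Boundary integrals are with respect to surface measure, and $\partial(V\cap\Gamma)$ is the boundary relative to $\Gamma(t)$, which is empty if $d=1$. (a) Assume the sign conditions $$J_c^{(i)}\cdot\nabla G_i'(c^{(i)})\le0,\qquad T^{(i)}:\nabla v\ge0\qquad\text{in }\Omega^{(i)},\ i=1,2,$$ $$J_\Gamma\cdot\nabla_\Gamma\gamma'(c^\Gamma)\le0,\qquad (-1)^{i+1}(J_c^{(i)}\cdot\nu)\,(\gamma'(c^\Gamma)-G_i'(c^{(i)}))\le0\ (i=1,2)\qquad\text{on }\Gamma,$$ $$\bigl(-[T]_1^2\nu-\sigma(c^\Gamma)\kappa\nu-\nabla_\Gamma\sigma(c^\Gamma)\bigr)\cdot v\le0\qquad\text{on }\Gamma.$$ Then for every material test volume $V$ and every $t\in I$ at which it is regular, all the integrals below converge absolutely, the energy is differentiable at $t$, and $$\frac{d}{dt}\Bigl(\sum_{i=1}^2\int_{V(t)\cap\Omega^{(i)}(t)}\bigl(\tfrac{\overline\rho^{(i)}}2|v|^2+G_i(c^{(i)})\bigr)+\int_{V(t)\cap\Gamma(t)}\gamma(c^\Gamma)\Bigr)$$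 $$\le\sum_{i=1}^2\int_{\partial(V(t)\cap\Omega^{(i)}(t))\setminus\Gamma(t)}\bigl((T^{(i)})^{\top}v-G_i'(c^{(i)})J_c^{(i)}\bigr)\cdot\nu_{ext}+\int_{\partial(V(t)\cap\Gamma(t))}\bigl(-\gamma'(c^\Gamma)J_\Gamma\cdot\mu+\sigma(c^\Gamma)v_\tau\cdot\mu\bigr).$$ (b) The constitutive laws $$J_c^{(i)}=-M_c^{(i)}(c^{(i)})\nabla G_i'(c^{(i)}),\quad T^{(i)}=-pI+2\eta^{(i)}D(v)\ \text{ in }\Omega^{(i)},\qquad J_\Gamma=-M_\Gamma(c^\Gamma)\nabla_\Gamma\gamma'(c^\Gamma)\ \text{ on }\Gamma,$$ $$\alpha^{(i)}(c^\Gamma,c^{(i)})(-1)^{i+1}J_c^{(i)}\cdot\nu=-(\gamma'(c^\Gamma)-G_i'(c^{(i)})),\qquad -[T]_1^2\nu=\sigma(c^\Gamma)\kappa\nu+\nabla_\Gamma\sigma(c^\Gamma)\ \text{ on }\Gamma,$$ with $D(v)=\frac12(\nabla v+(\nabla v)^\top)$, $M_c^{(i)}>0$, $M_\Gamma>0$,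 $\alpha^{(i)}\ge0$, $\eta^{(i)}\ge0$, imply all the sign conditions of (a), and hence the energy inequality. -/

import Mathlib

open MeasureTheory Filter Topology
open scoped Gradient InnerProductSpace

noncomputable section

namespace SurfactantFlow

/-- Euclidean space of dimension `d`. -/
abbrev Space (d : ℕ) : Type := EuclideanSpace ℝ (Fin d)

/-- Space-time; a point is a pair `(t, x)`. -/
abbrev SpaceTime (d : ℕ) : Type := ℝ × Space d

/-- The slice at time `t` of a set of space-time points. -/
def slice {d : ℕ} (A : Set (SpaceTime d)) (t : ℝ) : Set (Space d) := {x | (t, x) ∈ A}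

/-! ### Differential operators on space-time fields -/

section Operators

variable {d : ℕ} {F : Type*} [NormedAddCommGroup F] [NormedSpace ℝ F]

/-- `∂ₜ f`. -/
def timeDeriv (f : SpaceTime d → F) (z : SpaceTime d) : F :=
  deriv (fun s => f (s, z.2)) z.1

/-- The derivative with respect to the space variable (for a vector field `w`, the matrix with
entries `∂ⱼ wᵢ`). -/
def spaceDeriv (f : SpaceTime d → F) (z : SpaceTime d) : Space d →L[ℝ] F :=
  fderiv ℝ (fun y => f (z.1, y)) z.2

/-- The spatial gradient of a scalar field. -/
def grad (f : SpaceTime d → ℝ) (z : SpaceTime d) : Space d :=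
  ∇ (fun y => f (z.1, y)) z.2

/-- The material derivative `∂ₜ f + (v · ∇) f`. -/
def materialDeriv (v : SpaceTime d → Space d) (f : SpaceTime d → F) (z : SpaceTime d) : F :=
  timeDeriv f z + spaceDeriv f z (v z)

/-- The spatial divergence of a vector field. -/
def div (w : SpaceTime d → Space d) (z : SpaceTime d) : ℝ :=
  LinearMap.trace ℝ (Space d) (spaceDeriv w z : Space d →ₗ[ℝ] Space d)

/-- The spatial divergence of a tensor field, `(∇ · T)ₖ = ∑ⱼ ∂ⱼ Tₖⱼ`. -/
def tensorDiv (T : SpaceTime d → Space d →L[ℝ] Space d) (z : SpaceTime d) : Space d :=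
  ∑ j : Fin d, spaceDeriv T z (EuclideanSpace.single j 1) (EuclideanSpace.single j 1)

/-- The component of `w` orthogonal to the unit vector `n`. -/
def tangentialPart (n w : Space d) : Space d := w - ⟪w, n⟫_ℝ • n

/-- The surface gradient `∇_Γ f = (I - ν ⊗ ν) ∇ f`. At points of `Γ` it depends only on the values
of `f` on `Γ`. -/
def surfGrad (ν : SpaceTime d → Space d) (f : SpaceTime d → ℝ) (z : SpaceTime d) : Space d :=
  tangentialPart (ν z) (grad f z)

/-- The surface divergence `∇_Γ · w = tr ((I - ν ⊗ ν) ∇ w)`. At points of `Γ` it depends only on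
the values of `w` on `Γ`. -/
def surfDiv (ν : SpaceTime d → Space d) (w : SpaceTime d → Space d) (z : SpaceTime d) : ℝ :=
  div w z - ⟪spaceDeriv w z (ν z), ν z⟫_ℝ

/-- The mean curvature `κ = - ∇_Γ · ν`. -/
def meanCurvature (ν : SpaceTime d → Space d) (z : SpaceTime d) : ℝ := -surfDiv ν ν z

/-- The double contraction `A : B = tr (Aᵀ B)`. -/
def doubleContraction (A B : Space d →L[ℝ] Space d) : ℝ :=
  LinearMap.trace ℝ (Space d)
    ((ContinuousLinearMap.adjoint A ∘L B : Space d →L[ℝ] Space d) : Space d →ₗ[ℝ] Space d)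

/-- The rate of deformation tensor `D(v) = ½ (∇v + (∇v)ᵀ)`. -/
def rateOfDeformation (v : SpaceTime d → Space d) (z : SpaceTime d) : Space d →L[ℝ] Space d :=
  (1 / 2 : ℝ) • (spaceDeriv v z + ContinuousLinearMap.adjoint (spaceDeriv v z))

end Operators

/-! ### Unit normals and co-normals -/

section Normals

variable {d : ℕ}

/-- `n` is the external unit normal of the set `W` at the boundary point `x`, where `W` has a
`C¹` boundary. -/
def IsOuterNormal (W : Set (Space d)) (x n : Space d) : Prop :=
  ∃ ψ : Space d → ℝ, ContDiffAt ℝ 1 ψ x ∧ ψ x = 0 ∧ ∇ ψ x ≠ 0 ∧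
    (∀ᶠ y in 𝓝 x, (y ∈ W ↔ ψ y < 0)) ∧ n = ‖∇ ψ x‖⁻¹ • ∇ ψ x

open Classical in
/-- The external unit normal of `W` at `x` (zero where there is none, e.g. at an edge). -/
def outerNormal (W : Set (Space d)) (x : Space d) : Space d :=
  if h : ∃ n, IsOuterNormal W x n then h.choose else 0

/-- `m` is the external unit co-normal at `x` of the part of the hypersurface `M`, with unit normal
`n` at `x`, that lies in `V`: the unit vector tangent to `M`, normal to the boundary of `M ∩ V`
in `M`, and pointing out of `V`. -/
def IsOuterConormal (M : Set (Space d)) (n : Space d) (V : Set (Space d)) (x m : Space d) : Prop :=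
  ∃ ψ : Space d → ℝ, ContDiffAt ℝ 1 ψ x ∧ ψ x = 0 ∧ tangentialPart n (∇ ψ x) ≠ 0 ∧
    (∀ᶠ y in 𝓝[M] x, (y ∈ V ↔ ψ y < 0)) ∧
    m = ‖tangentialPart n (∇ ψ x)‖⁻¹ • tangentialPart n (∇ ψ x)

open Classical in
/-- The external unit co-normal of `M ∩ V` at `x` (zero where there is none). -/
def outerConormal (M : Set (Space d)) (n : Space d) (V : Set (Space d)) (x : Space d) : Space d :=
  if h : ∃ m, IsOuterConormal M n V x m then h.choose else 0

/-- The boundary, relative to `M`, of the subset `S` of `M`. -/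
def relBoundary (M S : Set (Space d)) : Set (Space d) := M ∩ closure S ∩ closure (M \ S)

end Normals

/-! ### The two-phase system -/

/-- The unknowns and the material data of a two-phase flow with surfactant. The index `i : Fin 2`
numbers the two fluids: `0` stands for fluid 1 and `1` for fluid 2. A bulk field of fluid `i`
matters only on the closure of the phase (the phase together with the interface), an interface
field only on the interface. -/
structure TwoPhaseSystem (d : ℕ) where
  /-- the time interval -/
  times : Set ℝ
  /-- the spatial domain `Ω` -/
  domain : Set (Space d)
  /-- the space-time set occupied by fluid `i` -/
  phase : Fin 2 → Set (SpaceTime d)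
  /-- the space-time interface `Γ` -/
  interface : Set (SpaceTime d)
  /-- the unit normal `ν` of `Γ(t)` pointing into the second phase -/
  normal : SpaceTime d → Space d
  /-- the normal velocity `u_Γ` of the interface -/
  normalVelocity : SpaceTime d → ℝ
  /-- the constant mass densities -/
  density : Fin 2 → ℝ
  /-- the bulk free energy densities `G_i` -/
  bulkEnergy : Fin 2 → ℝ → ℝ
  /-- the bulk surfactant densities for which `G_i` is defined -/
  bulkRange : Fin 2 → Set ℝ
  /-- the surface free energy density `γ` -/
  surfEnergy : ℝ → ℝ
  /-- the interface surfactant densities for which `γ` is defined -/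
  surfRange : Set ℝ
  /-- the fluid velocity in fluid `i` -/
  velocity : Fin 2 → SpaceTime d → Space d
  /-- the stress tensor `T^(i)` -/
  stress : Fin 2 → SpaceTime d → Space d →L[ℝ] Space d
  /-- the bulk surfactant density `c^(i)` -/
  conc : Fin 2 → SpaceTime d → ℝ
  /-- the bulk molecular flux `J_c^(i)` -/
  flux : Fin 2 → SpaceTime d → Space d
  /-- the interface surfactant density `c^Γ` -/
  surfConc : SpaceTime d → ℝ
  /-- the interfacial molecular flux `J_Γ` -/
  surfFlux : SpaceTime d → Space d

namespace TwoPhaseSystem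

variable {d : ℕ} (S : TwoPhaseSystem d)

/-- Phase `i` together with the interface: the closure of the phase relative to the domain. -/
def closedPhase (i : Fin 2) : Set (SpaceTime d) := S.phase i ∪ S.interface

/-- The bulk chemical potential `G_i'(c^(i))`. -/
def bulkPotential (i : Fin 2) (z : SpaceTime d) : ℝ := deriv (S.bulkEnergy i) (S.conc i z)

/-- The interface chemical potential `γ'(c^Γ)`. -/
def surfPotential (z : SpaceTime d) : ℝ := deriv S.surfEnergy (S.surfConc z)

/-- The density dependent surface tension `σ(s) = γ(s) - s γ'(s)`. -/
def surfaceTension (s : ℝ) : ℝ := S.surfEnergy s - s * deriv S.surfEnergy s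

/-- The jump `[T]₁² ν` of the normal stress across the interface. -/
def stressJump (z : SpaceTime d) : Space d :=
  S.stress 1 z (S.normal z) - S.stress 0 z (S.normal z)

/-- The fluid velocity in the whole domain (on the interface the two velocities agree). -/
def fluidVelocity (z : SpaceTime d) : Space d :=
  open Classical in if z ∈ S.phase 0 then S.velocity 0 z else S.velocity 1 z

/-- The geometric setting: the space-time domain is the disjoint union of the two open phases and
of a `C²` evolving hypersurface with unit normal `ν` pointing into the second phase and with normal
velocity `u_Γ`. -/
structure IsEvolvingInterface : Prop where
  isOpen_times : IsOpen S.times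
  ordConnected_times : S.times.OrdConnected
  isOpen_domain : IsOpen S.domain
  isOpen_phase : ∀ i, IsOpen (S.phase i)
  disjoint_phases : Disjoint (S.phase 0) (S.phase 1)
  disjoint_interface : ∀ i, Disjoint (S.phase i) S.interface
  cover : S.phase 0 ∪ S.phase 1 ∪ S.interface = S.times ×ˢ S.domain
  hypersurface : ∀ z ∈ S.interface, ∃ ψ : SpaceTime d → ℝ,
    ContDiffAt ℝ 2 ψ z ∧ grad ψ z ≠ 0 ∧
    ∀ᶠ y in 𝓝 z, (y ∈ S.phase 0 ↔ ψ y < 0) ∧ (y ∈ S.interface ↔ ψ y = 0) ∧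
      (y ∈ S.phase 1 ↔ 0 < ψ y) ∧
      (y ∈ S.interface → S.normal y = ‖grad ψ y‖⁻¹ • grad ψ y ∧
        S.normalVelocity y = -(timeDeriv ψ y / ‖grad ψ y‖))
  smooth_normal : ∀ z ∈ S.interface, ContDiffAt ℝ 1 S.normal z

/-- The free energies are of class `C²` and have positive second derivative, and the surfactant
densities take values where they are defined. -/
structure HasConvexEnergies : Prop where
  isOpen_bulkRange : ∀ i, IsOpen (S.bulkRange i)
  bulk_smooth : ∀ i, ContDiffOn ℝ 2 (S.bulkEnergy i) (S.bulkRange i)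
  bulk_convex : ∀ i, ∀ s ∈ S.bulkRange i, 0 < deriv (deriv (S.bulkEnergy i)) s
  isOpen_surfRange : IsOpen S.surfRange
  surf_smooth : ContDiffOn ℝ 2 S.surfEnergy S.surfRange
  surf_convex : ∀ s ∈ S.surfRange, 0 < deriv (deriv S.surfEnergy) s
  conc_mem : ∀ i, ∀ z ∈ S.closedPhase i, S.conc i z ∈ S.bulkRange i
  surfConc_mem : ∀ z ∈ S.interface, S.surfConc z ∈ S.surfRange

/-- Each bulk field is of class `C¹` up to the interface from its own side, that is, it extends to
a `C¹` field near every point of the closed phase; the interface fields are of class `C¹`, that is,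
they extend to `C¹` fields near every point of the interface. -/
structure HasSmoothFields : Prop where
  velocity : ∀ i, ∀ z ∈ S.closedPhase i, ContDiffAt ℝ 1 (S.velocity i) z
  stress : ∀ i, ∀ z ∈ S.closedPhase i, ContDiffAt ℝ 1 (S.stress i) z
  conc : ∀ i, ∀ z ∈ S.closedPhase i, ContDiffAt ℝ 1 (S.conc i) z
  flux : ∀ i, ∀ z ∈ S.closedPhase i, ContDiffAt ℝ 1 (S.flux i) z
  surfConc : ∀ z ∈ S.interface, ContDiffAt ℝ 1 S.surfConc z
  surfFlux : ∀ z ∈ S.interface, ContDiffAt ℝ 1 S.surfFlux z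

/-- The balance equations: mass, momentum and surfactant in the bulk; on the interface, continuity
of the velocity, transport of the interface with the flow, and surfactant balance
`∂ₜ• c^Γ + c^Γ ∇_Γ·v = -∇_Γ·J_Γ - [J_c]₁²·ν` with a tangential interfacial flux. (On the interface
`∂ₜ•` and `∇_Γ·` may be computed with the velocity of either fluid.) -/
structure SatisfiesBalanceLaws : Prop where
  density_pos : ∀ i, 0 < S.density i
  stress_symm : ∀ i, ∀ z ∈ S.closedPhase i,
    ContinuousLinearMap.adjoint (S.stress i z) = S.stress i z
  incompressible : ∀ i, ∀ z ∈ S.phase i, div (S.velocity i) z = 0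
  momentum : ∀ i, ∀ z ∈ S.phase i,
    S.density i • materialDeriv (S.velocity i) (S.velocity i) z = tensorDiv (S.stress i) z
  bulk_surfactant : ∀ i, ∀ z ∈ S.phase i,
    materialDeriv (S.velocity i) (S.conc i) z + div (S.flux i) z = 0
  no_slip : ∀ z ∈ S.interface, S.velocity 0 z = S.velocity 1 z
  transported : ∀ z ∈ S.interface, ⟪S.velocity 0 z, S.normal z⟫_ℝ = S.normalVelocity z
  surfFlux_tangential : ∀ z ∈ S.interface, ⟪S.surfFlux z, S.normal z⟫_ℝ = 0
  surf_surfactant : ∀ z ∈ S.interface,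
    materialDeriv (S.velocity 0) S.surfConc z
        + S.surfConc z * surfDiv S.normal (S.velocity 0) z
      = -surfDiv S.normal S.surfFlux z - ⟪S.flux 1 z - S.flux 0 z, S.normal z⟫_ℝ

/-- A smooth motion of the sharp interface model (before any constitutive law is chosen). -/
structure IsSharpInterfaceModel : Prop where
  geometry : S.IsEvolvingInterface
  energies : S.HasConvexEnergies
  smooth : S.HasSmoothFields
  balance : S.SatisfiesBalanceLaws

/-- The sign conditions. For `i = 0, 1` the sign `(-1) ^ i` is `+1` for fluid 1 and `-1` for
fluid 2. -/
structure SignConditions : Prop where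
  bulk_diffusion : ∀ i, ∀ z ∈ S.phase i, ⟪S.flux i z, grad (S.bulkPotential i) z⟫_ℝ ≤ 0
  stress_power : ∀ i, ∀ z ∈ S.phase i,
    0 ≤ doubleContraction (S.stress i z) (spaceDeriv (S.velocity i) z)
  surf_diffusion : ∀ z ∈ S.interface,
    ⟪S.surfFlux z, surfGrad S.normal S.surfPotential z⟫_ℝ ≤ 0
  adsorption : ∀ i : Fin 2, ∀ z ∈ S.interface,
    ((-1) ^ (i : ℕ) * ⟪S.flux i z, S.normal z⟫_ℝ) * (S.surfPotential z - S.bulkPotential i z) ≤ 0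
  stress_jump : ∀ z ∈ S.interface,
    ⟪-S.stressJump z - (S.surfaceTension (S.surfConc z) * meanCurvature S.normal z) • S.normal z
      - surfGrad S.normal (fun y => S.surfaceTension (S.surfConc y)) z, S.velocity 0 z⟫_ℝ ≤ 0

/-- The constitutive laws of the general model, with pressure `p`, viscosities `η`, mobilities
`M` and `MΓ` and kinetic factors `α`; the sign `(-1)^(i+1)` of fluid `i = 1, 2` is `(-1) ^ i` in
the present numbering. The kinetic factors may vanish (instantaneous adsorption). -/
structure ConstitutiveLaws (p : Fin 2 → SpaceTime d → ℝ) (η : Fin 2 → ℝ) (M : Fin 2 → ℝ → ℝ)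
    (MΓ : ℝ → ℝ) (α : Fin 2 → ℝ → ℝ → ℝ) : Prop where
  viscosity_nonneg : ∀ i, 0 ≤ η i
  mobility_pos : ∀ i, ∀ s ∈ S.bulkRange i, 0 < M i s
  surfMobility_pos : ∀ s ∈ S.surfRange, 0 < MΓ s
  kinetic_nonneg : ∀ i, ∀ r ∈ S.surfRange, ∀ s ∈ S.bulkRange i, 0 ≤ α i r s
  bulk_flux : ∀ i, ∀ z ∈ S.phase i,
    S.flux i z = -(M i (S.conc i z) • grad (S.bulkPotential i) z)
  surf_flux : ∀ z ∈ S.interface,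
    S.surfFlux z = -(MΓ (S.surfConc z) • surfGrad S.normal S.surfPotential z)
  adsorption : ∀ i : Fin 2, ∀ z ∈ S.interface,
    α i (S.surfConc z) (S.conc i z) * (-1) ^ (i : ℕ) * ⟪S.flux i z, S.normal z⟫_ℝ
      = -(S.surfPotential z - S.bulkPotential i z)
  newtonian : ∀ i, ∀ z ∈ S.phase i,
    S.stress i z = -(p i z • ContinuousLinearMap.id ℝ (Space d))
      + (2 * η i) • rateOfDeformation (S.velocity i) z
  stress_balance : ∀ z ∈ S.interface,
    -S.stressJump z
      = (S.surfaceTension (S.surfConc z) * meanCurvature S.normal z) • S.normal z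
        + surfGrad S.normal (fun y => S.surfaceTension (S.surfConc y)) z

/-! ### Material test volumes -/

/-- `V` is a material volume: for every time `s`, the set `V t` consists of the positions at time
`t` of the fluid particles that are in `V s` at time `s`. -/
def IsMaterialVolume (V : ℝ → Set (Space d)) : Prop :=
  ∀ s ∈ S.times, ∃ X : ℝ → Space d → Space d,
    (∀ x ∈ V s, X s x = x ∧ ∀ t ∈ S.times, X t x ∈ S.domain ∧
      HasDerivAt (fun r => X r x) (S.fluidVelocity (t, X t x)) t) ∧
    ∀ t ∈ S.times, V t = X t '' V s

/-- The set `V` is a regular test volume at time `t`: it is open, relatively compact in `Ω`, and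
has a piecewise `C²` boundary that is transversal to `Γ(t)`. Near a boundary point inside a phase,
`V` is the intersection of finitely many sublevel sets with independent gradients (one at a regular
point, several at an edge or a corner). Near a boundary point on the interface, the same holds in
each of the two closed phases, the gradients being independent also of the normal of the interface;
a kink of the boundary across the interface is allowed, because the flow produces it. -/
structure IsRegularTestVolume (t : ℝ) (V : Set (Space d)) : Prop where
  isOpen : IsOpen V
  isBounded : Bornology.IsBounded V
  closure_subset : closure V ⊆ S.domain
  boundary_bulk : ∀ i, ∀ x ∈ frontier V ∩ slice (S.phase i) t,
    ∃ (k : ℕ) (ψ : Fin k → Space d → ℝ),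
      (∀ j, ContDiffAt ℝ 2 (ψ j) x ∧ ψ j x = 0) ∧
      LinearIndependent ℝ (fun j => ∇ (ψ j) x) ∧
      ∀ᶠ y in 𝓝 x, (y ∈ V ↔ ∀ j, ψ j y < 0)
  boundary_interface : ∀ i, ∀ x ∈ frontier V ∩ slice S.interface t,
    ∃ (k : ℕ) (ψ : Fin k → Space d → ℝ),
      (∀ j, ContDiffAt ℝ 2 (ψ j) x ∧ ψ j x = 0) ∧
      LinearIndependent ℝ
        (Fin.cons (S.normal (t, x)) (fun j => ∇ (ψ j) x) : Fin (k + 1) → Space d) ∧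
      ∀ᶠ y in 𝓝[slice (S.closedPhase i) t] x, (y ∈ V ↔ ∀ j, ψ j y < 0)

/-! ### Energy and working -/

/-- The density `½ ρ_i |v|² + G_i(c^(i))` of kinetic and bulk free energy. -/
def bulkEnergyDensity (i : Fin 2) (z : SpaceTime d) : ℝ :=
  S.density i / 2 * ‖S.velocity i z‖ ^ 2 + S.bulkEnergy i (S.conc i z)

/-- The total energy in the test volume `V` at time `t`; `μHE[d - 1]` is surface measure. -/
def energy (V : ℝ → Set (Space d)) (t : ℝ) : ℝ :=
  (∑ i : Fin 2, ∫ x in V t ∩ slice (S.phase i) t, S.bulkEnergyDensity i (t, x))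
    + ∫ x in V t ∩ slice S.interface t, S.surfEnergy (S.surfConc (t, x)) ∂μHE[d - 1]

/-- All integrals in `energy V t` converge absolutely. -/
def EnergyIntegrable (V : ℝ → Set (Space d)) (t : ℝ) : Prop :=
  (∀ i, IntegrableOn (fun x => S.bulkEnergyDensity i (t, x)) (V t ∩ slice (S.phase i) t)) ∧
  IntegrableOn (fun x => S.surfEnergy (S.surfConc (t, x))) (V t ∩ slice S.interface t) μHE[d - 1]

/-- The part `∂(V ∩ Ω^(i)(t)) \ Γ(t)` of the boundary. -/
def outerBoundary (i : Fin 2) (V : Set (Space d)) (t : ℝ) : Set (Space d) :=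
  frontier (V ∩ slice (S.phase i) t) \ slice S.interface t

/-- The boundary `∂(V ∩ Γ(t))` of `V ∩ Γ(t)` in `Γ(t)`; it is empty in dimension one. -/
def interfaceBoundary (V : Set (Space d)) (t : ℝ) : Set (Space d) :=
  relBoundary (slice S.interface t) (V ∩ slice S.interface t)

/-- The integrand `((T^(i))ᵀ v - G_i'(c^(i)) J_c^(i)) · ν_ext`. -/
def bulkWorking (i : Fin 2) (V : Set (Space d)) (t : ℝ) (x : Space d) : ℝ :=
  ⟪ContinuousLinearMap.adjoint (S.stress i (t, x)) (S.velocity i (t, x))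
      - S.bulkPotential i (t, x) • S.flux i (t, x),
    outerNormal (V ∩ slice (S.phase i) t) x⟫_ℝ

/-- The integrand `-γ'(c^Γ) J_Γ · μ + σ(c^Γ) v_τ · μ`. -/
def surfWorking (V : Set (Space d)) (t : ℝ) (x : Space d) : ℝ :=
  -(S.surfPotential (t, x)
      * ⟪S.surfFlux (t, x), outerConormal (slice S.interface t) (S.normal (t, x)) V x⟫_ℝ)
    + S.surfaceTension (S.surfConc (t, x))
      * ⟪tangentialPart (S.normal (t, x)) (S.velocity 0 (t, x)),
          outerConormal (slice S.interface t) (S.normal (t, x)) V x⟫_ℝ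

/-- The working on the test volume `V` at time `t` through its boundary. In dimension one the
second integral is over the empty set. -/
def working (V : Set (Space d)) (t : ℝ) : ℝ :=
  (∑ i : Fin 2, ∫ x in S.outerBoundary i V t, S.bulkWorking i V t x ∂μHE[d - 1])
    + ∫ x in S.interfaceBoundary V t, S.surfWorking V t x ∂μHE[d - 2]

/-- All integrals in `working V t` converge absolutely. -/
def WorkingIntegrable (V : Set (Space d)) (t : ℝ) : Prop :=
  (∀ i, IntegrableOn (S.bulkWorking i V t) (S.outerBoundary i V t) μHE[d - 1]) ∧
  IntegrableOn (S.surfWorking V t) (S.interfaceBoundary V t) μHE[d - 2]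

/-- The energy inequality: for every material volume and every time at which it is a regular test
volume, the total energy is differentiable in time and its derivative is at most the working. -/
def EnergyInequality : Prop :=
  ∀ V : ℝ → Set (Space d), S.IsMaterialVolume V →
    ∀ t ∈ S.times, S.IsRegularTestVolume t (V t) →
      (∀ᶠ s in 𝓝 t, S.EnergyIntegrable V s) ∧ S.WorkingIntegrable (V t) t ∧
      ∃ e : ℝ, HasDerivAt (S.energy V) e t ∧ e ≤ S.working (V t) t

end TwoPhaseSystem

end SurfactantFlow

end

/-!
The energy inequality is the sum of an exact energy balance and of terms with a sign.

*Transport.* A defining function `ψ` of the interface has zero material derivative where it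
vanishes, so along a fluid trajectory its values `g` satisfy `|g'| ≤ C |g|`. Hence no particle
enters or leaves the interface, and a material volume is transported phase by phase
(`TwoPhaseSystem.IsMaterialVolume.exists_flow`). The transport theorem
`IsFlowOn.hasDerivAt_integral_image`, for volumes and for pieces of hypersurface alike, then gives
the derivative of the energy: the integral of the material derivative plus the rate of expansion
times the density. It needs neither uniqueness nor differentiability of the flow `X` in the initial
point: for `s` near `t` the map `X s` is `id + (s - t) ∇v` up to a map with a small Lipschitz
constant, so by the area formula `lintegral_normDet_fderiv_eq_image` it multiplies `k`-dimensional
measure by `1 + (s - t) θ + o(s - t)`, with `θ` the divergence or the surface divergence of `v`.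

*Local balance.* By the balance laws, the integrand in a phase is the divergence of the power
`Tᵀ v - G'(c) J` minus the dissipation `T : ∇v - J · ∇G'(c)`, and that on the interface is the
surface divergence of `-γ'(c) J_Γ + σ(c) v_τ` plus terms from the jumps and from diffusion
(`TwoPhaseSystem.IsSharpInterfaceModel.materialDeriv_bulkEnergyDensity` and
`TwoPhaseSystem.IsSharpInterfaceModel.materialDeriv_surfEnergyDensity`).

*Divergence theorems.* Near a corner the defining covectors of a region are independent, so the
directions in which all of them are positive form a nonempty open cone, which contains a basis. In
each direction of this basis the region is the subgraph of a Lipschitz function, and the component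
of a vector field in this direction can be integrated along lines; summing up gives
`IsCorner.exists_integral_div`. A partition of unity turns it into the divergence theorem for regions
with corners, `integral_trace_fderiv_eq_integral_frontier`, and, through graph charts of the
hypersurface, into `integral_tangentialTrace_eq_integral_relBoundary` for the surface divergence.
Transversality makes the part of the boundary of `V` on the interface negligible, so that the
boundary of `V ∩ Ω⁽ⁱ⁾` consists of its outer part and of `V ∩ Γ`, where the external normal is `ν`
or `-ν` (`TwoPhaseSystem.IsRegularTestVolume.integral_div_eq`). In dimension one the interface is a
set of isolated points, on which the surface divergence vanishes.

*Signs.* The integrals over `V ∩ Γ` combine to a single one, whose integrand is estimated by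
`TwoPhaseSystem.SignConditions.interface_le`; the dissipation in the phases is nonnegative. The
constitutive laws make every dissipation term a nonnegative quadratic form
(`TwoPhaseSystem.ConstitutiveLaws.signConditions`); for the viscous stress this uses that the
pressure does no work in an incompressible fluid.
-/

set_option linter.unusedSectionVars false

namespace SurfactantFlow

/-! ### The area formula for the Euclidean Hausdorff measure -/

section AreaFormula

open Module Set
open scoped NNReal ENNReal

variable {U V : Type*} [NormedAddCommGroup U] [InnerProductSpace ℝ U] [FiniteDimensional ℝ U]
  [MeasurableSpace U] [BorelSpace U] [NormedAddCommGroup V] [InnerProductSpace ℝ V]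
  [FiniteDimensional ℝ V] [MeasurableSpace V] [BorelSpace V]

/-- If `f` stretches distances on `s` at most `C` times as much as `g` does, then the
`n`-dimensional measure of `f '' s` is at most `C ^ n` times that of `g '' s`. -/
theorem euclideanHausdorffMeasure_image_le_of_dist_le {α X Y : Type*} [MetricSpace X]
    [MeasurableSpace X] [BorelSpace X] [MetricSpace Y] [MeasurableSpace Y] [BorelSpace Y]
    (n : ℕ) {C : ℝ≥0} {f : α → X} {g : α → Y} {s : Set α}
    (h : ∀ x ∈ s, ∀ y ∈ s, dist (f x) (f y) ≤ C * dist (g x) (g y)) :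
    (μHE[n] : Measure X) (f '' s) ≤ (C : ℝ≥0∞) ^ n * (μHE[n] : Measure Y) (g '' s) := by
  rcases s.eq_empty_or_nonempty with rfl | hs
  · simp
  have : Nonempty α := ⟨hs.some⟩
  set k : Y → X := fun z => f (Function.invFunOn g s z) with hk
  have hmem : ∀ z ∈ g '' s, Function.invFunOn g s z ∈ s := fun z hz =>
    Function.invFunOn_mem hz
  have heq : ∀ z ∈ g '' s, g (Function.invFunOn g s z) = z := fun z hz =>
    Function.invFunOn_eq hz
  have hL : LipschitzOnWith C k (g '' s) := by
    refine LipschitzOnWith.of_dist_le_mul fun z hz w hw => ?_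
    have := h _ (hmem z hz) _ (hmem w hw)
    rwa [heq z hz, heq w hw] at this
  have himg : k '' (g '' s) = f '' s := by
    rw [image_image]
    refine image_congr fun x hx => ?_
    have hx' : g x ∈ g '' s := mem_image_of_mem g hx
    have := h _ (hmem _ hx') x hx
    rw [heq _ hx', dist_self, mul_zero] at this
    exact dist_le_zero.1 this
  have := hL.hausdorffMeasure_image_le (d := (n : ℝ)) (Nat.cast_nonneg n)
  rw [himg] at this
  simp only [Measure.euclideanHausdorffMeasure_def, Measure.smul_apply, ENNReal.smul_def,
    smul_eq_mul]
  calc _ ≤ _ := mul_le_mul_right this _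
    _ = _ := by
      rw [ENNReal.rpow_natCast]; ring

theorem LipschitzOnWith.euclideanHausdorffMeasure_image_le {X Y : Type*} [MetricSpace X]
    [MeasurableSpace X] [BorelSpace X] [MetricSpace Y] [MeasurableSpace Y] [BorelSpace Y]
    (n : ℕ) {C : ℝ≥0} {f : X → Y} {s : Set X} (h : LipschitzOnWith C f s) :
    (μHE[n] : Measure Y) (f '' s) ≤ (C : ℝ≥0∞) ^ n * (μHE[n] : Measure X) s := by
  simpa using euclideanHausdorffMeasure_image_le_of_dist_le n (g := id)
    fun x hx y hy => h.dist_le_mul x hx y hy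

theorem continuous_normDet : Continuous fun A : U →L[ℝ] V => (A : U →ₗ[ℝ] V).normDet := by
  have h : ∀ A : U →L[ℝ] V, (A : U →ₗ[ℝ] V).normDet
      = Real.sqrt ((ContinuousLinearMap.adjoint A ∘L A).det) := by
    intro A
    have := A.normDet_sq
    simp only [RCLike.ofReal_real_eq_id, id] at this
    rw [← this, Real.sqrt_sq (LinearMap.normDet_nonneg _)]
  simp_rw [h]
  refine Real.continuous_sqrt.comp (ContinuousLinearMap.continuous_det.comp ?_)
  exact (ContinuousLinearMap.adjoint.continuous).clm_comp continuous_id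

theorem normDet_pos {A : U →L[ℝ] V} (hA : Function.Injective A) :
    0 < (A : U →ₗ[ℝ] V).normDet := by
  refine lt_of_le_of_ne (LinearMap.normDet_nonneg _) (Ne.symm ?_)
  exact ((A : U →ₗ[ℝ] V).normDet_ne_zero_tfae.out 0 4).2 hA

theorem exists_pos_norm_le_of_injective {A : U →L[ℝ] V} (hA : Function.Injective A) :
    ∃ K : ℝ, 0 < K ∧ ∀ z, ‖z‖ ≤ K * ‖A z‖ := by
  obtain ⟨K, hK, h⟩ := (A : U →ₗ[ℝ] V).exists_antilipschitzWith (LinearMap.ker_eq_bot.2 hA)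
  refine ⟨K, hK, fun z => ?_⟩
  simpa using h.le_mul_dist z 0

/-- For maps that are close enough to an injective linear map `A`, both sides of the area formula
agree with their values for `A` up to a factor `c > 1`: the volume factors of all derivatives close
to `A`, and the measures of the images of all sets. -/
theorem exists_approx_bounds {A : U →L[ℝ] V} (hA : Function.Injective A) {c : ℝ≥0} (hc : 1 < c) :
    ∃ δ : ℝ≥0, 0 < δ ∧
      (∀ B : U →L[ℝ] V, ‖B - A‖ ≤ finrank ℝ V * δ →
        (A : U →ₗ[ℝ] V).normDet ≤ c * (B : U →ₗ[ℝ] V).normDet ∧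
        (B : U →ₗ[ℝ] V).normDet ≤ c * (A : U →ₗ[ℝ] V).normDet) ∧
      ∀ (t : Set U) (g : U → V), ApproximatesLinearOn g A t δ →
        μHE[finrank ℝ U] (g '' t) ≤ c * (ENNReal.ofReal (A : U →ₗ[ℝ] V).normDet * volume t) ∧
        ENNReal.ofReal (A : U →ₗ[ℝ] V).normDet * volume t ≤ c * μHE[finrank ℝ U] (g '' t) := by
  obtain ⟨K, hK, hKA⟩ := exists_pos_norm_le_of_injective hA
  have hp := normDet_pos hA
  have hc0 : (0 : ℝ) < c := lt_trans one_pos (by exact_mod_cast hc)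
  have hc1 : (1 : ℝ) < c := by exact_mod_cast hc
  have h1 : ∀ᶠ B : U →L[ℝ] V in 𝓝 A, (A : U →ₗ[ℝ] V).normDet ≤ c * (B : U →ₗ[ℝ] V).normDet ∧
        (B : U →ₗ[ℝ] V).normDet ≤ c * (A : U →ₗ[ℝ] V).normDet := by
    have hA1 : (A : U →ₗ[ℝ] V).normDet < c * (A : U →ₗ[ℝ] V).normDet := by nlinarith
    have t1 := ((continuous_normDet (U := U) (V := V)).const_mul (c : ℝ)).tendsto A
    have t2 := (continuous_normDet (U := U) (V := V)).tendsto A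
    filter_upwards [t1.eventually (lt_mem_nhds hA1), t2.eventually (gt_mem_nhds hA1)] with B h1 h2
    exact ⟨h1.le, h2.le⟩
  obtain ⟨r, hr, hr'⟩ := Metric.eventually_nhds_iff.1 h1
  -- `e` is so small that `(1 + e) ^ dim` and `(1 - e) ^ (- dim)` are at most `c`
  obtain ⟨e, he0, he1, he2, he3⟩ : ∃ e : ℝ, 0 < e ∧ e < 1 ∧ (1 + e) ^ finrank ℝ U ≤ c ∧
      ((1 - e)⁻¹) ^ finrank ℝ U ≤ c := by
    have t1 : Tendsto (fun e : ℝ => (1 + e) ^ finrank ℝ U) (𝓝[>] 0) (𝓝 ((1 + 0) ^ finrank ℝ U)) :=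
      ((continuous_const.add continuous_id).pow _).continuousAt.tendsto.mono_left
        nhdsWithin_le_nhds
    have t2 : Tendsto (fun e : ℝ => ((1 - e)⁻¹) ^ finrank ℝ U) (𝓝[>] 0)
        (𝓝 (((1 - 0)⁻¹) ^ finrank ℝ U)) := by
      refine Tendsto.mono_left ?_ nhdsWithin_le_nhds
      refine ContinuousAt.tendsto (f := fun e : ℝ => ((1 - e)⁻¹) ^ finrank ℝ U) ?_
      exact ((continuousAt_const.sub continuousAt_id).inv₀ (by simp)).pow _
    simp only [add_zero, one_pow, sub_zero, inv_one] at t1 t2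
    have := ((t1.eventually (gt_mem_nhds hc1)).and (t2.eventually (gt_mem_nhds hc1))).and
      (Ioo_mem_nhdsGT (zero_lt_one (α := ℝ)))
    obtain ⟨e, ⟨h1, h2⟩, h3⟩ := this.exists
    exact ⟨e, h3.1, h3.2, h1.le, h2.le⟩
  set m : ℝ := min (e / K) (r / (2 * (finrank ℝ V + 1))) with hm
  have hm0 : 0 < m := lt_min (by positivity) (by positivity)
  refine ⟨m.toNNReal, Real.toNNReal_pos.2 hm0, fun B hB => hr' ?_, fun t g hg => ?_⟩
  · rw [dist_eq_norm]
    rw [Real.coe_toNNReal _ hm0.le] at hB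
    have : (finrank ℝ V : ℝ) * m ≤ finrank ℝ V * (r / (2 * (finrank ℝ V + 1))) := by
      gcongr; exact min_le_right _ _
    have h3 : (finrank ℝ V : ℝ) * (r / (2 * (finrank ℝ V + 1))) < r := by
      rw [← mul_div_assoc, div_lt_iff₀ (by positivity)]
      nlinarith [Nat.cast_nonneg (α := ℝ) (finrank ℝ V)]
    linarith
  have hmK : m * K ≤ e := by
    have := min_le_left (e / K) (r / (2 * (finrank ℝ V + 1)))
    rw [← hm] at this
    calc m * K ≤ e / K * K := by gcongr
      _ = e := by field_simp
  have hclose : ∀ x ∈ t, ∀ y ∈ t, ‖g x - g y - A (x - y)‖ ≤ e * ‖A (x - y)‖ := by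
    intro x hx y hy
    have := hg x hx y hy
    rw [Real.coe_toNNReal _ hm0.le] at this
    calc _ ≤ m * ‖x - y‖ := this
      _ ≤ m * (K * ‖A (x - y)‖) := by gcongr; exact hKA _
      _ = m * K * ‖A (x - y)‖ := by ring
      _ ≤ _ := by gcongr
  have hvol : (μHE[finrank ℝ U] : Measure V) (A '' t)
      = ENNReal.ofReal (A : U →ₗ[ℝ] V).normDet * volume t :=
    LinearMap.euclideanHausdorffMeasure_image_eq_normDet_mul_volume (A : U →ₗ[ℝ] V) t
  rw [← hvol]
  have key : ∀ x : ℝ, 0 ≤ x → x ^ finrank ℝ U ≤ c →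
      (x.toNNReal : ℝ≥0∞) ^ finrank ℝ U ≤ c := by
    intro x hx h
    rw [← ENNReal.coe_pow, ENNReal.coe_le_coe, ← NNReal.coe_le_coe, NNReal.coe_pow,
      Real.coe_toNNReal _ hx]
    exact h
  constructor
  · refine (euclideanHausdorffMeasure_image_le_of_dist_le (finrank ℝ U) (C := (1 + e).toNNReal)
      (g := A) fun x hx y hy => ?_).trans ?_
    · rw [Real.coe_toNNReal _ (by positivity), dist_eq_norm, dist_eq_norm, ← map_sub]
      have := hclose x hx y hy
      have h2 := norm_le_norm_add_norm_sub' (g x - g y) (A (x - y))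
      linarith
    · gcongr
      exact key _ (by positivity) he2
  · have h1e : 0 < 1 - e := by linarith
    refine (euclideanHausdorffMeasure_image_le_of_dist_le (finrank ℝ U)
      (C := ((1 - e)⁻¹).toNNReal) (f := A) (g := g) fun x hx y hy => ?_).trans ?_
    · rw [Real.coe_toNNReal _ (by positivity), dist_eq_norm, dist_eq_norm, ← map_sub,
        inv_mul_eq_div, le_div_iff₀ h1e]
      have := hclose x hx y hy
      have h2 := norm_le_norm_add_norm_sub (g x - g y) (A (x - y))
      nlinarith
    · gcongr
      exact key _ (by positivity) he3

/-- On a set on which `f` is approximated by the linear map `A`, its derivative is almost everywhere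
close to `A`. -/
theorem ae_norm_fderiv_sub_le {f : U → V} {A : U →L[ℝ] V} {δ : ℝ≥0} {s : Set U}
    (hf : ApproximatesLinearOn f A s δ) (hs : MeasurableSet s)
    (hd : ∀ x ∈ s, DifferentiableAt ℝ f x) :
    ∀ᵐ x ∂volume.restrict s, ‖fderiv ℝ f x - A‖ ≤ finrank ℝ V * δ := by
  rcases subsingleton_or_nontrivial U with hU | hU
  · refine Eventually.of_forall fun x => ?_
    have : fderiv ℝ f x - A = 0 := by
      ext z; rw [Subsingleton.elim z 0]; simp
    rw [this, norm_zero]; positivity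
  obtain ⟨v, hv⟩ := exists_norm_eq U zero_le_one
  set b := stdOrthonormalBasis ℝ V
  -- compare the coordinates of `f`, regarded as maps from `U` to the line spanned by `v`
  let L : Fin (finrank ℝ V) → V →L[ℝ] U := fun i => (innerSL ℝ (b i)).smulRight v
  have hL : ∀ i w, ‖L i w‖ = |⟪b i, w⟫_ℝ| := fun i w => by
    simp [L, norm_smul, hv]
  have h : ∀ i, ∀ᵐ x ∂volume.restrict s,
      ‖(L i ∘L fderiv ℝ f x) - L i ∘L A‖₊ ≤ δ := by
    intro i
    have ha : ApproximatesLinearOn (fun x => L i (f x)) (L i ∘L A) s δ := by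
      intro x hx y hy
      have := hf x hx y hy
      have e : L i (f x) - L i (f y) - (L i ∘L A) (x - y) = L i (f x - f y - A (x - y)) := by
        simp
      rw [e, hL]
      refine (abs_real_inner_le_norm _ _).trans ?_
      simpa using this
    exact ha.norm_fderiv_sub_le volume hs (fun x => L i ∘L fderiv ℝ f x) fun x hx =>
      ((L i).hasFDerivAt.comp x (hd x hx).hasFDerivAt).hasFDerivWithinAt
  filter_upwards [ae_all_iff.2 h] with x hx
  refine ContinuousLinearMap.opNorm_le_bound _ (by positivity) fun z => ?_
  set w := (fderiv ℝ f x - A) z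
  calc ‖w‖ = ‖∑ i, ⟪b i, w⟫_ℝ • b i‖ := by rw [b.sum_repr' w]
    _ ≤ ∑ i, ‖⟪b i, w⟫_ℝ • b i‖ := norm_sum_le _ _
    _ ≤ ∑ _i : Fin (finrank ℝ V), δ * ‖z‖ := by
      refine Finset.sum_le_sum fun i _ => ?_
      have h1 : ‖((L i ∘L fderiv ℝ f x) - L i ∘L A) z‖ ≤ δ * ‖z‖ :=
        ((L i ∘L fderiv ℝ f x) - L i ∘L A).le_of_opNorm_le (by exact_mod_cast hx i) z
      have h2 : ((L i ∘L fderiv ℝ f x) - L i ∘L A) z = L i w := by simp [w]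
      rw [h2, hL] at h1
      rw [norm_smul, b.norm_eq_one, mul_one]
      exact h1
    _ = _ := by simp [mul_assoc]

theorem measurableSet_image_of_differentiableAt {f : U → V} {s : Set U} (hs : MeasurableSet s)
    (hd : ∀ x ∈ s, DifferentiableAt ℝ f x) (hf : InjOn f s) : MeasurableSet (f '' s) :=
  hs.image_of_continuousOn_injOn (fun x hx => (hd x hx).continuousAt.continuousWithinAt) hf

theorem measurable_normDet_fderiv (f : U → V) :
    Measurable fun x => (fderiv ℝ f x : U →ₗ[ℝ] V).normDet :=
  continuous_normDet.measurable.comp (measurable_fderiv ℝ f)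

/-- **Area formula.** The measure of the image of an injective map whose derivatives are
injective. -/
theorem lintegral_normDet_fderiv_eq_image {f : U → V} {s : Set U} (hs : MeasurableSet s)
    (hd : ∀ x ∈ s, DifferentiableAt ℝ f x) (hi : ∀ x ∈ s, Function.Injective (fderiv ℝ f x))
    (hf : InjOn f s) :
    ∫⁻ x in s, ENNReal.ofReal (fderiv ℝ f x : U →ₗ[ℝ] V).normDet = μHE[finrank ℝ U] (f '' s) := by
  rcases s.eq_empty_or_nonempty with rfl | hne
  · simp
  -- up to a factor `c ^ 2` the formula is checked on the pieces of a partition on which `f` is almost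
  -- linear; then `c` tends to `1`
  have main : ∀ c : ℝ≥0, 1 < c →
      ∫⁻ x in s, ENNReal.ofReal (fderiv ℝ f x : U →ₗ[ℝ] V).normDet
        ≤ (c * c : ℝ≥0∞) * μHE[finrank ℝ U] (f '' s) ∧
      μHE[finrank ℝ U] (f '' s)
        ≤ (c * c : ℝ≥0∞) * ∫⁻ x in s, ENNReal.ofReal (fderiv ℝ f x : U →ₗ[ℝ] V).normDet := by
    intro c hc
    have hex : ∀ A : U →L[ℝ] V, ∃ δ : ℝ≥0, 0 < δ ∧ (Function.Injective A →
        (∀ B : U →L[ℝ] V, ‖B - A‖ ≤ finrank ℝ V * δ →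
          (A : U →ₗ[ℝ] V).normDet ≤ c * (B : U →ₗ[ℝ] V).normDet ∧
          (B : U →ₗ[ℝ] V).normDet ≤ c * (A : U →ₗ[ℝ] V).normDet) ∧
        ∀ (t : Set U) (g : U → V), ApproximatesLinearOn g A t δ →
          μHE[finrank ℝ U] (g '' t) ≤ c * (ENNReal.ofReal (A : U →ₗ[ℝ] V).normDet * volume t) ∧
          ENNReal.ofReal (A : U →ₗ[ℝ] V).normDet * volume t
            ≤ c * μHE[finrank ℝ U] (g '' t)) := by
      intro A
      by_cases hA : Function.Injective A
      · obtain ⟨δ, h0, h1⟩ := exists_approx_bounds hA hc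
        exact ⟨δ, h0, fun _ => h1⟩
      · exact ⟨1, one_pos, fun h => absurd h hA⟩
    choose δ hδ0 hδ using hex
    obtain ⟨t, A, t_disj, t_meas, t_cover, ht, hA⟩ :=
      exists_partition_approximatesLinearOn_of_hasFDerivWithinAt f s (fderiv ℝ f)
        (fun x hx => (hd x hx).hasFDerivAt.hasFDerivWithinAt) δ fun A => (hδ0 A).ne'
    have hAinj : ∀ n, Function.Injective (A n) := fun n => by
      obtain ⟨y, hy, h⟩ := hA hne n
      rw [h]; exact hi y hy
    have M : ∀ n, MeasurableSet (s ∩ t n) := fun n => hs.inter (t_meas n)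
    have hs_eq : s = ⋃ n, s ∩ t n := by
      rw [← inter_iUnion, inter_eq_self_of_subset_left t_cover]
    have D : Pairwise (Function.onFun Disjoint fun n => s ∩ t n) :=
      pairwise_disjoint_mono t_disj fun n => inter_subset_right
    have hint : ∫⁻ x in s, ENNReal.ofReal (fderiv ℝ f x : U →ₗ[ℝ] V).normDet
        = ∑' n, ∫⁻ x in s ∩ t n, ENNReal.ofReal (fderiv ℝ f x : U →ₗ[ℝ] V).normDet := by
      conv_lhs => rw [hs_eq]
      exact lintegral_iUnion M D _
    have himg : (μHE[finrank ℝ U] : Measure V) (f '' s)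
        = ∑' n, (μHE[finrank ℝ U] : Measure V) (f '' (s ∩ t n)) := by
      conv_lhs => rw [hs_eq, image_iUnion]
      refine measure_iUnion (fun i j hij => ?_) fun n =>
        measurableSet_image_of_differentiableAt (M n) (fun x hx => hd x hx.1)
          (hf.mono inter_subset_left)
      refine Set.disjoint_left.2 ?_
      rintro _ ⟨x, hx, rfl⟩ ⟨y, hy, h⟩
      obtain rfl := hf hy.1 hx.1 h
      exact Set.disjoint_left.1 (D hij) hx hy
    have hae : ∀ n, ∀ᵐ x ∂volume.restrict (s ∩ t n),
        ENNReal.ofReal (A n : U →ₗ[ℝ] V).normDet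
          ≤ c * ENNReal.ofReal (fderiv ℝ f x : U →ₗ[ℝ] V).normDet ∧
        ENNReal.ofReal (fderiv ℝ f x : U →ₗ[ℝ] V).normDet
          ≤ c * ENNReal.ofReal (A n : U →ₗ[ℝ] V).normDet := by
      intro n
      filter_upwards [ae_norm_fderiv_sub_le (ht n) (M n) fun x hx => hd x hx.1] with x hx
      have := (hδ (A n) (hAinj n)).1 _ hx
      rw [← ENNReal.ofReal_coe_nnreal, ← ENNReal.ofReal_mul (by positivity),
        ← ENNReal.ofReal_mul (by positivity)]
      exact ⟨ENNReal.ofReal_le_ofReal this.1, ENNReal.ofReal_le_ofReal this.2⟩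
    rw [hint, himg, ← ENNReal.tsum_mul_left, ← ENNReal.tsum_mul_left]
    constructor
    · refine ENNReal.tsum_le_tsum fun n => ?_
      calc _ ≤ ∫⁻ x in s ∩ t n, c * ENNReal.ofReal (A n : U →ₗ[ℝ] V).normDet :=
            lintegral_mono_ae ((hae n).mono fun x hx => hx.2)
        _ = c * (ENNReal.ofReal (A n : U →ₗ[ℝ] V).normDet * volume (s ∩ t n)) := by
            rw [setLIntegral_const, mul_assoc]
        _ ≤ c * (c * μHE[finrank ℝ U] (f '' (s ∩ t n))) := by
            gcongr 1
            exact ((hδ (A n) (hAinj n)).2 _ _ (ht n)).2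
        _ = _ := by rw [mul_assoc]
    · refine ENNReal.tsum_le_tsum fun n => ?_
      calc _ ≤ c * (ENNReal.ofReal (A n : U →ₗ[ℝ] V).normDet * volume (s ∩ t n)) :=
            ((hδ (A n) (hAinj n)).2 _ _ (ht n)).1
        _ = c * ∫⁻ x in s ∩ t n, ENNReal.ofReal (A n : U →ₗ[ℝ] V).normDet := by
            rw [setLIntegral_const]
        _ ≤ c * ∫⁻ x in s ∩ t n, c * ENNReal.ofReal (fderiv ℝ f x : U →ₗ[ℝ] V).normDet := by
            gcongr 1
            exact lintegral_mono_ae ((hae n).mono fun x hx => hx.1)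
        _ = _ := by
            rw [lintegral_const_mul _ (measurable_normDet_fderiv f).ennreal_ofReal, mul_assoc]
  have lim : ∀ x : ℝ≥0∞, Tendsto (fun c : ℝ≥0 => (c * c : ℝ≥0∞) * x) (𝓝[>] 1) (𝓝 x) := by
    intro x
    have h1 : Tendsto (fun c : ℝ≥0 => ((c * c : ℝ≥0) : ℝ≥0∞)) (𝓝[>] 1) (𝓝 ((1 * 1 : ℝ≥0) : ℝ≥0∞)) :=
      (ENNReal.tendsto_coe.2 ((continuous_id.mul continuous_id).tendsto 1)).mono_left
        nhdsWithin_le_nhds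
    have := ENNReal.Tendsto.mul_const (b := x) h1 (Or.inl (by simp))
    simpa using this
  refine le_antisymm ?_ ?_
  · refine ge_of_tendsto (lim _) ?_
    filter_upwards [self_mem_nhdsWithin] with c hc using (main c hc).1
  · refine ge_of_tendsto (lim _) ?_
    filter_upwards [self_mem_nhdsWithin] with c hc using (main c hc).2

/-- The area formula as an identity of measures on the image. -/
theorem map_withDensity_normDet_fderiv {f : U → V} {s : Set U} (hs : MeasurableSet s)
    (hd : ∀ x ∈ s, DifferentiableAt ℝ f x) (hi : ∀ x ∈ s, Function.Injective (fderiv ℝ f x))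
    (hf : InjOn f s) :
    Measure.map (s.domRestrict f) (Measure.comap (↑) ((volume : Measure U).withDensity fun x =>
        ENNReal.ofReal (fderiv ℝ f x : U →ₗ[ℝ] V).normDet))
      = (μHE[finrank ℝ U] : Measure V).restrict (f '' s) := by
  have hc : Continuous (s.domRestrict f) := continuousOn_iff_continuous_domRestrict.1
    fun x hx => (hd x hx).continuousAt.continuousWithinAt
  refine Measure.ext fun t ht => ?_
  have hpre : MeasurableSet (s.domRestrict f ⁻¹' t) := hc.measurable ht
  rw [Measure.map_apply hc.measurable ht, Measure.restrict_apply ht,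
    (MeasurableEmbedding.subtype_coe hs).comap_apply]
  have hm := (MeasurableEmbedding.subtype_coe hs).measurableSet_image.2 hpre
  have hsub : ((↑) '' (s.domRestrict f ⁻¹' t) : Set U) ⊆ s := by
    rintro _ ⟨x, -, rfl⟩; exact x.2
  rw [withDensity_apply _ hm, lintegral_normDet_fderiv_eq_image hm (fun x hx => hd x (hsub hx))
    (fun x hx => hi x (hsub hx)) (hf.mono hsub)]
  congr 1
  ext y
  constructor
  · rintro ⟨_, ⟨x, hx, rfl⟩, rfl⟩
    exact ⟨hx, x, x.2, rfl⟩
  · rintro ⟨hy, x, hx, rfl⟩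
    exact ⟨x, ⟨⟨x, hx⟩, hy, rfl⟩, rfl⟩

theorem measurableEmbedding_domRestrict {f : U → V} {s : Set U} (hs : MeasurableSet s)
    (hd : ∀ x ∈ s, DifferentiableAt ℝ f x) (hf : InjOn f s) :
    MeasurableEmbedding (s.domRestrict f) :=
  ContinuousOn.measurableEmbedding hs
    (fun x hx => (hd x hx).continuousAt.continuousWithinAt) hf

theorem integrableOn_image_iff_normDet_fderiv {f : U → V} {s : Set U} (hs : MeasurableSet s)
    (hd : ∀ x ∈ s, DifferentiableAt ℝ f x) (hi : ∀ x ∈ s, Function.Injective (fderiv ℝ f x))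
    (hf : InjOn f s) (g : V → ℝ) :
    IntegrableOn g (f '' s) μHE[finrank ℝ U] ↔
      IntegrableOn (fun x => (fderiv ℝ f x : U →ₗ[ℝ] V).normDet * g (f x)) s := by
  rw [IntegrableOn, ← map_withDensity_normDet_fderiv hs hd hi hf,
    (measurableEmbedding_domRestrict hs hd hf).integrable_map_iff]
  simp only [Set.domRestrict_eq, ← Function.comp_assoc, ENNReal.ofReal]
  rw [← (MeasurableEmbedding.subtype_coe hs).integrable_map_iff, map_comap_subtype_coe hs,
    restrict_withDensity hs, integrable_withDensity_iff_integrable_coe_smul₀]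
  · simp_rw [IntegrableOn, Real.coe_toNNReal _ (LinearMap.normDet_nonneg _), Function.comp_apply,
      smul_eq_mul]
  · exact (measurable_normDet_fderiv f).real_toNNReal.aemeasurable

theorem integral_image_eq_normDet_fderiv {f : U → V} {s : Set U} (hs : MeasurableSet s)
    (hd : ∀ x ∈ s, DifferentiableAt ℝ f x) (hi : ∀ x ∈ s, Function.Injective (fderiv ℝ f x))
    (hf : InjOn f s) (g : V → ℝ) :
    ∫ x in f '' s, g x ∂μHE[finrank ℝ U]
      = ∫ x in s, (fderiv ℝ f x : U →ₗ[ℝ] V).normDet * g (f x) := by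
  rw [← map_withDensity_normDet_fderiv hs hd hi hf,
    (measurableEmbedding_domRestrict hs hd hf).integral_map]
  simp only [Set.domRestrict_apply, ← Function.comp_apply (f := g), ENNReal.ofReal]
  rw [← (MeasurableEmbedding.subtype_coe hs).integral_map, map_comap_subtype_coe hs,
    setIntegral_withDensity_eq_setIntegral_smul₀
      ((measurable_normDet_fderiv f).real_toNNReal.aemeasurable) _ hs]
  congr with x
  rw [NNReal.smul_def, Real.coe_toNNReal _ (LinearMap.normDet_nonneg _), smul_eq_mul]

end AreaFormula

end SurfactantFlow

namespace SurfactantFlow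

/-! ### Orthogonal splittings of a Euclidean space into a hyperplane and a line -/

section Splittings

open Module Set
open scoped NNReal ENNReal

variable {E' E F : Type*} [NormedAddCommGroup E'] [InnerProductSpace ℝ E'] [FiniteDimensional ℝ E']
  [NormedAddCommGroup E] [InnerProductSpace ℝ E] [FiniteDimensional ℝ E]
  [NormedAddCommGroup F] [InnerProductSpace ℝ F] [FiniteDimensional ℝ F]

variable (E' E) in
/-- An orthogonal splitting of `E` into a copy of `E'` and the line through the unit vector
`dir`. -/
structure Splitting where
  /-- the embedding of `E'` as a hyperplane -/
  incl : E' →ₗᵢ[ℝ] E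
  /-- the unit normal of the hyperplane -/
  dir : E
  norm_dir : ‖dir‖ = 1
  inner_incl_dir : ∀ y, ⟪incl y, dir⟫_ℝ = 0
  finrank_eq : finrank ℝ E = finrank ℝ E' + 1

namespace Splitting

variable (S : Splitting E' E)

theorem inner_dir_incl (y : E') : ⟪S.dir, S.incl y⟫_ℝ = 0 := by
  rw [real_inner_comm]; exact S.inner_incl_dir y

theorem inner_dir_dir : ⟪S.dir, S.dir⟫_ℝ = 1 := by
  rw [real_inner_self_eq_norm_sq, S.norm_dir]; norm_num

/-- The splitting as an isometry from the Euclidean product. -/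
noncomputable def isometryEquiv : WithLp 2 (E' × ℝ) ≃ₗᵢ[ℝ] E :=
  LinearIsometry.toLinearIsometryEquiv
    { toFun := fun p => S.incl p.fst + p.snd • S.dir
      map_add' := fun p q => by simp [add_smul]; abel
      map_smul' := fun c p => by simp [mul_smul]
      norm_map' := fun p => by
        have h : ‖S.incl p.fst + p.snd • S.dir‖ ^ 2 = ‖p‖ ^ 2 := by
          rw [WithLp.prod_norm_sq_eq_of_L2, norm_add_sq_real, inner_smul_right, S.inner_incl_dir,
            norm_smul, S.norm_dir, S.incl.norm_map]
          simp
        exact (sq_eq_sq₀ (norm_nonneg _) (norm_nonneg _)).1 h }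
    (by
      rw [S.finrank_eq, (WithLp.linearEquiv 2 ℝ (E' × ℝ)).finrank_eq]; simp)

/-- The point over `y` at height `s`, as a linear equivalence from `E' × ℝ`. -/
noncomputable def pt : (E' × ℝ) ≃L[ℝ] E :=
  (WithLp.prodContinuousLinearEquiv 2 ℝ E' ℝ).symm.trans S.isometryEquiv.toContinuousLinearEquiv

@[simp] theorem pt_apply (p : E' × ℝ) : S.pt p = S.incl p.1 + p.2 • S.dir := rfl

theorem measurePreserving_pt [MeasurableSpace E'] [BorelSpace E'] [MeasurableSpace E]
    [BorelSpace E] : MeasurePreserving S.pt volume volume :=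
  (S.isometryEquiv.measurePreserving).comp (WithLp.volume_preserving_toLp E' ℝ)

/-- The orthogonal projection onto the hyperplane, with values in `E'`. -/
noncomputable def proj : E →L[ℝ] E' := ContinuousLinearMap.adjoint S.incl.toContinuousLinearMap

theorem inner_proj (x : E) (y : E') : ⟪S.proj x, y⟫_ℝ = ⟪x, S.incl y⟫_ℝ := by
  simp [proj, ContinuousLinearMap.adjoint_inner_left]

@[simp] theorem proj_incl (y : E') : S.proj (S.incl y) = y :=
  ext_inner_right ℝ fun z => by rw [inner_proj, S.incl.inner_map_map]

@[simp] theorem proj_dir : S.proj S.dir = 0 :=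
  ext_inner_right ℝ fun z => by rw [inner_proj, S.inner_dir_incl, inner_zero_left]

theorem exists_eq (x : E) : x = S.incl (S.proj x) + ⟪S.dir, x⟫_ℝ • S.dir := by
  obtain ⟨p, rfl⟩ := S.pt.surjective x
  rw [pt_apply, map_add, proj_incl, map_smul, proj_dir, inner_add_right, S.inner_dir_incl,
    inner_smul_right, S.inner_dir_dir]
  simp

theorem pt_symm_apply (x : E) : S.pt.symm x = (S.proj x, ⟪S.dir, x⟫_ℝ) := by
  rw [ContinuousLinearEquiv.symm_apply_eq, pt_apply]
  exact S.exists_eq x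

/-- An orthonormal basis adapted to the splitting. -/
noncomputable def basis : OrthonormalBasis (Fin (finrank ℝ E') ⊕ Unit) ℝ E :=
  ((stdOrthonormalBasis ℝ E').prod (OrthonormalBasis.singleton Unit ℝ)).map S.isometryEquiv

theorem basis_inl (i : Fin (finrank ℝ E')) :
    S.basis (Sum.inl i) = S.incl (stdOrthonormalBasis ℝ E' i) := by
  simp only [basis, OrthonormalBasis.map_apply, OrthonormalBasis.prod_apply]
  change S.incl _ + (_ : ℝ) • S.dir = _
  simp

theorem basis_inr : S.basis (Sum.inr ()) = S.dir := by
  simp only [basis, OrthonormalBasis.map_apply, OrthonormalBasis.prod_apply]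
  change S.incl _ + (_ : ℝ) • S.dir = _
  simp

/-- In a basis adapted to the splitting, an endomorphism with the eigenvector `dir` is block
triangular. -/
theorem det_of_apply_dir (N : E →ₗ[ℝ] E) {c : ℝ} (h : N S.dir = c • S.dir) :
    LinearMap.det N
      = LinearMap.det ((S.proj : E →ₗ[ℝ] E') ∘ₗ N ∘ₗ S.incl.toLinearMap) * c := by
  set b := stdOrthonormalBasis ℝ E'
  rw [← LinearMap.det_toMatrix S.basis.toBasis, ← LinearMap.det_toMatrix b.toBasis]
  have : LinearMap.toMatrix S.basis.toBasis S.basis.toBasis N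
      = Matrix.fromBlocks
        (LinearMap.toMatrix b.toBasis b.toBasis
          ((S.proj : E →ₗ[ℝ] E') ∘ₗ N ∘ₗ S.incl.toLinearMap)) 0
        (Matrix.of fun _ j => ⟪S.dir, N (S.incl (b j))⟫_ℝ) (Matrix.of fun _ _ => c) := by
    ext i j
    rw [LinearMap.toMatrix_apply]
    rcases i with i | i <;> rcases j with j | j
    · simp only [LinearMap.toMatrix_apply, OrthonormalBasis.coe_toBasis,
        OrthonormalBasis.coe_toBasis_repr_apply, OrthonormalBasis.repr_apply_apply, S.basis_inl,
        Matrix.fromBlocks_apply₁₁, LinearMap.comp_apply, ContinuousLinearMap.coe_coe,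
        LinearIsometry.coe_toLinearMap]
      rw [real_inner_comm, ← S.inner_proj, real_inner_comm]
    · simp [OrthonormalBasis.repr_apply_apply, S.basis_inl, S.basis_inr, h, S.inner_incl_dir]
    · simp [OrthonormalBasis.repr_apply_apply, S.basis_inl, S.basis_inr, b]
    · simp [OrthonormalBasis.repr_apply_apply, S.basis_inr, h, S.norm_dir]
  rw [this, Matrix.det_fromBlocks_zero₁₂]
  simp

/-- Volume is base times height: if `C x` is orthogonal to the image of the hyperplane, the volume
factor of `C` is that of its restriction to the hyperplane times the height `‖C x‖ / |⟪dir, x⟫|`. -/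
theorem normDet_mul_abs_inner (C : E →L[ℝ] F) {x : E} (hx : ∀ y, ⟪C x, C (S.incl y)⟫_ℝ = 0) :
    (C : E →ₗ[ℝ] F).normDet * |⟪S.dir, x⟫_ℝ|
      = ((C : E →ₗ[ℝ] F) ∘ₗ S.incl.toLinearMap).normDet * ‖C x‖ := by
  set K : E →L[ℝ] E := ContinuousLinearMap.adjoint C ∘L C with hK
  have hKi : ∀ v w, ⟪K v, w⟫_ℝ = ⟪C v, C w⟫_ℝ := fun v w => by
    simp [hK, ContinuousLinearMap.adjoint_inner_left]
  set a := ⟪S.dir, x⟫_ℝ with ha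
  set l := ⟪C x, C S.dir⟫_ℝ with hl
  -- `C x` is orthogonal to the image of the hyperplane, so `Cᵀ C x` is orthogonal to the hyperplane
  have hKx : K x = l • S.dir := by
    have h1 := S.exists_eq (K x)
    have h2 : S.proj (K x) = 0 := ext_inner_right ℝ fun z => by
      rw [S.inner_proj, hKi, hx, inner_zero_left]
    rw [h2, map_zero, zero_add, real_inner_comm, hKi] at h1
    exact h1
  -- `T` fixes the hyperplane and maps `dir` to `x`, so that `Cᵀ C T` has the eigenvector `dir`
  set T : E →ₗ[ℝ] E := LinearMap.transvection (innerSL ℝ S.dir : E →ₗ[ℝ] ℝ) (x - S.dir) with hT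
  have hTd : LinearMap.det T = a := by
    rw [hT, LinearMap.transvection.det]
    simp [inner_sub_right, S.norm_dir, ← ha]
  have hTdir : T S.dir = x := by
    simp [hT, LinearMap.transvection.apply, S.norm_dir]
  have hTincl : ∀ y, T (S.incl y) = S.incl y := fun y => by
    simp [hT, LinearMap.transvection.apply, S.inner_dir_incl]
  have h1 := S.det_of_apply_dir ((K : E →ₗ[ℝ] E) ∘ₗ T) (c := l) (by simp [hTdir, hKx])
  have h2 : (S.proj : E →ₗ[ℝ] E') ∘ₗ ((K : E →ₗ[ℝ] E) ∘ₗ T) ∘ₗ S.incl.toLinearMap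
      = ((ContinuousLinearMap.adjoint (C ∘L S.incl.toContinuousLinearMap) ∘L
          (C ∘L S.incl.toContinuousLinearMap) : E' →L[ℝ] E') : E' →ₗ[ℝ] E') := by
    ext1 y
    refine ext_inner_right ℝ fun z => ?_
    simp [hTincl, S.inner_proj, hKi, ContinuousLinearMap.adjoint_inner_left,
      -ContinuousLinearMap.adjoint_comp]
  have s1 : ((C : E →ₗ[ℝ] F).normDet) ^ 2 = LinearMap.det (K : E →ₗ[ℝ] E) := C.normDet_sq
  have s2 : (((C : E →ₗ[ℝ] F) ∘ₗ S.incl.toLinearMap).normDet) ^ 2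
      = LinearMap.det ((ContinuousLinearMap.adjoint (C ∘L S.incl.toContinuousLinearMap) ∘L
          (C ∘L S.incl.toContinuousLinearMap) : E' →L[ℝ] E') : E' →ₗ[ℝ] E') :=
    (C ∘L S.incl.toContinuousLinearMap).normDet_sq
  rw [h2, ← s2, LinearMap.det_comp, ← s1, hTd] at h1
  have h3 : ‖C x‖ ^ 2 = l * a := by
    rw [← real_inner_self_eq_norm_sq]
    have : C x = C (S.incl (S.proj x)) + a • C S.dir := by
      conv_lhs => rw [S.exists_eq x]
      simp [ha]
    refine (congrArg (fun v => ⟪C x, v⟫_ℝ) this).trans ?_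
    rw [inner_add_right, hx, inner_smul_right, zero_add, mul_comm]
  refine (sq_eq_sq₀ (mul_nonneg (LinearMap.normDet_nonneg _) (abs_nonneg _))
    (mul_nonneg (LinearMap.normDet_nonneg _) (norm_nonneg _))).1 ?_
  rw [mul_pow, mul_pow, sq_abs, h3]
  linear_combination a * h1

/-- The derivative of the graph of a function with derivative `l`. -/
noncomputable def graphDeriv (l : E' →L[ℝ] ℝ) : E' →L[ℝ] E :=
  S.incl.toContinuousLinearMap + l.smulRight S.dir

@[simp] theorem graphDeriv_apply (l : E' →L[ℝ] ℝ) (y : E') :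
    S.graphDeriv l y = S.incl y + l y • S.dir := rfl

/-- `normDet_mul_abs_inner` for a graph in place of the hyperplane; `p` is a covector which
vanishes on the tangent space of the graph. -/
theorem normDet_mul_abs_apply (C : E →L[ℝ] F) (l : E' →L[ℝ] ℝ) {p : E →L[ℝ] ℝ}
    (hp : ∀ y, p (S.graphDeriv l y) = 0) {n : E} (hn : ∀ y, ⟪C n, C (S.graphDeriv l y)⟫_ℝ = 0) :
    (C : E →ₗ[ℝ] F).normDet * |p n|
      = |p S.dir| * (((C ∘L S.graphDeriv l : E' →L[ℝ] F) : E' →ₗ[ℝ] F).normDet * ‖C n‖) := by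
  -- the shear that maps the hyperplane to the graph
  set B : E →ₗ[ℝ] E := LinearMap.transvection (l ∘L S.proj : E →L[ℝ] ℝ).toLinearMap S.dir with hB
  have hBd : LinearMap.det B = 1 := by
    rw [hB, LinearMap.transvection.det]; simp
  have hBapply : ∀ v, B v = v + l (S.proj v) • S.dir := fun v => by
    simp [hB, LinearMap.transvection.apply]
  have hBincl : ∀ y, B (S.incl y) = S.graphDeriv l y := fun y => by
    rw [hBapply, proj_incl, graphDeriv_apply]
  have hp' : ∀ y, p (S.incl y) = - (l y * p S.dir) := fun y => by
    have := hp y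
    rw [graphDeriv_apply, map_add, map_smul, smul_eq_mul] at this
    linarith
  set x := n - l (S.proj n) • S.dir with hx
  have hBx : B x = n := by
    rw [hBapply, hx, map_sub, map_smul, proj_dir]; simp
  set C' : E →L[ℝ] F := C ∘L LinearMap.toContinuousLinearMap B with hC'
  have h := S.normDet_mul_abs_inner C' (x := x) fun y => by
    simp only [hC', ContinuousLinearMap.comp_apply, LinearMap.coe_toContinuousLinearMap', hBincl,
      hBx]
    exact hn y
  have e1 : (C' : E →ₗ[ℝ] F).normDet = (C : E →ₗ[ℝ] F).normDet := by
    have : (C' : E →ₗ[ℝ] F) = (C : E →ₗ[ℝ] F) ∘ₗ B := rfl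
    rw [this, LinearMap.normDet_comp_of_finrank_eq _ _ rfl, LinearMap.normDet_eq_abs_det, hBd]
    simp
  have e2 : (C' : E →ₗ[ℝ] F) ∘ₗ S.incl.toLinearMap
      = ((C ∘L S.graphDeriv l : E' →L[ℝ] F) : E' →ₗ[ℝ] F) := by
    ext y
    simp only [hC', LinearMap.comp_apply, ContinuousLinearMap.coe_coe,
      ContinuousLinearMap.comp_apply, LinearMap.coe_toContinuousLinearMap',
      LinearIsometry.coe_toLinearMap, hBincl]
  have e3 : C' x = C n := by
    simp only [hC', ContinuousLinearMap.comp_apply, LinearMap.coe_toContinuousLinearMap', hBx]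
  rw [e1, e2, e3] at h
  have e4 : p n = p S.dir * ⟪S.dir, x⟫_ℝ := by
    conv_lhs => rw [S.exists_eq n]
    rw [map_add, hp', map_smul, smul_eq_mul, hx, inner_sub_right, inner_smul_right,
      S.inner_dir_dir]
    ring
  rw [e4, abs_mul, ← h]
  ring

end Splitting

/-- Every unit vector is the direction of a splitting. -/
theorem exists_splitting {k : ℕ} (hk : finrank ℝ E = k + 1) {u : E} (hu : ‖u‖ = 1) :
    ∃ S : Splitting (EuclideanSpace ℝ (Fin k)) E, S.dir = u := by
  have hu0 : u ≠ 0 := by rintro rfl; simp at hu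
  have : Fact (finrank ℝ E = k + 1) := ⟨hk⟩
  have hfr : finrank ℝ (ℝ ∙ u)ᗮ = k := Submodule.finrank_orthogonal_span_singleton hu0
  let e := (stdOrthonormalBasis ℝ (ℝ ∙ u)ᗮ).reindex (finCongr hfr)
  refine ⟨⟨(ℝ ∙ u)ᗮ.subtypeₗᵢ.comp e.repr.symm.toLinearIsometry, u, hu, fun y => ?_, ?_⟩, rfl⟩
  · have := (e.repr.symm y).2
    rw [Submodule.mem_orthogonal_singleton_iff_inner_left] at this
    exact this
  · simp [hk]

end Splittings

end SurfactantFlow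

namespace SurfactantFlow

/-! ### Level sets and corners as graphs -/

section Graphs

open Module Set
open scoped NNReal ENNReal ContDiff

variable {E' E : Type*} [NormedAddCommGroup E'] [InnerProductSpace ℝ E'] [FiniteDimensional ℝ E']
  [NormedAddCommGroup E] [InnerProductSpace ℝ E] [FiniteDimensional ℝ E]

namespace Splitting

variable (S : Splitting E' E)

/-- Near a point at which `ψ` increases in the direction `dir`, the sign of `ψ` is that of the
height over the graph of a function `h`. -/
theorem exists_graph {n : ℕ∞ω} (hn : n ≠ 0) {ψ : E → ℝ} {x₀ : E} (hψ : ContDiffAt ℝ n ψ x₀)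
    (h0 : ψ x₀ = 0) (hd : 0 < fderiv ℝ ψ x₀ S.dir) :
    ∃ h : E' → ℝ, ContDiffAt ℝ n h (S.pt.symm x₀).1 ∧ h (S.pt.symm x₀).1 = (S.pt.symm x₀).2 ∧
      ∀ᶠ p in 𝓝 (S.pt.symm x₀), (ψ (S.pt p) < 0 ↔ p.2 < h p.1) ∧
        (ψ (S.pt p) = 0 ↔ p.2 = h p.1) := by
  set p₀ := S.pt.symm x₀ with hp₀
  have hpx : S.pt p₀ = x₀ := S.pt.apply_symm_apply x₀
  set f : E' × ℝ → ℝ := fun p => ψ (S.pt p) with hf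
  have hψ1 : ContDiffAt ℝ 1 ψ x₀ := hψ.of_le (ENat.one_le_iff_ne_zero_withTop.2 hn)
  have hcf : ContDiffAt ℝ n f p₀ := by
    refine ContDiffAt.comp p₀ (g := ψ) (f := S.pt) (by rwa [hpx]) S.pt.contDiff.contDiffAt
  have hfd : fderiv ℝ f p₀ = fderiv ℝ ψ x₀ ∘L (S.pt : (E' × ℝ) →L[ℝ] E) := by
    have h1 : HasFDerivAt ψ (fderiv ℝ ψ x₀) (S.pt p₀) := by
      rw [hpx]; exact (hψ1.differentiableAt one_ne_zero).hasFDerivAt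
    exact (h1.comp p₀ S.pt.hasFDerivAt).fderiv
  have hinv : (fderiv ℝ f p₀ ∘L .inr ℝ E' ℝ).IsInvertible := by
    refine ⟨ContinuousLinearEquiv.unitsEquivAut ℝ (Units.mk0 _ hd.ne'), ?_⟩
    ext
    simp [hfd]
  set h := hcf.implicitFunction hn hinv with hh
  have e1 : h p₀.1 = p₀.2 := hcf.implicitFunction_apply_self hn hinv
  have e2 := hcf.eventually_apply_eq_iff_implicitFunction hn hinv
  have e3 : ContDiffAt ℝ n h p₀.1 := hcf.contDiffAt_implicitFunction hn hinv
  have hf0 : f p₀ = 0 := by rw [hf]; simp only [hpx, h0]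
  refine ⟨h, e3, e1, ?_⟩
  -- on a box around `p₀`, `ψ` is strictly increasing in the height
  have e4 : ∀ᶠ p in 𝓝 p₀, DifferentiableAt ℝ ψ (S.pt p) ∧ 0 < fderiv ℝ ψ (S.pt p) S.dir := by
    have hc : Tendsto S.pt (𝓝 p₀) (𝓝 x₀) := by
      have := S.pt.continuous.tendsto p₀; rwa [hpx] at this
    have h1 : ∀ᶠ x in 𝓝 x₀, ContDiffAt ℝ 1 ψ x := hψ1.eventually (by simp)
    have h2 : ContinuousAt (fun x => fderiv ℝ ψ x S.dir) x₀ :=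
      (hψ1.continuousAt_fderiv one_ne_zero).clm_apply continuousAt_const
    filter_upwards [hc.eventually h1, hc.eventually (h2.eventually (lt_mem_nhds hd))] with p a b
    exact ⟨a.differentiableAt one_ne_zero, b⟩
  have e5 := e2.and e4
  obtain ⟨r, hr, hbox'⟩ := Metric.eventually_nhds_iff.1 e5
  have hbox : ∀ ⦃x : E' × ℝ⦄, x ∈ Metric.ball p₀.1 r ×ˢ Metric.ball p₀.2 r →
      (f x = f p₀ ↔ h x.1 = x.2) ∧ DifferentiableAt ℝ ψ (S.pt x) ∧
        0 < fderiv ℝ ψ (S.pt x) S.dir := fun x hx => by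
    refine hbox' ?_
    rw [Prod.dist_eq]
    exact max_lt hx.1 hx.2
  have e6 : ∀ᶠ y in 𝓝 p₀.1, h y ∈ Metric.ball p₀.2 r := by
    have := e3.continuousAt.tendsto
    rw [e1] at this
    exact this (Metric.ball_mem_nhds _ hr)
  have e7 : ∀ᶠ p in 𝓝 p₀, p.1 ∈ Metric.ball p₀.1 r ∧ p.2 ∈ Metric.ball p₀.2 r ∧
      h p.1 ∈ Metric.ball p₀.2 r := by
    have c1 := (continuous_fst.tendsto p₀).eventually (Metric.ball_mem_nhds p₀.1 hr)
    have c2 := (continuous_snd.tendsto p₀).eventually (Metric.ball_mem_nhds p₀.2 hr)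
    have c3 := (continuous_fst.tendsto p₀).eventually e6
    filter_upwards [c1, c2, c3] with p a b c using ⟨a, b, c⟩
  filter_upwards [e7] with p ⟨hp1, hp2, hp3⟩
  have hmono : StrictMonoOn (fun s => ψ (S.pt (p.1, s))) (Metric.ball p₀.2 r) := by
    have hder : ∀ s ∈ Metric.ball p₀.2 r, HasDerivAt (fun s => ψ (S.pt (p.1, s)))
        (fderiv ℝ ψ (S.pt (p.1, s)) S.dir) s := by
      intro s hs
      have h1 := ((hbox (x := (p.1, s)) ⟨hp1, hs⟩).2.1).hasFDerivAt
      have h2 : HasDerivAt (fun s : ℝ => S.pt (p.1, s)) S.dir s := by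
        simp only [pt_apply]
        simpa using ((hasDerivAt_id s).smul_const S.dir).const_add (S.incl p.1)
      exact h1.comp_hasDerivAt s h2
    refine strictMonoOn_of_deriv_pos (convex_ball _ _)
      (fun s hs => (hder s hs).continuousAt.continuousWithinAt) fun s hs => ?_
    have hs' := interior_subset hs
    rw [(hder s hs').deriv]
    exact (hbox (x := (p.1, s)) ⟨hp1, hs'⟩).2.2
  have hz : ψ (S.pt (p.1, h p.1)) = 0 := by
    have := (hbox (x := (p.1, h p.1)) ⟨hp1, hp3⟩).1
    rw [hf0] at this
    exact this.2 rfl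
  constructor
  · have := hmono.lt_iff_lt hp2 hp3
    simp only [hz] at this
    exact this
  · have := hmono.injOn.eq_iff hp2 hp3
    simp only [hz] at this
    exact this

/-- The point of the graph of `h` over `y`. -/
noncomputable def graphMap (h : E' → ℝ) (y : E') : E := S.pt (y, h y)

theorem graphMap_apply (h : E' → ℝ) (y : E') : S.graphMap h y = S.incl y + h y • S.dir := rfl

theorem pt_symm_graphMap (h : E' → ℝ) (y : E') : S.pt.symm (S.graphMap h y) = (y, h y) :=
  S.pt.symm_apply_apply _

theorem graphMap_injective (h : E' → ℝ) : Function.Injective (S.graphMap h) := fun y z hyz => by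
  have := S.pt.injective hyz
  exact (Prod.ext_iff.1 this).1

theorem graphDeriv_injective (l : E' →L[ℝ] ℝ) : Function.Injective (S.graphDeriv l) := by
  intro y z hyz
  have := congrArg S.proj hyz
  simpa using this

theorem hasFDerivAt_graphMap {h : E' → ℝ} {y : E'} (hh : DifferentiableAt ℝ h y) :
    HasFDerivAt (S.graphMap h) (S.graphDeriv (fderiv ℝ h y)) y := by
  have h1 : HasFDerivAt (fun y => S.incl y) S.incl.toContinuousLinearMap y :=
    S.incl.toContinuousLinearMap.hasFDerivAt
  exact h1.add (hh.hasFDerivAt.smul_const S.dir)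

theorem exists_eq_graphDeriv (l : E' →L[ℝ] ℝ) (v : E) :
    ∃ a : ℝ, v = S.graphDeriv l (S.proj v) + a • S.dir := by
  refine ⟨⟪S.dir, v⟫_ℝ - l (S.proj v), ?_⟩
  conv_lhs => rw [S.exists_eq v]
  rw [graphDeriv_apply, sub_smul]; abel

/-- The derivative of `ψ` annihilates the tangent vectors of a graph on which `ψ` vanishes. -/
theorem fderiv_graphDeriv_eq_zero {ψ : E → ℝ} {h : E' → ℝ} {y : E'}
    (hψ : DifferentiableAt ℝ ψ (S.graphMap h y)) (hh : DifferentiableAt ℝ h y)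
    (h0 : ∀ᶠ z in 𝓝 y, ψ (S.graphMap h z) = 0) (v : E') :
    fderiv ℝ ψ (S.graphMap h y) (S.graphDeriv (fderiv ℝ h y) v) = 0 := by
  have h1 := hψ.hasFDerivAt.comp y (S.hasFDerivAt_graphMap hh)
  have h2 : (ψ ∘ S.graphMap h) =ᶠ[𝓝 y] fun _ => (0 : ℝ) := h0
  have h3 := (h1.congr_of_eventuallyEq h2.symm).unique (hasFDerivAt_const (0 : ℝ) y)
  exact congrArg (fun L : E' →L[ℝ] ℝ => L v) h3

/-- `W` is a region with `C¹` boundary near `x`, given by `ψ < 0`, whose boundary is transversal to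
the direction of the splitting and has the slope `l` at `x`. -/
structure IsRegularBoundaryPoint (W : Set E) (x : E) (l : E' →L[ℝ] ℝ) (ψ : E → ℝ) : Prop where
  contDiffAt : ContDiffAt ℝ 1 ψ x
  eq_zero : ψ x = 0
  pos : 0 < fderiv ℝ ψ x S.dir
  tangent : ∀ v, fderiv ℝ ψ x (S.graphDeriv l v) = 0
  mem_iff : ∀ᶠ y in 𝓝 x, (y ∈ W ↔ ψ y < 0)

/-- Near `x₀` the region `W` is the subgraph of a Lipschitz function `h`, over a ball of radius
`r`. -/
structure IsSubgraphNear [MeasurableSpace E'] [BorelSpace E'] (W : Set E) (x₀ : E) (h : E' → ℝ)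
    (r : ℝ) : Prop where
  pos : 0 < r
  lipschitz : ∃ C, LipschitzOnWith C h (Metric.ball (S.pt.symm x₀).1 r)
  mem_iff : ∀ᶠ p in 𝓝 (S.pt.symm x₀), (S.pt p ∈ W ↔ p.2 < h p.1)
  frontier_iff : ∀ᶠ p in 𝓝 (S.pt.symm x₀), (S.pt p ∈ frontier W ↔ p.2 = h p.1)
  ae_regular : ∀ᵐ y, y ∈ Metric.ball (S.pt.symm x₀).1 r →
    DifferentiableAt ℝ h y ∧ ∃ ψ, S.IsRegularBoundaryPoint W (S.graphMap h y) (fderiv ℝ h y) ψ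

/-- The boundary of the subgraph of a continuous function is its graph. -/
theorem frontier_iff_of_mem_iff {W : Set E} {x₀ : E} {h : E' → ℝ}
    (hh : ∀ᶠ y in 𝓝 (S.pt.symm x₀).1, ContinuousAt h y)
    (hW : ∀ᶠ p in 𝓝 (S.pt.symm x₀), (S.pt p ∈ W ↔ p.2 < h p.1)) :
    ∀ᶠ p in 𝓝 (S.pt.symm x₀), (S.pt p ∈ frontier W ↔ p.2 = h p.1) := by
  have hW2 := hW.eventually_nhds
  have hh2 := (continuous_fst.tendsto (S.pt.symm x₀)).eventually hh
  filter_upwards [hW2, hh2] with p hp hc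
  have hc2 : ContinuousAt (fun q : E' × ℝ => h q.1) p := hc.comp continuousAt_fst
  have hpre : ∀ T : Set E, S.pt p ∈ closure T ↔ p ∈ closure (S.pt ⁻¹' T) := fun T => by
    exact Set.ext_iff.1 (S.pt.toHomeomorph.preimage_closure T) p
  have key : S.pt p ∈ frontier W ↔ (∃ᶠ q in 𝓝 p, q.2 < h q.1) ∧ ∃ᶠ q in 𝓝 p, ¬ q.2 < h q.1 := by
    rw [frontier_eq_closure_inter_closure, mem_inter_iff, hpre, hpre, mem_closure_iff_frequently,
      mem_closure_iff_frequently]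
    refine and_congr (frequently_congr hp) (frequently_congr ?_)
    filter_upwards [hp] with q hq
    exact not_congr hq
  rw [key]
  constructor
  · rintro ⟨h1, h2⟩
    by_contra hne
    rcases lt_or_gt_of_ne hne with hlt | hlt
    · exact h2 (by
        filter_upwards [continuousAt_snd.eventually_lt hc2 hlt] with q hq using by simpa using hq)
    · exact h1 (by
        filter_upwards [hc2.eventually_lt continuousAt_snd hlt] with q hq using by
          simpa using hq.le)
  · intro he
    have hv : Tendsto (fun s : ℝ => (p.1, s)) (𝓝 p.2) (𝓝 p) :=
      (Continuous.prodMk_right p.1).tendsto p.2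
    constructor
    · refine hv.frequently ?_
      have : ∃ᶠ s in 𝓝[<] p.2, s < h p.1 :=
        (eventually_nhdsWithin_of_forall fun s hs => he ▸ hs).frequently
      exact this.filter_mono nhdsWithin_le_nhds
    · refine fun hcon => ?_
      have := hcon.self_of_nhds
      simp [he] at this

/-- A region with a corner is the subgraph of the minimum of finitely many `C¹` functions, in every
direction in which all its defining functions increase. Where this minimum is differentiable, which
is almost everywhere by Rademacher's theorem, the boundary is `C¹`. -/
theorem exists_isSubgraphNear [MeasurableSpace E'] [BorelSpace E'] {J : Type*} [Fintype J]
    [Nonempty J] {ψ : J → E → ℝ} {x₀ : E} {W : Set E} (hψ : ∀ j, ContDiffAt ℝ 1 (ψ j) x₀)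
    (h0 : ∀ j, ψ j x₀ = 0) (hd : ∀ j, 0 < fderiv ℝ (ψ j) x₀ S.dir)
    (hind : LinearIndependent ℝ fun j => fderiv ℝ (ψ j) x₀)
    (hW : ∀ᶠ x in 𝓝 x₀, (x ∈ W ↔ ∀ j, ψ j x < 0)) :
    ∃ h r, S.IsSubgraphNear W x₀ h r := by
  set p₀ := S.pt.symm x₀ with hp₀
  have hpx : S.pt p₀ = x₀ := S.pt.apply_symm_apply x₀
  have hg := fun j => S.exists_graph one_ne_zero (hψ j) (h0 j) (hd j)
  choose g hgc hg0 hgs using hg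
  -- the subgraph of the smallest of the functions whose subgraphs are the regions `ψ j < 0`
  set h : E' → ℝ := fun y => Finset.univ.inf' Finset.univ_nonempty fun j => g j y with hh
  have hlt : ∀ y s, s < h y ↔ ∀ j, s < g j y := fun y s => by
    simp [hh, Finset.lt_inf'_iff]
  have hle : ∀ y j, h y ≤ g j y := fun y j => Finset.inf'_le _ (Finset.mem_univ j)
  have hact : ∀ y, ∃ j, h y = g j y := fun y => by
    obtain ⟨j, -, hj⟩ := Finset.exists_mem_eq_inf' (Finset.univ_nonempty (α := J)) fun j => g j y
    exact ⟨j, hj⟩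
  have hc : Tendsto S.pt (𝓝 p₀) (𝓝 x₀) := by
    have := S.pt.continuous.tendsto p₀; rwa [hpx] at this
  have hind' : ∀ᶠ x in 𝓝 x₀, LinearIndependent ℝ fun j => fderiv ℝ (ψ j) x := by
    have ht : Tendsto (fun x j => fderiv ℝ (ψ j) x) (𝓝 x₀) (𝓝 fun j => fderiv ℝ (ψ j) x₀) :=
      tendsto_pi_nhds.2 fun j => (hψ j).continuousAt_fderiv one_ne_zero
    exact ht.eventually (isOpen_setOfPred_linearIndependent.mem_nhds hind)
  have hψ' : ∀ᶠ x in 𝓝 x₀, ∀ j, ContDiffAt ℝ 1 (ψ j) x ∧ 0 < fderiv ℝ (ψ j) x S.dir := by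
    refine eventually_all.2 fun j => ((hψ j).eventually (by simp)).and ?_
    have h2 : ContinuousAt (fun x => fderiv ℝ (ψ j) x S.dir) x₀ :=
      ((hψ j).continuousAt_fderiv one_ne_zero).clm_apply continuousAt_const
    exact h2.eventually (lt_mem_nhds (hd j))
  have hWp : ∀ᶠ p in 𝓝 p₀, (S.pt p ∈ W ↔ p.2 < h p.1) := by
    filter_upwards [hc.eventually hW, eventually_all.2 hgs] with p h1 h2
    rw [h1, hlt]
    exact forall_congr' fun j => (h2 j).1
  have hall : ∀ᶠ p in 𝓝 p₀, (∀ j, ∀ᶠ q in 𝓝 p, (ψ j (S.pt q) < 0 ↔ q.2 < g j q.1) ∧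
        (ψ j (S.pt q) = 0 ↔ q.2 = g j q.1)) ∧
      (LinearIndependent ℝ fun j => fderiv ℝ (ψ j) (S.pt p)) ∧
      (∀ j, ContDiffAt ℝ 1 (ψ j) (S.pt p) ∧ 0 < fderiv ℝ (ψ j) (S.pt p) S.dir) ∧
      ∀ᶠ x in 𝓝 (S.pt p), (x ∈ W ↔ ∀ j, ψ j x < 0) :=
    (eventually_all.2 fun j => (hgs j).eventually_nhds).and
      ((hc.eventually hind').and ((hc.eventually hψ').and (hc.eventually hW.eventually_nhds)))
  have hh0 : h p₀.1 = p₀.2 := by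
    obtain ⟨j, hj⟩ := hact p₀.1
    rw [hj, hg0]
  have hhc0 : ContinuousAt h p₀.1 :=
    ContinuousAt.finset_inf'_apply Finset.univ_nonempty fun j _ => (hgc j).continuousAt
  have hgraph : Tendsto (fun y => (y, h y)) (𝓝 p₀.1) (𝓝 p₀) := by
    have : Tendsto (fun y => (y, h y)) (𝓝 p₀.1) (𝓝 (p₀.1, h p₀.1)) :=
      (continuousAt_id.prodMk hhc0).tendsto
    rwa [hh0] at this
  have hgc' : ∀ᶠ y in 𝓝 p₀.1, ∀ j, ContDiffAt ℝ 1 (g j) y :=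
    eventually_all.2 fun j => (hgc j).eventually (by simp)
  obtain ⟨C, T, hT, hLip⟩ : ∃ (C : ℝ≥0) (T : Set E'), T ∈ 𝓝 p₀.1 ∧ LipschitzOnWith C h T := by
    choose K t ht hK using fun j => (hgc j).exists_lipschitzOnWith
    refine ⟨Finset.univ.sup K, ⋂ j, t j, iInter_mem.2 ht, LipschitzOnWith.of_le_add_mul _ ?_⟩
    intro y hy z hz
    obtain ⟨j, hj⟩ := hact z
    have h1 := (hK j).dist_le_mul y (mem_iInter.1 hy j) z (mem_iInter.1 hz j)
    have h2 : (K j : ℝ) ≤ (Finset.univ.sup K : ℝ≥0) := by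
      exact_mod_cast Finset.le_sup (f := K) (Finset.mem_univ j)
    have h3 := le_of_abs_le h1
    have h4 : (K j : ℝ) * dist y z ≤ (Finset.univ.sup K : ℝ≥0) * dist y z := by gcongr
    have h5 := hle y j
    rw [hj]
    linarith
  obtain ⟨r, hr, hball⟩ := Metric.eventually_nhds_iff_ball.1 (hgc'.and (Filter.Eventually.and hT
    (hgraph.eventually hall)))
  have hL : LipschitzOnWith C h (Metric.ball p₀.1 r) := hLip.mono fun y hy => (hball y hy).2.1
  refine ⟨h, r, hr, ⟨C, hL⟩, hWp, S.frontier_iff_of_mem_iff ?_ hWp, ?_⟩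
  · filter_upwards [Metric.ball_mem_nhds p₀.1 hr] with y hy
    exact hL.continuousOn.continuousAt (Metric.isOpen_ball.mem_nhds hy)
  filter_upwards [hL.ae_differentiableWithinAt_of_mem (μ := volume)] with y hyd hy
  have hd' : DifferentiableAt ℝ h y :=
    (hyd hy).differentiableAt (Metric.isOpen_ball.mem_nhds hy)
  obtain ⟨hgy, -, hsg, hli, hψy, hWy⟩ := hball y hy
  -- an active function touches `h` from above, hence has the same derivative
  have hder : ∀ j, h y = g j y → ∀ v, fderiv ℝ (ψ j) (S.graphMap h y)
      (S.graphDeriv (fderiv ℝ h y) v) = 0 := by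
    intro j hj v
    have hgd := (hgy j).differentiableAt one_ne_zero
    have hmin : IsLocalMin (g j - h) y := Eventually.of_forall fun z => by
      have := hle z j
      simp [hj, this]
    have he : fderiv ℝ (g j) y = fderiv ℝ h y := by
      have := hmin.fderiv_eq_zero
      rw [fderiv_sub hgd hd'] at this
      exact sub_eq_zero.1 this
    have hgm : S.graphMap h y = S.graphMap (g j) y := by rw [graphMap, graphMap, hj]
    rw [hgm, ← he]
    refine S.fderiv_graphDeriv_eq_zero ?_ hgd ?_ v
    · rw [← hgm]; exact ((hψy j).1).differentiableAt one_ne_zero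
    · have ht : Tendsto (fun z => (z, g j z)) (𝓝 y) (𝓝 (y, h y)) := by
        rw [hj]; exact (continuousAt_id.prodMk (hgy j).continuousAt).tendsto
      filter_upwards [ht.eventually (hsg j)] with z hz
      exact hz.2.2 rfl
  obtain ⟨j, hj⟩ := hact y
  -- only one function is active where `h` is differentiable
  have huniq : ∀ l, h y = g l y → l = j := by
    intro l hl
    by_contra hne
    set x := S.graphMap h y
    have hrel : (fderiv ℝ (ψ l) x S.dir) • fderiv ℝ (ψ j) x
        - (fderiv ℝ (ψ j) x S.dir) • fderiv ℝ (ψ l) x = 0 := by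
      ext v
      obtain ⟨a, ha⟩ := S.exists_eq_graphDeriv (fderiv ℝ h y) v
      rw [ha]
      simp only [sub_apply, smul_apply, map_add, map_smul,
        hder j hj, hder l hl, smul_eq_mul, zero_apply]
      ring
    have hcomp := hli.comp ![j, l] (by
      intro a b hab
      fin_cases a <;> fin_cases b <;> simp_all [eq_comm])
    rw [show (fun j => fderiv ℝ (ψ j) (S.pt (y, h y))) ∘ ![j, l]
      = ![fderiv ℝ (ψ j) x, fderiv ℝ (ψ l) x] by ext i; fin_cases i <;> rfl] at hcomp
    have hp := LinearIndependent.pair_iff.1 hcomp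
    exact (hψy l).2.ne' (hp _ (-(fderiv ℝ (ψ j) x S.dir)) (by
      rw [neg_smul, ← sub_eq_add_neg]; exact hrel)).1
  refine ⟨hd', ψ j, (hψy j).1, ?_, (hψy j).2, hder j hj, ?_⟩
  · exact ((hsg j).self_of_nhds.2).2 hj
  · have hothers : ∀ᶠ x in 𝓝 (S.graphMap h y), ∀ l, l ≠ j → ψ l x < 0 := by
      refine eventually_all.2 fun l => ?_
      by_cases hlj : l = j
      · exact Eventually.of_forall fun x hx => absurd hlj hx
      have : ψ l (S.graphMap h y) < 0 :=
        ((hsg l).self_of_nhds.1).2 (lt_of_le_of_ne (hle y l) fun he => hlj (huniq l he))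
      filter_upwards [(hψy l).1.continuousAt.eventually_lt continuousAt_const this] with x hx _
        using hx
    filter_upwards [hWy, hothers] with x hx ho
    rw [hx]
    refine ⟨fun h => h j, fun h l => ?_⟩
    by_cases hlj : l = j
    · rw [hlj]; exact h
    · exact ho l hlj

/-- Fundamental theorem of calculus in the direction of the splitting. -/
theorem integral_fderiv_subgraph [MeasurableSpace E'] [BorelSpace E'] [MeasurableSpace E]
    [BorelSpace E] {f : E → ℝ} (hf : ContDiff ℝ 1 f) (hc : HasCompactSupport f) {W : Set E}
    (hWm : MeasurableSet W) {h : E' → ℝ}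
    (hW : ∀ p, S.pt p ∈ tsupport f → (S.pt p ∈ W ↔ p.2 < h p.1)) :
    ∫ x in W, fderiv ℝ f x S.dir = ∫ y, f (S.graphMap h y) := by
  have hcont : Continuous fun x => fderiv ℝ f x S.dir :=
    (hf.continuous_fderiv one_ne_zero).clm_apply continuous_const
  have hcs : HasCompactSupport fun x => fderiv ℝ f x S.dir := hc.fderiv_apply (𝕜 := ℝ) S.dir
  have hint : Integrable (fun x => fderiv ℝ f x S.dir) := hcont.integrable_of_hasCompactSupport hcs
  have hzero : ∀ x, x ∉ tsupport f → fderiv ℝ f x S.dir = 0 := fun x hx => by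
    rw [fderiv_of_notMem_tsupport (𝕜 := ℝ) hx]; rfl
  rw [← integral_indicator hWm,
    ← S.measurePreserving_pt.integral_comp S.pt.toHomeomorph.measurableEmbedding]
  have hint2 : Integrable (fun p => W.indicator (fun x => fderiv ℝ f x S.dir) (S.pt p))
      ((volume : Measure E').prod (volume : Measure ℝ)) :=
    (S.measurePreserving_pt.integrable_comp_emb S.pt.toHomeomorph.measurableEmbedding).2
      (hint.indicator hWm)
  rw [Measure.volume_eq_prod, integral_prod _ hint2]
  refine integral_congr_ae (Eventually.of_forall fun y => ?_)
  simp only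
  have hline : ∀ s : ℝ, HasDerivAt (fun s => S.pt (y, s)) S.dir s := fun s => by
    simp only [pt_apply]
    simpa using ((hasDerivAt_id s).smul_const S.dir).const_add (S.incl y)
  have hderiv : ∀ s : ℝ, HasDerivAt (fun s => f (S.pt (y, s))) (fderiv ℝ f (S.pt (y, s)) S.dir) s :=
    fun s => ((hf.differentiable one_ne_zero).differentiableAt.hasFDerivAt).comp_hasDerivAt s (hline s)
  have h1 : ∀ s : ℝ, W.indicator (fun x => fderiv ℝ f x S.dir) (S.pt (y, s))
      = (Iio (h y)).indicator (fun s => deriv (fun s => f (S.pt (y, s))) s) s := by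
    intro s
    classical
    rw [indicator_apply, indicator_apply, (hderiv s).deriv]
    by_cases hs : S.pt (y, s) ∈ tsupport f
    · have := hW (y, s) hs
      simp only [mem_Iio, this]
    · simp only [hzero _ hs, ite_self]
  simp_rw [h1]
  rw [integral_indicator measurableSet_Iio, ← integral_Iic_eq_integral_Iio]
  have hcd : ContDiff ℝ 1 fun s : ℝ => f (S.pt (y, s)) := by
    refine hf.comp (S.pt.contDiff.comp (contDiff_const.prodMk contDiff_id))
  have hcs2 : HasCompactSupport fun s : ℝ => f (S.pt (y, s)) := by
    have he : Isometry fun s : ℝ => S.pt (y, s) := Isometry.of_dist_eq fun s s' => by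
      rw [dist_eq_norm, dist_eq_norm, pt_apply, pt_apply, add_sub_add_left_eq_sub, ← sub_smul,
        norm_smul, S.norm_dir, mul_one]
    exact hc.comp_isClosedEmbedding he.isClosedEmbedding
  exact HasCompactSupport.integral_Iic_deriv_eq hcd hcs2 (h y)

end Splitting
end Graphs
end SurfactantFlow

namespace SurfactantFlow

/-! ### Integration by parts near a boundary point -/

section LocalBoundary

open Module Set
open scoped NNReal ENNReal ContDiff

variable {E' E F : Type*} [NormedAddCommGroup E'] [InnerProductSpace ℝ E'] [FiniteDimensional ℝ E']
  [MeasurableSpace E'] [BorelSpace E']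
  [NormedAddCommGroup E] [InnerProductSpace ℝ E] [FiniteDimensional ℝ E]
  [MeasurableSpace E] [BorelSpace E]
  [NormedAddCommGroup F] [InnerProductSpace ℝ F] [FiniteDimensional ℝ F]
  [MeasurableSpace F] [BorelSpace F]

theorem eventually_injective_fderiv {φ : E → F} {x₀ : E} (hφ : ContDiffAt ℝ 1 φ x₀)
    (hi : Function.Injective (fderiv ℝ φ x₀)) :
    ∀ᶠ x in 𝓝 x₀, DifferentiableAt ℝ φ x ∧ Function.Injective (fderiv ℝ φ x) := by
  have hc := hφ.continuousAt_fderiv one_ne_zero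
  have h1 := hc.eventually (ContinuousLinearMap.isOpen_injective.mem_nhds hi)
  filter_upwards [h1, hφ.eventually (by simp)] with x a b
  exact ⟨b.differentiableAt one_ne_zero, a⟩

/-- An immersion is locally injective and Lipschitz. -/
theorem exists_nhds_injOn_lipschitzOnWith {φ : E → F} {x₀ : E} (hφ : ContDiffAt ℝ 1 φ x₀)
    (hi : Function.Injective (fderiv ℝ φ x₀)) :
    ∃ T ∈ 𝓝 x₀, InjOn φ T ∧ ∃ C, LipschitzOnWith C φ T := by
  obtain ⟨K, hK, hKA⟩ := exists_pos_norm_le_of_injective hi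
  have hs := hφ.hasStrictFDerivAt one_ne_zero
  obtain ⟨T, hT, hTa⟩ := hs.approximates_deriv_on_nhds (c := (1 / (2 * K)).toNNReal)
    (Or.inr (Real.toNNReal_pos.2 (by positivity)))
  obtain ⟨C, T', hT', hC⟩ := hφ.exists_lipschitzOnWith
  refine ⟨T ∩ T', inter_mem hT hT', ?_, C, hC.mono inter_subset_right⟩
  intro x hx y hy hxy
  have h := hTa x hx.1 y hy.1
  rw [hxy, sub_self, zero_sub, norm_neg, Real.coe_toNNReal _ (by positivity)] at h
  have h2 := hKA (x - y)
  have h3 : K * (1 / (2 * K) * ‖x - y‖) = ‖x - y‖ / 2 := by field_simp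
  have h4 : ‖x - y‖ ≤ ‖x - y‖ / 2 := by
    calc _ ≤ _ := h2
      _ ≤ K * (1 / (2 * K) * ‖x - y‖) := by gcongr
      _ = _ := h3
  have : ‖x - y‖ = 0 := le_antisymm (by linarith) (norm_nonneg _)
  exact sub_eq_zero.1 (norm_eq_zero.1 this)

namespace Splitting

variable (S : Splitting E' E)

/-- Integration by parts in the direction of the splitting, for functions supported near a boundary
point. The boundary integral is taken over the image of the boundary under the immersion `φ`; the
hypothesis on `Q` says that `Q` times the volume factor of the parametrized boundary is `f`. -/
theorem IsSubgraphNear.exists_integral_boundary {S : Splitting E' E} {W : Set E} {x₀ : E}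
    {h : E' → ℝ} {r : ℝ} (hs : S.IsSubgraphNear W x₀ h r) (hWm : MeasurableSet W) {φ : E → F}
    (hφ : ContDiffAt ℝ 1 φ x₀) (hφi : Function.Injective (fderiv ℝ φ x₀)) :
    ∃ U₀ ∈ 𝓝 x₀, ∀ U ⊆ U₀, IsOpen U → ∀ f : E → ℝ, ContDiff ℝ 1 f → HasCompactSupport f →
      tsupport f ⊆ U → ∀ Q : F → ℝ, (∀ x ∈ U, ∀ l ψ, S.IsRegularBoundaryPoint W x l ψ →
        ((fderiv ℝ φ x ∘L S.graphDeriv l : E' →L[ℝ] F) : E' →ₗ[ℝ] F).normDet * Q (φ x) = f x) →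
      IntegrableOn Q (φ '' (frontier W ∩ U)) μHE[finrank ℝ E'] ∧
        ∫ x in W, fderiv ℝ f x S.dir = ∫ x in φ '' (frontier W ∩ U), Q x ∂μHE[finrank ℝ E'] := by
  set p₀ := S.pt.symm x₀ with hp₀
  have hsymm : Tendsto S.pt.symm (𝓝 x₀) (𝓝 p₀) := S.pt.symm.continuous.tendsto x₀
  obtain ⟨T, hT, hTi, Cφ, hTC⟩ := exists_nhds_injOn_lipschitzOnWith hφ hφi
  have hev : ∀ᶠ x in 𝓝 x₀, x ∈ T ∧ (DifferentiableAt ℝ φ x ∧ Function.Injective (fderiv ℝ φ x)) ∧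
      (x ∈ W ↔ (S.pt.symm x).2 < h (S.pt.symm x).1) ∧
      (x ∈ frontier W ↔ (S.pt.symm x).2 = h (S.pt.symm x).1) ∧
      (S.pt.symm x).1 ∈ Metric.ball p₀.1 r := by
    have h1 := hsymm.eventually hs.mem_iff
    have h2 := hsymm.eventually hs.frontier_iff
    have h3 := ((continuous_fst.tendsto p₀).comp hsymm).eventually
      (Metric.ball_mem_nhds p₀.1 hs.pos)
    filter_upwards [hT, eventually_injective_fderiv hφ hφi, h1, h2, h3] with x a b c d e
    rw [S.pt.apply_symm_apply] at c d
    exact ⟨a, b, c, d, e⟩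
  refine ⟨_, hev, fun U hU₀ hUo f hf hfc hfU Q hQ => ?_⟩
  have hU := fun x hx => hU₀ (a := x) hx
  simp only [mem_ofPred_eq] at hU
  set B := Metric.ball p₀.1 r with hB
  obtain ⟨C, hC⟩ := hs.lipschitz
  set c := S.graphMap h with hc
  have hcsymm : ∀ y, S.pt.symm (c y) = (y, h y) := S.pt_symm_graphMap h
  have hcB : ∀ y, c y ∈ U → y ∈ B := fun y hy => by
    have := (hU _ hy).2.2.2.2
    rwa [hcsymm] at this
  have hccont : ContinuousOn c B :=
    S.pt.continuous.comp_continuousOn (continuousOn_id.prodMk hC.continuousOn)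
  set G : Set E' := {y | c y ∈ U} with hG
  have hGB : G ⊆ B := fun y hy => hcB y hy
  have hGo : IsOpen G := by
    have := hccont.isOpen_inter_preimage Metric.isOpen_ball hUo
    rwa [show B ∩ c ⁻¹' U = G from by
      ext y; exact ⟨fun hy => hy.2, fun hy => ⟨hGB hy, hy⟩⟩] at this
  -- the boundary is the graph of `h` over `G`
  have himg : frontier W ∩ U = c '' G := by
    ext x
    constructor
    · rintro ⟨hx1, hx2⟩
      have := ((hU x hx2).2.2.2.1).1 hx1
      have hx : c (S.pt.symm x).1 = x := by
        rw [hc, graphMap, ← this]; exact S.pt.apply_symm_apply x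
      exact ⟨(S.pt.symm x).1, by rw [hG, mem_ofPred_eq, hx]; exact hx2, hx⟩
    · rintro ⟨y, hy, rfl⟩
      refine ⟨((hU _ hy).2.2.2.1).2 ?_, hy⟩
      rw [hcsymm]
  -- the points over which the boundary is regular
  obtain ⟨Z, hZsub, hZm, hZ0⟩ := exists_measurable_superset_of_null (ae_iff.1 hs.ae_regular)
  set G' := G \ Z with hG'
  have hG'm : MeasurableSet G' := hGo.measurableSet.diff hZm
  have hreg : ∀ y ∈ G', DifferentiableAt ℝ h y ∧
      ∃ ψ, S.IsRegularBoundaryPoint W (c y) (fderiv ℝ h y) ψ := by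
    intro y hy
    by_contra hcon
    exact hy.2 (hZsub fun himp => hcon (himp (hGB hy.1)))
  set Φ : E' → F := fun y => φ (c y) with hΦ
  have hΦd : ∀ y ∈ G', HasFDerivAt Φ (fderiv ℝ φ (c y) ∘L S.graphDeriv (fderiv ℝ h y)) y := by
    intro y hy
    exact ((hU _ hy.1).2.1.1.hasFDerivAt).comp y (S.hasFDerivAt_graphMap (hreg y hy).1)
  have hd : ∀ y ∈ G', DifferentiableAt ℝ Φ y := fun y hy => (hΦd y hy).differentiableAt
  have hi : ∀ y ∈ G', Function.Injective (fderiv ℝ Φ y) := fun y hy => by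
    rw [(hΦd y hy).fderiv]
    exact (hU _ hy.1).2.1.2.comp (S.graphDeriv_injective _)
  have hinjG : InjOn Φ G := fun y hy z hz hyz =>
    S.graphMap_injective h (hTi (hU _ hy).1 (hU _ hz).1 hyz)
  have hinj : InjOn Φ G' := hinjG.mono sdiff_subset
  have hLip : ∃ K, LipschitzOnWith K Φ G := by
    have h1 : LipschitzOnWith (1 + C) c B := by
      refine LipschitzOnWith.of_dist_le_mul fun y hy z hz => ?_
      have h2 := hC.dist_le_mul y hy z hz
      have h3 : c y - c z = S.incl (y - z) + (h y - h z) • S.dir := by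
        simp only [hc, graphMap_apply, map_sub, sub_smul]; abel
      rw [dist_eq_norm (c y), h3]
      refine (norm_add_le _ _).trans ?_
      rw [S.incl.norm_map, norm_smul, S.norm_dir, mul_one, NNReal.coe_add, NNReal.coe_one,
        ← dist_eq_norm, ← dist_eq_norm]
      linarith
    exact ⟨Cφ * (1 + C), hTC.comp (h1.mono hGB) fun y hy => (hU _ hy).1⟩
  obtain ⟨K, hK⟩ := hLip
  -- `Φ` is Lipschitz and maps null sets to null sets
  have hnull : (μHE[finrank ℝ E'] : Measure F) (Φ '' G \ Φ '' G') = 0 := by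
    have h1 : Φ '' G \ Φ '' G' ⊆ Φ '' (G ∩ Z) := by
      rintro _ ⟨⟨y, hy, rfl⟩, hn⟩
      refine ⟨y, ⟨hy, ?_⟩, rfl⟩
      by_contra hyZ
      exact hn ⟨y, ⟨hy, hyZ⟩, rfl⟩
    have h2 := SurfactantFlow.LipschitzOnWith.euclideanHausdorffMeasure_image_le
      (finrank ℝ E') (hK.mono (inter_subset_left (t := Z)))
    rw [InnerProductSpace.euclideanHausdorffMeasure_eq_volume,
      measure_mono_null inter_subset_right hZ0, mul_zero] at h2
    exact measure_mono_null h1 (le_antisymm h2 bot_le)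
  have hae : Φ '' G' =ᵐ[μHE[finrank ℝ E']] Φ '' G := by
    refine ae_eq_set.2 ⟨?_, hnull⟩
    rw [sdiff_eq_empty.2 (image_mono sdiff_subset)]
    exact measure_empty
  have hGG' : G' =ᵐ[volume] G := by
    refine ae_eq_set.2 ⟨by rw [sdiff_eq_empty.2 sdiff_subset]; exact measure_empty, ?_⟩
    refine measure_mono_null (fun y hy => ?_) hZ0
    by_contra hyZ
    exact hy.2 ⟨hy.1, hyZ⟩
  have hQG : ∀ y ∈ G', (fderiv ℝ Φ y : E' →ₗ[ℝ] F).normDet * Q (Φ y) = f (c y) := by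
    intro y hy
    obtain ⟨ψ, hψ⟩ := (hreg y hy).2
    rw [(hΦd y hy).fderiv]
    exact hQ _ hy.1 _ _ hψ
  have himg2 : φ '' (frontier W ∩ U) = Φ '' G := by rw [himg, image_image]
  have hfc' : ContinuousOn (fun y => f (c y)) G :=
    hf.continuous.comp_continuousOn (hccont.mono hGB)
  obtain ⟨M, hM⟩ := hfc.exists_bound_of_continuous hf.continuous
  have hintf : IntegrableOn (fun y => f (c y)) G := by
    have : IsFiniteMeasure (volume.restrict G) :=
      ⟨by rw [Measure.restrict_apply_univ]; exact (measure_mono hGB).trans_lt measure_ball_lt_top⟩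
    exact Integrable.of_bound (hfc'.aestronglyMeasurable hGo.measurableSet) M
      (Eventually.of_forall fun y => hM _)
  rw [himg2]
  refine ⟨?_, ?_⟩
  · refine IntegrableOn.congr_set_ae ?_ hae.symm
    rw [integrableOn_image_iff_normDet_fderiv hG'm hd hi hinj]
    exact (hintf.mono_set sdiff_subset).congr_fun (fun y hy => (hQG y hy).symm) hG'm
  · rw [← setIntegral_congr_set hae, integral_image_eq_normDet_fderiv hG'm hd hi hinj,
      setIntegral_congr_fun hG'm hQG, setIntegral_congr_set hGG',
      S.integral_fderiv_subgraph hf hfc hWm (h := h)]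
    · refine (setIntegral_eq_integral_of_forall_compl_eq_zero fun y hy => ?_).symm
      by_contra hne
      exact hy (hfU (subset_tsupport f hne))
    · intro p hp
      have := (hU _ (hfU hp)).2.2.1
      rwa [S.pt.symm_apply_apply] at this

end Splitting

end LocalBoundary

end SurfactantFlow

namespace SurfactantFlow

/-! ### The divergence theorem near a boundary point -/

section LocalDivergence

open Module Set
open scoped NNReal ENNReal

variable {E F : Type*}
  [NormedAddCommGroup E] [InnerProductSpace ℝ E] [FiniteDimensional ℝ E]
  [MeasurableSpace E] [BorelSpace E]
  [NormedAddCommGroup F] [InnerProductSpace ℝ F] [FiniteDimensional ℝ F]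
  [MeasurableSpace F] [BorelSpace F]

/-- Near `x`, the set `W` is the negative set of the `C¹` function `ψ`, which vanishes at `x` with
a nonzero derivative. -/
structure IsDefiningFunction (W : Set E) (x : E) (ψ : E → ℝ) : Prop where
  contDiffAt : ContDiffAt ℝ 1 ψ x
  eq_zero : ψ x = 0
  fderiv_ne_zero : fderiv ℝ ψ x ≠ 0
  mem_iff : ∀ᶠ y in 𝓝 x, (y ∈ W ↔ ψ y < 0)

/-- Near `x`, the set `W` is a corner: the intersection of the negative sets of finitely many `C¹`
functions which vanish at `x` with independent derivatives. -/
structure IsCorner {J : Type*} (W : Set E) (x : E) (ψ : J → E → ℝ) : Prop where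
  contDiffAt : ∀ j, ContDiffAt ℝ 1 (ψ j) x
  eq_zero : ∀ j, ψ j x = 0
  linearIndependent : LinearIndependent ℝ fun j => fderiv ℝ (ψ j) x
  mem_iff : ∀ᶠ y in 𝓝 x, (y ∈ W ↔ ∀ j, ψ j y < 0)

/-- Independent covectors take prescribed values at a suitable vector. -/
theorem exists_forall_eq_of_linearIndependent {J : Type*} [Finite J] {p : J → E →L[ℝ] ℝ}
    (hp : LinearIndependent ℝ p) (c : J → ℝ) : ∃ e, ∀ j, p j e = c j := by
  have := Fintype.ofFinite J
  let L : E →ₗ[ℝ] (J → ℝ) := LinearMap.pi fun j => (p j : E →ₗ[ℝ] ℝ)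
  suffices h : Function.Surjective L by
    obtain ⟨e, he⟩ := h c
    exact ⟨e, fun j => congrFun he j⟩
  rw [← LinearMap.range_eq_top]
  by_contra hne
  obtain ⟨f, hf0, hf⟩ := Submodule.exists_le_ker_of_lt_top _ (lt_top_iff_ne_top.2 hne)
  classical
  rw [Fintype.linearIndependent_iff] at hp
  have hf' : ∀ y, f y = ∑ j, y j * f (Pi.single j 1) := fun y => by
    conv_lhs => rw [pi_eq_sum_univ' y]
    simp [map_sum]
  have h0 := hp (fun j => f (Pi.single j 1)) (by
    ext e
    have h1 : f (L e) = 0 := hf ⟨e, rfl⟩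
    rw [hf'] at h1
    simp only [sum_apply, smul_apply, smul_eq_mul,
      zero_apply]
    rw [← h1]
    exact Finset.sum_congr rfl fun j _ => mul_comm _ _)
  apply hf0
  ext j
  simp [h0 j]

/-- A nonempty open set contains a basis. -/
theorem exists_basis_mem_of_isOpen {E : Type*} [NormedAddCommGroup E] [NormedSpace ℝ E]
    [FiniteDimensional ℝ E] {s : Set E} (hs : IsOpen s) {e : E} (he : e ∈ s) :
    ∃ (n : ℕ) (b : Basis (Fin n) ℝ E), ∀ i, b i ∈ s := by
  have hspan : ⊤ ≤ Submodule.span ℝ s :=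
    (Submodule.eq_top_of_nonempty_interior' _
      ⟨e, interior_maximal Submodule.subset_span hs he⟩).ge
  have hsub := Basis.ofSpan_subset hspan
  have := FiniteDimensional.fintypeBasisIndex (Basis.ofSpan hspan)
  exact ⟨_, (Basis.ofSpan hspan).reindex (Fintype.equivFin _), fun i =>
    hsub (by rw [Basis.reindex_apply]; exact mem_range_self _)⟩

/-- The directions on which finitely many independent covectors are positive contain a basis. -/
theorem exists_basis_pos {J : Type*} [Finite J] {p : J → E →L[ℝ] ℝ} (hp : LinearIndependent ℝ p) :
    ∃ (n : ℕ) (b : Basis (Fin n) ℝ E), ∀ i j, 0 < p j (b i) := by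
  obtain ⟨e, he⟩ := exists_forall_eq_of_linearIndependent hp 1
  refine exists_basis_mem_of_isOpen (s := {v | ∀ j, 0 < p j v}) (e := e) ?_ fun j => by simp [he j]
  rw [ofPred_forall]
  exact isOpen_iInter_of_finite fun j => isOpen_lt continuous_const (p j).continuous

/-- An injective linear map pulls the inner product back to an inner product, with respect to which
every covector has a gradient. -/
theorem exists_forall_inner_eq {A : E →L[ℝ] F} (hA : Function.Injective A) (p : E →L[ℝ] ℝ) :
    ∃ n, ∀ v, ⟪A n, A v⟫_ℝ = p v := by
  set K : E →L[ℝ] E := ContinuousLinearMap.adjoint A ∘L A with hK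
  have hKi : ∀ v w, ⟪K v, w⟫_ℝ = ⟪A v, A w⟫_ℝ := fun v w => by
    simp [hK, ContinuousLinearMap.adjoint_inner_left]
  have hinj : Function.Injective (K : E →ₗ[ℝ] E) := by
    rw [injective_iff_map_eq_zero]
    intro v hv
    have h1 := hKi v v
    rw [show K v = 0 from hv, inner_zero_left] at h1
    exact (injective_iff_map_eq_zero A).1 hA v (inner_self_eq_zero.1 h1.symm)
  obtain ⟨n, hn⟩ := LinearMap.injective_iff_surjective.1 hinj
    ((InnerProductSpace.toDual ℝ E).symm p)
  refine ⟨n, fun v => ?_⟩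
  rw [← hKi, show K n = _ from hn, InnerProductSpace.toDual_symm_apply]

/-- The divergence theorem for vector fields with compact support in the whole space. -/
theorem integral_trace_fderiv_eq_zero {w : E → E} (hw : ContDiff ℝ 1 w)
    (hc : HasCompactSupport w) : ∫ x, LinearMap.trace ℝ E (fderiv ℝ w x) = 0 := by
  set b := stdOrthonormalBasis ℝ E
  have hd : ∀ x, HasFDerivAt w (fderiv ℝ w x) x := fun x =>
    (hw.differentiable one_ne_zero x).hasFDerivAt
  have htr : ∀ x, LinearMap.trace ℝ E (fderiv ℝ w x)
      = ∑ i, fderiv ℝ (fun x => ⟪b i, w x⟫_ℝ) x (b i) := fun x => by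
    rw [LinearMap.trace_eq_sum_inner _ b]
    refine Finset.sum_congr rfl fun i _ => ?_
    have h1 : HasFDerivAt (fun x => ⟪b i, w x⟫_ℝ) (innerSL ℝ (b i) ∘L fderiv ℝ w x) x :=
      (innerSL ℝ (b i)).hasFDerivAt.comp x (hd x)
    rw [h1.fderiv]
    rfl
  have hcd : ∀ i, ContDiff ℝ 1 fun x => ⟪b i, w x⟫_ℝ := fun i => contDiff_const.inner ℝ hw
  have hcs : ∀ i, HasCompactSupport fun x => ⟪b i, w x⟫_ℝ := fun i =>
    hc.comp_left (g := fun z => ⟪b i, z⟫_ℝ) (inner_zero_right _)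
  have hint : ∀ i, Integrable fun x => fderiv ℝ (fun x => ⟪b i, w x⟫_ℝ) x (b i) := fun i =>
    (((hcd i).continuous_fderiv one_ne_zero).clm_apply
      continuous_const).integrable_of_hasCompactSupport ((hcs i).fderiv_apply (𝕜 := ℝ) _)
  simp only [htr]
  rw [integral_finsetSum _ fun i _ => hint i]
  refine Finset.sum_eq_zero fun i _ => ?_
  have := integral_mul_fderiv_eq_neg_fderiv_mul_of_integrable (μ := (volume : Measure E))
    (f := fun _ => (1 : ℝ)) (g := fun x => ⟪b i, w x⟫_ℝ) (v := b i) (by simp)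
    (by simpa using hint i)
    (by simpa using (hcd i).continuous.integrable_of_hasCompactSupport (hcs i))
    (fun x _ => differentiableAt_const _) (fun x _ => (hcd i).differentiable one_ne_zero x)
  simpa using this

/-- The divergence theorem in a region with a corner, for vector fields supported near the
corner.
The boundary integral is transported by an immersion `φ`. The field `N` is the unit normal of the
image of the boundary in the image of `φ`. -/
theorem IsCorner.exists_integral_div {J : Type*} [Finite J] {W : Set E} {x₀ : E} {ψ : J → E → ℝ}
    (h : IsCorner W x₀ ψ) (hWm : MeasurableSet W) {k : ℕ}
    (hk : finrank ℝ E = k + 1) {φ : E → F} (hφ : ContDiffAt ℝ 1 φ x₀)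
    (hφi : Function.Injective (fderiv ℝ φ x₀)) :
    ∃ U₀ ∈ 𝓝 x₀, ∀ U ⊆ U₀, IsOpen U → ∀ (ω : E → E), ContDiff ℝ 1 ω → HasCompactSupport ω →
      tsupport ω ⊆ U → ∀ (q : F → ℝ) (N : F → F),
      (∀ x ∈ U, q (φ x) = ⟪N (φ x), fderiv ℝ φ x (ω x)⟫_ℝ / (fderiv ℝ φ x : E →ₗ[ℝ] F).normDet) →
      (∀ x ∈ U, ∀ ψ, IsDefiningFunction W x ψ → ∀ n,
        (∀ v, ⟪fderiv ℝ φ x n, fderiv ℝ φ x v⟫_ℝ = fderiv ℝ ψ x v) →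
        N (φ x) = ‖fderiv ℝ φ x n‖⁻¹ • fderiv ℝ φ x n) →
      IntegrableOn q (φ '' (frontier W ∩ U)) μHE[k] ∧
        ∫ x in W, LinearMap.trace ℝ E (fderiv ℝ ω x)
          = ∫ z in φ '' (frontier W ∩ U), q z ∂μHE[k] := by
  have := Fintype.ofFinite J
  rcases isEmpty_or_nonempty J with hJ | hJ
  · -- without constraints, `x₀` is an interior point
    have hW : W ∈ 𝓝 x₀ := by
      filter_upwards [h.mem_iff] with y hy using hy.2 fun j => hJ.elim j
    refine ⟨interior W, interior_mem_nhds.2 hW, fun U hU _ w hw hwc hwU q N _ _ => ?_⟩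
    have hemp : frontier W ∩ U = ∅ := by
      rw [← disjoint_iff_inter_eq_empty]
      exact disjoint_interior_frontier.symm.mono_right hU
    rw [hemp, image_empty, setIntegral_empty, setIntegral_eq_integral_of_forall_compl_eq_zero,
      integral_trace_fderiv_eq_zero hw hwc]
    · exact ⟨integrableOn_empty, rfl⟩
    · intro x hx
      have hx' : x ∉ tsupport w := fun h' => hx (interior_subset (hU (hwU h')))
      rw [fderiv_of_notMem_tsupport (𝕜 := ℝ) hx']
      simp
  -- all defining functions increase in the directions of a basis; in each of these directions the
  -- region is a subgraph, and the corresponding component of `ω` can be integrated by parts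
  obtain ⟨m, b, hb⟩ := exists_basis_pos h.linearIndependent
  have hb0 : ∀ i, 0 < ‖b i‖ := fun i => norm_pos_iff.2 (b.ne_zero i)
  have hS := fun i => exists_splitting (E := E) hk (u := ‖b i‖⁻¹ • b i) (norm_smul_inv_norm (b.ne_zero i))
  choose S hSdir using hS
  have hloc := fun i => (S i).exists_isSubgraphNear h.contDiffAt h.eq_zero (fun j => by
    rw [hSdir, map_smul]; exact mul_pos (inv_pos.2 (hb0 i)) (hb i j)) h.linearIndependent h.mem_iff
  choose g r hgr using hloc
  have hloc2 := fun i => (hgr i).exists_integral_boundary hWm hφ hφi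
  choose U₁ hU₁ hU₁i using hloc2
  obtain ⟨T, hT, hTi, -⟩ := exists_nhds_injOn_lipschitzOnWith hφ hφi
  refine ⟨(⋂ i, U₁ i) ∩ T ∩ {x | DifferentiableAt ℝ φ x ∧ Function.Injective (fderiv ℝ φ x)},
    inter_mem (inter_mem (iInter_mem.2 hU₁) hT) (eventually_injective_fderiv hφ hφi),
    fun U hU hUo ω hω hωc hωU q N hq hN => ?_⟩
  set a : Fin m → E →L[ℝ] ℝ := fun i => ‖b i‖ • LinearMap.toContinuousLinearMap (b.coord i) with ha
  have hab : ∀ v, v = ∑ i, a i v • (S i).dir := fun v => by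
    conv_lhs => rw [← b.sum_repr v]
    refine Finset.sum_congr rfl fun i _ => ?_
    rw [hSdir, smul_smul]
    congr 1
    simp only [ha, smul_apply, smul_eq_mul,
      LinearMap.coe_toContinuousLinearMap', Basis.coord_apply]
    field_simp [(hb0 i).ne']
  have hUinj : InjOn φ U := hTi.mono fun x hx => (hU hx).1.2
  set X : F → E := Function.invFunOn φ U with hX
  have hXφ : ∀ x ∈ U, X (φ x) = x := fun x hx => hUinj.leftInvOn_invFunOn hx
  set Q : Fin m → F → ℝ := fun i z => a i (ω (X z)) *
    (⟪N z, fderiv ℝ φ (X z) (S i).dir⟫_ℝ / (fderiv ℝ φ (X z) : E →ₗ[ℝ] F).normDet) with hQ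
  have hmain : ∀ i, IntegrableOn (Q i) (φ '' (frontier W ∩ U)) μHE[k] ∧
      ∫ x in W, fderiv ℝ (fun x => a i (ω x)) x (S i).dir
        = ∫ z in φ '' (frontier W ∩ U), Q i z ∂μHE[k] := by
    intro i
    have key := hU₁i i U (fun x hx => (mem_iInter.1 (hU hx).1.1 i)) hUo (fun x => a i (ω x))
      ((a i).contDiff.comp hω) (hωc.comp_left (map_zero _))
      ((closure_mono (Function.support_comp_subset (map_zero (a i)) ω)).trans hωU) (Q i)
    rw [finrank_euclideanSpace_fin] at key
    refine key fun x hx l ψ hψ => ?_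
    have hAi := (hU hx).2.2
    set A := fderiv ℝ φ x with hA
    have hψ0 : fderiv ℝ ψ x ≠ 0 := fun h0 => by
      have := hψ.pos; rw [h0] at this; exact lt_irrefl _ this
    obtain ⟨n, hn⟩ := exists_forall_inner_eq hAi (fderiv ℝ ψ x)
    have hNx := hN x hx ψ ⟨hψ.contDiffAt, hψ.eq_zero, hψ0, hψ.mem_iff⟩ n hn
    have hl := (S i).normDet_mul_abs_apply A l hψ.tangent (n := n) fun y => by
      rw [hn, hψ.tangent]
    have hAn : 0 < ‖A n‖ := by
      rw [norm_pos_iff]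
      intro h0
      apply hψ0
      ext v
      rw [← hn, h0, inner_zero_left]; rfl
    have hpn : fderiv ℝ ψ x n = ‖A n‖ ^ 2 := by rw [← hn, real_inner_self_eq_norm_sq]
    have hnd : 0 < (A : E →ₗ[ℝ] F).normDet := normDet_pos hAi
    rw [hpn, abs_of_nonneg (by positivity), abs_of_pos hψ.pos] at hl
    simp only [hQ, hXφ x hx, hNx, ← hA, inner_smul_left, hn]
    simp only [conj_trivial]
    have hne := hψ.pos.ne'
    have h2 : (A : E →ₗ[ℝ] F).normDet * ‖A n‖ = fderiv ℝ ψ x (S i).dir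
        * ((A ∘L (S i).graphDeriv l : EuclideanSpace ℝ (Fin k) →L[ℝ] F) :
          EuclideanSpace ℝ (Fin k) →ₗ[ℝ] F).normDet := by
      refine mul_right_cancel₀ hAn.ne' ?_
      linear_combination hl
    rw [show ∀ D : ℝ, D * (a i (ω x) * (‖A n‖⁻¹ * fderiv ℝ ψ x (S i).dir
      / (A : E →ₗ[ℝ] F).normDet)) = a i (ω x) * ((fderiv ℝ ψ x (S i).dir * D)
        / ((A : E →ₗ[ℝ] F).normDet * ‖A n‖)) from fun D => by field_simp, ← h2,
      div_self (by positivity), mul_one]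
  have hqQ : ∀ z ∈ φ '' (frontier W ∩ U), q z = ∑ i, Q i z := by
    rintro _ ⟨x, ⟨-, hx⟩, rfl⟩
    rw [hq x hx]
    conv_lhs => rw [hab (ω x)]
    simp only [hQ, hXφ x hx, map_sum, map_smul, inner_sum, inner_smul_right, Finset.sum_div,
      mul_div_assoc]
  have hmeas : MeasurableSet (φ '' (frontier W ∩ U)) := by
    refine measurableSet_image_of_differentiableAt (isClosed_frontier.measurableSet.inter
      hUo.measurableSet) (fun x hx => (hU hx.2).2.1) (hUinj.mono inter_subset_right)
  have htr : ∀ x, LinearMap.trace ℝ E (fderiv ℝ ω x)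
      = ∑ i, fderiv ℝ (fun x => a i (ω x)) x (S i).dir := by
    intro x
    have hd := (hω.differentiable one_ne_zero x).hasFDerivAt
    have h1 : ∀ i, fderiv ℝ (fun x => a i (ω x)) x = a i ∘L fderiv ℝ ω x := fun i =>
      ((a i).hasFDerivAt.comp x hd).fderiv
    have h2 : (fderiv ℝ ω x : E →ₗ[ℝ] E) = ∑ i, LinearMap.smulRight
        ((a i ∘L fderiv ℝ ω x : E →L[ℝ] ℝ) : E →ₗ[ℝ] ℝ) (S i).dir := by
      ext v
      simp only [LinearMap.sum_apply, LinearMap.smulRight_apply]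
      exact hab _
    rw [h2, map_sum]
    refine Finset.sum_congr rfl fun i _ => ?_
    rw [LinearMap.trace_smulRight, h1]; rfl
  refine ⟨?_, ?_⟩
  · exact (show IntegrableOn (fun z => ∑ i, Q i z) _ _ from
      integrable_finsetSum Finset.univ fun i _ => (hmain i).1).congr_fun
      (fun z hz => (hqQ z hz).symm) hmeas
  · rw [setIntegral_congr_fun hmeas hqQ, integral_finsetSum _ fun i _ => (hmain i).1]
    simp only [htr]
    rw [integral_finsetSum]
    · exact Finset.sum_congr rfl fun i _ => (hmain i).2
    · intro i _
      have hc : ContDiff ℝ 1 fun x => a i (ω x) := (a i).contDiff.comp hω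
      exact (((hc.continuous_fderiv one_ne_zero).clm_apply
        continuous_const).integrable_of_hasCompactSupport
        ((hωc.comp_left (g := a i) (map_zero _)).fderiv_apply (𝕜 := ℝ) _)).integrableOn

end LocalDivergence

end SurfactantFlow

namespace SurfactantFlow

/-! ### The divergence theorem in the bulk -/

section BulkDivergence

open Module Set

section Uniqueness

variable {E : Type*} [NormedAddCommGroup E] [InnerProductSpace ℝ E]

/-- The signs of a function along a ray from one of its zeros. -/
theorem eventually_neg_of_fderiv_neg {ψ : E → ℝ} {x : E} (hψ : DifferentiableAt ℝ ψ x)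
    (h0 : ψ x = 0) {v : E} (hv : fderiv ℝ ψ x v < 0) :
    ∀ᶠ t in 𝓝[>] (0 : ℝ), ψ (x + t • v) < 0 := by
  have h1 : HasDerivAt (fun t : ℝ => x + t • v) v 0 := by
    simpa using ((hasDerivAt_id (0 : ℝ)).smul_const v).const_add x
  have h2 : HasDerivAt (fun t : ℝ => ψ (x + t • v)) (fderiv ℝ ψ x v) 0 := by
    have h3 : HasFDerivAt ψ (fderiv ℝ ψ x) (x + (0 : ℝ) • v) := by simpa using hψ.hasFDerivAt
    exact h3.comp_hasDerivAt (0 : ℝ) h1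
  have h4 := (hasDerivWithinAt_iff_tendsto_slope' (by simp)).1 (h2.hasDerivWithinAt (s := Ioi 0))
  filter_upwards [h4.eventually (gt_mem_nhds hv), self_mem_nhdsWithin] with t ht ht0
  rw [slope_def_field] at ht
  simp only [zero_smul, add_zero, h0, sub_zero] at ht
  have ht1 : 0 < t := ht0
  have := mul_neg_of_neg_of_pos ht ht1
  rwa [div_mul_cancel₀ _ ht1.ne'] at this

/-- Two defining functions of the same set have proportional derivatives. -/
theorem IsDefiningFunction.exists_pos_smul_eq [FiniteDimensional ℝ E] {W : Set E} {x : E}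
    {ψ ψ' : E → ℝ} (h : IsDefiningFunction W x ψ) (h' : IsDefiningFunction W x ψ') :
    ∃ c : ℝ, 0 < c ∧ fderiv ℝ ψ' x = c • fderiv ℝ ψ x := by
  have hd := h.contDiffAt.differentiableAt one_ne_zero
  have hd' := h'.contDiffAt.differentiableAt one_ne_zero
  have key : ∀ v, fderiv ℝ ψ x v < 0 → fderiv ℝ ψ' x v ≤ 0 := by
    intro v hv
    by_contra! hv'
    have e1 := eventually_neg_of_fderiv_neg hd h.eq_zero hv
    have e2 : ∀ᶠ t in 𝓝[>] (0 : ℝ), -ψ' (x + t • v) < 0 := by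
      refine eventually_neg_of_fderiv_neg (ψ := fun y => -ψ' y) hd'.neg (by simp [h'.eq_zero]) ?_
      rw [fderiv_fun_neg]
      simpa using hv'
    have hcont : Tendsto (fun t : ℝ => x + t • v) (𝓝[>] 0) (𝓝 x) := by
      have : Continuous fun t : ℝ => x + t • v := by fun_prop
      have h3 := this.tendsto 0
      rw [zero_smul, add_zero] at h3
      exact h3.mono_left nhdsWithin_le_nhds
    obtain ⟨t, ⟨⟨h1, h2⟩, h3⟩, h4⟩ := (((e1.and e2).and (hcont.eventually h.mem_iff)).and
      (hcont.eventually h'.mem_iff)).exists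
    have := h4.1 (h3.2 h1)
    linarith
  obtain ⟨v₀, hv₀⟩ : ∃ v, fderiv ℝ ψ x v = 1 := by
    obtain ⟨v, hv⟩ : ∃ v, fderiv ℝ ψ x v ≠ 0 := by
      by_contra! hcon
      exact h.fderiv_ne_zero (ContinuousLinearMap.ext hcon)
    exact ⟨(fderiv ℝ ψ x v)⁻¹ • v, by rw [map_smul, smul_eq_mul, inv_mul_cancel₀ hv]⟩
  -- the half-space inequality extends to the kernel by continuity, hence the kernels agree
  have hker : ∀ u, fderiv ℝ ψ x u = 0 → fderiv ℝ ψ' x u ≤ 0 := by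
    intro u hu
    refine le_of_forall_pos_le_add fun ε hε => ?_
    set K := |fderiv ℝ ψ' x v₀| + 1
    have hK : 0 < K := by positivity
    have h1 := key (u - (ε / K) • v₀) (by
      rw [map_sub, hu, map_smul, hv₀, smul_eq_mul, mul_one, zero_sub, neg_lt_zero]
      positivity)
    rw [map_sub, map_smul, smul_eq_mul] at h1
    have h2 : ε / K * fderiv ℝ ψ' x v₀ ≤ ε / K * K := by
      gcongr
      exact (le_abs_self _).trans (by simp [K])
    rw [div_mul_cancel₀ _ hK.ne'] at h2
    linarith
  have heq : fderiv ℝ ψ' x = fderiv ℝ ψ' x v₀ • fderiv ℝ ψ x := by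
    ext v
    have h1 : fderiv ℝ ψ x (v - fderiv ℝ ψ x v • v₀) = 0 := by
      rw [map_sub, map_smul, hv₀]; simp
    have h2 := hker _ h1
    have h3 := hker (-(v - fderiv ℝ ψ x v • v₀)) (by rw [map_neg, h1, neg_zero])
    rw [map_neg] at h3
    rw [map_sub, map_smul, smul_eq_mul] at h2 h3
    rw [smul_apply, smul_eq_mul]
    linarith
  refine ⟨_, ?_, heq⟩
  have h1 := key (-v₀) (by rw [map_neg, hv₀]; norm_num)
  rw [map_neg] at h1
  refine lt_of_le_of_ne (by linarith) fun h0 => h'.fderiv_ne_zero ?_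
  rw [heq, ← h0, zero_smul]

end Uniqueness

section Gluing

variable {F : Type*} [NormedAddCommGroup F] [InnerProductSpace ℝ F] [FiniteDimensional ℝ F]
  [MeasurableSpace F] [BorelSpace F]

/-- A finite partition of unity on a compact set by compactly supported functions. -/
theorem exists_smooth_partition {K : Set F} (hK : IsCompact K) {O : F → Set F}
    (hO : ∀ x ∈ K, O x ∈ 𝓝 x) :
    ∃ (t : Finset F) (θ : F → F → ℝ), (∀ i ∈ t, i ∈ K) ∧ (∀ i ∈ t, ContDiff ℝ 1 (θ i)) ∧
      (∀ i ∈ t, HasCompactSupport (θ i)) ∧ (∀ i ∈ t, tsupport (θ i) ⊆ O i) ∧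
      ∀ x ∈ K, ∑ i ∈ t, θ i x = 1 := by
  obtain ⟨t, htK, htc⟩ := hK.elim_nhds_subcover (fun x => interior (O x ∩ Metric.ball x 1))
    fun x hx => interior_mem_nhds.2 (inter_mem (hO x hx) (Metric.ball_mem_nhds x one_pos))
  obtain ⟨f, hf⟩ := SmoothPartitionOfUnity.exists_isSubordinate (modelWithCornersSelf ℝ F)
    hK.isClosed (fun i : t => interior (O i ∩ Metric.ball i 1)) (fun i => isOpen_interior)
    (by simpa [iUnion_subtype] using htc)
  classical
  refine ⟨t, fun i => if h : i ∈ t then f ⟨i, h⟩ else 0, htK, fun i hi => ?_, fun i hi => ?_,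
    fun i hi => ?_, fun x hx => ?_⟩
  · simp only [dif_pos hi]
    exact ((f ⟨i, hi⟩).contMDiff.contDiff).of_le (by norm_cast)
  · simp only [dif_pos hi]
    refine HasCompactSupport.of_support_subset_isCompact (isCompact_closedBall i 1)
      ((subset_tsupport _).trans ((hf ⟨i, hi⟩).trans (interior_subset.trans
        (inter_subset_right.trans Metric.ball_subset_closedBall))))
  · simp only [dif_pos hi]
    exact (hf ⟨i, hi⟩).trans (interior_subset.trans inter_subset_left)
  · have h1 := f.sum_eq_one hx
    rw [finsum_eq_sum_of_fintype] at h1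
    rw [← h1, ← Finset.sum_coe_sort t]
    exact Finset.sum_congr rfl fun i _ => by simp

/-- An identity between integrals over `A` and `B` holds if it holds locally, that is, after
multiplication by cut-off functions. The left-hand integrand changes by the product rule. -/
theorem integral_eq_integral_of_locally {K V A B : Set F} (hK : IsCompact K) (hV : IsOpen V)
    (hAV : A ⊆ V) (hVK : V ⊆ K) (hBK : B ⊆ K) (hA : MeasurableSet A) (hB : MeasurableSet B)
    {a q : F → ℝ} {b : F → F} {α β : Measure F}
    (h : ∀ x ∈ K, ∃ O ∈ 𝓝 x, ∀ θ : F → ℝ, ContDiff ℝ 1 θ → HasCompactSupport θ → tsupport θ ⊆ O →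
      IntegrableOn (fun y => θ y * q y) B β ∧
      IntegrableOn (fun y => θ y * a y + fderiv ℝ θ y (b y)) A α ∧
      ∫ y in A, (θ y * a y + fderiv ℝ θ y (b y)) ∂α = ∫ y in B, θ y * q y ∂β) :
    IntegrableOn q B β ∧ IntegrableOn a A α ∧ ∫ y in A, a y ∂α = ∫ y in B, q y ∂β := by
  have h' : ∀ x, ∃ O, x ∈ K → O ∈ 𝓝 x ∧ ∀ θ : F → ℝ, ContDiff ℝ 1 θ → HasCompactSupport θ →
      tsupport θ ⊆ O → IntegrableOn (fun y => θ y * q y) B β ∧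
      IntegrableOn (fun y => θ y * a y + fderiv ℝ θ y (b y)) A α ∧
      ∫ y in A, (θ y * a y + fderiv ℝ θ y (b y)) ∂α = ∫ y in B, θ y * q y ∂β := fun x => by
    by_cases hx : x ∈ K
    · obtain ⟨O, hO, hO'⟩ := h x hx
      exact ⟨O, fun _ => ⟨hO, hO'⟩⟩
    · exact ⟨∅, fun hx' => absurd hx' hx⟩
  choose O hO using h'
  obtain ⟨t, θ, htK, hθ, hθc, hθO, hθ1⟩ := exists_smooth_partition hK fun x hx => (hO x hx).1
  have hloc := fun i (hi : i ∈ t) => (hO i (htK i hi)).2 (θ i) (hθ i hi) (hθc i hi) (hθO i hi)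
  have hq : ∀ y ∈ B, q y = ∑ i ∈ t, θ i y * q y := fun y hy => by
    rw [← Finset.sum_mul, hθ1 y (hBK hy), one_mul]
  have ha : ∀ y ∈ A, a y = ∑ i ∈ t, (θ i y * a y + fderiv ℝ (θ i) y (b y)) := fun y hy => by
    have h1 : (fun y => ∑ i ∈ t, θ i y) =ᶠ[𝓝 y] fun _ => 1 := by
      filter_upwards [hV.mem_nhds (hAV hy)] with z hz using hθ1 z (hVK hz)
    have h2 : ∑ i ∈ t, fderiv ℝ (θ i) y = 0 := by
      rw [← fderiv_fun_sum fun i hi => (hθ i hi).differentiable one_ne_zero y, h1.fderiv_eq]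
      exact fderiv_const_apply _
    rw [Finset.sum_add_distrib, ← Finset.sum_mul, hθ1 y (hVK (hAV hy)), one_mul, ← sum_apply, h2]
    simp
  have hqi : IntegrableOn (fun y => ∑ i ∈ t, θ i y * q y) B β :=
    integrable_finsetSum t fun i hi => (hloc i hi).1
  have hai : IntegrableOn (fun y => ∑ i ∈ t, (θ i y * a y + fderiv ℝ (θ i) y (b y))) A α :=
    integrable_finsetSum t fun i hi => (hloc i hi).2.1
  refine ⟨hqi.congr_fun (fun y hy => (hq y hy).symm) hB,
    hai.congr_fun (fun y hy => (ha y hy).symm) hA, ?_⟩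
  rw [setIntegral_congr_fun hA ha, setIntegral_congr_fun hB hq,
    integral_finsetSum t fun i hi => (hloc i hi).1,
    integral_finsetSum t fun i hi => (hloc i hi).2.1]
  exact Finset.sum_congr rfl fun i hi => (hloc i hi).2.2

theorem contDiff_smul_of_tsupport {θ : F → ℝ} {w : F → F} (hθ : ContDiff ℝ 1 θ)
    (hw : ∀ x ∈ tsupport θ, ContDiffAt ℝ 1 w x) : ContDiff ℝ 1 fun x => θ x • w x := by
  rw [contDiff_iff_contDiffAt]
  intro x
  by_cases hx : x ∈ tsupport θ
  · exact hθ.contDiffAt.smul (hw x hx)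
  · have h1 : θ =ᶠ[𝓝 x] 0 := notMem_tsupport_iff_eventuallyEq.1 hx
    have h2 : (fun x => θ x • w x) =ᶠ[𝓝 x] fun _ => 0 := by
      filter_upwards [h1] with y hy
      simp [hy]
    exact contDiffAt_const.congr_of_eventuallyEq h2

theorem continuous_trace {E : Type*} [NormedAddCommGroup E] [NormedSpace ℝ E]
    [FiniteDimensional ℝ E] :
    Continuous fun L : E →L[ℝ] E => LinearMap.trace ℝ E (L : E →ₗ[ℝ] E) :=
  ((LinearMap.trace ℝ E).comp (ContinuousLinearMap.coeLM ℝ)).continuous_of_finiteDimensional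

theorem trace_fderiv_smul {θ : F → ℝ} {w : F → F} {x : F} (hθ : DifferentiableAt ℝ θ x)
    (hw : DifferentiableAt ℝ w x) :
    LinearMap.trace ℝ F (fderiv ℝ (fun x => θ x • w x) x)
      = θ x * LinearMap.trace ℝ F (fderiv ℝ w x) + fderiv ℝ θ x (w x) := by
  rw [fderiv_fun_smul hθ hw]
  have h1 : (((θ x • fderiv ℝ w x + (fderiv ℝ θ x).smulRight (w x) : F →L[ℝ] F)) : F →ₗ[ℝ] F)
      = θ x • (fderiv ℝ w x : F →ₗ[ℝ] F)
        + LinearMap.smulRight (fderiv ℝ θ x : F →ₗ[ℝ] ℝ) (w x) := rfl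
  rw [h1, map_add, map_smul, LinearMap.trace_smulRight]
  rfl

end Gluing

variable {d : ℕ}

theorem inner_gradient (ψ : Space d → ℝ) (x v : Space d) : ⟪∇ ψ x, v⟫_ℝ = fderiv ℝ ψ x v :=
  InnerProductSpace.toDual_symm_apply

theorem gradient_eq_zero_iff {ψ : Space d → ℝ} {x : Space d} : ∇ ψ x = 0 ↔ fderiv ℝ ψ x = 0 := by
  rw [gradient, LinearIsometryEquiv.map_eq_zero_iff]

theorem norm_inv_smul_pos_smul {E : Type*} [NormedAddCommGroup E] [NormedSpace ℝ E] {c : ℝ}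
    (hc : 0 < c) (v : E) : ‖c • v‖⁻¹ • (c • v) = ‖v‖⁻¹ • v := by
  rw [norm_smul, Real.norm_of_nonneg hc.le, smul_smul, mul_inv]
  congr 1
  field_simp

/-- The chosen external normal is the normalized gradient of any defining function. -/
theorem IsDefiningFunction.outerNormal_eq {W : Set (Space d)} {x : Space d} {ψ : Space d → ℝ}
    (h : IsDefiningFunction W x ψ) : outerNormal W x = ‖∇ ψ x‖⁻¹ • ∇ ψ x := by
  have hex : ∃ n, IsOuterNormal W x n := ⟨_, ψ, h.contDiffAt, h.eq_zero,
    fun h0 => h.fderiv_ne_zero (gradient_eq_zero_iff.1 h0), h.mem_iff, rfl⟩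
  rw [outerNormal, dif_pos hex]
  obtain ⟨ψ', h1, h2, h3, h4, h5⟩ := hex.choose_spec
  rw [h5]
  obtain ⟨c, hc, hcc⟩ := h.exists_pos_smul_eq
    ⟨h1, h2, fun h0 => h3 (gradient_eq_zero_iff.2 h0), h4⟩
  have h6 : ∇ ψ' x = c • ∇ ψ x := by
    rw [gradient, gradient, hcc]; simp
  rw [h6, norm_inv_smul_pos_smul hc]

/-- The divergence theorem in a bounded region with piecewise `C¹` boundary. -/
theorem integral_trace_fderiv_eq_integral_frontier {k : ℕ} {W : Set (Space (k + 1))}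
    (hWo : IsOpen W) (hWb : Bornology.IsBounded W)
    (hW : ∀ x ∈ frontier W, ∃ (n : ℕ) (ψ : Fin n → Space (k + 1) → ℝ), IsCorner W x ψ)
    {w : Space (k + 1) → Space (k + 1)} (hw : ∀ x ∈ closure W, ContDiffAt ℝ 1 w x) :
    IntegrableOn (fun x => ⟪w x, outerNormal W x⟫_ℝ) (frontier W) μHE[k] ∧
      IntegrableOn (fun x => LinearMap.trace ℝ (Space (k + 1)) (fderiv ℝ w x)) W ∧
      ∫ x in W, LinearMap.trace ℝ (Space (k + 1)) (fderiv ℝ w x)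
        = ∫ x in frontier W, ⟪w x, outerNormal W x⟫_ℝ ∂μHE[k] := by
  refine integral_eq_integral_of_locally hWb.isCompact_closure hWo subset_rfl subset_closure
    frontier_subset_closure hWo.measurableSet isClosed_frontier.measurableSet (b := w)
    fun x hx => ?_
  have hcorner : ∃ (n : ℕ) (ψ : Fin n → Space (k + 1) → ℝ), IsCorner W x ψ := by
    by_cases hxW : x ∈ W
    · refine ⟨0, fun j => j.elim0, fun j => j.elim0, fun j => j.elim0,
        linearIndependent_empty_type, ?_⟩
      filter_upwards [hWo.mem_nhds hxW] with y hy
      simpa using hy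
    · exact hW x ⟨hx, by rwa [hWo.interior_eq]⟩
  obtain ⟨n, ψ, hψ⟩ := hcorner
  have hid : (fderiv ℝ (id : Space (k + 1) → Space (k + 1)) x) = .id ℝ _ := fderiv_id
  obtain ⟨U₀, hU₀, hU⟩ := hψ.exists_integral_div hWo.measurableSet
    (finrank_euclideanSpace_fin (𝕜 := ℝ)) (φ := id) contDiffAt_id (by
      rw [hid]; exact Function.injective_id)
  have hwx : {y | ContDiffAt ℝ 1 w y} ∈ 𝓝 x := (hw x hx).eventually (by simp)
  set O := interior (U₀ ∩ {y | ContDiffAt ℝ 1 w y}) with hO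
  refine ⟨O, interior_mem_nhds.2 (inter_mem hU₀ hwx), fun θ hθ hθc hθO => ?_⟩
  have hOU : ∀ y ∈ O, ContDiffAt ℝ 1 w y := fun y hy => (interior_subset hy).2
  have hθw : ContDiff ℝ 1 fun x => θ x • w x :=
    contDiff_smul_of_tsupport hθ fun y hy => hOU y (hθO hy)
  have hcs : HasCompactSupport fun x => θ x • w x := hθc.smul_right
  have key := hU O (interior_subset.trans inter_subset_left) isOpen_interior (fun x => θ x • w x)
    hθw hcs ((tsupport_smul_subset_left θ w).trans hθO)
    (fun y => θ y * ⟪w y, outerNormal W y⟫_ℝ) (outerNormal W) (fun y _ => by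
      rw [fderiv_id]
      simp only [id, ContinuousLinearMap.coe_id, LinearMap.normDet_id, div_one,
        ContinuousLinearMap.coe_id', inner_smul_right]
      rw [real_inner_comm]) (fun y _ χ hχ m hm => by
      rw [fderiv_id] at hm ⊢
      have hmχ : m = ∇ χ y := ext_inner_right ℝ fun v => by
        rw [inner_gradient]; exact hm v
      simp only [id, ContinuousLinearMap.coe_id', hmχ]
      exact hχ.outerNormal_eq)
  rw [image_id] at key
  have htr : ∀ y, LinearMap.trace ℝ (Space (k + 1)) (fderiv ℝ (fun x => θ x • w x) y)
      = θ y * LinearMap.trace ℝ (Space (k + 1)) (fderiv ℝ w y) + fderiv ℝ θ y (w y) := fun y => by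
    by_cases hy : y ∈ tsupport θ
    · exact trace_fderiv_smul (hθ.differentiable one_ne_zero y)
        ((hOU y (hθO hy)).differentiableAt one_ne_zero)
    · have h1 : θ y = 0 := image_eq_zero_of_notMem_tsupport hy
      rw [fderiv_of_notMem_tsupport (𝕜 := ℝ)
          (fun h => hy (tsupport_smul_subset_left θ w h)),
        fderiv_of_notMem_tsupport (𝕜 := ℝ) hy, h1]
      simp
  have hoff : ∀ y ∈ frontier W \ (frontier W ∩ O), θ y * ⟪w y, outerNormal W y⟫_ℝ = 0 := by
    intro y hy
    have : θ y = 0 := image_eq_zero_of_notMem_tsupport fun h => hy.2 ⟨hy.1, hθO h⟩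
    rw [this, zero_mul]
  simp only [← htr]
  refine ⟨key.1.of_forall_sdiff_eq_zero isClosed_frontier.measurableSet hoff, ?_, ?_⟩
  · refine Integrable.integrableOn (Continuous.integrable_of_hasCompactSupport ?_ ?_)
    · exact continuous_trace.comp (hθw.continuous_fderiv one_ne_zero)
    · exact (hcs.fderiv (𝕜 := ℝ)).comp_left
        (g := fun L : Space (k + 1) →L[ℝ] Space (k + 1) => LinearMap.trace ℝ (Space (k + 1))
          (L : Space (k + 1) →ₗ[ℝ] Space (k + 1))) (by simp)
  · rw [key.2]
    exact (setIntegral_eq_of_subset_of_forall_sdiff_eq_zero isClosed_frontier.measurableSet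
      inter_subset_left hoff).symm

end BulkDivergence

end SurfactantFlow

namespace SurfactantFlow

/-! ### Graph charts of a hypersurface -/

section Charts

open Module Set

variable {k : ℕ}

namespace Splitting

variable (S : Splitting (Space k) (Space (k + 1)))

/-- The upward normal `dir - ι g` of a graph with slope `⟪g, ·⟫`; it is not normalized. -/
noncomputable def graphNormal (g : Space k) : Space (k + 1) := S.dir - S.incl g

theorem inner_dir_graphNormal (g : Space k) : ⟪S.dir, S.graphNormal g⟫_ℝ = 1 := by
  rw [graphNormal, inner_sub_right, S.inner_dir_dir, S.inner_dir_incl, sub_zero]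

theorem proj_graphNormal (g : Space k) : S.proj (S.graphNormal g) = -g := by
  rw [graphNormal, map_sub, S.proj_dir, S.proj_incl, zero_sub]

theorem graphNormal_ne_zero (g : Space k) : S.graphNormal g ≠ 0 := fun h => by
  have := S.inner_dir_graphNormal g
  rw [h, inner_zero_right] at this
  exact zero_ne_one this

theorem norm_graphNormal_sq (g : Space k) : ‖S.graphNormal g‖ ^ 2 = 1 + ‖g‖ ^ 2 := by
  rw [← real_inner_self_eq_norm_sq]
  nth_rewrite 1 [graphNormal]
  rw [inner_sub_left, S.inner_dir_graphNormal, graphNormal, inner_sub_right, S.incl.inner_map_map,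
    real_inner_self_eq_norm_sq, real_inner_comm, S.inner_dir_incl]
  ring

theorem inner_graphNormal_graphDeriv (g : Space k) (v : Space k) :
    ⟪S.graphNormal g, S.graphDeriv (innerSL ℝ g) v⟫_ℝ = 0 := by
  rw [graphDeriv_apply, graphNormal, inner_sub_left, inner_add_right, inner_add_right,
    inner_smul_right, inner_smul_right, S.inner_dir_dir, S.inner_dir_incl, S.incl.inner_map_map,
    real_inner_comm (S.dir) (S.incl g), S.inner_dir_incl, innerSL_apply_apply]
  ring

/-- Vectors orthogonal to the normal of a graph are tangent to it. -/
theorem graphDeriv_proj {g : Space k} {z : Space (k + 1)} (hz : ⟪z, S.graphNormal g⟫_ℝ = 0) :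
    S.graphDeriv (innerSL ℝ g) (S.proj z) = z := by
  conv_rhs => rw [S.exists_eq z]
  rw [graphDeriv_apply, innerSL_apply_apply]
  congr 2
  rw [graphNormal, inner_sub_right, ← S.inner_proj, real_inner_comm] at hz
  rw [real_inner_comm]
  linarith

/-- Vectors orthogonal to a graph are multiples of its normal. -/
theorem eq_smul_graphNormal {g : Space k} {z : Space (k + 1)}
    (hz : ∀ v, ⟪z, S.graphDeriv (innerSL ℝ g) v⟫_ℝ = 0) :
    z = ⟪S.dir, z⟫_ℝ • S.graphNormal g := by
  have hp : S.proj z = -(⟪S.dir, z⟫_ℝ • g) := by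
    refine ext_inner_right ℝ fun v => ?_
    have := hz v
    rw [graphDeriv_apply, inner_add_right, inner_smul_right, innerSL_apply_apply,
      ← S.inner_proj, real_inner_comm S.dir z] at this
    rw [inner_neg_left, inner_smul_left, conj_trivial]
    linarith
  conv_lhs => rw [S.exists_eq z, hp]
  rw [graphNormal, smul_sub, map_neg, map_smul]
  abel

/-- The area element `√(1 + |g|²)` of a graph is the length of its upward normal. -/
theorem normDet_graphDeriv (g : Space k) :
    (S.graphDeriv (innerSL ℝ g) : Space k →ₗ[ℝ] Space (k + 1)).normDet = ‖S.graphNormal g‖ := by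
  have h := S.normDet_mul_abs_apply (.id ℝ (Space (k + 1))) (innerSL ℝ g)
    (p := innerSL ℝ (S.graphNormal g)) (S.inner_graphNormal_graphDeriv g)
    (n := S.graphNormal g) (S.inner_graphNormal_graphDeriv g)
  have hn := norm_pos_iff.2 (S.graphNormal_ne_zero g)
  rw [ContinuousLinearMap.coe_id, LinearMap.normDet_id, innerSL_apply_apply, innerSL_apply_apply,
    real_inner_self_eq_norm_sq, real_inner_comm, S.inner_dir_graphNormal,
    ContinuousLinearMap.id_comp, ContinuousLinearMap.id_apply, abs_one, one_mul, one_mul,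
    abs_of_nonneg (by positivity), sq] at h
  exact (mul_right_cancel₀ hn.ne' h).symm

end Splitting

/-- The trace of `L` over the hyperplane orthogonal to the unit vector `n`; the surface divergence
of a vector field is the tangential trace of its derivative. -/
noncomputable def tangentialTrace (n : Space k) (L : Space k →L[ℝ] Space k) : ℝ :=
  LinearMap.trace ℝ (Space k) L - ⟪L n, n⟫_ℝ

namespace Splitting

variable (S : Splitting (Space k) (Space (k + 1)))

/-- The tangential trace, computed in the coordinates of a graph. -/
theorem tangentialTrace_eq (g : Space k) (L : Space (k + 1) →L[ℝ] Space (k + 1))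
    {N : Space k →L[ℝ] Space k} {b : Space k →L[ℝ] ℝ}
    (hL : ∀ v, L (S.graphDeriv (innerSL ℝ g) v)
      = S.graphDeriv (innerSL ℝ g) (N v) + b v • S.dir) :
    tangentialTrace (‖S.graphNormal g‖⁻¹ • S.graphNormal g) L
      = LinearMap.trace ℝ (Space k) N + b g / ‖S.graphNormal g‖ ^ 2 := by
  set n := S.graphNormal g with hn
  set A := S.graphDeriv (innerSL ℝ g) with hA
  have hn0 : 0 < ‖n‖ := norm_pos_iff.2 (S.graphNormal_ne_zero g)
  set ν := ‖n‖⁻¹ • n with hν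
  have hνν : ⟪ν, ν⟫_ℝ = 1 := by
    rw [hν, inner_smul_left, inner_smul_right, real_inner_self_eq_norm_sq, conj_trivial]
    field_simp
  -- the orthogonal projection onto the tangent space
  set P : Space (k + 1) →ₗ[ℝ] Space (k + 1) :=
    LinearMap.id - LinearMap.smulRight (innerSL ℝ ν : Space (k + 1) →ₗ[ℝ] ℝ) ν with hP
  have hPx : ∀ x, P x = x - ⟪ν, x⟫_ℝ • ν := fun x => rfl
  have hPn : ∀ x, ⟪P x, n⟫_ℝ = 0 := fun x => by
    have h1 : n = ‖n‖ • ν := by rw [hν, smul_smul, mul_inv_cancel₀ hn0.ne', one_smul]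
    rw [hPx, h1, inner_smul_right, inner_sub_left, inner_smul_left, hνν, conj_trivial,
      real_inner_comm]
    ring
  set B : Space (k + 1) →ₗ[ℝ] Space k := (S.proj : Space (k + 1) →ₗ[ℝ] Space k) ∘ₗ P with hB
  have hAB : (A : Space k →ₗ[ℝ] Space (k + 1)) ∘ₗ B = P := by
    ext1 x
    exact S.graphDeriv_proj (hPn x)
  have hBA : ∀ v, B (A v) = v := fun v => by
    have h1 : P (A v) = A v := by
      rw [hPx, hν, inner_smul_left, S.inner_graphNormal_graphDeriv]; simp
    change S.proj (P (A v)) = v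
    rw [h1, hA, graphDeriv_apply]; simp
  have hBdir : B S.dir = (‖n‖ ^ 2)⁻¹ • g := by
    change S.proj (P S.dir) = _
    rw [hPx, hν, inner_smul_left, real_inner_comm, S.inner_dir_graphNormal, map_sub, map_smul,
      map_smul, S.proj_dir, S.proj_graphNormal, smul_smul, smul_neg, zero_sub, neg_neg,
      conj_trivial, mul_one, ← mul_inv, sq]
  have h1 : tangentialTrace ν L
      = LinearMap.trace ℝ _ ((L : Space (k + 1) →ₗ[ℝ] Space (k + 1)) ∘ₗ P) := by
    have h2 : (L : Space (k + 1) →ₗ[ℝ] Space (k + 1)) ∘ₗ P = (L : Space (k + 1) →ₗ[ℝ] _)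
        - LinearMap.smulRight (innerSL ℝ ν : Space (k + 1) →ₗ[ℝ] ℝ) (L ν) := by
      ext1 x
      simp [hPx]
    rw [h2, map_sub, LinearMap.trace_smulRight, tangentialTrace]
    congr 1
    exact real_inner_comm _ _
  rw [h1, ← hAB, ← LinearMap.comp_assoc, LinearMap.trace_comp_comm']
  have h3 : B ∘ₗ (L : Space (k + 1) →ₗ[ℝ] Space (k + 1)) ∘ₗ (A : Space k →ₗ[ℝ] Space (k + 1))
      = (N : Space k →ₗ[ℝ] Space k)
        + LinearMap.smulRight (b : Space k →ₗ[ℝ] ℝ) ((‖n‖ ^ 2)⁻¹ • g) := by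
    ext1 v
    change B (L (A v)) = N v + b v • ((‖n‖ ^ 2)⁻¹ • g)
    rw [hL, map_add, hBA, map_smul, hBdir]
  rw [h3, map_add, LinearMap.trace_smulRight]
  congr 1
  change b _ = _
  rw [map_smul, smul_eq_mul, inv_mul_eq_div]

/-- In `O`, the hypersurface `M` is the graph of the `C²` function `h` over the ball of radius `r`
around `y₀`, and `ν` is its unit normal pointing upwards. -/
structure IsChart (M : Set (Space (k + 1))) (ν : Space (k + 1) → Space (k + 1))
    (h : Space k → ℝ) (y₀ : Space k) (r : ℝ) (O : Set (Space (k + 1))) : Prop where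
  pos : 0 < r
  contDiffAt : ∀ y ∈ Metric.ball y₀ r, ContDiffAt ℝ 2 h y
  isOpen : IsOpen O
  graphMap_mem : ∀ y ∈ Metric.ball y₀ r, S.graphMap h y ∈ O
  proj_mem : ∀ x ∈ O, S.proj x ∈ Metric.ball y₀ r
  mem_iff : ∀ x ∈ O, (x ∈ M ↔ S.graphMap h (S.proj x) = x)
  normal_eq : ∀ y ∈ Metric.ball y₀ r,
    ν (S.graphMap h y) = ‖S.graphNormal (∇ h y)‖⁻¹ • S.graphNormal (∇ h y)

end Splitting

/-- Near `x`, the set `M` is the zero set of the `C²` function `ψ`, and `ν` is its normalized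
gradient. -/
structure IsHypersurfaceAt (M : Set (Space k)) (ν : Space k → Space k) (x : Space k)
    (ψ : Space k → ℝ) : Prop where
  contDiffAt : ContDiffAt ℝ 2 ψ x
  gradient_ne_zero : ∇ ψ x ≠ 0
  mem : x ∈ M
  mem_iff : ∀ᶠ y in 𝓝 x, (y ∈ M ↔ ψ y = 0) ∧ (y ∈ M → ν y = ‖∇ ψ y‖⁻¹ • ∇ ψ y)

theorem innerSL_gradient {k : ℕ} (h : Space k → ℝ) (y : Space k) :
    innerSL ℝ (∇ h y) = fderiv ℝ h y := by
  ext v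
  exact inner_gradient h y v

/-- A hypersurface has charts, of any small size, in the direction of its normal. -/
theorem IsHypersurfaceAt.exists_isChart {M : Set (Space (k + 1))}
    {ν : Space (k + 1) → Space (k + 1)} {x₀ : Space (k + 1)} {ψ : Space (k + 1) → ℝ}
    (h : IsHypersurfaceAt M ν x₀ ψ) :
    ∃ S : Splitting (Space k) (Space (k + 1)), S.dir = ν x₀ ∧ ∃ g : Space k → ℝ,
      S.graphMap g (S.proj x₀) = x₀ ∧
      ∀ T ∈ 𝓝 x₀, ∀ T' ∈ 𝓝 (S.proj x₀), ∃ r O, S.IsChart M ν g (S.proj x₀) r O ∧ x₀ ∈ O ∧ O ⊆ T ∧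
        Metric.ball (S.proj x₀) r ⊆ T' := by
  have hνx := h.mem_iff.self_of_nhds.2 h.mem
  have hψ0 := h.mem_iff.self_of_nhds.1.1 h.mem
  have hgpos : 0 < ‖∇ ψ x₀‖ := norm_pos_iff.2 h.gradient_ne_zero
  obtain ⟨S, hS⟩ := exists_splitting (E := Space (k + 1)) (finrank_euclideanSpace_fin (𝕜 := ℝ))
    (u := ν x₀) (by rw [hνx]; exact norm_smul_inv_norm h.gradient_ne_zero)
  refine ⟨S, hS, ?_⟩
  obtain ⟨g, hg, hg0, hgs⟩ := S.exists_graph two_ne_zero h.contDiffAt hψ0 (by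
    rw [hS, hνx, ← inner_gradient, inner_smul_right, real_inner_self_eq_norm_sq]
    positivity)
  have hp : S.pt.symm x₀ = (S.proj x₀, ⟪S.dir, x₀⟫_ℝ) := S.pt_symm_apply x₀
  rw [hp] at hg hg0
  simp only at hg hg0
  have hgx : S.graphMap g (S.proj x₀) = x₀ := by
    rw [Splitting.graphMap_apply, hg0, ← S.exists_eq]
  refine ⟨g, hgx, fun T hT T' hT' => ?_⟩
  have hgc : ContinuousAt (S.graphMap g) (S.proj x₀) :=
    S.pt.continuous.continuousAt.comp (continuousAt_id.prodMk hg.continuousAt)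
  -- the ambient neighbourhood
  have e1 : ∀ᶠ x in 𝓝 x₀, ψ x = 0 ↔ ⟪S.dir, x⟫_ℝ = g (S.proj x) := by
    have h1 : Tendsto S.pt.symm (𝓝 x₀) (𝓝 (S.pt.symm x₀)) := S.pt.symm.continuous.tendsto x₀
    filter_upwards [h1.eventually hgs] with x hx
    have := hx.2
    rw [S.pt.apply_symm_apply, S.pt_symm_apply] at this
    exact this
  have e2 : ∀ᶠ x in 𝓝 x₀, 0 < ⟪S.dir, ∇ ψ x⟫_ℝ ∧ DifferentiableAt ℝ ψ x := by
    have h1 : ContDiffAt ℝ 1 ψ x₀ := h.contDiffAt.of_le (by norm_num)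
    have h2 : ContinuousAt (fun x => fderiv ℝ ψ x S.dir) x₀ :=
      (h1.continuousAt_fderiv one_ne_zero).clm_apply continuousAt_const
    have h3 : 0 < fderiv ℝ ψ x₀ S.dir := by
      rw [hS, hνx, ← inner_gradient, inner_smul_right, real_inner_self_eq_norm_sq]
      positivity
    filter_upwards [h2.eventually (lt_mem_nhds h3), h1.eventually (by simp)] with x a b
    rw [real_inner_comm, inner_gradient]
    exact ⟨a, b.differentiableAt one_ne_zero⟩
  obtain ⟨O₁, hO₁, hO₁o, hxO₁⟩ := eventually_nhds_iff.1 ((h.mem_iff.and e1).and (e2.and hT))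
  have e3 : ∀ᶠ y in 𝓝 (S.proj x₀), ContDiffAt ℝ 2 g y := hg.eventually (by simp)
  have e4 : ∀ᶠ y in 𝓝 (S.proj x₀), S.graphMap g y ∈ O₁ :=
    hgc.eventually (by rw [hgx]; exact hO₁o.mem_nhds hxO₁)
  obtain ⟨r, hr, hball⟩ := Metric.eventually_nhds_iff_ball.1 ((e3.and e4).and hT')
  have hmem : ∀ x ∈ O₁, (x ∈ M ↔ S.graphMap g (S.proj x) = x) := fun x hx => by
    rw [(hO₁ x hx).1.1.1, (hO₁ x hx).1.2]
    constructor
    · intro hxe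
      rw [Splitting.graphMap_apply, ← hxe, ← S.exists_eq]
    · intro hxe
      have := congrArg (fun z => ⟪S.dir, z⟫_ℝ) hxe
      simp only [Splitting.graphMap_apply, inner_add_right, S.inner_dir_incl, inner_smul_right,
        S.inner_dir_dir] at this
      linarith
  have hprojg : ∀ y, S.proj (S.graphMap g y) = y := fun y => by
    rw [Splitting.graphMap_apply]; simp
  refine ⟨r, O₁ ∩ S.proj ⁻¹' Metric.ball (S.proj x₀) r, ⟨hr, fun y hy => (hball y hy).1.1,
    hO₁o.inter (Metric.isOpen_ball.preimage S.proj.continuous), fun y hy => ⟨(hball y hy).1.2, by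
      rw [mem_preimage, hprojg]; exact hy⟩, fun x hx => hx.2, fun x hx => hmem x hx.1,
      fun y hy => ?_⟩, ⟨hxO₁, Metric.mem_ball_self hr⟩, fun x hx => (hO₁ x hx.1).2.2,
      fun y hy => (hball y hy).2⟩
  have hyO := (hball y hy).1.2
  have hyM : S.graphMap g y ∈ M := (hmem _ hyO).2 (by rw [hprojg])
  have hd : DifferentiableAt ℝ g y := (hball y hy).1.1.differentiableAt two_ne_zero
  have h0 : ∀ᶠ z in 𝓝 y, ψ (S.graphMap g z) = 0 := by
    filter_upwards [Metric.isOpen_ball.mem_nhds hy] with z hz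
    have hzO := (hball z hz).1.2
    exact ((hO₁ _ hzO).1.1.1).1 ((hmem _ hzO).2 (by rw [hprojg]))
  have h1 := S.fderiv_graphDeriv_eq_zero (hO₁ _ hyO).2.1.2 hd h0
  have h2 : ∇ ψ (S.graphMap g y) = ⟪S.dir, ∇ ψ (S.graphMap g y)⟫_ℝ • S.graphNormal (∇ g y) :=
    S.eq_smul_graphNormal fun v => by
      rw [inner_gradient, innerSL_gradient]; exact h1 v
  rw [(hO₁ _ hyO).1.1.2 hyM, h2, norm_inv_smul_pos_smul (hO₁ _ hyO).2.1.1]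

namespace Splitting.IsChart

variable {S : Splitting (Space k) (Space (k + 1))} {M : Set (Space (k + 1))}
  {ν : Space (k + 1) → Space (k + 1)} {h : Space k → ℝ} {y₀ : Space k} {r : ℝ}
  {O : Set (Space (k + 1))}

theorem proj_graphMap (S : Splitting (Space k) (Space (k + 1))) (h : Space k → ℝ) (y : Space k) :
    S.proj (S.graphMap h y) = y := by
  rw [Splitting.graphMap_apply]; simp

theorem mem (hc : S.IsChart M ν h y₀ r O) {y : Space k} (hy : y ∈ Metric.ball y₀ r) :
    S.graphMap h y ∈ M :=
  (hc.mem_iff _ (hc.graphMap_mem y hy)).2 (by rw [proj_graphMap])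

theorem hasFDerivAt (hc : S.IsChart M ν h y₀ r O) {y : Space k} (hy : y ∈ Metric.ball y₀ r) :
    HasFDerivAt (S.graphMap h) (S.graphDeriv (innerSL ℝ (∇ h y))) y := by
  rw [innerSL_gradient]
  exact S.hasFDerivAt_graphMap ((hc.contDiffAt y hy).differentiableAt two_ne_zero)

theorem contDiffAt_graphMap (hc : S.IsChart M ν h y₀ r O) {y : Space k}
    (hy : y ∈ Metric.ball y₀ r) : ContDiffAt ℝ 2 (S.graphMap h) y := by
  have h1 : ContDiffAt ℝ 2 (fun y => S.incl.toContinuousLinearMap y) y :=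
    S.incl.toContinuousLinearMap.contDiff.contDiffAt
  exact h1.add ((hc.contDiffAt y hy).smul contDiffAt_const)

/-- The chart is a homeomorphism onto an open part of the hypersurface. -/
theorem map_nhds (hc : S.IsChart M ν h y₀ r O) {y : Space k} (hy : y ∈ Metric.ball y₀ r) :
    map (S.graphMap h) (𝓝 y) = 𝓝[M] (S.graphMap h y) := by
  refine le_antisymm ?_ fun s hs => ?_
  · refine tendsto_nhdsWithin_iff.2 ⟨(hc.hasFDerivAt hy).continuousAt, ?_⟩
    filter_upwards [Metric.isOpen_ball.mem_nhds hy] with z hz using hc.mem hz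
  · have h1 : Tendsto S.proj (𝓝 (S.graphMap h y)) (𝓝 y) := by
      have := S.proj.continuous.tendsto (S.graphMap h y)
      rwa [proj_graphMap] at this
    have h2 := h1.eventually (mem_map.1 hs)
    rw [mem_nhdsWithin_iff_eventually]
    filter_upwards [h2, hc.isOpen.mem_nhds (hc.graphMap_mem y hy)] with x hx hxO hxM
    have h3 := (hc.mem_iff x hxO).1 hxM
    rw [← h3]; exact hx

theorem graphMap_mem_closure_iff (hc : S.IsChart M ν h y₀ r O) {y : Space k}
    (hy : y ∈ Metric.ball y₀ r) {T : Set (Space (k + 1))} (hT : T ⊆ M) :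
    S.graphMap h y ∈ closure T ↔ ∃ᶠ z in 𝓝 y, S.graphMap h z ∈ T := by
  rw [mem_closure_iff_frequently]
  rw [← frequently_map (m := S.graphMap h) (P := fun x => x ∈ T), hc.map_nhds hy,
    frequently_nhdsWithin_iff]
  exact frequently_congr (Eventually.of_forall fun x => ⟨fun hx => ⟨hx, hT hx⟩, fun hx => hx.1⟩)

theorem image_preimage_inter (hc : S.IsChart M ν h y₀ r O) (V : Set (Space (k + 1))) :
    S.graphMap h '' (Metric.ball y₀ r ∩ S.graphMap h ⁻¹' V) = V ∩ M ∩ O := by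
  ext x
  constructor
  · rintro ⟨y, ⟨hy, hyV⟩, rfl⟩
    exact ⟨⟨hyV, hc.mem hy⟩, hc.graphMap_mem y hy⟩
  · rintro ⟨⟨hxV, hxM⟩, hxO⟩
    have h1 := (hc.mem_iff x hxO).1 hxM
    exact ⟨S.proj x, ⟨hc.proj_mem x hxO, by rw [mem_preimage, h1]; exact hxV⟩, h1⟩

end Splitting.IsChart

end Charts

end SurfactantFlow

namespace SurfactantFlow

/-! ### The divergence theorem on a hypersurface -/

section SurfaceDivergence

open Module Set

variable {k : ℕ}

theorem contDiffAt_gradient {h : Space k → ℝ} {y : Space k} (hh : ContDiffAt ℝ 2 h y) :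
    ContDiffAt ℝ 1 (fun z => ∇ h z) y := by
  have h1 : ContDiffAt ℝ 1 (fderiv ℝ h) y := hh.fderiv_right (by norm_num)
  exact ((InnerProductSpace.toDual ℝ (Space k)).symm.contDiff.contDiffAt).comp y h1

/-- The Hessian is symmetric. -/
theorem inner_fderiv_gradient_comm {h : Space k → ℝ} {y : Space k} (hh : ContDiffAt ℝ 2 h y)
    (a b : Space k) :
    ⟪fderiv ℝ (fun z => ∇ h z) y a, b⟫_ℝ = ⟪fderiv ℝ (fun z => ∇ h z) y b, a⟫_ℝ := by
  have h1 : DifferentiableAt ℝ (fderiv ℝ h) y :=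
    (hh.fderiv_right (m := 1) (by norm_num)).differentiableAt one_ne_zero
  have h2 : ∀ a b, ⟪fderiv ℝ (fun z => ∇ h z) y a, b⟫_ℝ = fderiv ℝ (fderiv ℝ h) y a b := by
    intro a b
    have h3 := (contDiffAt_gradient hh).differentiableAt one_ne_zero
    have h4 : fderiv ℝ (fun z => ⟪∇ h z, b⟫_ℝ) y a = ⟪fderiv ℝ (fun z => ∇ h z) y a, b⟫_ℝ := by
      rw [fderiv_inner_apply ℝ h3 (differentiableAt_const b)]
      simp
    have h5 : HasFDerivAt (fun z => fderiv ℝ h z b)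
        (ContinuousLinearMap.apply ℝ ℝ b ∘L fderiv ℝ (fderiv ℝ h) y) y :=
      (ContinuousLinearMap.apply ℝ ℝ b).hasFDerivAt.comp y h1.hasFDerivAt
    rw [← h4]
    simp only [inner_gradient]
    rw [h5.fderiv]
    rfl
  rw [h2, h2]
  exact hh.isSymmSndFDerivAt (by simp) a b

namespace Splitting.IsChart

variable {S : Splitting (Space k) (Space (k + 1))} {M : Set (Space (k + 1))}
  {ν : Space (k + 1) → Space (k + 1)} {h : Space k → ℝ} {y₀ : Space k} {r : ℝ}
  {O : Set (Space (k + 1))}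

/-- The area density of a chart is `C¹`. -/
theorem contDiffAt_density (hc : S.IsChart M ν h y₀ r O) {y : Space k}
    (hy : y ∈ Metric.ball y₀ r) : ContDiffAt ℝ 1 (fun z => ‖S.graphNormal (∇ h z)‖) y := by
  have h1 : ContDiffAt ℝ 1 (fun z => S.graphNormal (∇ h z)) y :=
    contDiffAt_const.sub (S.incl.contDiff.contDiffAt.comp y
      (contDiffAt_gradient (hc.contDiffAt y hy)))
  exact h1.norm ℝ (S.graphNormal_ne_zero _)

/-- In a chart, the surface divergence of a tangential field is, up to the area density, the
divergence of its coordinate representation multiplied by the area density. -/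
theorem trace_fderiv_density_smul (hc : S.IsChart M ν h y₀ r O) {y : Space k}
    (hy : y ∈ Metric.ball y₀ r) {w : Space (k + 1) → Space (k + 1)}
    (hw : DifferentiableAt ℝ w (S.graphMap h y)) (hwt : ∀ x ∈ M ∩ O, ⟪w x, ν x⟫_ℝ = 0) :
    LinearMap.trace ℝ (Space k)
        (fderiv ℝ (fun z => ‖S.graphNormal (∇ h z)‖ • S.proj (w (S.graphMap h z))) y)
      = ‖S.graphNormal (∇ h y)‖
        * tangentialTrace (ν (S.graphMap h y)) (fderiv ℝ w (S.graphMap h y)) := by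
  set L := fderiv ℝ w (S.graphMap h y) with hL
  set G := fun z => ∇ h z with hG
  set H := fderiv ℝ G y with hH
  set A := S.graphDeriv (innerSL ℝ (∇ h y)) with hA
  set W := fun z => S.proj (w (S.graphMap h z)) with hW
  have hGd : HasFDerivAt G H y :=
    ((contDiffAt_gradient (hc.contDiffAt y hy)).differentiableAt one_ne_zero).hasFDerivAt
  have hwφ : HasFDerivAt (fun z => w (S.graphMap h z)) (L ∘L A) y :=
    hw.hasFDerivAt.comp y (hc.hasFDerivAt hy)
  have hWd : HasFDerivAt W (S.proj ∘L L ∘L A) y := S.proj.hasFDerivAt.comp y hwφ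
  set N := S.proj ∘L L ∘L A with hN
  -- a tangential field is determined by its coordinates
  have htan : (fun z => w (S.graphMap h z))
      =ᶠ[𝓝 y] fun z => S.incl.toContinuousLinearMap (W z) + ⟪G z, W z⟫_ℝ • S.dir := by
    filter_upwards [Metric.isOpen_ball.mem_nhds hy] with z hz
    have h1 := hwt _ ⟨hc.mem hz, hc.graphMap_mem z hz⟩
    rw [hc.normal_eq z hz, inner_smul_right, mul_eq_zero] at h1
    have h2 := h1.resolve_left (inv_ne_zero (norm_ne_zero_iff.2 (S.graphNormal_ne_zero _)))
    exact (S.graphDeriv_proj h2).symm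
  have hd2 : HasFDerivAt (fun z => S.incl.toContinuousLinearMap (W z) + ⟪G z, W z⟫_ℝ • S.dir)
      (S.incl.toContinuousLinearMap ∘L N
        + ((fderivInnerCLM ℝ (G y, W y)).comp (H.prod N)).smulRight S.dir) y :=
    (S.incl.toContinuousLinearMap.hasFDerivAt.comp y hWd).add
      ((hGd.inner ℝ hWd).smul_const S.dir)
  have hLA := hwφ.unique (hd2.congr_of_eventuallyEq htan)
  set b : Space k →L[ℝ] ℝ := innerSL ℝ (W y) ∘L H with hb
  have hLv : ∀ v, L (S.graphDeriv (innerSL ℝ (∇ h y)) v)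
      = S.graphDeriv (innerSL ℝ (∇ h y)) (N v) + b v • S.dir := by
    intro v
    have := congrArg (fun T : Space k →L[ℝ] Space (k + 1) => T v) hLA
    simp only [ContinuousLinearMap.comp_apply, add_apply, ContinuousLinearMap.smulRight_apply,
      ContinuousLinearMap.prod_apply, fderivInnerCLM_apply] at this
    change L (A v) = _
    rw [this, graphDeriv_apply, add_smul, ← add_assoc, ← real_inner_comm (H v)]
    rfl
  rw [hc.normal_eq y hy, S.tangentialTrace_eq (∇ h y) L hLv]
  set J := fun z => ‖S.graphNormal (∇ h z)‖ with hJ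
  have hJ0 : 0 < J y := norm_pos_iff.2 (S.graphNormal_ne_zero _)
  have hJd := (hc.contDiffAt_density hy).differentiableAt one_ne_zero
  -- differentiate `J ^ 2 = 1 + |∇ h| ^ 2`
  have hJ2 : ∀ u, J y * fderiv ℝ J y u = ⟪H u, ∇ h y⟫_ℝ := by
    intro u
    have h1 : HasFDerivAt (fun z => J z ^ 2) ((2 * J y) • fderiv ℝ J y) y := by
      have := hJd.hasFDerivAt.pow 2
      simpa using this
    have h2 : HasFDerivAt (fun z => 1 + ‖G z‖ ^ 2) (2 • (innerSL ℝ (G y) ∘L H)) y :=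
      (hGd.norm_sq).const_add 1
    have h3 : (fun z => J z ^ 2) = fun z => 1 + ‖G z‖ ^ 2 := by
      ext z; exact S.norm_graphNormal_sq _
    rw [h3] at h1
    have h4 := congrArg (fun T : Space k →L[ℝ] ℝ => T u) (h1.unique h2)
    simp only [smul_apply, smul_eq_mul, ContinuousLinearMap.comp_apply, innerSL_apply_apply,
      nsmul_eq_mul, Nat.cast_ofNat] at h4
    rw [real_inner_comm]
    change _ = ⟪G y, H u⟫_ℝ
    linarith
  have h5 := trace_fderiv_smul (F := Space k) hJd hWd.differentiableAt
  change LinearMap.trace ℝ (Space k) (fderiv ℝ (fun z => J z • W z) y) = _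
  rw [h5, hWd.fderiv, mul_add]
  congr 1
  change fderiv ℝ J y (W y) = _
  have h6 := hJ2 (W y)
  rw [hH, hG, inner_fderiv_gradient_comm (hc.contDiffAt y hy)] at h6
  have h7 : b (∇ h y) = J y * fderiv ℝ J y (W y) := by
    rw [h6, hb, ContinuousLinearMap.comp_apply, innerSL_apply_apply, real_inner_comm]
  rw [h7]
  change _ = J y * (J y * _ / J y ^ 2)
  field_simp

/-- The relative boundary of a part of a hypersurface, in a chart. -/
theorem image_frontier_inter_ball (hc : S.IsChart M ν h y₀ r O) (V : Set (Space (k + 1))) :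
    S.graphMap h '' (frontier (Metric.ball y₀ r ∩ S.graphMap h ⁻¹' V) ∩ Metric.ball y₀ r)
      = relBoundary M (V ∩ M) ∩ O := by
  have key : ∀ y ∈ Metric.ball y₀ r,
      (y ∈ frontier (Metric.ball y₀ r ∩ S.graphMap h ⁻¹' V) ↔
        S.graphMap h y ∈ relBoundary M (V ∩ M)) := by
    intro y hy
    have hb : ∀ᶠ z in 𝓝 y, z ∈ Metric.ball y₀ r := Metric.isOpen_ball.mem_nhds hy
    rw [frontier_eq_closure_inter_closure, mem_inter_iff, relBoundary, mem_inter_iff,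
      mem_inter_iff, hc.graphMap_mem_closure_iff hy inter_subset_right,
      hc.graphMap_mem_closure_iff hy sdiff_subset, mem_closure_iff_frequently,
      mem_closure_iff_frequently]
    have e1 : (∃ᶠ z in 𝓝 y, z ∈ Metric.ball y₀ r ∩ S.graphMap h ⁻¹' V)
        ↔ ∃ᶠ z in 𝓝 y, S.graphMap h z ∈ V ∩ M := by
      refine frequently_congr ?_
      filter_upwards [hb] with z hz
      exact ⟨fun hz' => ⟨hz'.2, hc.mem hz⟩, fun hz' => ⟨hz, hz'.1⟩⟩
    have e2 : (∃ᶠ z in 𝓝 y, z ∈ (Metric.ball y₀ r ∩ S.graphMap h ⁻¹' V)ᶜ)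
        ↔ ∃ᶠ z in 𝓝 y, S.graphMap h z ∈ M \ (V ∩ M) := by
      refine frequently_congr ?_
      filter_upwards [hb] with z hz
      exact ⟨fun hz' => ⟨hc.mem hz, fun h' => hz' ⟨hz, h'.1⟩⟩,
        fun hz' h' => hz'.2 ⟨h'.2, hz'.1⟩⟩
    rw [e1, e2]
    have hm := hc.mem hy
    tauto
  ext x
  constructor
  · rintro ⟨y, ⟨hy1, hy2⟩, rfl⟩
    exact ⟨(key y hy2).1 hy1, hc.graphMap_mem y hy2⟩
  · rintro ⟨hx, hxO⟩
    have h1 := (hc.mem_iff x hxO).1 hx.1.1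
    have h2 := hc.proj_mem x hxO
    exact ⟨S.proj x, ⟨(key _ h2).2 (by rw [h1]; exact hx), h2⟩, h1⟩

end Splitting.IsChart

theorem inner_tangentialPart_self {n : Space k} (hn : ⟪n, n⟫_ℝ = 1) (w : Space k) :
    ⟪tangentialPart n w, n⟫_ℝ = 0 := by
  rw [tangentialPart, inner_sub_left, inner_smul_left, hn, conj_trivial, mul_one, sub_self]

namespace Splitting.IsChart

variable {S : Splitting (Space k) (Space (k + 1))} {M : Set (Space (k + 1))}
  {ν : Space (k + 1) → Space (k + 1)} {h : Space k → ℝ} {y₀ : Space k} {r : ℝ}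
  {O : Set (Space (k + 1))}

theorem inner_normal_self (hc : S.IsChart M ν h y₀ r O) {y : Space k}
    (hy : y ∈ Metric.ball y₀ r) : ⟪ν (S.graphMap h y), ν (S.graphMap h y)⟫_ℝ = 1 := by
  have h1 : ‖ν (S.graphMap h y)‖ = 1 := by
    rw [hc.normal_eq y hy]; exact norm_smul_inv_norm (S.graphNormal_ne_zero _)
  rw [real_inner_self_eq_norm_mul_norm, h1, mul_one]

theorem inner_normal (hc : S.IsChart M ν h y₀ r O) {y : Space k} (hy : y ∈ Metric.ball y₀ r)
    (v : Space k) : ⟪S.graphDeriv (innerSL ℝ (∇ h y)) v, ν (S.graphMap h y)⟫_ℝ = 0 := by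
  rw [hc.normal_eq y hy, inner_smul_right, real_inner_comm, S.inner_graphNormal_graphDeriv,
    mul_zero]

/-- A vector whose products with tangent vectors are those of a tangent vector `A n` has the
tangential part `A n`. -/
theorem tangentialPart_eq (hc : S.IsChart M ν h y₀ r O) {y : Space k}
    (hy : y ∈ Metric.ball y₀ r) {z : Space (k + 1)} {n : Space k}
    (hz : ∀ v, ⟪S.graphDeriv (innerSL ℝ (∇ h y)) n, S.graphDeriv (innerSL ℝ (∇ h y)) v⟫_ℝ
      = ⟪z, S.graphDeriv (innerSL ℝ (∇ h y)) v⟫_ℝ) :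
    tangentialPart (ν (S.graphMap h y)) z = S.graphDeriv (innerSL ℝ (∇ h y)) n := by
  set ν' := ν (S.graphMap h y) with hν'
  set A := S.graphDeriv (innerSL ℝ (∇ h y)) with hA
  have h0 : ‖S.graphNormal (∇ h y)‖⁻¹ ≠ 0 :=
    inv_ne_zero (norm_ne_zero_iff.2 (S.graphNormal_ne_zero _))
  have h1 : ⟪tangentialPart ν' z - A n, ν'⟫_ℝ = 0 := by
    rw [inner_sub_left, inner_tangentialPart_self (hc.inner_normal_self hy), hA, hc.inner_normal hy,
      sub_zero]
  have h2 := h1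
  rw [hν', hc.normal_eq y hy, inner_smul_right, mul_eq_zero] at h2
  have h3 := S.graphDeriv_proj (h2.resolve_left h0)
  rw [← sub_eq_zero, ← inner_self_eq_zero (𝕜 := ℝ)]
  rw [← hc.normal_eq y hy, ← hν', ← hA] at h3
  nth_rewrite 2 [← h3]
  rw [inner_sub_left, tangentialPart, inner_sub_left, inner_smul_left, hz,
    real_inner_comm _ ν', hc.inner_normal hy]
  simp

/-- The chosen co-normal is the image under the chart of the metric normal of the coordinate
region. -/
theorem outerConormal_eq (hc : S.IsChart M ν h y₀ r O) (V : Set (Space (k + 1))) {y : Space k}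
    (hy : y ∈ Metric.ball y₀ r) {ψ : Space k → ℝ}
    (hψ : IsDefiningFunction (Metric.ball y₀ r ∩ S.graphMap h ⁻¹' V) y ψ) {n : Space k}
    (hn : ∀ v, ⟪S.graphDeriv (innerSL ℝ (∇ h y)) n, S.graphDeriv (innerSL ℝ (∇ h y)) v⟫_ℝ
      = fderiv ℝ ψ y v) :
    outerConormal M (ν (S.graphMap h y)) V (S.graphMap h y)
      = ‖S.graphDeriv (innerSL ℝ (∇ h y)) n‖⁻¹ • S.graphDeriv (innerSL ℝ (∇ h y)) n := by
  set A := S.graphDeriv (innerSL ℝ (∇ h y)) with hA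
  set x := S.graphMap h y with hx
  have hpx : S.proj x = y := proj_graphMap S h y
  have hAn : A n ≠ 0 := fun h0 => hψ.fderiv_ne_zero (by
    ext v; rw [← hn, h0, inner_zero_left]; rfl)
  have hb : ∀ᶠ z in 𝓝 y, z ∈ Metric.ball y₀ r := Metric.isOpen_ball.mem_nhds hy
  -- the coordinate function, extended to be constant along the normal of the hyperplane
  have hproj : Tendsto S.proj (𝓝 x) (𝓝 y) := by
    have := S.proj.continuous.tendsto x
    rwa [hpx] at this
  have hgrad : ∀ v, ⟪∇ (fun z => ψ (S.proj z)) x, v⟫_ℝ = fderiv ℝ ψ y (S.proj v) := fun v => by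
    have h1 : HasFDerivAt ψ (fderiv ℝ ψ y) (S.proj x) := by
      rw [hpx]; exact (hψ.contDiffAt.differentiableAt one_ne_zero).hasFDerivAt
    have h2 : HasFDerivAt (fun z => ψ (S.proj z)) (fderiv ℝ ψ y ∘L S.proj) x :=
      h1.comp x S.proj.hasFDerivAt
    rw [inner_gradient, h2.fderiv]; rfl
  have htp : tangentialPart (ν x) (∇ (fun z => ψ (S.proj z)) x) = A n :=
    hc.tangentialPart_eq hy fun v => by
      rw [hn, hgrad, graphDeriv_apply]; simp
  -- a co-normal exists, so that the choice in the definition is not a junk value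
  have hex : ∃ m, IsOuterConormal M (ν x) V x m := by
    refine ⟨_, fun z => ψ (S.proj z), ?_, ?_, ?_, ?_, rfl⟩
    · exact ContDiffAt.comp x (by rw [hpx]; exact hψ.contDiffAt) S.proj.contDiff.contDiffAt
    · simp only [hpx, hψ.eq_zero]
    · rw [htp]; exact hAn
    · rw [hx, ← hc.map_nhds hy, eventually_map]
      filter_upwards [hψ.mem_iff, hb] with z hz hzb
      rw [proj_graphMap, ← hz]
      exact ⟨fun h' => ⟨hzb, h'⟩, fun h' => h'.2⟩
  rw [outerConormal, dif_pos hex]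
  obtain ⟨χ, h1, h2, h3, h4, h5⟩ := hex.choose_spec
  rw [h5]
  have hχd : fderiv ℝ (fun z => χ (S.graphMap h z)) y = fderiv ℝ χ x ∘L A :=
    ((h1.differentiableAt one_ne_zero).hasFDerivAt.comp y (hc.hasFDerivAt hy)).fderiv
  have hdef : IsDefiningFunction (Metric.ball y₀ r ∩ S.graphMap h ⁻¹' V) y
      (fun z => χ (S.graphMap h z)) := by
    refine ⟨ContDiffAt.comp y h1 ((hc.contDiffAt_graphMap hy).of_le (by norm_num)), h2, ?_, ?_⟩
    · intro h0
      rw [hχd] at h0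
      apply h3
      have h6 : tangentialPart (ν x) (∇ χ x) = A 0 := hc.tangentialPart_eq hy fun v => by
        rw [map_zero, inner_zero_left, inner_gradient]
        exact (congrArg (fun T : Space k →L[ℝ] ℝ => T v) h0).symm
      rw [h6, map_zero]
    · rw [hx, ← hc.map_nhds hy, eventually_map] at h4
      filter_upwards [h4, hb] with z hz hzb
      rw [← hz]
      exact ⟨fun h' => h'.2, fun h' => ⟨hzb, h'⟩⟩
  obtain ⟨c, hc0, hcc⟩ := hψ.exists_pos_smul_eq hdef
  have h7 : tangentialPart (ν x) (∇ χ x) = A (c • n) := hc.tangentialPart_eq hy fun v => by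
    rw [map_smul, inner_smul_left, hn, inner_gradient, conj_trivial]
    rw [hχd] at hcc
    exact (congrArg (fun T : Space k →L[ℝ] ℝ => T v) hcc).symm
  rw [h7, map_smul, norm_inv_smul_pos_smul hc0]

end Splitting.IsChart

end SurfaceDivergence

end SurfactantFlow

namespace SurfactantFlow

section SurfaceDivergenceTheorem

open Module Set

/-- The product rule for the surface divergence of a multiple of a tangential field. -/
theorem tangentialTrace_fderiv_smul {k : ℕ} {θ : Space k → ℝ} {w : Space k → Space k}
    {x n : Space k} (hθ : DifferentiableAt ℝ θ x) (hw : DifferentiableAt ℝ w x)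
    (hn : ⟪w x, n⟫_ℝ = 0) :
    tangentialTrace n (fderiv ℝ (fun x => θ x • w x) x)
      = θ x * tangentialTrace n (fderiv ℝ w x) + fderiv ℝ θ x (w x) := by
  rw [tangentialTrace, trace_fderiv_smul hθ hw, fderiv_fun_smul hθ hw, tangentialTrace]
  simp only [add_apply, smul_apply, ContinuousLinearMap.smulRight_apply, inner_add_left,
    inner_smul_left, hn, conj_trivial]
  ring

/-- Near `x`, the part of the hypersurface `M`, with normal `n` at `x`, that lies in `V` is a corner
region in `M`. -/
structure IsSurfaceCorner {k : ℕ} {J : Type*} (M V : Set (Space k)) (n x : Space k)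
    (ψ : J → Space k → ℝ) : Prop where
  contDiffAt : ∀ j, ContDiffAt ℝ 1 (ψ j) x
  eq_zero : ∀ j, ψ j x = 0
  independent : ∀ c : J →₀ ℝ, ∀ a : ℝ, (c.sum fun j cj => cj • ∇ (ψ j) x) = a • n → c = 0
  mem_iff : ∀ᶠ y in 𝓝[M] x, (y ∈ V ↔ ∀ j, ψ j y < 0)

variable {k : ℕ}

/-- In a chart, a corner of a part of a hypersurface is a corner of the coordinate region. -/
theorem IsSurfaceCorner.isCorner {J : Type*} {S : Splitting (Space k) (Space (k + 1))}
    {M V : Set (Space (k + 1))} {ν : Space (k + 1) → Space (k + 1)} {h : Space k → ℝ}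
    {y₀ : Space k} {r : ℝ} {O : Set (Space (k + 1))} (hc : S.IsChart M ν h y₀ r O)
    {ψ : J → Space (k + 1) → ℝ}
    (hψ : IsSurfaceCorner M V (ν (S.graphMap h y₀)) (S.graphMap h y₀) ψ) :
    IsCorner (Metric.ball y₀ r ∩ S.graphMap h ⁻¹' V) y₀ fun j z => ψ j (S.graphMap h z) := by
  have hy : y₀ ∈ Metric.ball y₀ r := Metric.mem_ball_self hc.pos
  have hd : ∀ j, fderiv ℝ (fun z => ψ j (S.graphMap h z)) y₀
      = fderiv ℝ (ψ j) (S.graphMap h y₀) ∘L S.graphDeriv (innerSL ℝ (∇ h y₀)) := fun j =>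
    (((hψ.contDiffAt j).differentiableAt one_ne_zero).hasFDerivAt.comp y₀
      (hc.hasFDerivAt hy)).fderiv
  refine ⟨fun j => ContDiffAt.comp y₀ (hψ.contDiffAt j)
    ((hc.contDiffAt_graphMap hy).of_le (by norm_num)), hψ.eq_zero, ?_, ?_⟩
  · rw [linearIndependent_iff]
    intro c hcz
    set z := c.sum fun j cj => cj • ∇ (ψ j) (S.graphMap h y₀) with hz
    have h1 : ∀ v, ⟪z, S.graphDeriv (innerSL ℝ (∇ h y₀)) v⟫_ℝ = 0 := by
      intro v
      have h2 := congrArg (fun T : Space k →L[ℝ] ℝ => T v) hcz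
      simp only [Finsupp.linearCombination_apply, Finsupp.sum, sum_apply, smul_apply,
        smul_eq_mul, zero_apply, hd, ContinuousLinearMap.comp_apply] at h2
      rw [hz, Finsupp.sum, sum_inner, ← h2]
      refine Finset.sum_congr rfl fun j _ => ?_
      rw [inner_smul_left, inner_gradient, conj_trivial]
    have h3 := S.eq_smul_graphNormal h1
    have h0 : ‖S.graphNormal (∇ h y₀)‖ ≠ 0 := norm_ne_zero_iff.2 (S.graphNormal_ne_zero _)
    refine hψ.independent c (⟪S.dir, z⟫_ℝ * ‖S.graphNormal (∇ h y₀)‖) ?_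
    rw [hc.normal_eq y₀ hy, smul_smul, mul_assoc, mul_inv_cancel₀ h0, mul_one]
    exact h3
  · have h4 := hψ.mem_iff
    rw [← hc.map_nhds hy, eventually_map] at h4
    filter_upwards [h4, Metric.isOpen_ball.mem_nhds hy] with z hz hzb
    rw [← hz]
    exact ⟨fun h' => h'.2, fun h' => ⟨hzb, h'⟩⟩

/-- The divergence theorem on the part of a hypersurface that lies in a bounded region transversal
to it, for tangential vector fields. -/
theorem integral_tangentialTrace_eq_integral_relBoundary {m : ℕ} {V M : Set (Space (m + 2))}
    {ν w : Space (m + 2) → Space (m + 2)} (hVo : IsOpen V) (hVb : Bornology.IsBounded V)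
    (hMm : MeasurableSet M) (hMc : ∀ x ∈ closure V, x ∉ M → Mᶜ ∈ 𝓝 x)
    (hM : ∀ x ∈ closure V ∩ M, ∃ ψ, IsHypersurfaceAt M ν x ψ)
    (hV : ∀ x ∈ frontier V ∩ M, ∃ (n : ℕ) (ψ : Fin n → Space (m + 2) → ℝ),
      IsSurfaceCorner M V (ν x) x ψ)
    (hw : ∀ x ∈ closure V ∩ M, ContDiffAt ℝ 1 w x) (hwt : ∀ x ∈ M, ⟪w x, ν x⟫_ℝ = 0) :
    IntegrableOn (fun x => ⟪w x, outerConormal M (ν x) V x⟫_ℝ) (relBoundary M (V ∩ M)) μHE[m] ∧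
      IntegrableOn (fun x => tangentialTrace (ν x) (fderiv ℝ w x)) (V ∩ M) μHE[m + 1] ∧
      ∫ x in V ∩ M, tangentialTrace (ν x) (fderiv ℝ w x) ∂μHE[m + 1]
        = ∫ x in relBoundary M (V ∩ M), ⟪w x, outerConormal M (ν x) V x⟫_ℝ ∂μHE[m] := by
  have hBm : MeasurableSet (relBoundary M (V ∩ M)) :=
    (hMm.inter isClosed_closure.measurableSet).inter isClosed_closure.measurableSet
  have hAm : MeasurableSet (V ∩ M) := hVo.measurableSet.inter hMm
  refine integral_eq_integral_of_locally hVb.isCompact_closure hVo inter_subset_left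
    subset_closure (fun x hx => closure_mono inter_subset_left hx.1.2) hAm hBm (b := w)
    fun x₀ hx₀ => ?_
  by_cases hx₀M : x₀ ∉ M
  · -- away from the hypersurface both sides vanish
    refine ⟨Mᶜ, hMc x₀ hx₀ hx₀M, fun θ hθ _ hθO => ?_⟩
    have h1 : ∀ x ∈ M, x ∉ tsupport θ := fun x hx h' => hθO h' hx
    have h2 : ∀ x ∈ V ∩ M, θ x * tangentialTrace (ν x) (fderiv ℝ w x) + fderiv ℝ θ x (w x) = 0 :=
      fun x hx => by
        rw [image_eq_zero_of_notMem_tsupport (h1 x hx.2),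
          fderiv_of_notMem_tsupport (𝕜 := ℝ) (h1 x hx.2)]
        simp
    have h3 : ∀ x ∈ relBoundary M (V ∩ M),
        θ x * ⟪w x, outerConormal M (ν x) V x⟫_ℝ = 0 := fun x hx => by
      rw [image_eq_zero_of_notMem_tsupport (h1 x hx.1.1), zero_mul]
    refine ⟨integrableOn_zero.congr_fun (fun x hx => (h3 x hx).symm) hBm,
      integrableOn_zero.congr_fun (fun x hx => (h2 x hx).symm) hAm, ?_⟩
    rw [setIntegral_congr_fun hAm h2, setIntegral_congr_fun hBm h3]
    simp
  push Not at hx₀M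
  obtain ⟨χ, hχ⟩ := hM x₀ ⟨hx₀, hx₀M⟩
  obtain ⟨S, -, h, hhx, hcharts⟩ := hχ.exists_isChart
  set y₀ := S.proj x₀ with hy₀
  set φ := S.graphMap h with hφ
  have hcorner : ∃ (n : ℕ) (ψ : Fin n → Space (m + 2) → ℝ), IsSurfaceCorner M V (ν x₀) x₀ ψ := by
    by_cases hxV : x₀ ∈ V
    · refine ⟨0, fun j => j.elim0, fun j => j.elim0, fun j => j.elim0,
        fun c _ _ => Subsingleton.elim _ _, ?_⟩
      filter_upwards [mem_nhdsWithin_of_mem_nhds (hVo.mem_nhds hxV)] with y hy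
      simpa using hy
    · exact hV x₀ ⟨⟨hx₀, by rwa [hVo.interior_eq]⟩, hx₀M⟩
  obtain ⟨n, ψ, hψ⟩ := hcorner
  obtain ⟨R, O₁, hc₁, -, -, -⟩ := hcharts univ univ_mem univ univ_mem
  have hy₀R : y₀ ∈ Metric.ball y₀ R := Metric.mem_ball_self hc₁.pos
  rw [← hhx] at hψ
  have hcor := hψ.isCorner hc₁
  have hopen : ∀ {r O}, S.IsChart M ν h y₀ r O → IsOpen (Metric.ball y₀ r ∩ φ ⁻¹' V) :=
    fun hc => ContinuousOn.isOpen_inter_preimage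
      (fun y hy => (hc.hasFDerivAt hy).continuousAt.continuousWithinAt) Metric.isOpen_ball hVo
  have hmeasW : MeasurableSet (Metric.ball y₀ R ∩ φ ⁻¹' V) := (hopen hc₁).measurableSet
  have hfd : ∀ {r O}, S.IsChart M ν h y₀ r O → ∀ y ∈ Metric.ball y₀ r,
      fderiv ℝ φ y = S.graphDeriv (innerSL ℝ (∇ h y)) := fun hc y hy => (hc.hasFDerivAt hy).fderiv
  obtain ⟨U₀, hU₀, hU⟩ := hcor.exists_integral_div hmeasW
    (finrank_euclideanSpace_fin (𝕜 := ℝ)) (φ := φ)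
    ((hc₁.contDiffAt_graphMap hy₀R).of_le (by norm_num)) (by
      rw [hfd hc₁ y₀ hy₀R]; exact S.graphDeriv_injective _)
  have hwx : {x | ContDiffAt ℝ 1 w x} ∈ 𝓝 x₀ := (hw x₀ ⟨hx₀, hx₀M⟩).eventually (by simp)
  obtain ⟨r, O, hc, hx₀O, hOw, hrU⟩ := hcharts _ hwx _
    (inter_mem hU₀ (Metric.ball_mem_nhds y₀ hc₁.pos))
  set B := Metric.ball y₀ r with hB
  refine ⟨O, hc.isOpen.mem_nhds hx₀O, fun θ hθ hθc hθO => ?_⟩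
  set J := fun z => ‖S.graphNormal (∇ h z)‖ with hJ
  have hJ0 : ∀ z, 0 < J z := fun z => norm_pos_iff.2 (S.graphNormal_ne_zero _)
  -- the coordinate field whose divergence is the surface divergence times the area density
  set ω := fun z => J z • S.proj (θ (φ z) • w (φ z)) with hω
  have hθw : ContDiff ℝ 1 fun x => θ x • w x :=
    contDiff_smul_of_tsupport hθ fun y hy => hOw (hθO hy)
  have hKc : IsCompact (S.proj '' tsupport θ) := hθc.isCompact.image S.proj.continuous
  have hKB : S.proj '' tsupport θ ⊆ B := by
    rintro _ ⟨x, hx, rfl⟩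
    exact hc.proj_mem x (hθO hx)
  have hsupp : Function.support ω ⊆ S.proj '' tsupport θ := by
    intro z hz
    refine ⟨φ z, subset_tsupport θ fun h0 => hz ?_, Splitting.IsChart.proj_graphMap S h z⟩
    simp only [hω, h0, zero_smul, map_zero, smul_zero]
  have hts : tsupport ω ⊆ S.proj '' tsupport θ := closure_minimal hsupp hKc.isClosed
  have hωc : HasCompactSupport ω := HasCompactSupport.of_support_subset_isCompact hKc hsupp
  have hωd : ContDiff ℝ 1 ω := by
    rw [contDiff_iff_contDiffAt]
    intro z
    by_cases hz : z ∈ tsupport ω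
    · have hzB := hKB (hts hz)
      have h1 : ContDiffAt ℝ 1 (fun z => θ (φ z) • w (φ z)) z :=
        ContDiffAt.comp (g := fun x => θ x • w x) z hθw.contDiffAt
          ((hc.contDiffAt_graphMap hzB).of_le (by norm_num))
      exact (hc.contDiffAt_density hzB).smul (S.proj.contDiff.contDiffAt.comp z h1)
    · have : ω =ᶠ[𝓝 z] fun _ => 0 := notMem_tsupport_iff_eventuallyEq.1 hz
      exact contDiffAt_const.congr_of_eventuallyEq this
  have hBR : B ⊆ Metric.ball y₀ R := fun y hy => (hrU hy).2
  have hWB : Metric.ball y₀ R ∩ φ ⁻¹' V ∩ B = B ∩ φ ⁻¹' V := by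
    ext y
    exact ⟨fun hy => ⟨hy.2, hy.1.2⟩, fun hy => ⟨⟨hBR hy.1, hy.2⟩, hy.1⟩⟩
  have hfr : frontier (Metric.ball y₀ R ∩ φ ⁻¹' V) ∩ B = frontier (B ∩ φ ⁻¹' V) ∩ B := by
    rw [← hWB, frontier_inter_open_inter Metric.isOpen_ball]
  have htanφ : ∀ y ∈ B, S.graphDeriv (innerSL ℝ (∇ h y)) (S.proj (w (φ y))) = w (φ y) := by
    intro y hy
    refine S.graphDeriv_proj ?_
    have h1 := hwt _ (hc.mem hy)
    rw [hc.normal_eq y hy, inner_smul_right, mul_eq_zero] at h1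
    exact h1.resolve_left (inv_ne_zero (hJ0 y).ne')
  have key := hU B (fun y hy => (hrU hy).1) Metric.isOpen_ball ω hωd hωc (hts.trans hKB)
    (fun x => θ x * ⟪w x, outerConormal M (ν x) V x⟫_ℝ) (fun x => outerConormal M (ν x) V x)
    (fun y hy => by
      rw [hfd hc y hy, S.normDet_graphDeriv, hω]
      simp only [map_smul, htanφ y hy, inner_smul_right]
      rw [real_inner_comm (w (φ y))]
      exact (mul_div_cancel_left₀ _ (hJ0 y).ne').symm)
    (fun y hy χ hχ v hv => by
      rw [hfd hc y hy] at hv ⊢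
      refine hc.outerConormal_eq V hy ⟨hχ.contDiffAt, hχ.eq_zero, hχ.fderiv_ne_zero, ?_⟩ hv
      filter_upwards [hχ.mem_iff, Metric.isOpen_ball.mem_nhds hy] with z hz hzB
      rw [← hz]
      exact ⟨fun h' => ⟨hBR hzB, h'.2⟩, fun h' => ⟨hzB, h'.2⟩⟩)
  rw [hfr, hc.image_frontier_inter_ball] at key
  have hwd : ∀ x ∈ O, DifferentiableAt ℝ w x := fun x hx => by
    have h1 : ContDiffAt ℝ 1 w x := hOw hx
    exact h1.differentiableAt one_ne_zero
  -- the integrand in coordinates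
  set a := fun x => θ x * tangentialTrace (ν x) (fderiv ℝ w x) + fderiv ℝ θ x (w x) with ha
  have htr : ∀ y ∈ B ∩ φ ⁻¹' V, LinearMap.trace ℝ (Space (m + 1)) (fderiv ℝ ω y)
      = (fderiv ℝ φ y : Space (m + 1) →ₗ[ℝ] Space (m + 2)).normDet * a (φ y) := by
    intro y hy
    rw [hfd hc y hy.1, S.normDet_graphDeriv, ha]
    simp only
    rw [← tangentialTrace_fderiv_smul (hθ.differentiable one_ne_zero _)
      (hwd _ (hc.graphMap_mem y hy.1)) (hwt _ (hc.mem hy.1))]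
    exact hc.trace_fderiv_density_smul hy.1 (w := fun x => θ x • w x)
      (hθw.differentiable one_ne_zero _) fun x hx => by
        rw [inner_smul_left, hwt x hx.1, mul_zero]
  have hBVm : MeasurableSet (B ∩ φ ⁻¹' V) := (hopen hc).measurableSet
  have hdφ : ∀ y ∈ B ∩ φ ⁻¹' V, DifferentiableAt ℝ φ y := fun y hy =>
    (hc.hasFDerivAt hy.1).differentiableAt
  have hiφ : ∀ y ∈ B ∩ φ ⁻¹' V, Function.Injective (fderiv ℝ φ y) := fun y hy => by
    rw [hfd hc y hy.1]; exact S.graphDeriv_injective _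
  have hinj : InjOn φ (B ∩ φ ⁻¹' V) := (S.graphMap_injective h).injOn
  have hcont : Continuous fun y => LinearMap.trace ℝ (Space (m + 1)) (fderiv ℝ ω y) :=
    continuous_trace.comp (hωd.continuous_fderiv one_ne_zero)
  have htrint : Integrable fun y => LinearMap.trace ℝ (Space (m + 1)) (fderiv ℝ ω y) :=
    hcont.integrable_of_hasCompactSupport ((hωc.fderiv (𝕜 := ℝ)).comp_left
      (g := fun L : Space (m + 1) →L[ℝ] Space (m + 1) => LinearMap.trace ℝ (Space (m + 1))
        (L : Space (m + 1) →ₗ[ℝ] Space (m + 1))) (by simp))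
  have himg : φ '' (B ∩ φ ⁻¹' V) = V ∩ M ∩ O := hc.image_preimage_inter V
  have hfin : finrank ℝ (Space (m + 1)) = m + 1 := finrank_euclideanSpace_fin
  have hai : IntegrableOn a (V ∩ M ∩ O) μHE[m + 1] := by
    have h1 := integrableOn_image_iff_normDet_fderiv hBVm hdφ hiφ hinj a
    rw [himg, hfin] at h1
    exact h1.2 (htrint.integrableOn.congr_fun htr hBVm)
  have hae : ∫ x in V ∩ M ∩ O, a x ∂μHE[m + 1]
      = ∫ y in B ∩ φ ⁻¹' V, LinearMap.trace ℝ (Space (m + 1)) (fderiv ℝ ω y) := by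
    have h1 := integral_image_eq_normDet_fderiv hBVm hdφ hiφ hinj a
    rw [himg, hfin] at h1
    rw [h1, setIntegral_congr_fun hBVm htr]
  have hoffA : ∀ x ∈ (V ∩ M) \ (V ∩ M ∩ O), a x = 0 := by
    intro x hx
    have h1 : x ∉ tsupport θ := fun h' => hx.2 ⟨hx.1, hθO h'⟩
    rw [ha]
    simp only
    rw [image_eq_zero_of_notMem_tsupport h1, fderiv_of_notMem_tsupport (𝕜 := ℝ) h1]
    simp
  have hoffB : ∀ x ∈ relBoundary M (V ∩ M) \ (relBoundary M (V ∩ M) ∩ O),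
      θ x * ⟪w x, outerConormal M (ν x) V x⟫_ℝ = 0 := by
    intro x hx
    have h1 : x ∉ tsupport θ := fun h' => hx.2 ⟨hx.1, hθO h'⟩
    rw [image_eq_zero_of_notMem_tsupport h1, zero_mul]
  have hoffW : ∀ y ∈ (Metric.ball y₀ R ∩ φ ⁻¹' V) \ (B ∩ φ ⁻¹' V),
      LinearMap.trace ℝ (Space (m + 1)) (fderiv ℝ ω y) = 0 := by
    intro y hy
    have h1 : y ∉ tsupport ω := fun h' => hy.2 ⟨hKB (hts h'), hy.1.2⟩
    rw [fderiv_of_notMem_tsupport (𝕜 := ℝ) h1]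
    simp
  refine ⟨key.1.of_forall_sdiff_eq_zero hBm hoffB, hai.of_forall_sdiff_eq_zero hAm hoffA, ?_⟩
  rw [setIntegral_eq_of_subset_of_forall_sdiff_eq_zero hAm inter_subset_left hoffA, hae,
    setIntegral_eq_of_subset_of_forall_sdiff_eq_zero hBm inter_subset_left hoffB, ← key.2]
  exact (setIntegral_eq_of_subset_of_forall_sdiff_eq_zero hmeasW
    (inter_subset_inter_left _ hBR) hoffW).symm

end SurfaceDivergenceTheorem

end SurfactantFlow

namespace SurfactantFlow

/-! ### Short-time behaviour of trajectories -/

section Trajectories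

open Module Set

variable {E : Type*} [NormedAddCommGroup E] [NormedSpace ℝ E]

/-- On `I`, the curves `s ↦ X s x` that start at time `t` at the points `x` of `A` are trajectories
of the velocity field `u`. -/
structure IsFlowOn (u : ℝ × E → E) (X : ℝ → E → E) (A : Set E) (t : ℝ) (I : Set ℝ) : Prop where
  mem_nhds : I ∈ 𝓝 t
  initial : ∀ x ∈ A, X t x = x
  hasDerivAt : ∀ x ∈ A, ∀ s ∈ I, HasDerivAt (fun r => X r x) (u (s, X s x)) s

/-- A curve stays in a cone as long as its speed is controlled inside the cone. -/
theorem norm_sub_le_of_forward {c c' : ℝ → E} {t δ M M' : ℝ} (hMM : M < M')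
    (hc : ∀ s ∈ Icc t (t + δ), HasDerivAt c (c' s) s)
    (hb : ∀ s ∈ Icc t (t + δ), ‖c s - c t‖ ≤ M' * (s - t) → ‖c' s‖ ≤ M) :
    ∀ s ∈ Icc t (t + δ), ‖c s - c t‖ ≤ M' * (s - t) := by
  have h := image_norm_le_of_norm_deriv_right_lt_deriv_boundary (f := fun s => c s - c t)
    (f' := c') (a := t) (b := t + δ) (B := fun s => M' * (s - t)) (B' := fun _ => M')
    (fun s hs => ((hc s hs).continuousAt.sub continuousAt_const).continuousWithinAt)
    (fun s hs => ((hc s (Ico_subset_Icc_self hs)).sub_const _).hasDerivWithinAt) (by simp)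
    (fun s => by simpa using ((hasDerivAt_id s).sub_const t).const_mul M')
    (fun s hs he => (hb s (Ico_subset_Icc_self hs) he.le).trans_lt hMM)
  exact fun s hs => h hs

/-- A curve stays in a cone, forward and backward in time, as long as its speed is controlled inside
the cone. -/
theorem norm_sub_le_of_norm_deriv_le {c c' : ℝ → E} {t δ M M' : ℝ} (hMM : M < M')
    (hc : ∀ s, |s - t| ≤ δ → HasDerivAt c (c' s) s)
    (hb : ∀ s, |s - t| ≤ δ → ‖c s - c t‖ ≤ M' * |s - t| → ‖c' s‖ ≤ M) :
    ∀ s, |s - t| ≤ δ → ‖c s - c t‖ ≤ M' * |s - t| := by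
  intro s hs
  rcases le_total t s with hts | hts
  · have h := norm_sub_le_of_forward (c := c) (c' := c') (t := t) (δ := δ) hMM
      (fun r hr => hc r (abs_le.2 ⟨by linarith [hr.1, (abs_nonneg (s - t)).trans hs],
        by linarith [hr.2]⟩))
      (fun r hr hle => hb r (abs_le.2 ⟨by linarith [hr.1, (abs_nonneg (s - t)).trans hs],
        by linarith [hr.2]⟩) (by rwa [abs_of_nonneg (by linarith [hr.1])]))
    rw [abs_of_nonneg (by linarith)] at hs ⊢
    exact h s ⟨hts, by linarith⟩
  · -- reverse the time
    have h := norm_sub_le_of_forward (c := fun r => c (2 * t - r)) (c' := fun r => -c' (2 * t - r))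
      (t := t) (δ := δ) hMM
      (fun r hr => by
        have h1 := hc (2 * t - r) (abs_le.2 ⟨by linarith [hr.2], by
          linarith [hr.1, (abs_nonneg (s - t)).trans hs]⟩)
        have h2 : HasDerivAt (fun r : ℝ => 2 * t - r) (-1) r := by
          simpa using (hasDerivAt_id r).const_sub (2 * t)
        have h3 := h1.scomp r h2
        rw [neg_one_smul] at h3
        exact h3)
      (fun r hr hle => by
        rw [norm_neg]
        refine hb (2 * t - r) (abs_le.2 ⟨by linarith [hr.2], by
          linarith [hr.1, (abs_nonneg (s - t)).trans hs]⟩) ?_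
        rw [show 2 * t - r - t = -(r - t) by ring, abs_neg, abs_of_nonneg (by linarith [hr.1])]
        rwa [show 2 * t - t = t by ring] at hle)
    rw [abs_of_nonpos (by linarith)] at hs ⊢
    have h3 := h (2 * t - s) ⟨by linarith, by linarith⟩
    simp only [show 2 * t - (2 * t - s) = s by ring, show 2 * t - t = t by ring] at h3
    rw [show 2 * t - s - t = -(s - t) by ring] at h3
    exact h3

/-- A curve whose speed is controlled by its size and which vanishes at time `t` vanishes for a
short time; more generally its growth is controlled. -/
theorem norm_le_two_mul_of_norm_deriv_le {g g' : ℝ → E} {t δ K : ℝ} (hK : 0 ≤ K)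
    (hKδ : K * δ ≤ 1 / 2) (hg : ∀ s, |s - t| ≤ δ → HasDerivAt g (g' s) s)
    (hb : ∀ s, |s - t| ≤ δ → ‖g' s‖ ≤ K * ‖g s‖) :
    ∀ s, |s - t| ≤ δ → ‖g s‖ ≤ 2 * ‖g t‖ := by
  intro s hs
  have hδ : 0 ≤ δ := (abs_nonneg _).trans hs
  have hIcc : ∀ r, r ∈ Icc (t - δ) (t + δ) ↔ |r - t| ≤ δ := fun r => by
    rw [abs_le]
    constructor
    · rintro ⟨h1, h2⟩; constructor <;> linarith
    · rintro ⟨h1, h2⟩; constructor <;> linarith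
  have hcont : ContinuousOn (fun r => ‖g r‖) (Icc (t - δ) (t + δ)) := fun r hr =>
    (hg r ((hIcc r).1 hr)).continuousAt.norm.continuousWithinAt
  obtain ⟨r₀, hr₀, hmax⟩ := isCompact_Icc.exists_isMaxOn ⟨s, (hIcc s).2 hs⟩ hcont
  have hmv := (convex_Icc (t - δ) (t + δ)).norm_image_sub_le_of_norm_hasDerivWithin_le
    (f := g) (f' := g') (C := K * ‖g r₀‖)
    (fun r hr => (hg r ((hIcc r).1 hr)).hasDerivWithinAt)
    (fun r hr => (hb r ((hIcc r).1 hr)).trans (by gcongr; exact hmax hr))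
    ((hIcc t).2 (by simpa using hδ)) hr₀
  rw [Real.norm_eq_abs] at hmv
  have h1 : K * ‖g r₀‖ * |r₀ - t| ≤ 1 / 2 * ‖g r₀‖ := by
    calc K * ‖g r₀‖ * |r₀ - t| ≤ K * ‖g r₀‖ * δ := by
          gcongr; exact (hIcc r₀).1 hr₀
      _ = K * δ * ‖g r₀‖ := by ring
      _ ≤ _ := by gcongr
  have h2 : ‖g r₀‖ ≤ ‖g t‖ + ‖g r₀ - g t‖ := by
    have := norm_add_le (g t) (g r₀ - g t)
    rwa [add_sub_cancel] at this
  have h3 : ‖g s‖ ≤ ‖g r₀‖ := hmax ((hIcc s).2 hs)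
  linarith

/-- Trajectories that start near `x₀` stay near their starting points for a short time. -/
theorem IsFlowOn.exists_norm_sub_le {u : ℝ × E → E} {X : ℝ → E → E} {A : Set E} {t : ℝ}
    {I : Set ℝ} (h : IsFlowOn u X A t I) {x₀ : E} (hu : ContinuousAt u (t, x₀))
    {Z : Set (ℝ × E)} (hZ : Z ∈ 𝓝 (t, x₀)) :
    ∃ M, 0 < M ∧ ∃ O ∈ 𝓝 x₀, ∃ δ, 0 < δ ∧ ∀ x ∈ A ∩ O, ∀ s, |s - t| ≤ δ →
      s ∈ I ∧ ‖X s x - x‖ ≤ M * |s - t| ∧ (s, X s x) ∈ Z := by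
  set M := ‖u (t, x₀)‖ + 1 with hM
  have hM0 : 0 < M := by positivity
  have e1 : ∀ᶠ z in 𝓝 (t, x₀), ‖u z‖ ≤ M :=
    (hu.norm.eventually (gt_mem_nhds (lt_add_one _))).mono fun z hz => le_of_lt hz
  obtain ⟨ρ, hρ, hball⟩ := Metric.eventually_nhds_iff.1 (e1.and hZ)
  obtain ⟨δ₀, hδ₀, hI⟩ := Metric.mem_nhds_iff.1 h.mem_nhds
  set δ := min (δ₀ / 2) (min (ρ / 2) (ρ / (4 * (M + 1)))) with hδ
  have hδ0 : 0 < δ := by positivity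
  have hδ1 : δ ≤ δ₀ / 2 := min_le_left _ _
  have hδ2 : δ ≤ ρ / 2 := (min_le_right _ _).trans (min_le_left _ _)
  have hδ3 : (M + 1) * δ ≤ ρ / 4 := by
    have : δ ≤ ρ / (4 * (M + 1)) := (min_le_right _ _).trans (min_le_right _ _)
    calc (M + 1) * δ ≤ (M + 1) * (ρ / (4 * (M + 1))) := by gcongr
      _ = _ := by field_simp
  have hsI : ∀ s, |s - t| ≤ δ → s ∈ I := fun s hs => hI (by
    rw [Metric.mem_ball, Real.dist_eq]; linarith)
  have hin : ∀ x ∈ A ∩ Metric.ball x₀ (ρ / 4), ∀ s, |s - t| ≤ δ →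
      ‖X s x - x‖ ≤ (M + 1) * |s - t| → dist (s, X s x) (t, x₀) < ρ := by
    intro x hx s hs hle
    rw [Prod.dist_eq]
    refine max_lt (by rw [Real.dist_eq]; linarith) ?_
    have h1 : dist (X s x) x ≤ ρ / 4 := by
      rw [dist_eq_norm]
      exact hle.trans ((mul_le_mul_of_nonneg_left hs (by positivity)).trans hδ3)
    have h2 := dist_triangle (X s x) x x₀
    have h3 : dist x x₀ < ρ / 4 := hx.2
    linarith
  have key : ∀ x ∈ A ∩ Metric.ball x₀ (ρ / 4), ∀ s, |s - t| ≤ δ →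
      ‖X s x - x‖ ≤ (M + 1) * |s - t| := by
    intro x hx
    have := norm_sub_le_of_norm_deriv_le (c := fun s => X s x) (c' := fun s => u (s, X s x))
      (t := t) (δ := δ) (lt_add_one M) (fun s hs => h.hasDerivAt x hx.1 s (hsI s hs))
      (fun s hs hle => by
        rw [h.initial x hx.1] at hle
        exact (hball (hin x hx s hs hle)).1)
    simpa only [h.initial x hx.1] using this
  exact ⟨M + 1, by positivity, Metric.ball x₀ (ρ / 4), Metric.ball_mem_nhds _ (by positivity), δ,
    hδ0, fun x hx s hs => ⟨hsI s hs, key x hx s hs, (hball (hin x hx s hs (key x hx s hs))).2⟩⟩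

theorem hasFDerivAt_comp_mk {F : Type*} [NormedAddCommGroup F] [NormedSpace ℝ F] {u : ℝ × E → F}
    {t : ℝ} {x : E} (hu : DifferentiableAt ℝ u (t, x)) :
    HasFDerivAt (fun y => u (t, y)) (fderiv ℝ u (t, x) ∘L .inr ℝ ℝ E) x :=
  hu.hasFDerivAt.comp x (hasFDerivAt_prodMk_right t x)

/-- For short times the flow is `id + (s - t) ∇u` up to a map with a small Lipschitz constant. -/
theorem IsFlowOn.exists_norm_sub_sub_le {u : ℝ × E → E} {X : ℝ → E → E} {A : Set E} {t : ℝ}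
    {I : Set ℝ} (h : IsFlowOn u X A t I) {x₀ : E} (hu : ContDiffAt ℝ 1 u (t, x₀)) {ε : ℝ}
    (hε : 0 < ε) :
    ∃ O ∈ 𝓝 x₀, ∃ δ, 0 < δ ∧ ∀ x ∈ A ∩ O, ∀ y ∈ A ∩ O, ∀ s, |s - t| ≤ δ →
      ‖X s x - X s y - (x - y) - (s - t) • fderiv ℝ (fun z => u (t, z)) x₀ (x - y)‖
        ≤ ε * |s - t| * ‖x - y‖ := by
  set D := fderiv ℝ (fun z => u (t, z)) x₀ with hD
  have hD' : D = fderiv ℝ u (t, x₀) ∘L .inr ℝ ℝ E :=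
    (hasFDerivAt_comp_mk (hu.differentiableAt one_ne_zero)).fderiv
  have hs := hu.hasStrictFDerivAt one_ne_zero
  set η := ε / 4 with hη
  have hη0 : 0 < η := by positivity
  obtain ⟨Z, hZ, hZa⟩ := hs.approximates_deriv_on_nhds (c := η.toNNReal)
    (Or.inr (Real.toNNReal_pos.2 hη0))
  obtain ⟨M, hM, O, hO, δ₁, hδ₁, hstay⟩ := h.exists_norm_sub_le hu.continuousAt hZ
  set K := ‖D‖ + η with hK
  have hK0 : 0 < K := by positivity
  set δ := min δ₁ (min (1 / (2 * K)) (η / (K * (‖D‖ + 1)))) with hδ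
  have hδ0 : 0 < δ := by positivity
  have hδ1 : δ ≤ δ₁ := min_le_left _ _
  have hδ2 : K * δ ≤ 1 / 2 := by
    have : δ ≤ 1 / (2 * K) := (min_le_right _ _).trans (min_le_left _ _)
    calc K * δ ≤ K * (1 / (2 * K)) := by gcongr
      _ = _ := by field_simp
  have hδ3 : ‖D‖ * (K * δ) ≤ η := by
    have : δ ≤ η / (K * (‖D‖ + 1)) := (min_le_right _ _).trans (min_le_right _ _)
    calc ‖D‖ * (K * δ) ≤ (‖D‖ + 1) * (K * (η / (K * (‖D‖ + 1)))) := by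
          gcongr; linarith
      _ = _ := by field_simp
  refine ⟨O, hO, δ, hδ0, fun x hx y hy s hsδ => ?_⟩
  -- the separation `g` of two trajectories solves `g' = D g` up to a small multiple of `g`
  set g := fun r => X r x - X r y with hg
  set g' := fun r => u (r, X r x) - u (r, X r y) with hg'
  have hst := fun r (hr : |r - t| ≤ δ) => hstay x hx r (hr.trans hδ1)
  have hst' := fun r (hr : |r - t| ≤ δ) => hstay y hy r (hr.trans hδ1)
  have hgd : ∀ r, |r - t| ≤ δ → HasDerivAt g (g' r) r := fun r hr =>
    (h.hasDerivAt x hx.1 r (hst r hr).1).sub (h.hasDerivAt y hy.1 r (hst' r hr).1)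
  have hlin : ∀ r, |r - t| ≤ δ → ‖g' r - D (g r)‖ ≤ η * ‖g r‖ := by
    intro r hr
    have h1 := hZa _ (hst r hr).2.2 _ (hst' r hr).2.2
    rw [Real.coe_toNNReal _ hη0.le] at h1
    have h2 : ((r, X r x) : ℝ × E) - (r, X r y) = (0, g r) := by simp [hg]
    rw [h2] at h1
    have h3 : ‖((0, g r) : ℝ × E)‖ = ‖g r‖ := by simp [Prod.norm_def]
    rw [h3] at h1
    rw [hD']
    exact h1
  have hgb : ∀ r, |r - t| ≤ δ → ‖g' r‖ ≤ K * ‖g r‖ := by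
    intro r hr
    have h1 := norm_add_le (g' r - D (g r)) (D (g r))
    rw [sub_add_cancel] at h1
    have h2 := D.le_opNorm (g r)
    have h3 := hlin r hr
    rw [hK, add_mul]; linarith
  have hgt : g t = x - y := by simp [hg, h.initial x hx.1, h.initial y hy.1]
  have h2b := norm_le_two_mul_of_norm_deriv_le hK0.le hδ2 hgd hgb
  rw [hgt] at h2b
  have hball : ∀ r, r ∈ Metric.closedBall t δ ↔ |r - t| ≤ δ := fun r => by
    rw [Metric.mem_closedBall, Real.dist_eq]
  have htb : t ∈ Metric.closedBall t δ := Metric.mem_closedBall_self hδ0.le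
  have hgg : ∀ r, |r - t| ≤ δ → ‖g r - (x - y)‖ ≤ 2 * K * δ * ‖x - y‖ := by
    intro r hr
    have h1 := (convex_closedBall t δ).norm_image_sub_le_of_norm_hasDerivWithin_le (f := g)
      (f' := g') (C := K * (2 * ‖x - y‖))
      (fun r hr => (hgd r ((hball r).1 hr)).hasDerivWithinAt)
      (fun r hr => (hgb r ((hball r).1 hr)).trans (by
        gcongr; exact h2b r ((hball r).1 hr))) htb ((hball r).2 hr)
    rw [hgt, Real.norm_eq_abs] at h1
    calc _ ≤ _ := h1
      _ ≤ K * (2 * ‖x - y‖) * δ := by gcongr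
      _ = _ := by ring
  have hfin := (convex_closedBall t δ).norm_image_sub_le_of_norm_hasDerivWithin_le
      (f := fun r => g r - (r - t) • D (x - y)) (f' := fun r => g' r - D (x - y))
      (C := ε * ‖x - y‖)
      (fun r hr => by
        have h1 : HasDerivAt (fun r : ℝ => (r - t) • D (x - y)) (D (x - y)) r := by
          simpa using ((hasDerivAt_id r).sub_const t).smul_const (D (x - y))
        exact ((hgd r ((hball r).1 hr)).sub h1).hasDerivWithinAt)
      (fun r hr => by
        have hr' := (hball r).1 hr
        have h1 : g' r - D (x - y) = (g' r - D (g r)) + D (g r - (x - y)) := by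
          rw [map_sub D (g r)]; abel
        rw [h1]
        refine (norm_add_le _ _).trans ?_
        have h2 := hlin r hr'
        have h3 := D.le_opNorm (g r - (x - y))
        have h4 := hgg r hr'
        have h5 := h2b r hr'
        have h6 : ‖D‖ * ‖g r - (x - y)‖ ≤ ‖D‖ * (2 * K * δ * ‖x - y‖) := by gcongr
        have h7 : ‖D‖ * (2 * K * δ * ‖x - y‖) = 2 * (‖D‖ * (K * δ)) * ‖x - y‖ := by ring
        have h8 : 2 * (‖D‖ * (K * δ)) * ‖x - y‖ ≤ 2 * η * ‖x - y‖ := by gcongr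
        have h9 : η * ‖g r‖ ≤ η * (2 * ‖x - y‖) := by gcongr
        have h10 : ε * ‖x - y‖ = η * (2 * ‖x - y‖) + 2 * η * ‖x - y‖ := by rw [hη]; ring
        linarith) htb ((hball s).2 hsδ)
  simp only [hgt, sub_self, zero_smul, sub_zero, Real.norm_eq_abs] at hfin
  have h11 : X s x - X s y - (x - y) - (s - t) • D (x - y)
      = X s x - X s y - (s - t) • D (x - y) - (x - y) := by abel
  rw [h11]
  calc _ ≤ _ := hfin
    _ = _ := by ring

end Trajectories

end SurfactantFlow

namespace SurfactantFlow

/-! ### The volume factor near an isometry -/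

section NormDetDerivative

open Module Set

variable {E' E : Type*} [NormedAddCommGroup E'] [InnerProductSpace ℝ E'] [FiniteDimensional ℝ E']
  [NormedAddCommGroup E] [InnerProductSpace ℝ E] [FiniteDimensional ℝ E]

/-- Jacobi's formula at the identity, along a quadratic curve of matrices. -/
theorem hasDerivAt_det_one_add {n : Type*} [Fintype n] [DecidableEq n] (S T : Matrix n n ℝ) :
    HasDerivAt (fun r : ℝ => (1 + r • S + r ^ 2 • T).det) S.trace 0 := by
  let M : Matrix n n (Polynomial ℝ) := S.map Polynomial.C + (Polynomial.X : Polynomial ℝ) • T.map Polynomial.C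
  obtain ⟨Q, hQ⟩ : ∃ Q : Polynomial ℝ, (1 + (Polynomial.X : Polynomial ℝ) • M).det
      = 1 + M.trace * Polynomial.X + Q * Polynomial.X ^ 2 :=
    ⟨_, Matrix.det_one_add_smul Polynomial.X M⟩
  have hev : ∀ r : ℝ, (1 + r • S + r ^ 2 • T).det
      = 1 + (S.trace + r * T.trace) * r + Q.eval r * r ^ 2 := by
    intro r
    have h1 := congrArg (Polynomial.evalRingHom r) hQ
    rw [RingHom.map_det] at h1
    have h2 : (Polynomial.evalRingHom r).mapMatrix (1 + (Polynomial.X : Polynomial ℝ) • M)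
        = 1 + r • S + r ^ 2 • T := by
      ext i j
      by_cases hij : i = j
      · subst hij; simp [M]; ring
      · simp [M, hij]; ring
    rw [h2] at h1
    rw [h1]
    have h3 : M.trace.eval r = S.trace + r * T.trace := by
      simp [M, Matrix.trace, Polynomial.eval_finsetSum, Finset.sum_add_distrib, Finset.sum_mul,
        mul_comm r]
    simp [h3]
  have h4 := (((hasDerivAt_id (0 : ℝ)).mul_const T.trace).const_add S.trace).mul
    (hasDerivAt_id (0 : ℝ)) |>.const_add 1 |>.add ((Q.hasDerivAt 0).mul (hasDerivAt_pow 2 (0 : ℝ)))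
  refine (h4.congr_deriv ?_).congr_of_eventuallyEq (Eventually.of_forall fun r => ?_)
  · simp
  · simpa using hev r

/-- At an isometry the volume factor has the derivative `H ↦ tr (ιᵀ H)`. -/
theorem exists_hasStrictFDerivAt_normDet {ι : Type*} [Fintype ι] (b : OrthonormalBasis ι ℝ E')
    {A : E' →L[ℝ] E} (hA : ∀ x y, ⟪A x, A y⟫_ℝ = ⟪x, y⟫_ℝ) :
    ∃ L : (E' →L[ℝ] E) →L[ℝ] ℝ,
      HasStrictFDerivAt (fun B : E' →L[ℝ] E => (B : E' →ₗ[ℝ] E).normDet) L A ∧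
      (A : E' →ₗ[ℝ] E).normDet = 1 ∧ ∀ H, L H = ∑ i, ⟪A (b i), H (b i)⟫_ℝ := by
  classical
  set p : (E' →L[ℝ] E) → ℝ := fun B => (Matrix.of fun i j => ⟪B (b i), B (b j)⟫_ℝ).det with hp
  have hN : ∀ B : E' →L[ℝ] E, (B : E' →ₗ[ℝ] E).normDet = √(p B) := fun B => by
    have h1 := (B : E' →ₗ[ℝ] E).normDet_sq_eq_det_gram b
    have h2 : p B = (B : E' →ₗ[ℝ] E).normDet ^ 2 := by
      have h3 : ((B : E' →ₗ[ℝ] E).normDet : ℝ) ^ 2 = (Matrix.gram ℝ (fun i => B (b i))).det := by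
        exact_mod_cast h1
      rw [h3]; rfl
    rw [h2, Real.sqrt_sq (LinearMap.normDet_nonneg _)]
  have hpc : ContDiff ℝ 1 p := by
    simp only [hp, Matrix.det_apply, Matrix.of_apply]
    refine ContDiff.sum fun σ _ => ContDiff.const_smul _ (contDiff_prod fun i _ => ?_)
    exact ((ContinuousLinearMap.apply ℝ E (b (σ i))).contDiff).inner ℝ
      ((ContinuousLinearMap.apply ℝ E (b i)).contDiff)
  have hpA : p A = 1 := by
    rw [hp]
    simp only [hA]
    rw [show (Matrix.of fun i j => ⟪b i, b j⟫_ℝ) = (1 : Matrix ι ι ℝ) by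
      ext i j
      rw [Matrix.of_apply, Matrix.one_apply]
      exact orthonormal_iff_ite.1 b.orthonormal i j]
    exact Matrix.det_one
  have hps := hpc.contDiffAt.hasStrictFDerivAt (x := A) one_ne_zero
  -- along a line through the isometry `A` the Gram matrix is a quadratic polynomial with constant
  -- term `1`
  have hpd : ∀ H, fderiv ℝ p A H = 2 * ∑ i, ⟪A (b i), H (b i)⟫_ℝ := by
    intro H
    have h1 : HasDerivAt (fun r : ℝ => A + r • H) H 0 := by
      simpa using ((hasDerivAt_id (0 : ℝ)).smul_const H).const_add A
    have h2 : HasFDerivAt p (fderiv ℝ p A) (A + (0 : ℝ) • H) := by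
      simpa using hps.hasFDerivAt
    have h3 := h2.comp_hasDerivAt (0 : ℝ) h1
    change HasDerivAt (fun r : ℝ => p (A + r • H)) (fderiv ℝ p A H) 0 at h3
    have h4 := hasDerivAt_det_one_add
      (Matrix.of fun i j => ⟪A (b i), H (b j)⟫_ℝ + ⟪H (b i), A (b j)⟫_ℝ)
      (Matrix.of fun i j => ⟪H (b i), H (b j)⟫_ℝ)
    have h5 : (fun r : ℝ => p (A + r • H)) = fun r : ℝ => (1
        + r • (Matrix.of fun i j => ⟪A (b i), H (b j)⟫_ℝ + ⟪H (b i), A (b j)⟫_ℝ)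
        + r ^ 2 • (Matrix.of fun i j => ⟪H (b i), H (b j)⟫_ℝ)).det := by
      ext r
      simp only [hp]
      congr 1
      ext i j
      have h6 : ⟪A (b i), A (b j)⟫_ℝ = (1 : Matrix ι ι ℝ) i j := by
        rw [hA, Matrix.one_apply]; exact orthonormal_iff_ite.1 b.orthonormal i j
      simp only [Matrix.of_apply, Matrix.add_apply, Matrix.smul_apply, add_apply, smul_apply,
        inner_add_left, inner_add_right, inner_smul_left, inner_smul_right, conj_trivial,
        smul_eq_mul, h6]
      ring
    rw [h5] at h3
    rw [h3.unique h4, Matrix.trace, Finset.mul_sum]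
    refine Finset.sum_congr rfl fun i _ => ?_
    rw [Matrix.diag_apply, Matrix.of_apply, real_inner_comm (A (b i)) (H (b i))]
    ring
  refine ⟨(1 / (2 * √(p A))) • fderiv ℝ p A, ?_, by rw [hN, hpA, Real.sqrt_one], fun H => ?_⟩
  · simp only [hN]
    exact hps.sqrt (by rw [hpA]; exact one_ne_zero)
  · rw [smul_apply, hpd, hpA, Real.sqrt_one, smul_eq_mul]
    ring

end NormDetDerivative

end SurfactantFlow

namespace SurfactantFlow

/-! ### Change of surface measure under a flow -/

section LocalTransport

open Module Set
open scoped NNReal ENNReal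

/-- The area formula for Lipschitz maps. -/
theorem LipschitzOnWith.integral_image {U V : Type*} [NormedAddCommGroup U]
    [InnerProductSpace ℝ U] [FiniteDimensional ℝ U]
    [MeasurableSpace U] [BorelSpace U] [NormedAddCommGroup V] [InnerProductSpace ℝ V]
    [FiniteDimensional ℝ V] [MeasurableSpace V] [BorelSpace V] {f : U → V} {Q s : Set U} {K : ℝ≥0}
    (hK : LipschitzOnWith K f Q) (hQ : IsOpen Q) (hsQ : s ⊆ Q) (hs : MeasurableSet s)
    (hi : ∀ x ∈ s, DifferentiableAt ℝ f x → Function.Injective (fderiv ℝ f x)) (hf : InjOn f s)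
    (g : V → ℝ) :
    (IntegrableOn g (f '' s) μHE[finrank ℝ U] ↔
      IntegrableOn (fun x => (fderiv ℝ f x : U →ₗ[ℝ] V).normDet * g (f x)) s) ∧
    ∫ x in f '' s, g x ∂μHE[finrank ℝ U]
      = ∫ x in s, (fderiv ℝ f x : U →ₗ[ℝ] V).normDet * g (f x) := by
  have hae : ∀ᵐ x, x ∈ Q → DifferentiableAt ℝ f x := by
    filter_upwards [hK.ae_differentiableWithinAt_of_mem (μ := volume)] with x hx hxQ
    exact (hx hxQ).differentiableAt (hQ.mem_nhds hxQ)
  obtain ⟨Z, hZsub, hZm, hZ0⟩ := exists_measurable_superset_of_null (ae_iff.1 hae)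
  set s' := s \ Z with hs'
  have hs'm : MeasurableSet s' := hs.diff hZm
  have hd : ∀ x ∈ s', DifferentiableAt ℝ f x := fun x hx => by
    by_contra hcon
    exact hx.2 (hZsub fun himp => hcon (himp (hsQ hx.1)))
  have hnull : (μHE[finrank ℝ U] : Measure V) (f '' s \ f '' s') = 0 := by
    have h1 : f '' s \ f '' s' ⊆ f '' (s ∩ Z) := by
      rintro _ ⟨⟨y, hy, rfl⟩, hn⟩
      refine ⟨y, ⟨hy, ?_⟩, rfl⟩
      by_contra hyZ
      exact hn ⟨y, ⟨hy, hyZ⟩, rfl⟩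
    have h2 := SurfactantFlow.LipschitzOnWith.euclideanHausdorffMeasure_image_le
      (finrank ℝ U) (hK.mono (inter_subset_left.trans hsQ : s ∩ Z ⊆ Q))
    rw [InnerProductSpace.euclideanHausdorffMeasure_eq_volume,
      measure_mono_null inter_subset_right hZ0, mul_zero] at h2
    exact measure_mono_null h1 (le_antisymm h2 bot_le)
  have hae1 : f '' s' =ᵐ[μHE[finrank ℝ U]] f '' s := by
    refine ae_eq_set.2 ⟨?_, hnull⟩
    rw [sdiff_eq_empty.2 (image_mono sdiff_subset)]
    exact measure_empty
  have hae2 : s' =ᵐ[volume] s := by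
    refine ae_eq_set.2 ⟨by rw [sdiff_eq_empty.2 sdiff_subset]; exact measure_empty, ?_⟩
    refine measure_mono_null (fun y hy => ?_) hZ0
    by_contra hyZ
    exact hy.2 ⟨hy.1, hyZ⟩
  -- apart from null sets on both sides, `f` is differentiable
  have hinj : InjOn f s' := hf.mono sdiff_subset
  have hi' : ∀ x ∈ s', Function.Injective (fderiv ℝ f x) := fun x hx => hi x hx.1 (hd x hx)
  constructor
  · rw [← integrableOn_congr_set_ae hae1, ← integrableOn_congr_set_ae hae2]
    exact integrableOn_image_iff_normDet_fderiv hs'm hd hi' hinj g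
  · rw [← setIntegral_congr_set hae1, ← setIntegral_congr_set hae2]
    exact integral_image_eq_normDet_fderiv hs'm hd hi' hinj g

variable {E' E : Type*} [NormedAddCommGroup E'] [InnerProductSpace ℝ E'] [FiniteDimensional ℝ E']
  [MeasurableSpace E'] [BorelSpace E']
  [NormedAddCommGroup E] [InnerProductSpace ℝ E] [FiniteDimensional ℝ E]
  [MeasurableSpace E] [BorelSpace E]

/-- Near `x₀`, the set `A` is parametrized by the `C¹` map `φ` on a relatively open subset of `G`;
the derivative of `φ` at the point `y₀` over `x₀` is an isometry. -/
structure IsParam (A : Set E) (x₀ : E) (φ : E' → E) (y₀ : E') (G : Set E') : Prop where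
  isOpen : IsOpen G
  mem : y₀ ∈ G
  apply_eq : φ y₀ = x₀
  contDiffAt : ∀ y ∈ G, ContDiffAt ℝ 1 φ y
  injOn : InjOn φ G
  isometry : ∀ v w, ⟪fderiv ℝ φ y₀ v, fderiv ℝ φ y₀ w⟫_ℝ = ⟪v, w⟫_ℝ
  isOpen_preimage : IsOpen (G ∩ φ ⁻¹' A)
  exists_nhds : ∀ G' ⊆ G, G' ∈ 𝓝 y₀ → ∃ O ∈ 𝓝 x₀, A ∩ O ⊆ φ '' G'

/-- The volume factor of the flowed parametrization is close to `1 + (s - t) θ` times that of the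
parametrization. -/
theorem exists_normDet_sub_le {ι : Type*} [Fintype ι] (b : OrthonormalBasis ι ℝ E') {φ : E' → E}
    {y₀ : E'} (hφ : ContDiffAt ℝ 1 φ y₀)
    (hiso : ∀ v w, ⟪fderiv ℝ φ y₀ v, fderiv ℝ φ y₀ w⟫_ℝ = ⟪v, w⟫_ℝ) {θ : E → ℝ} {D : E →L[ℝ] E}
    (hθ : ContinuousAt θ (φ y₀))
    (hθ0 : θ (φ y₀) = ∑ i, ⟪fderiv ℝ φ y₀ (b i), D (fderiv ℝ φ y₀ (b i))⟫_ℝ) {ε : ℝ} (hε : 0 < ε) :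
    ∃ η, 0 < η ∧ ∃ G' ∈ 𝓝 y₀, ∃ δ, 0 < δ ∧ ∀ y ∈ G',
      1 / 2 ≤ (fderiv ℝ φ y : E' →ₗ[ℝ] E).normDet ∧ (fderiv ℝ φ y : E' →ₗ[ℝ] E).normDet ≤ 2 ∧
      |θ (φ y)| ≤ |θ (φ y₀)| + 1 ∧ Function.Injective (fderiv ℝ φ y) ∧
      ∀ r, |r| ≤ δ → ∀ B : E' →L[ℝ] E, ‖B - fderiv ℝ φ y - r • (D ∘L fderiv ℝ φ y)‖ ≤ η * |r| →
        Function.Injective B ∧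
        |(B : E' →ₗ[ℝ] E).normDet - (1 + r * θ (φ y)) * (fderiv ℝ φ y : E' →ₗ[ℝ] E).normDet|
          ≤ ε * |r| := by
  obtain ⟨L, hL, hN1, hLH⟩ := exists_hasStrictFDerivAt_normDet b hiso
  set A₀ := fderiv ℝ φ y₀ with hA₀
  set N : (E' →L[ℝ] E) → ℝ := fun B => (B : E' →ₗ[ℝ] E).normDet with hN
  set Q := ‖D‖ * (‖A₀‖ + 1) with hQ
  have hQ0 : 0 ≤ Q := by positivity
  set η := min 1 (ε / (4 * (Q + 1 + ‖L‖))) with hη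
  have hη0 : 0 < η := by positivity
  have hη1 : η ≤ 1 := min_le_left _ _
  have hη2 : η * (Q + 1 + ‖L‖) ≤ ε / 4 := by
    calc η * (Q + 1 + ‖L‖) ≤ ε / (4 * (Q + 1 + ‖L‖)) * (Q + 1 + ‖L‖) := by
          gcongr; exact min_le_right _ _
      _ = _ := by field_simp
  obtain ⟨T, hT, hTa⟩ := hL.approximates_deriv_on_nhds (c := η.toNNReal)
    (Or.inr (Real.toNNReal_pos.2 hη0))
  obtain ⟨ρ, hρ, hρT⟩ := Metric.mem_nhds_iff.1 hT
  have hA : ContinuousAt (fun y => fderiv ℝ φ y) y₀ := hφ.continuousAt_fderiv one_ne_zero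
  have hφc := hφ.continuousAt
  have e1 : ∀ᶠ y in 𝓝 y₀, ‖fderiv ℝ φ y - A₀‖ < min (1 / 4) (ρ / 2) := by
    have := hA.eventually (Metric.ball_mem_nhds A₀ (ε := min (1 / 4) (ρ / 2)) (by positivity))
    filter_upwards [this] with y hy
    rwa [← dist_eq_norm]
  have hNc : ContinuousAt (fun y => N (fderiv ℝ φ y)) y₀ :=
    continuous_normDet.continuousAt.comp hA
  have e2 : ∀ᶠ y in 𝓝 y₀, 1 / 2 < N (fderiv ℝ φ y) :=
    hNc.eventually (lt_mem_nhds (by change 1 / 2 < N A₀; simp only [hN, hN1]; norm_num))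
  have e3 : ∀ᶠ y in 𝓝 y₀, N (fderiv ℝ φ y) < 2 :=
    hNc.eventually (gt_mem_nhds (by change N A₀ < 2; simp only [hN, hN1]; norm_num))
  have hθc : ContinuousAt (fun y => θ (φ y)) y₀ := ContinuousAt.comp hθ hφc
  have e4 : ∀ᶠ y in 𝓝 y₀, |θ (φ y)| < |θ (φ y₀)| + 1 :=
    hθc.abs.eventually (gt_mem_nhds (lt_add_one _))
  have hdc : ContinuousAt (fun y => L (D ∘L fderiv ℝ φ y) - θ (φ y) * N (fderiv ℝ φ y)) y₀ :=
    (L.continuous.continuousAt.comp (continuousAt_const.clm_comp hA)).sub (hθc.mul hNc)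
  have e5 : ∀ᶠ y in 𝓝 y₀, |L (D ∘L fderiv ℝ φ y) - θ (φ y) * N (fderiv ℝ φ y)| < ε / 4 := by
    refine hdc.abs.eventually (gt_mem_nhds ?_)
    change |L (D ∘L A₀) - θ (φ y₀) * N A₀| < ε / 4
    rw [hLH, hθ0]
    simp only [hN, hN1, mul_one]
    simp [hε]
  set δ := min 1 (min (1 / (4 * (Q + 1))) (ρ / (4 * (Q + 1)))) with hδ
  have hδ0 : 0 < δ := by positivity
  refine ⟨η, hη0, _, (e1.and e2).and (e3.and (e4.and e5)), δ, hδ0, ?_⟩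
  rintro y ⟨⟨h1, h2⟩, h3, h4, h5⟩
  set A := fderiv ℝ φ y with hAy
  have hiso' : ∀ v, ‖A₀ v‖ = ‖v‖ := fun v => by
    have := hiso v v
    rw [real_inner_self_eq_norm_sq, real_inner_self_eq_norm_sq] at this
    exact (sq_eq_sq₀ (norm_nonneg _) (norm_nonneg _)).1 this
  have hinj : ∀ B : E' →L[ℝ] E, ‖B - A₀‖ ≤ 1 / 2 → Function.Injective B := by
    intro B hB
    rw [injective_iff_map_eq_zero]
    intro v hv
    have h6 := (B - A₀).le_opNorm v
    rw [sub_apply, hv, zero_sub, norm_neg, hiso'] at h6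
    have h7 : ‖B - A₀‖ * ‖v‖ ≤ 1 / 2 * ‖v‖ := by gcongr
    exact norm_eq_zero.1 (le_antisymm (by linarith) (norm_nonneg v))
  have h11 : ‖A - A₀‖ < 1 / 4 := h1.trans_le (min_le_left _ _)
  have h12 : ‖A - A₀‖ < ρ / 2 := h1.trans_le (min_le_right _ _)
  refine ⟨h2.le, h3.le, h4.le, hinj A (by linarith), fun r hr B hB => ?_⟩
  have hAn : ‖A‖ ≤ ‖A₀‖ + 1 := by
    have := norm_add_le (A - A₀) A₀
    rw [sub_add_cancel] at this
    linarith
  have hDA : ‖D ∘L A‖ ≤ Q := (D.opNorm_comp_le A).trans (by rw [hQ]; gcongr)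
  have hBA : ‖B - A‖ ≤ (Q + 1) * |r| := by
    have h6 := norm_add_le (B - A - r • (D ∘L A)) (r • (D ∘L A))
    rw [sub_add_cancel, norm_smul, Real.norm_eq_abs] at h6
    have h7 : |r| * ‖D ∘L A‖ ≤ |r| * Q := by gcongr
    have h8 : η * |r| ≤ 1 * |r| := by gcongr
    linarith
  have hr2 : (Q + 1) * |r| ≤ 1 / 4 := by
    calc (Q + 1) * |r| ≤ (Q + 1) * (1 / (4 * (Q + 1))) := by
          gcongr; exact hr.trans ((min_le_right _ _).trans (min_le_left _ _))
      _ = _ := by field_simp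
  have hr3 : (Q + 1) * |r| ≤ ρ / 4 := by
    calc (Q + 1) * |r| ≤ (Q + 1) * (ρ / (4 * (Q + 1))) := by
          gcongr; exact hr.trans ((min_le_right _ _).trans (min_le_right _ _))
      _ = _ := by field_simp
  have hBA₀ : ‖B - A₀‖ ≤ ‖B - A‖ + ‖A - A₀‖ := by
    have := norm_add_le (B - A) (A - A₀)
    rwa [sub_add_sub_cancel] at this
  refine ⟨hinj B (by linarith), ?_⟩
  have h6 := hTa B (hρT (by rw [Metric.mem_ball, dist_eq_norm]; linarith)) A
    (hρT (by rw [Metric.mem_ball, dist_eq_norm]; linarith))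
  rw [Real.coe_toNNReal _ hη0.le, Real.norm_eq_abs] at h6
  have h7 : L (B - A) = r * L (D ∘L A) + L (B - A - r • (D ∘L A)) := by
    rw [map_sub L (B - A), map_smul, smul_eq_mul]; ring
  have h8 : |L (B - A - r • (D ∘L A))| ≤ ‖L‖ * (η * |r|) := by
    have := L.le_opNorm (B - A - r • (D ∘L A))
    rw [Real.norm_eq_abs] at this
    exact this.trans (by gcongr)
  -- linearize the volume factor `N` at the isometry; by continuity `L (D A)` is close to `θ N`
  have h9 : N B - (1 + r * θ (φ y)) * N A = (N B - N A - L (B - A))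
      + r * (L (D ∘L A) - θ (φ y) * N A) + L (B - A - r • (D ∘L A)) := by
    rw [h7]; ring
  change |N B - (1 + r * θ (φ y)) * N A| ≤ _
  rw [h9]
  have h10 : |r * (L (D ∘L A) - θ (φ y) * N A)| ≤ |r| * (ε / 4) := by
    rw [abs_mul]; gcongr
  have h13 : η * ‖B - A‖ ≤ η * ((Q + 1) * |r|) := by gcongr
  have h14 := abs_add_three (N B - N A - L (B - A)) (r * (L (D ∘L A) - θ (φ y) * N A))
    (L (B - A - r • (D ∘L A)))
  have h15 : η * ((Q + 1) * |r|) + ‖L‖ * (η * |r|) = η * (Q + 1 + ‖L‖) * |r| := by ring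
  have h16 : η * (Q + 1 + ‖L‖) * |r| ≤ ε / 4 * |r| := by gcongr
  have h17 : N B - N A - L (B - A) = (fun B => N B) B - (fun B => N B) A - L (B - A) := rfl
  have h18 : |N B - N A - L (B - A)| ≤ η * ‖B - A‖ := h6
  have h19 : 0 ≤ ε * |r| := by positivity
  linarith

end LocalTransport

end SurfactantFlow

namespace SurfactantFlow

section TransportNear

open Module Set
open scoped NNReal ENNReal

variable {E' E : Type*} [NormedAddCommGroup E'] [InnerProductSpace ℝ E'] [FiniteDimensional ℝ E']
  [MeasurableSpace E'] [BorelSpace E']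
  [NormedAddCommGroup E] [InnerProductSpace ℝ E] [FiniteDimensional ℝ E]
  [MeasurableSpace E] [BorelSpace E]

theorem measurableSet_inter_preimage {φ : E' → E} {G : Set E'} (hG : IsOpen G)
    (hφ : ContinuousOn φ G) {B : Set E} (hB : MeasurableSet B) : MeasurableSet (G ∩ φ ⁻¹' B) := by
  have h := (continuousOn_iff_continuous_domRestrict.1 hφ).measurable hB
  have h2 := hG.measurableSet.subtype_image h
  rwa [Set.domRestrict_eq, preimage_comp, Subtype.image_preimage_coe] at h2

/-- For short times the trajectories separate points at a rate between `1 / 2` and `2`. -/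
theorem IsFlowOn.exists_dist_le {u : ℝ × E → E} {X : ℝ → E → E} {A : Set E} {t : ℝ}
    {I : Set ℝ} (h : IsFlowOn u X A t I) {x₀ : E} (hu : ContDiffAt ℝ 1 u (t, x₀)) :
    ∃ O ∈ 𝓝 x₀, ∃ δ, 0 < δ ∧ ∀ x ∈ A ∩ O, ∀ y ∈ A ∩ O, ∀ s, |s - t| ≤ δ →
      ‖X s x - X s y‖ ≤ 2 * ‖x - y‖ ∧ ‖x - y‖ ≤ 2 * ‖X s x - X s y‖ := by
  obtain ⟨O, hO, δ, hδ, hX⟩ := h.exists_norm_sub_sub_le hu one_pos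
  set D := fderiv ℝ (fun z => u (t, z)) x₀ with hD
  refine ⟨O, hO, min δ (1 / (2 * (‖D‖ + 1))), by positivity, fun x hx y hy s hs => ?_⟩
  have h1 := hX x hx y hy s (hs.trans (min_le_left _ _))
  have h2 : (‖D‖ + 1) * |s - t| ≤ 1 / 2 := by
    calc (‖D‖ + 1) * |s - t| ≤ (‖D‖ + 1) * (1 / (2 * (‖D‖ + 1))) := by
          gcongr; exact hs.trans (min_le_right _ _)
      _ = _ := by field_simp
  have h3 : ‖(s - t) • D (x - y)‖ ≤ |s - t| * (‖D‖ * ‖x - y‖) := by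
    rw [norm_smul, Real.norm_eq_abs]
    gcongr
    exact D.le_opNorm _
  have h4 : ‖X s x - X s y - (x - y)‖ ≤ 1 / 2 * ‖x - y‖ := by
    have h5 := norm_add_le (X s x - X s y - (x - y) - (s - t) • D (x - y)) ((s - t) • D (x - y))
    rw [sub_add_cancel] at h5
    have h6 : (‖D‖ + 1) * |s - t| * ‖x - y‖ ≤ 1 / 2 * ‖x - y‖ := by gcongr
    nlinarith
  have h5 := norm_add_le (X s x - X s y - (x - y)) (x - y)
  rw [sub_add_cancel] at h5
  have h6 := norm_sub_le (X s x - X s y) (X s x - X s y - (x - y))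
  rw [sub_sub_cancel] at h6
  constructor <;> linarith [norm_nonneg (x - y)]

/-- Change of variables under the flow near a point, to first order in time: the surface measure of
a transported set is multiplied by `1 + (s - t) θ`, up to an error `ε |s - t|`. -/
theorem IsFlowOn.exists_transport_near {u : ℝ × E → E} {X : ℝ → E → E} {A : Set E} {t : ℝ}
    {I : Set ℝ} (h : IsFlowOn u X A t I) {x₀ : E} (hu : ContDiffAt ℝ 1 u (t, x₀))
    {φ : E' → E} {y₀ : E'} {G : Set E'} (hφ : IsParam A x₀ φ y₀ G)
    {ι : Type*} [Fintype ι] (b : OrthonormalBasis ι ℝ E') {θ : E → ℝ} (hθ : ContinuousAt θ x₀)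
    (hθA : ContinuousOn θ A)
    (hθ0 : θ x₀ = ∑ i, ⟪fderiv ℝ φ y₀ (b i),
      fderiv ℝ (fun z => u (t, z)) x₀ (fderiv ℝ φ y₀ (b i))⟫_ℝ) {ε : ℝ} (hε : 0 < ε) :
    ∃ O, IsOpen O ∧ x₀ ∈ O ∧ (μHE[finrank ℝ E'] : Measure E) (A ∩ O) < ⊤ ∧ ∃ δ, 0 < δ ∧
      ∀ s, |s - t| ≤ δ → InjOn (X s) (A ∩ O) ∧ ContinuousOn (X s) (A ∩ O) ∧
      ∀ B ⊆ A ∩ O, MeasurableSet B → ∀ (g : E → ℝ) (C : ℝ), 0 ≤ C → ContinuousOn g (X s '' B) →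
        (∀ z ∈ X s '' B, |g z| ≤ C) →
        IntegrableOn g (X s '' B) μHE[finrank ℝ E'] ∧
        IntegrableOn (fun x => g (X s x) * (1 + (s - t) * θ x)) B μHE[finrank ℝ E'] ∧
        |(∫ z in X s '' B, g z ∂μHE[finrank ℝ E'])
          - ∫ x in B, g (X s x) * (1 + (s - t) * θ x) ∂μHE[finrank ℝ E']|
            ≤ ε * |s - t| * (C * (μHE[finrank ℝ E'] : Measure E).real B) := by
  have hφ0 := hφ.contDiffAt y₀ hφ.mem
  have hφeq := hφ.apply_eq
  subst hφeq
  obtain ⟨η, hη, G₁, hG₁, δ₁, hδ₁, hdet⟩ := exists_normDet_sub_le b hφ0 hφ.isometry hθ hθ0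
    (half_pos hε)
  obtain ⟨Kφ, G₂, hG₂, hLip⟩ := hφ0.exists_lipschitzOnWith
  set ε₂ := η / (Kφ + 1) with hε₂
  have hε₂0 : 0 < ε₂ := by positivity
  obtain ⟨O₁, hO₁, δ₂, hδ₂, hX⟩ := h.exists_norm_sub_sub_le hu hε₂0
  obtain ⟨O₂, hO₂, δ₃, hδ₃, hdist⟩ := h.exists_dist_le hu
  set D := fderiv ℝ (fun z => u (t, z)) (φ y₀) with hD
  -- a small open piece of the parameter domain
  set G' := interior (G ∩ G₁ ∩ G₂ ∩ Metric.ball y₀ 1) with hG'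
  have hG'o : IsOpen G' := isOpen_interior
  have hG'sub : G' ⊆ G ∩ G₁ ∩ G₂ ∩ Metric.ball y₀ 1 := interior_subset
  have hG'n : G' ∈ 𝓝 y₀ := interior_mem_nhds.2 (inter_mem (inter_mem (inter_mem
    (hφ.isOpen.mem_nhds hφ.mem) hG₁) hG₂) (Metric.ball_mem_nhds _ one_pos))
  have hG'G : G' ⊆ G := fun y hy => (hG'sub hy).1.1.1
  obtain ⟨O₃, hO₃, hcov⟩ := hφ.exists_nhds G' hG'G hG'n
  set O := interior (O₁ ∩ O₂ ∩ O₃) with hOdef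
  have hOsub : O ⊆ O₁ ∩ O₂ ∩ O₃ := interior_subset
  have hOn : O ∈ 𝓝 (φ y₀) := interior_mem_nhds.2 (inter_mem (inter_mem hO₁ hO₂) hO₃)
  have hφd : ∀ y ∈ G, DifferentiableAt ℝ φ y := fun y hy =>
    (hφ.contDiffAt y hy).differentiableAt one_ne_zero
  have hφc : ContinuousOn φ G := fun y hy => (hφd y hy).continuousAt.continuousWithinAt
  have hLip' : LipschitzOnWith Kφ φ G' := hLip.mono fun y hy => (hG'sub hy).1.2
  have hvol : volume G' < ⊤ := (measure_mono fun y hy => (hG'sub hy).2).trans_lt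
    (measure_ball_lt_top : volume (Metric.ball y₀ 1) < ⊤)
  have hvol' : ∀ S ⊆ G', (μHE[finrank ℝ E'] : Measure E') S < ⊤ := fun S hS => by
    rw [InnerProductSpace.euclideanHausdorffMeasure_eq_volume]
    exact (measure_mono hS).trans_lt hvol
  have hfin : ∀ {f : E' → E} {K : ℝ≥0} {S : Set E'}, S ⊆ G' → LipschitzOnWith K f S →
      (μHE[finrank ℝ E'] : Measure E) (f '' S) < ⊤ := fun hS hL =>
    (SurfactantFlow.LipschitzOnWith.euclideanHausdorffMeasure_image_le _ hL).trans_lt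
      (ENNReal.mul_lt_top (by finiteness) (hvol' _ hS))
  refine ⟨O, isOpen_interior, mem_of_mem_nhds hOn, ?_, min (min δ₁ δ₂) δ₃, by positivity,
    fun s hs => ?_⟩
  · exact (measure_mono ((inter_subset_inter_right _ fun x hx => (hOsub hx).2).trans hcov)).trans_lt
      (hfin subset_rfl hLip')
  have hs1 : |s - t| ≤ δ₁ := hs.trans ((min_le_left _ _).trans (min_le_left _ _))
  have hs2 : |s - t| ≤ δ₂ := hs.trans ((min_le_left _ _).trans (min_le_right _ _))
  have hs3 : |s - t| ≤ δ₃ := hs.trans (min_le_right _ _)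
  have hO1 : A ∩ O ⊆ A ∩ O₁ := inter_subset_inter_right _ fun x hx => (hOsub hx).1.1
  have hO2 : A ∩ O ⊆ A ∩ O₂ := inter_subset_inter_right _ fun x hx => (hOsub hx).1.2
  have hXinj : InjOn (X s) (A ∩ O) := by
    intro x hx y hy hxy
    have h1 := (hdist x (hO2 hx) y (hO2 hy) s hs3).2
    rw [hxy, sub_self, norm_zero, mul_zero] at h1
    exact sub_eq_zero.1 (norm_le_zero_iff.1 h1)
  have hXlip : LipschitzOnWith 2 (X s) (A ∩ O) := LipschitzOnWith.of_dist_le_mul fun x hx y hy => by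
    rw [dist_eq_norm, dist_eq_norm]
    exact (hdist x (hO2 hx) y (hO2 hy) s hs3).1
  refine ⟨hXinj, hXlip.continuousOn, fun B hB hBm g C hC hg hgC => ?_⟩
  -- the parameter sets
  set Q := (G ∩ φ ⁻¹' A) ∩ (G' ∩ φ ⁻¹' O) with hQ
  have hQo : IsOpen Q := hφ.isOpen_preimage.inter
    ((hφc.mono hG'G).isOpen_inter_preimage hG'o isOpen_interior)
  set P := G' ∩ φ ⁻¹' B with hP
  have hPQ : P ⊆ Q := fun y hy => ⟨⟨hG'G hy.1, (hB hy.2).1⟩, hy.1, (hB hy.2).2⟩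
  have hQG' : Q ⊆ G' := fun y hy => hy.2.1
  have hPG' : P ⊆ G' := inter_subset_left
  have hPm : MeasurableSet P := measurableSet_inter_preimage hG'o (hφc.mono hG'G) hBm
  have hQAO : ∀ y ∈ Q, φ y ∈ A ∩ O := fun y hy => ⟨hy.1.2, hy.2.2⟩
  have hPB : φ '' P = B := by
    refine subset_antisymm (image_subset_iff.2 fun y hy => hy.2) fun x hx => ?_
    obtain ⟨y, hy, rfl⟩ := hcov ⟨(hB hx).1, (hOsub (hB hx).2).2⟩
    exact ⟨y, ⟨hy, hx⟩, rfl⟩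
  set Φ : E' → E := fun y => X s (φ y) with hΦ
  have hΦB : Φ '' P = X s '' B := by rw [← hPB, image_image]
  have hφinj : InjOn φ P := hφ.injOn.mono (hPG'.trans hG'G)
  have hΦinj : InjOn Φ P := fun y hy y' hy' he =>
    hφinj hy hy' (hXinj (hQAO y (hPQ hy)) (hQAO y' (hPQ hy')) he)
  have hΦlip : LipschitzOnWith (2 * Kφ) Φ Q :=
    hXlip.comp (hLip'.mono hQG') fun y hy => hQAO y hy
  -- the derivative of the flowed parametrization
  have hΦd : ∀ y ∈ Q, DifferentiableAt ℝ Φ y →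
      ‖fderiv ℝ Φ y - fderiv ℝ φ y - (s - t) • (D ∘L fderiv ℝ φ y)‖ ≤ η * |s - t| := by
    intro y hy hd
    have hdφ := (hφd y hy.1.1).hasFDerivAt
    have hd2 : HasFDerivAt (fun y => Φ y - φ y - (s - t) • D (φ y))
        (fderiv ℝ Φ y - fderiv ℝ φ y - (s - t) • (D ∘L fderiv ℝ φ y)) y :=
      (hd.hasFDerivAt.sub hdφ).sub ((D.hasFDerivAt.comp y hdφ).const_smul (s - t))
    have hK : 0 ≤ ε₂ * |s - t| * Kφ := by positivity
    have h1 := hd2.le_of_lipschitzOn (hQo.mem_nhds hy)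
      (C := (ε₂ * |s - t| * Kφ).toNNReal) (LipschitzOnWith.of_dist_le_mul fun y₁ hy₁ y₂ hy₂ => by
        rw [dist_eq_norm, Real.coe_toNNReal _ hK]
        have h2 := hX _ (hO1 (hQAO y₁ hy₁)) _ (hO1 (hQAO y₂ hy₂)) s hs2
        have h3 := hLip'.dist_le_mul y₁ (hQG' hy₁) y₂ (hQG' hy₂)
        rw [dist_eq_norm] at h3
        have h4 : Φ y₁ - φ y₁ - (s - t) • D (φ y₁) - (Φ y₂ - φ y₂ - (s - t) • D (φ y₂))
            = X s (φ y₁) - X s (φ y₂) - (φ y₁ - φ y₂) - (s - t) • D (φ y₁ - φ y₂) := by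
          rw [map_sub, smul_sub]; simp only [hΦ]; abel
        rw [h4, mul_assoc]
        exact h2.trans (by gcongr))
    rw [Real.coe_toNNReal _ hK] at h1
    refine h1.trans ?_
    have h5 : ε₂ * Kφ ≤ η := by
      rw [hε₂, div_mul_eq_mul_div, div_le_iff₀ (by positivity)]
      nlinarith [Kφ.coe_nonneg]
    nlinarith [abs_nonneg (s - t)]
  have hdetP : ∀ y ∈ P, _ := fun y hy => hdet y (hG'sub (hPG' hy)).1.1.2
  have hΦi : ∀ y ∈ P, DifferentiableAt ℝ Φ y → Function.Injective (fderiv ℝ Φ y) := fun y hy hd =>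
    ((hdetP y hy).2.2.2.2 (s - t) hs1 _ (hΦd y (hPQ hy) hd)).1
  obtain ⟨hΦI, hΦe⟩ := SurfactantFlow.LipschitzOnWith.integral_image hΦlip hQo hPQ hPm hΦi hΦinj g
  have hφI := fun g => SurfactantFlow.LipschitzOnWith.integral_image (hLip'.mono hQG') hQo hPQ hPm
    (fun y hy _ => (hdetP y hy).2.2.2.1) hφinj g
  rw [hΦB] at hΦI hΦe
  rw [hPB] at hφI
  -- integrability
  have hXm : MeasurableSet (X s '' B) :=
    hBm.image_of_continuousOn_injOn (hXlip.continuousOn.mono hB) (hXinj.mono hB)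
  have hg1 : IntegrableOn g (X s '' B) μHE[finrank ℝ E'] := by
    refine IntegrableOn.of_bound ?_ (hg.aestronglyMeasurable hXm) C
      ((ae_restrict_mem hXm).mono fun z hz => hgC z hz)
    rw [← hΦB]
    exact hfin hPG' (hΦlip.mono hPQ)
  have hBfin : (μHE[finrank ℝ E'] : Measure E) B < ⊤ := by
    rw [← hPB]; exact hfin hPG' (hLip'.mono hPG')
  have hgX : ContinuousOn (fun x => g (X s x)) B :=
    hg.comp (hXlip.continuousOn.mono hB) (mapsTo_image _ _)
  have hgXC : ∀ x ∈ B, |g (X s x)| ≤ C := fun x hx => hgC _ (mem_image_of_mem _ hx)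
  have hθB : ContinuousOn (fun x => 1 + (s - t) * θ x) B :=
    continuousOn_const.add (continuousOn_const.mul (hθA.mono fun x hx => (hB hx).1))
  have hg2 : IntegrableOn (fun x => g (X s x) * (1 + (s - t) * θ x)) B μHE[finrank ℝ E'] := by
    refine IntegrableOn.of_bound hBfin ((hgX.mul hθB).aestronglyMeasurable hBm)
      (C * (1 + |s - t| * (|θ (φ y₀)| + 1))) ((ae_restrict_mem hBm).mono fun x hx => ?_)
    obtain ⟨y, hy, rfl⟩ := hPB.symm ▸ hx
    rw [Real.norm_eq_abs, abs_mul]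
    refine mul_le_mul (hgXC _ hx) ((abs_add_le _ _).trans ?_) (abs_nonneg _) hC
    rw [abs_one, abs_mul]
    gcongr
    exact (hdetP y hy).2.2.1
  refine ⟨hg1, hg2, ?_⟩
  have i1 := hΦI.1 hg1
  have i2 := (hφI _).1.1 hg2
  rw [hΦe, (hφI _).2, ← integral_sub i1 i2]
  -- the volume of the parameter set
  have hone : IntegrableOn (fun _ => (1 : ℝ)) B (μHE[finrank ℝ E'] : Measure E) :=
    integrableOn_const hBfin.ne
  have hPvol : volume.real P ≤ 2 * (μHE[finrank ℝ E'] : Measure E).real B := by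
    have h1 := (hφI fun _ => 1).2
    rw [setIntegral_const, smul_eq_mul, mul_one] at h1
    have h2 : ∫ _ in P, (1 / 2 : ℝ) ≤ ∫ x in P, (fderiv ℝ φ x : E' →ₗ[ℝ] E).normDet * 1 :=
      setIntegral_mono_on (integrableOn_const ((measure_mono hPG').trans_lt hvol).ne)
        ((hφI fun _ => 1).1.1 hone) hPm fun y hy => by rw [mul_one]; exact (hdetP y hy).1
    rw [setIntegral_const, smul_eq_mul] at h2
    linarith
  have hae : ∀ᵐ y ∂volume.restrict P, DifferentiableAt ℝ Φ y := by
    rw [ae_restrict_iff' hPm]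
    filter_upwards [hΦlip.ae_differentiableWithinAt_of_mem (μ := volume)] with y hy hyP
    exact (hy (hPQ hyP)).differentiableAt (hQo.mem_nhds (hPQ hyP))
  have hbound : ∀ᵐ y ∂volume.restrict P,
      ‖(fderiv ℝ Φ y : E' →ₗ[ℝ] E).normDet * g (Φ y)
        - (fderiv ℝ φ y : E' →ₗ[ℝ] E).normDet * (g (X s (φ y)) * (1 + (s - t) * θ (φ y)))‖
        ≤ ε / 2 * |s - t| * C := by
    filter_upwards [hae, ae_restrict_mem hPm] with y hd hy
    have h1 := ((hdetP y hy).2.2.2.2 (s - t) hs1 _ (hΦd y (hPQ hy) hd)).2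
    have h2 : (fderiv ℝ Φ y : E' →ₗ[ℝ] E).normDet * g (Φ y)
        - (fderiv ℝ φ y : E' →ₗ[ℝ] E).normDet * (g (X s (φ y)) * (1 + (s - t) * θ (φ y)))
        = ((fderiv ℝ Φ y : E' →ₗ[ℝ] E).normDet
          - (1 + (s - t) * θ (φ y)) * (fderiv ℝ φ y : E' →ₗ[ℝ] E).normDet) * g (X s (φ y)) := by
      simp only [hΦ]; ring
    rw [h2, Real.norm_eq_abs, abs_mul]
    exact mul_le_mul h1 (hgXC _ hy.2) (abs_nonneg _) (by positivity)
  have h3 := norm_setIntegral_le_of_norm_le_const_ae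
    ((measure_mono hPG').trans_lt hvol) hbound
  rw [Real.norm_eq_abs] at h3
  refine h3.trans ?_
  calc ε / 2 * |s - t| * C * volume.real P
      ≤ ε / 2 * |s - t| * C * (2 * (μHE[finrank ℝ E'] : Measure E).real B) := by gcongr
    _ = _ := by ring

end TransportNear

end SurfactantFlow

namespace SurfactantFlow

/-! ### The transport theorem -/

section Transport

open Module Set
open scoped NNReal ENNReal

/-- A property that holds for short times near every point of a compact set holds for short times
on the whole set. -/
theorem exists_forall_abs_sub_le_of_isCompact {E : Type*} [TopologicalSpace E] {A K : Set E}
    (hK : IsCompact K) (hAK : A ⊆ K) {t : ℝ} {P : ℝ → E → Prop}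
    (hP : ∀ x ∈ K, ∃ O ∈ 𝓝 x, ∃ δ, 0 < δ ∧ ∀ y ∈ A ∩ O, ∀ s, |s - t| ≤ δ → P s y) :
    ∃ δ, 0 < δ ∧ ∀ y ∈ A, ∀ s, |s - t| ≤ δ → P s y := by
  obtain ⟨δ, hδ, h⟩ : ∃ δ, 0 < δ ∧ ∀ y ∈ A ∩ K, ∀ s, |s - t| ≤ δ → P s y := by
    refine hK.induction_on (p := fun W => ∃ δ, 0 < δ ∧ ∀ y ∈ A ∩ W, ∀ s, |s - t| ≤ δ → P s y)
      ⟨1, one_pos, fun y hy => hy.2.elim⟩ ?_ ?_ ?_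
    · rintro W W' hW ⟨δ, hδ, h⟩
      exact ⟨δ, hδ, fun y hy => h y ⟨hy.1, hW hy.2⟩⟩
    · rintro W W' ⟨δ, hδ, h⟩ ⟨δ', hδ', h'⟩
      refine ⟨min δ δ', lt_min hδ hδ', fun y hy s hs => ?_⟩
      rcases hy.2 with hy2 | hy2
      · exact h y ⟨hy.1, hy2⟩ s (hs.trans (min_le_left _ _))
      · exact h' y ⟨hy.1, hy2⟩ s (hs.trans (min_le_right _ _))
    · intro x hx
      obtain ⟨O, hO, h⟩ := hP x hx
      exact ⟨O, mem_nhdsWithin_of_mem_nhds hO, h⟩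
  exact ⟨δ, hδ, fun y hy => h y ⟨hy, hAK hy⟩⟩

variable {E' E : Type*} [NormedAddCommGroup E'] [InnerProductSpace ℝ E'] [FiniteDimensional ℝ E']
  [MeasurableSpace E'] [BorelSpace E']
  [NormedAddCommGroup E] [InnerProductSpace ℝ E] [FiniteDimensional ℝ E]
  [MeasurableSpace E] [BorelSpace E]

/-- For short times, trajectories that start in a compact set do not meet. -/
theorem IsFlowOn.exists_injOn {u : ℝ × E → E} {X : ℝ → E → E} {A K : Set E} {t : ℝ}
    {I : Set ℝ} (h : IsFlowOn u X A t I) (hK : IsCompact K) (hAK : A ⊆ K)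
    (hu : ∀ x ∈ K, ContDiffAt ℝ 1 u (t, x)) :
    ∃ δ, 0 < δ ∧ ∀ s, |s - t| ≤ δ → InjOn (X s) A := by
  obtain ⟨δ, hδ, hδ'⟩ := exists_forall_abs_sub_le_of_isCompact (A := A ×ˢ A) (t := t)
    (P := fun s (y : E × E) => X s y.1 = X s y.2 → y.1 = y.2) (hK.prod hK)
    (prod_mono hAK hAK) (by
      rintro ⟨x₀, y₀⟩ ⟨hx₀, hy₀⟩
      -- near the diagonal trajectories separate at a positive rate; off the diagonal they are confined to
      -- disjoint neighbourhoods
      by_cases hxy : x₀ = y₀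
      · subst hxy
        obtain ⟨O, hO, δ, hδ, hd⟩ := h.exists_dist_le (hu x₀ hx₀)
        refine ⟨O ×ˢ O, prod_mem_nhds hO hO, δ, hδ, ?_⟩
        rintro ⟨x, y⟩ ⟨⟨hx, hy⟩, hxO, hyO⟩ s hs he
        have h1 := (hd x ⟨hx, hxO⟩ y ⟨hy, hyO⟩ s hs).2
        have h2 : X s x = X s y := he
        rw [h2, sub_self, norm_zero, mul_zero] at h1
        exact sub_eq_zero.1 (norm_le_zero_iff.1 h1)
      · obtain ⟨W, W', hW, hW', hWW⟩ := t2_separation_nhds hxy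
        have key : ∀ z₀ ∈ K, ∀ T ∈ 𝓝 z₀, ∃ O ∈ 𝓝 z₀, ∃ δ, 0 < δ ∧
            ∀ x ∈ A ∩ O, ∀ s, |s - t| ≤ δ → X s x ∈ T := fun z₀ hz₀ T hT => by
          obtain ⟨_, -, O, hO, δ, hδ, hX⟩ := h.exists_norm_sub_le (hu z₀ hz₀).continuousAt
            (prod_mem_nhds (univ_mem : univ ∈ 𝓝 t) hT)
          exact ⟨O, hO, δ, hδ, fun x hx s hs => (hX x hx s hs).2.2.2⟩
        obtain ⟨O, hO, δ, hδ, hX⟩ := key x₀ hx₀ W hW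
        obtain ⟨O', hO', δ', hδ', hX'⟩ := key y₀ hy₀ W' hW'
        refine ⟨O ×ˢ O', prod_mem_nhds hO hO', min δ δ', lt_min hδ hδ', ?_⟩
        rintro ⟨x, y⟩ ⟨⟨hx, hy⟩, hxO, hyO⟩ s hs he
        have h1 := hX x ⟨hx, hxO⟩ s (hs.trans (min_le_left _ _))
        have h2 := hX' y ⟨hy, hyO⟩ s (hs.trans (min_le_right _ _))
        have he' : X s x = X s y := he
        rw [he'] at h1
        exact (disjoint_left.1 hWW h1 h2).elim)
  exact ⟨δ, hδ, fun s hs x hx y hy he => hδ' (x, y) ⟨hx, hy⟩ s hs he⟩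

/-- The data for the transport theorem: near every point of the compact set `K`, the set `A ⊆ K` is
parametrized by `E'`, and `θ` is the rate at which the flow expands its surface measure. -/
structure IsTransportable (u : ℝ × E → E) (A K : Set E) (t : ℝ) (θ : E → ℝ) (E' : Type*)
    [NormedAddCommGroup E'] [InnerProductSpace ℝ E'] [FiniteDimensional ℝ E'] : Prop where
  measurableSet : MeasurableSet A
  isCompact : IsCompact K
  subset : A ⊆ K
  contDiffAt : ∀ x ∈ K, ContDiffAt ℝ 1 u (t, x)
  continuousAt : ∀ x ∈ K, ContinuousAt θ x
  exists_isParam : ∀ x ∈ K, ∃ (φ : E' → E) (y₀ : E') (G : Set E'), IsParam A x φ y₀ G ∧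
    θ x = ∑ i, ⟪fderiv ℝ φ y₀ (stdOrthonormalBasis ℝ E' i),
      fderiv ℝ (fun z => u (t, z)) x (fderiv ℝ φ y₀ (stdOrthonormalBasis ℝ E' i))⟫_ℝ

/-- Change of variables under the flow, to first order in time. -/
theorem IsFlowOn.exists_transport {u : ℝ × E → E} {X : ℝ → E → E} {A K : Set E} {t : ℝ}
    {I : Set ℝ} (h : IsFlowOn u X A t I) {θ : E → ℝ} (hT : IsTransportable u A K t θ E') {ε : ℝ}
    (hε : 0 < ε) :
    (μHE[finrank ℝ E'] : Measure E) A < ⊤ ∧ ∃ δ, 0 < δ ∧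
      ∀ s, |s - t| ≤ δ → ContinuousOn (X s) A ∧
      ∀ (g : E → ℝ) (C : ℝ), 0 ≤ C → ContinuousOn g (X s '' A) →
        (∀ z ∈ X s '' A, |g z| ≤ C) →
        IntegrableOn g (X s '' A) μHE[finrank ℝ E'] ∧
        IntegrableOn (fun x => g (X s x) * (1 + (s - t) * θ x)) A μHE[finrank ℝ E'] ∧
        |(∫ z in X s '' A, g z ∂μHE[finrank ℝ E'])
          - ∫ x in A, g (X s x) * (1 + (s - t) * θ x) ∂μHE[finrank ℝ E']|
            ≤ ε * |s - t| * (C * (μHE[finrank ℝ E'] : Measure E).real A) := by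
  obtain ⟨δ₀, hδ₀, hinj⟩ := h.exists_injOn hT.isCompact hT.subset hT.contDiffAt
  -- the estimate is additive in the set, so that it suffices to prove it locally; it is claimed for
  -- all measurable parts `B` to allow for disjoint decompositions
  have hloc := hT.isCompact.induction_on (p := fun W => ∃ O, IsOpen O ∧ W ⊆ O ∧
    (μHE[finrank ℝ E'] : Measure E) (A ∩ O) < ⊤ ∧ ∃ δ, 0 < δ ∧
      ∀ s, |s - t| ≤ δ → ContinuousOn (X s) (A ∩ O) ∧
      ∀ B ⊆ A ∩ O, MeasurableSet B → ∀ (g : E → ℝ) (C : ℝ), 0 ≤ C → ContinuousOn g (X s '' B) →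
        (∀ z ∈ X s '' B, |g z| ≤ C) →
        IntegrableOn g (X s '' B) μHE[finrank ℝ E'] ∧
        IntegrableOn (fun x => g (X s x) * (1 + (s - t) * θ x)) B μHE[finrank ℝ E'] ∧
        |(∫ z in X s '' B, g z ∂μHE[finrank ℝ E'])
          - ∫ x in B, g (X s x) * (1 + (s - t) * θ x) ∂μHE[finrank ℝ E']|
            ≤ ε * |s - t| * (C * (μHE[finrank ℝ E'] : Measure E).real B)) ?_ ?_ ?_ ?_
  · obtain ⟨O, hO, hKO, hfin, δ, hδ, H⟩ := hloc
    have hAO : A ∩ O = A := inter_eq_left.2 (hT.subset.trans hKO)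
    rw [hAO] at hfin H
    exact ⟨hfin, δ, hδ, fun s hs => ⟨(H s hs).1, (H s hs).2 A subset_rfl hT.measurableSet⟩⟩
  · refine ⟨∅, isOpen_empty, subset_rfl, by simp, 1, one_pos, fun s _ => ⟨by simp, ?_⟩⟩
    intro B hB _ g C hC _ _
    rw [inter_empty, subset_empty_iff] at hB
    subst hB
    simp
  · rintro W W' hW ⟨O, hO, hWO, H⟩
    exact ⟨O, hO, hW.trans hWO, H⟩
  -- two estimates combine on the disjoint parts `B ∩ O` and `B \ O`
  · rintro W W' ⟨O, hO, hWO, hf, δ, hδ, H⟩ ⟨O', hO', hWO', hf', δ', hδ', H'⟩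
    refine ⟨O ∪ O', hO.union hO', union_subset_union hWO hWO', ?_, min δ₀ (min δ δ'), by positivity,
      fun s hs => ?_⟩
    · rw [inter_union_distrib_left]
      exact (measure_union_le _ _).trans_lt (ENNReal.add_lt_top.2 ⟨hf, hf'⟩)
    have hs0 := hinj s (hs.trans (min_le_left _ _))
    obtain ⟨hc, H⟩ := H s (hs.trans ((min_le_right _ _).trans (min_le_left _ _)))
    obtain ⟨hc', H'⟩ := H' s (hs.trans ((min_le_right _ _).trans (min_le_right _ _)))
    have hcont : ContinuousOn (X s) (A ∩ (O ∪ O')) := by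
      intro x hx
      rcases hx.2 with hxO | hxO
      · refine (hc x ⟨hx.1, hxO⟩).mono_of_mem_nhdsWithin ?_
        filter_upwards [self_mem_nhdsWithin, mem_nhdsWithin_of_mem_nhds (hO.mem_nhds hxO)]
          with y hy hyO using ⟨hy.1, hyO⟩
      · refine (hc' x ⟨hx.1, hxO⟩).mono_of_mem_nhdsWithin ?_
        filter_upwards [self_mem_nhdsWithin, mem_nhdsWithin_of_mem_nhds (hO'.mem_nhds hxO)]
          with y hy hyO using ⟨hy.1, hyO⟩
    refine ⟨hcont, fun B hB hBm g C hC hg hgC => ?_⟩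
    have hB1 : B ∩ O ⊆ A ∩ O := fun x hx => ⟨(hB hx.1).1, hx.2⟩
    have hB2 : B \ O ⊆ A ∩ O' := fun x hx => ⟨(hB hx.1).1, (hB hx.1).2.resolve_left hx.2⟩
    have hBu : B ∩ O ∪ B \ O = B := inter_union_sdiff B O
    have hBd : Disjoint (B ∩ O) (B \ O) := disjoint_left.2 fun x hx hx' => hx'.2 hx.2
    have m1 : X s '' (B ∩ O) ⊆ X s '' B := image_mono inter_subset_left
    have m2 : X s '' (B \ O) ⊆ X s '' B := image_mono sdiff_subset
    obtain ⟨a1, b1, c1⟩ := H _ hB1 (hBm.inter hO.measurableSet) g C hC (hg.mono m1)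
      fun z hz => hgC z (m1 hz)
    obtain ⟨a2, b2, c2⟩ := H' _ hB2 (hBm.diff hO.measurableSet) g C hC (hg.mono m2)
      fun z hz => hgC z (m2 hz)
    have hBA : B ⊆ A := fun x hx => (hB hx).1
    have hXu : X s '' B = X s '' (B ∩ O) ∪ X s '' (B \ O) := by rw [← image_union, hBu]
    have hXd : Disjoint (X s '' (B ∩ O)) (X s '' (B \ O)) := by
      rw [disjoint_left]
      rintro _ ⟨x, hx, rfl⟩ ⟨y, hy, he⟩
      exact hy.2 (hs0 (hBA hy.1) (hBA hx.1) he ▸ hx.2)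
    have hXm : MeasurableSet (X s '' (B \ O)) := (hBm.diff hO.measurableSet).image_of_continuousOn_injOn
      (hc'.mono hB2) (hs0.mono fun x hx => hBA hx.1)
    have hm2 := hBm.diff hO.measurableSet
    have hfin2 : (μHE[finrank ℝ E'] : Measure E) (B ∩ O) ≠ ⊤ := ((measure_mono hB1).trans_lt hf).ne
    have hfin3 : (μHE[finrank ℝ E'] : Measure E) (B \ O) ≠ ⊤ := ((measure_mono hB2).trans_lt hf').ne
    refine ⟨hXu ▸ a1.union a2, hBu ▸ b1.union b2, ?_⟩
    have e1 := setIntegral_union hXd hXm a1 a2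
    have e2 := setIntegral_union hBd hm2 b1 b2
    have e3 := measureReal_union hBd hm2 hfin2 hfin3
    rw [← hXu] at e1
    rw [hBu] at e2 e3
    rw [e1, e2, e3, add_sub_add_comm]
    refine (abs_add_le _ _).trans ?_
    calc _ ≤ _ := add_le_add c1 c2
      _ = _ := by ring
  · intro x hx
    obtain ⟨φ, y₀, G, hφ, hθ⟩ := hT.exists_isParam x hx
    obtain ⟨O, hO, hxO, hf, δ, hδ, H⟩ := h.exists_transport_near (hT.contDiffAt x hx) hφ
      (stdOrthonormalBasis ℝ E') (hT.continuousAt x hx)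
      (fun y hy => (hT.continuousAt y (hT.subset hy)).continuousWithinAt) hθ hε
    exact ⟨O, mem_nhdsWithin_of_mem_nhds (hO.mem_nhds hxO), O, hO, subset_rfl, hf, δ, hδ,
      fun s hs => (H s hs).2⟩

/-- **Transport theorem.** The derivative of the integral of `f` over a transported set is the
integral of the material derivative of `f` plus `θ f`. -/
theorem IsFlowOn.hasDerivAt_integral_image {u : ℝ × E → E} {X : ℝ → E → E} {A K : Set E} {t : ℝ}
    {I : Set ℝ} (h : IsFlowOn u X A t I) {θ : E → ℝ} (hT : IsTransportable u A K t θ E')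
    {f : ℝ × E → ℝ} (hf : ∀ x ∈ K, ContDiffAt ℝ 1 f (t, x)) :
    (∀ᶠ s in 𝓝 t, IntegrableOn (fun z => f (s, z)) (X s '' A) μHE[finrank ℝ E']) ∧
    IntegrableOn (fun x => fderiv ℝ f (t, x) (1, u (t, x)) + θ x * f (t, x)) A
      μHE[finrank ℝ E'] ∧
    HasDerivAt (fun s => ∫ z in X s '' A, f (s, z) ∂μHE[finrank ℝ E'])
      (∫ x in A, (fderiv ℝ f (t, x) (1, u (t, x)) + θ x * f (t, x)) ∂μHE[finrank ℝ E']) t := by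
  set μ : Measure E := μHE[finrank ℝ E'] with hμ
  -- uniform bounds near `{t} × K`
  have hmk : Continuous fun x : E => (t, x) := by fun_prop
  have hfd : ∀ x ∈ K, ContinuousAt (fun z => fderiv ℝ f z) (t, x) := fun x hx =>
    (hf x hx).continuousAt_fderiv one_ne_zero
  have huc : ∀ x ∈ K, ContinuousAt u (t, x) := fun x hx => (hT.contDiffAt x hx).continuousAt
  have hFc : ∀ x ∈ K, ContinuousAt (fun z => fderiv ℝ f z (1, u z)) (t, x) := fun x hx =>
    (hfd x hx).clm_apply (continuousAt_const.prodMk (huc x hx))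
  obtain ⟨C₁, hC₁⟩ := hT.isCompact.exists_bound_of_continuousOn (f := fun x => f (t, x))
    fun x hx => ((hf x hx).continuousAt.comp hmk.continuousAt).continuousWithinAt
  obtain ⟨C₂, hC₂⟩ := hT.isCompact.exists_bound_of_continuousOn
    (f := fun x => fderiv ℝ f (t, x) (1, u (t, x)))
    fun x hx => (ContinuousAt.comp (f := fun x : E => (t, x)) (hFc x hx)
      hmk.continuousAt).continuousWithinAt
  obtain ⟨C₃, hC₃⟩ := hT.isCompact.exists_bound_of_continuousOn (f := θ)
    fun x hx => (hT.continuousAt x hx).continuousWithinAt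
  obtain ⟨δ₁, hδ₁, hstay⟩ := exists_forall_abs_sub_le_of_isCompact (A := A) (t := t)
    (P := fun s x => s ∈ I ∧ ContDiffAt ℝ 1 f (s, X s x) ∧ |f (s, X s x)| ≤ |C₁| + 1 ∧
      |fderiv ℝ f (s, X s x) (1, u (s, X s x))| ≤ |C₂| + 1) hT.isCompact hT.subset (by
      intro x hx
      have e1 : ∀ᶠ z in 𝓝 (t, x), ContDiffAt ℝ 1 f z := (hf x hx).eventually (by simp)
      have e2 : ∀ᶠ z in 𝓝 (t, x), |f z| < |C₁| + 1 :=
        (hf x hx).continuousAt.abs.eventually (gt_mem_nhds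
          (((hC₁ x hx).trans (le_abs_self _)).trans_lt (lt_add_one _)))
      have e3 : ∀ᶠ z in 𝓝 (t, x), |fderiv ℝ f z (1, u z)| < |C₂| + 1 :=
        (hFc x hx).abs.eventually (gt_mem_nhds
          (((hC₂ x hx).trans (le_abs_self _)).trans_lt (lt_add_one _)))
      obtain ⟨_, -, O, hO, δ, hδ, hX⟩ := h.exists_norm_sub_le (huc x hx) (e1.and (e2.and e3))
      refine ⟨O, hO, δ, hδ, fun y hy s hs => ?_⟩
      obtain ⟨a, -, b, c, d⟩ := hX y hy s hs
      exact ⟨a, b, c.le, d.le⟩)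
  obtain ⟨hfin, δ₂, hδ₂, htr⟩ := h.exists_transport hT one_pos
  set δ := min (min δ₁ δ₂) 1 with hδdef
  have hδ : 0 < δ := by positivity
  have hball : Metric.ball t δ ∈ 𝓝 t := Metric.ball_mem_nhds t hδ
  have hmem : ∀ s ∈ Metric.ball t δ, |s - t| ≤ δ₁ ∧ |s - t| ≤ δ₂ ∧ |s - t| ≤ 1 := fun s hs => by
    rw [Metric.mem_ball, Real.dist_eq] at hs
    exact ⟨hs.le.trans ((min_le_left _ _).trans (min_le_left _ _)),
      hs.le.trans ((min_le_left _ _).trans (min_le_right _ _)), hs.le.trans (min_le_right _ _)⟩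
  have hgc : ∀ s, |s - t| ≤ δ₁ → ContinuousOn (fun z => f (s, z)) (X s '' A) := by
    rintro s hs _ ⟨x, hx, rfl⟩
    have hmk' : Continuous fun x : E => (s, x) := by fun_prop
    exact (ContinuousAt.comp (f := fun x : E => (s, x)) (hstay x hx s hs).2.1.continuousAt
      hmk'.continuousAt).continuousWithinAt
  have hgb : ∀ s, |s - t| ≤ δ₁ → ∀ z ∈ X s '' A, |f (s, z)| ≤ |C₁| + 1 := by
    rintro s hs _ ⟨x, hx, rfl⟩
    exact (hstay x hx s hs).2.2.1
  have hC0 : 0 ≤ |C₁| + 1 := by positivity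
  -- the integral after the first-order change of variables
  set F : ℝ → E → ℝ := fun s x => f (s, X s x) * (1 + (s - t) * θ x) with hF
  set F' : ℝ → E → ℝ := fun s x => fderiv ℝ f (s, X s x) (1, u (s, X s x)) * (1 + (s - t) * θ x)
    + f (s, X s x) * θ x with hF'
  have hF't : ∀ x ∈ A, F' t x = fderiv ℝ f (t, x) (1, u (t, x)) + θ x * f (t, x) := fun x hx => by
    simp only [hF', h.initial x hx, sub_self, zero_mul, add_zero, mul_one]; ring
  have hFI : ∀ s ∈ Metric.ball t δ, IntegrableOn (F s) A μ := fun s hs =>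
    ((htr s (hmem s hs).2.1).2 _ _ hC0 (hgc s (hmem s hs).1) (hgb s (hmem s hs).1)).2.1
  have hAm := hT.measurableSet
  have hθb : ∀ x ∈ A, ∀ s ∈ Metric.ball t δ, |1 + (s - t) * θ x| ≤ 1 + |C₃| := fun x hx s hs => by
    refine (abs_add_le _ _).trans ?_
    rw [abs_one, abs_mul]
    have h1 : |θ x| ≤ |C₃| := (hC₃ x (hT.subset hx)).trans (le_abs_self _)
    nlinarith [(hmem s hs).2.2, abs_nonneg (s - t), abs_nonneg (θ x)]
  have hmain := hasDerivAt_integral_of_dominated_loc_of_deriv_le (μ := μ.restrict A) (F := F)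
    (F' := F') (x₀ := t) (s := Metric.ball t δ)
    (bound := fun _ => (|C₂| + 1) * (1 + |C₃|) + (|C₁| + 1) * |C₃|) hball
    (by filter_upwards [hball] with s hs using (hFI s hs).aestronglyMeasurable)
    (hFI t (Metric.mem_ball_self hδ)) (by
      have hc : ContinuousOn (F' t) A := by
        have : ContinuousOn (fun x => fderiv ℝ f (t, x) (1, u (t, x)) + θ x * f (t, x)) A :=
          fun x hx => ((ContinuousAt.comp (f := fun x : E => (t, x)) (hFc x (hT.subset hx))
            hmk.continuousAt).add ((hT.continuousAt x (hT.subset hx)).mul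
            ((hf x (hT.subset hx)).continuousAt.comp hmk.continuousAt))).continuousWithinAt
        exact this.congr hF't
      exact hc.aestronglyMeasurable hAm)
    (by
      refine (ae_restrict_mem hAm).mono fun x hx s hs => ?_
      obtain ⟨-, -, h1, h2⟩ := hstay x hx s (hmem s hs).1
      have h3 : |θ x| ≤ |C₃| := (hC₃ x (hT.subset hx)).trans (le_abs_self _)
      refine (norm_add_le _ _).trans ?_
      rw [Real.norm_eq_abs, Real.norm_eq_abs, abs_mul, abs_mul]
      have h4 := hθb x hx s hs
      gcongr)
    (integrableOn_const hfin.ne)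
    (by
      refine (ae_restrict_mem hAm).mono fun x hx s hs => ?_
      obtain ⟨hsI, h1, -, -⟩ := hstay x hx s (hmem s hs).1
      have h2 : HasDerivAt (fun r => (r, X r x)) (1, u (s, X s x)) s :=
        (hasDerivAt_id s).prodMk (h.hasDerivAt x hx s hsI)
      have h3 := (h1.differentiableAt one_ne_zero).hasFDerivAt.comp_hasDerivAt s h2
      have h4 : HasDerivAt (fun r => 1 + (r - t) * θ x) (θ x) s := by
        simpa using (((hasDerivAt_id s).sub_const t).mul_const (θ x)).const_add 1
      exact h3.mul h4)
  have hint : IntegrableOn (fun x => fderiv ℝ f (t, x) (1, u (t, x)) + θ x * f (t, x)) A μ :=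
    hmain.1.congr ((ae_restrict_mem hAm).mono hF't)
  refine ⟨?_, hint, ?_⟩
  · filter_upwards [hball] with s hs
    exact ((htr s (hmem s hs).2.1).2 _ _ hC0 (hgc s (hmem s hs).1) (hgb s (hmem s hs).1)).1
  -- the error is `o(s - t)`
  have herr : HasDerivAt (fun s => (∫ z in X s '' A, f (s, z) ∂μ) - ∫ x in A, F s x ∂μ) 0 t := by
    have himg : X t '' A = A := by
      rw [image_congr h.initial, image_id']
    have h0 : (∫ z in X t '' A, f (t, z) ∂μ) - ∫ x in A, F t x ∂μ = 0 := by
      rw [himg, sub_eq_zero]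
      refine setIntegral_congr_fun hAm fun x hx => ?_
      simp [hF, h.initial x hx]
    rw [hasDerivAt_iff_isLittleO, h0]
    simp only [sub_zero, smul_zero]
    rw [Asymptotics.isLittleO_iff]
    intro c hc
    set R := (|C₁| + 1) * μ.real A with hR
    have hR0 : 0 ≤ R := by positivity
    obtain ⟨-, δ₃, hδ₃, htr'⟩ := h.exists_transport hT (ε := c / (R + 1)) (by positivity)
    have hball' : Metric.ball t (min δ₁ δ₃) ∈ 𝓝 t := Metric.ball_mem_nhds t (by positivity)
    filter_upwards [hball'] with s hs
    rw [Metric.mem_ball, Real.dist_eq] at hs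
    have hs1 : |s - t| ≤ δ₁ := hs.le.trans (min_le_left _ _)
    have h1 := ((htr' s (hs.le.trans (min_le_right _ _))).2 _ _ hC0 (hgc s hs1) (hgb s hs1)).2.2
    refine h1.trans ?_
    rw [Real.norm_eq_abs]
    have h2 : c / (R + 1) * R ≤ c := by
      rw [div_mul_eq_mul_div, div_le_iff₀ (by positivity)]; nlinarith
    calc c / (R + 1) * |s - t| * R = c / (R + 1) * R * |s - t| := by ring
      _ ≤ c * |s - t| := by gcongr
  have hsum := herr.add hmain.2
  simp only [zero_add] at hsum
  rw [setIntegral_congr_fun hAm (fun x hx => (hF't x hx).symm)]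
  refine hsum.congr_of_eventuallyEq (Eventually.of_forall fun s => ?_)
  simp

end Transport

end SurfactantFlow

namespace SurfactantFlow

/-! ### Transport of open sets and of parts of hypersurfaces -/

section TransportableSets

open Module Set
open scoped NNReal ENNReal

/-- The rate of expansion of volume is the divergence of the velocity. -/
theorem isTransportable_of_isOpen {d : ℕ} {u : ℝ × Space d → Space d} {A K : Set (Space d)} {t : ℝ}
    (hA : IsOpen A) (hK : IsCompact K) (hAK : A ⊆ K) (hu : ∀ x ∈ K, ContDiffAt ℝ 1 u (t, x)) :
    IsTransportable u A K t
      (fun x => LinearMap.trace ℝ (Space d) (fderiv ℝ (fun z => u (t, z)) x)) (Space d) where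
  measurableSet := hA.measurableSet
  isCompact := hK
  subset := hAK
  contDiffAt := hu
  continuousAt x hx := by
    have h1 : ContDiffAt ℝ 1 (fun z => u (t, z)) x :=
      (hu x hx).comp x (contDiffAt_const.prodMk contDiffAt_id)
    exact continuous_trace.continuousAt.comp (h1.continuousAt_fderiv one_ne_zero)
  exists_isParam x hx := by
    refine ⟨id, x, univ, ⟨isOpen_univ, mem_univ _, rfl, fun y _ => contDiffAt_id, injOn_id _,
      fun v w => by simp, by simpa using hA, fun G' _ hG' => ⟨G', hG', by simp⟩⟩, ?_⟩
    rw [LinearMap.trace_eq_sum_inner _ (stdOrthonormalBasis ℝ (Space d))]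
    simp

variable {k : ℕ}

theorem Splitting.IsChart.gradient_eq_zero {S : Splitting (Space k) (Space (k + 1))}
    {M : Set (Space (k + 1))} {ν : Space (k + 1) → Space (k + 1)} {h : Space k → ℝ} {y₀ : Space k}
    {r : ℝ} {O : Set (Space (k + 1))} (hc : S.IsChart M ν h y₀ r O)
    (hν : ν (S.graphMap h y₀) = S.dir) : ∇ h y₀ = 0 := by
  have h1 := hc.normal_eq y₀ (Metric.mem_ball_self hc.pos)
  rw [hν] at h1
  have h2 := congrArg S.proj h1
  rw [S.proj_dir, map_smul, S.proj_graphNormal, smul_neg, eq_comm, neg_eq_zero, smul_eq_zero] at h2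
  exact h2.resolve_left (inv_ne_zero (norm_ne_zero_iff.2 (S.graphNormal_ne_zero _)))

theorem Splitting.graphDeriv_zero_apply (S : Splitting (Space k) (Space (k + 1))) (v : Space k) :
    S.graphDeriv 0 v = S.incl v := by
  simp [Splitting.graphDeriv_apply]

/-- The tangential trace is the trace of the restriction to the tangent space. -/
theorem Splitting.tangentialTrace_dir_eq (S : Splitting (Space k) (Space (k + 1)))
    (L : Space (k + 1) →L[ℝ] Space (k + 1)) {ι : Type*} [Fintype ι]
    (b : OrthonormalBasis ι ℝ (Space k)) :
    tangentialTrace S.dir L = ∑ i, ⟪S.incl (b i), L (S.incl (b i))⟫_ℝ := by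
  have h0 : S.graphNormal 0 = S.dir := by simp [Splitting.graphNormal]
  have h1 := S.tangentialTrace_eq 0 L
    (N := S.proj ∘L L ∘L S.incl.toContinuousLinearMap)
    (b := innerSL ℝ S.dir ∘L L ∘L S.incl.toContinuousLinearMap) (fun v => by
      rw [map_zero, S.graphDeriv_zero_apply, S.graphDeriv_zero_apply]
      exact S.exists_eq _)
  rw [h0, S.norm_dir, inv_one, one_smul, map_zero, zero_div, add_zero,
    LinearMap.trace_eq_sum_inner _ b] at h1
  rw [h1]
  refine Finset.sum_congr rfl fun i _ => ?_
  rw [real_inner_comm, real_inner_comm (L _)]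
  exact S.inner_proj _ _

/-- The rate of expansion of area is the surface divergence of the velocity. -/
theorem isTransportable_inter_hypersurface {u : ℝ × Space (k + 1) → Space (k + 1)}
    {M V : Set (Space (k + 1))} {ν : Space (k + 1) → Space (k + 1)} {t : ℝ} (hV : IsOpen V)
    (hM : MeasurableSet M) (hK : IsCompact (closure V ∩ M))
    (hMν : ∀ x ∈ closure V ∩ M, ∃ ψ, IsHypersurfaceAt M ν x ψ)
    (hν : ∀ x ∈ closure V ∩ M, ContinuousAt ν x)
    (hu : ∀ x ∈ closure V ∩ M, ContDiffAt ℝ 1 u (t, x)) :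
    IsTransportable u (V ∩ M) (closure V ∩ M) t
      (fun x => tangentialTrace (ν x) (fderiv ℝ (fun z => u (t, z)) x)) (Space k) where
  measurableSet := hV.measurableSet.inter hM
  isCompact := hK
  subset := inter_subset_inter_left _ subset_closure
  contDiffAt := hu
  continuousAt x hx := by
    have h1 : ContDiffAt ℝ 1 (fun z => u (t, z)) x :=
      (hu x hx).comp x (contDiffAt_const.prodMk contDiffAt_id)
    have h2 : ContinuousAt (fun x => fderiv ℝ (fun z => u (t, z)) x) x :=
      h1.continuousAt_fderiv one_ne_zero
    exact (continuous_trace.continuousAt.comp h2).sub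
      ((h2.clm_apply (hν x hx)).inner (hν x hx))
  exists_isParam x hx := by
    obtain ⟨ψ, hψ⟩ := hMν x hx
    -- in the chart in the normal direction at `x`, the gradient of the graph function vanishes over `x`,
    -- so that the derivative of the parametrization is isometric there
    obtain ⟨S, hS, g, hgx, hch⟩ := hψ.exists_isChart
    obtain ⟨r, O, hc, hxO, -, -⟩ := hch univ univ_mem univ univ_mem
    have hg0 : ∇ g (S.proj x) = 0 := hc.gradient_eq_zero (by rw [hgx, hS])
    have hd : fderiv ℝ (S.graphMap g) (S.proj x) = S.incl.toContinuousLinearMap := by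
      rw [(hc.hasFDerivAt (Metric.mem_ball_self hc.pos)).fderiv, hg0, map_zero]
      ext1 v
      exact S.graphDeriv_zero_apply v
    refine ⟨S.graphMap g, S.proj x, Metric.ball (S.proj x) r, ⟨Metric.isOpen_ball,
      Metric.mem_ball_self hc.pos, hgx, fun y hy => (hc.contDiffAt_graphMap hy).of_le one_le_two,
      (S.graphMap_injective g).injOn, fun v w => ?_, ?_, fun G' hG' hG'n => ?_⟩, ?_⟩
    · rw [hd]; exact S.incl.inner_map_map v w
    · have h1 : Metric.ball (S.proj x) r ∩ S.graphMap g ⁻¹' (V ∩ M)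
          = Metric.ball (S.proj x) r ∩ S.graphMap g ⁻¹' V := by
        ext y
        exact ⟨fun hy => ⟨hy.1, hy.2.1⟩, fun hy => ⟨hy.1, hy.2, hc.mem hy.1⟩⟩
      rw [h1]
      refine ContinuousOn.isOpen_inter_preimage (fun y hy => ?_) Metric.isOpen_ball hV
      exact (hc.hasFDerivAt hy).continuousAt.continuousWithinAt
    · refine ⟨O ∩ S.proj ⁻¹' G', inter_mem (hc.isOpen.mem_nhds hxO)
        (S.proj.continuous.continuousAt hG'n), ?_⟩
      rintro z ⟨hz, hzO, hzG⟩
      exact ⟨S.proj z, hzG, (hc.mem_iff z hzO).1 hz.2⟩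
    · rw [← hS, hd]
      exact S.tangentialTrace_dir_eq _ _

/-- The zero set of a `C¹` function is negligible where the derivative does not vanish: at such a
zero the absolute value of the function is Lipschitz but not differentiable. -/
theorem exists_volume_zeroSet_eq_zero {f : Space k → ℝ} {y₀ : Space k} (hf : ContDiffAt ℝ 1 f y₀)
    (hf0 : fderiv ℝ f y₀ ≠ 0) : ∃ T ∈ 𝓝 y₀, volume (T ∩ {y | f y = 0}) = 0 := by
  obtain ⟨K, T, hT, hL⟩ := hf.exists_lipschitzOnWith
  have e1 : ∀ᶠ y in 𝓝 y₀, fderiv ℝ f y ≠ 0 :=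
    (hf.continuousAt_fderiv one_ne_zero).eventually_ne hf0
  have e2 : ∀ᶠ y in 𝓝 y₀, ContDiffAt ℝ 1 f y := hf.eventually (by simp)
  obtain ⟨T', hT'sub, hT'o, hy₀⟩ := mem_nhds_iff.1 (inter_mem hT (e1.and e2))
  refine ⟨T', hT'o.mem_nhds hy₀, ?_⟩
  have hL' : LipschitzOnWith K (fun y => |f y|) T' := LipschitzOnWith.of_dist_le_mul
    fun x hx y hy => (abs_abs_sub_abs_le _ _).trans
      (hL.dist_le_mul x (hT'sub hx).1 y (hT'sub hy).1)
  refine measure_mono_null (fun y hy => ?_)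
    (ae_iff.1 (hL'.ae_differentiableWithinAt_of_mem (μ := volume)))
  obtain ⟨hyT, hy0⟩ := hy
  intro hd
  have hd' := ((hd hyT).differentiableAt (hT'o.mem_nhds hyT)).hasFDerivAt
  have hy0' : f y = 0 := hy0
  have hmin : IsLocalMin (fun y => |f y|) y := Eventually.of_forall fun z => by
    simp only [hy0', abs_zero]; exact abs_nonneg _
  rw [hmin.hasFDerivAt_eq_zero hd', hasFDerivAt_iff_isLittleO] at hd'
  have h1 : HasFDerivAt f (0 : Space k →L[ℝ] ℝ) y := by
    rw [hasFDerivAt_iff_isLittleO]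
    refine Asymptotics.IsLittleO.of_norm_left (hd'.norm_left.congr_left fun z => ?_)
    simp [hy0']
  exact (hT'sub hyT).2.1 h1.fderiv

/-- The part of a hypersurface on which a function vanishes is negligible near a zero at which the
tangential gradient of the function does not vanish. -/
theorem IsHypersurfaceAt.exists_measure_zeroSet_eq_zero {M : Set (Space (k + 1))}
    {ν : Space (k + 1) → Space (k + 1)} {x : Space (k + 1)} {ψ χ : Space (k + 1) → ℝ}
    (h : IsHypersurfaceAt M ν x ψ) (hχ : ContDiffAt ℝ 1 χ x)
    (hχ0 : ∀ a : ℝ, ∇ χ x ≠ a • ν x) :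
    ∃ O ∈ 𝓝 x, (μHE[k] : Measure (Space (k + 1))) (M ∩ O ∩ {y | χ y = 0}) = 0 := by
  obtain ⟨S, hS, g, hgx, hch⟩ := h.exists_isChart
  obtain ⟨r, O, hc, hxO, -, -⟩ := hch univ univ_mem univ univ_mem
  have hy₀ := Metric.mem_ball_self (x := S.proj x) hc.pos
  have hg0 : ∇ g (S.proj x) = 0 := hc.gradient_eq_zero (by rw [hgx, hS])
  have hφ : ContDiffAt ℝ 1 (S.graphMap g) (S.proj x) := (hc.contDiffAt_graphMap hy₀).of_le one_le_two
  have hχ' : ContDiffAt ℝ 1 χ (S.graphMap g (S.proj x)) := by rwa [hgx]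
  have hf : ContDiffAt ℝ 1 (fun y => χ (S.graphMap g y)) (S.proj x) := hχ'.comp _ hφ
  have hfd : HasFDerivAt (fun y => χ (S.graphMap g y)) _ (S.proj x) :=
    (hχ'.differentiableAt one_ne_zero).hasFDerivAt.comp (S.proj x) (hc.hasFDerivAt hy₀)
  have hf0 : fderiv ℝ (fun y => χ (S.graphMap g y)) (S.proj x) ≠ 0 := by
    intro hcon
    rw [hfd.fderiv, hg0, map_zero, hgx] at hcon
    have h1 : ∀ v, ⟪S.proj (∇ χ x), v⟫_ℝ = 0 := fun v => by
      rw [S.inner_proj, inner_gradient, ← S.graphDeriv_zero_apply]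
      exact congrArg (fun L : Space k →L[ℝ] ℝ => L v) hcon
    have h2 : S.proj (∇ χ x) = 0 := inner_self_eq_zero.1 (h1 _)
    refine hχ0 ⟪S.dir, ∇ χ x⟫_ℝ ?_
    have h3 := S.exists_eq (∇ χ x)
    rw [h2, map_zero, zero_add] at h3
    rw [← hS]
    exact h3
  obtain ⟨T, hT, hT0⟩ := exists_volume_zeroSet_eq_zero hf hf0
  obtain ⟨C, T', hT', hL⟩ := hφ.exists_lipschitzOnWith
  refine ⟨O ∩ S.proj ⁻¹' (T ∩ T'), inter_mem (hc.isOpen.mem_nhds hxO)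
    (S.proj.continuous.continuousAt (inter_mem hT hT')), ?_⟩
  have hsub : M ∩ (O ∩ S.proj ⁻¹' (T ∩ T')) ∩ {y | χ y = 0}
      ⊆ S.graphMap g '' (T' ∩ (T ∩ {y | χ (S.graphMap g y) = 0})) := by
    rintro z ⟨⟨hzM, hzO, hzT, hzT'⟩, hz0⟩
    have h1 := (hc.mem_iff z hzO).1 hzM
    exact ⟨S.proj z, ⟨hzT', hzT, by rw [mem_ofPred_eq, h1]; exact hz0⟩, h1⟩
  refine measure_mono_null hsub (le_antisymm ?_ bot_le)
  have h4 := SurfactantFlow.LipschitzOnWith.euclideanHausdorffMeasure_image_le k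
    (hL.mono (inter_subset_left : T' ∩ (T ∩ {y | χ (S.graphMap g y) = 0}) ⊆ T'))
  have h5 : (μHE[k] : Measure (Space k)) (T' ∩ (T ∩ {y | χ (S.graphMap g y) = 0})) = 0 := by
    have h6 := InnerProductSpace.euclideanHausdorffMeasure_eq_volume (V := Space k)
    rw [finrank_euclideanSpace_fin] at h6
    rw [h6]
    exact measure_mono_null inter_subset_right hT0
  rwa [h5, mul_zero] at h4

end TransportableSets

end SurfactantFlow

namespace SurfactantFlow

/-! ### Particles do not change phase -/

section LevelSets

open Module Set
open scoped NNReal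

/-- A `C¹` function that vanishes on the regular level set `ψ = 0` is bounded by a multiple of
`ψ`. -/
theorem exists_abs_le_mul_abs {E : Type*} [NormedAddCommGroup E] [NormedSpace ℝ E] {ψ q : E → ℝ}
    {z₀ : E} (hψ : ContDiffAt ℝ 1 ψ z₀) (hq : ContDiffAt ℝ 1 q z₀) (h0 : ψ z₀ = 0)
    (hd : fderiv ℝ ψ z₀ ≠ 0) (hqψ : ∀ᶠ y in 𝓝 z₀, ψ y = 0 → q y = 0) :
    ∃ C, 0 ≤ C ∧ ∀ᶠ y in 𝓝 z₀, |q y| ≤ C * |ψ y| := by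
  obtain ⟨e, he⟩ : ∃ e, fderiv ℝ ψ z₀ e = 1 := by
    obtain ⟨v, hv⟩ : ∃ v, fderiv ℝ ψ z₀ v ≠ 0 := by
      by_contra! hcon
      exact hd (ContinuousLinearMap.ext hcon)
    exact ⟨(fderiv ℝ ψ z₀ v)⁻¹ • v, by rw [map_smul, smul_eq_mul, inv_mul_cancel₀ hv]⟩
  have he0 : 0 < ‖e‖ := norm_pos_iff.2 fun h => by simp [h] at he
  obtain ⟨T, hT, hTa⟩ := (hψ.hasStrictFDerivAt one_ne_zero).approximates_deriv_on_nhds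
    (c := (1 / (4 * ‖e‖)).toNNReal) (Or.inr (Real.toNNReal_pos.2 (by positivity)))
  obtain ⟨K, T', hT', hL⟩ := hq.exists_lipschitzOnWith
  have e1 : ∀ᶠ y in 𝓝 z₀, ContinuousAt ψ y :=
    (hψ.eventually (by simp)).mono fun y hy => hy.continuousAt
  obtain ⟨ρ, hρ, hball⟩ := Metric.mem_nhds_iff.1 (inter_mem (inter_mem hT hT') (hqψ.and e1))
  have e2 : ∀ᶠ y in 𝓝 z₀, |ψ y| < ρ / (4 * ‖e‖) :=
    hψ.continuousAt.abs.eventually (gt_mem_nhds (by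
      change |ψ z₀| < _
      rw [h0, abs_zero]; positivity))
  refine ⟨K * (2 * ‖e‖), by positivity, ?_⟩
  filter_upwards [e2, Metric.ball_mem_nhds z₀ (half_pos hρ)] with y hy hyb
  -- the segment through `y` in the direction `e`
  have hmem : ∀ τ : ℝ, |τ| ≤ 2 * |ψ y| → y + τ • e ∈ Metric.ball z₀ ρ := fun τ hτ => by
    rw [Metric.mem_ball, dist_eq_norm] at hyb ⊢
    have h1 : ‖y + τ • e - z₀‖ ≤ ‖y - z₀‖ + |τ| * ‖e‖ := by
      rw [add_sub_right_comm]
      refine (norm_add_le _ _).trans ?_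
      rw [norm_smul, Real.norm_eq_abs]
    have h2 : |τ| * ‖e‖ ≤ ρ / 2 := by
      calc |τ| * ‖e‖ ≤ 2 * (ρ / (4 * ‖e‖)) * ‖e‖ := by
            gcongr; exact hτ.trans (by linarith)
        _ = _ := by field_simp; norm_num
    linarith
  have happ : ∀ τ : ℝ, |τ| ≤ 2 * |ψ y| → |ψ (y + τ • e) - ψ y - τ| ≤ |τ| / 4 := fun τ hτ => by
    have h1 := hTa (y + τ • e) (hball (hmem τ hτ)).1.1 y
      (hball (by simpa using hmem 0 (by simp))).1.1
    rw [add_sub_cancel_left, map_smul, he, smul_eq_mul, mul_one, norm_smul, Real.norm_eq_abs,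
      Real.norm_eq_abs, Real.coe_toNNReal _ (by positivity)] at h1
    refine h1.trans (le_of_eq ?_)
    field_simp
  have hcont : ContinuousOn (fun τ : ℝ => ψ (y + τ • e)) (Icc (-(2 * |ψ y|)) (2 * |ψ y|)) :=
    fun τ hτ => by
    have h1 : ContinuousAt ψ (y + τ • e) := (hball (hmem τ (abs_le.2 hτ))).2.2
    exact (ContinuousAt.comp (f := fun τ : ℝ => y + τ • e) h1
      (by fun_prop)).continuousWithinAt
  have hle : -(2 * |ψ y|) ≤ 2 * |ψ y| := by linarith [abs_nonneg (ψ y)]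
  have hp := happ (2 * |ψ y|) (by rw [abs_of_nonneg (by positivity)])
  have hm := happ (-(2 * |ψ y|)) (by rw [abs_neg, abs_of_nonneg (by positivity)])
  rw [abs_neg] at hm
  rw [abs_of_nonneg (by positivity : 0 ≤ 2 * |ψ y|)] at hp hm
  -- `ψ` changes sign on the segment, hence vanishes at distance at most `2 |ψ y| ‖e‖` from `y`
  obtain ⟨τ, hτ, hτ0⟩ := intermediate_value_Icc hle hcont
    (show (0 : ℝ) ∈ Icc _ _ from ⟨by
      linarith [(abs_le.1 hm).2, le_abs_self (ψ y), abs_nonneg (ψ y)], by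
      linarith [(abs_le.1 hp).1, neg_abs_le (ψ y), abs_nonneg (ψ y)]⟩)
  have hτ' := abs_le.2 hτ
  have hb := hball (hmem τ hτ')
  have h2 := hL.dist_le_mul y (hball (by simpa using hmem 0 (by simp))).1.2 _ hb.1.2
  rw [hb.2.1 hτ0, Real.dist_eq, sub_zero, dist_eq_norm, sub_add_cancel_left, norm_neg, norm_smul,
    Real.norm_eq_abs] at h2
  calc |q y| ≤ K * (|τ| * ‖e‖) := h2
    _ ≤ K * (2 * |ψ y| * ‖e‖) := by gcongr
    _ = _ := by ring

end LevelSets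

section FieldDerivatives

variable {d : ℕ} {F : Type*} [NormedAddCommGroup F] [NormedSpace ℝ F] {f : SpaceTime d → F}
  {z : SpaceTime d}

theorem spaceDeriv_eq (hf : DifferentiableAt ℝ f z) :
    spaceDeriv f z = fderiv ℝ f z ∘L .inr ℝ ℝ (Space d) :=
  (hasFDerivAt_comp_mk (t := z.1) (x := z.2) hf).fderiv

theorem timeDeriv_eq (hf : DifferentiableAt ℝ f z) : timeDeriv f z = fderiv ℝ f z (1, 0) := by
  have h1 : HasDerivAt (fun s : ℝ => (s, z.2)) (1, 0) z.1 :=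
    (hasDerivAt_id z.1).prodMk (hasDerivAt_const _ _)
  exact ((hf.hasFDerivAt (x := z)).comp_hasDerivAt z.1 h1).deriv

theorem materialDeriv_eq (v : SpaceTime d → Space d) (hf : DifferentiableAt ℝ f z) :
    materialDeriv v f z = fderiv ℝ f z (1, v z) := by
  rw [materialDeriv, timeDeriv_eq hf, spaceDeriv_eq hf]
  have : ((1 : ℝ), v z) = (1, 0) + (0, v z) := by simp
  rw [this, map_add]
  rfl

theorem grad_inner (f : SpaceTime d → ℝ) (z : SpaceTime d) (w : Space d) :
    ⟪grad f z, w⟫_ℝ = spaceDeriv f z w :=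
  inner_gradient _ _ _

end FieldDerivatives

namespace TwoPhaseSystem

open Set

variable {d : ℕ} {S : TwoPhaseSystem d}

/-- The path of a fluid particle: a solution of `x' = v(s, x)` that stays in the domain at all
times. -/
def IsTrajectory (S : TwoPhaseSystem d) (x : ℝ → Space d) : Prop :=
  ∀ s ∈ S.times, x s ∈ S.domain ∧ HasDerivAt x (S.fluidVelocity (s, x s)) s

/-- The interface is transported by either fluid: a defining function has zero material derivative
on it. -/
theorem IsSharpInterfaceModel.fderiv_eq_zero (hS : S.IsSharpInterfaceModel) {z₀ : SpaceTime d}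
    {ψ : SpaceTime d → ℝ} (hψ : ContDiffAt ℝ 2 ψ z₀) (hg : grad ψ z₀ ≠ 0)
    (hmem : ∀ᶠ y in 𝓝 z₀, (y ∈ S.phase 0 ↔ ψ y < 0) ∧ (y ∈ S.interface ↔ ψ y = 0) ∧
      (y ∈ S.phase 1 ↔ 0 < ψ y) ∧
      (y ∈ S.interface → S.normal y = ‖grad ψ y‖⁻¹ • grad ψ y ∧
        S.normalVelocity y = -(timeDeriv ψ y / ‖grad ψ y‖))) (i : Fin 2) :
    ∀ᶠ y in 𝓝 z₀, ψ y = 0 → fderiv ℝ ψ y (1, S.velocity i y) = 0 := by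
  have e1 : ∀ᶠ y in 𝓝 z₀, DifferentiableAt ℝ ψ y :=
    (hψ.eventually (by simp)).mono fun y hy => hy.differentiableAt two_ne_zero
  have hc : ContinuousAt (fun y => fderiv ℝ ψ y ∘L ContinuousLinearMap.inr ℝ ℝ (Space d)) z₀ :=
    (hψ.continuousAt_fderiv two_ne_zero).clm_comp continuousAt_const
  have hne : fderiv ℝ ψ z₀ ∘L ContinuousLinearMap.inr ℝ ℝ (Space d) ≠ 0 := by
    rw [← spaceDeriv_eq (hψ.differentiableAt two_ne_zero)]
    intro h0
    exact hg (ext_inner_right ℝ fun w => by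
      rw [grad_inner, h0, inner_zero_left]; rfl)
  filter_upwards [e1, hc.eventually_ne hne, hmem] with y hy1 hy2 hy3 hy0
  obtain ⟨-, hyΓ, -, hyn⟩ := hy3
  have hyI := hyΓ.2 hy0
  obtain ⟨hn, hv⟩ := hyn hyI
  rw [← spaceDeriv_eq hy1] at hy2
  have hg0 : ‖grad ψ y‖ ≠ 0 := fun h0 => hy2 (ContinuousLinearMap.ext fun w => by
    rw [← grad_inner, norm_eq_zero.1 h0, inner_zero_left]; rfl)
  have h1 := hS.balance.transported y hyI
  rw [hn, hv, inner_smul_right, real_inner_comm, grad_inner] at h1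
  -- there is no slip at the interface
  have h2 : S.velocity i y = S.velocity 0 y := by
    fin_cases i
    · rfl
    · exact (hS.balance.no_slip y hyI).symm
  rw [h2, ← materialDeriv_eq (S.velocity 0) hy1, materialDeriv]
  field_simp at h1
  linarith

theorem fluidVelocity_eq_or (z : SpaceTime d) : ∃ i, S.fluidVelocity z = S.velocity i z := by
  unfold fluidVelocity
  split_ifs
  exacts [⟨0, rfl⟩, ⟨1, rfl⟩]

/-- A particle on the interface stays there for a while: along its path a defining function of the
interface satisfies `|g'| ≤ C |g|`. -/
theorem IsTrajectory.eventually_mem_interface (hS : S.IsSharpInterfaceModel) {x : ℝ → Space d}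
    (hx : S.IsTrajectory x) {s : ℝ} (hs : s ∈ S.times) (hsI : (s, x s) ∈ S.interface) :
    ∀ᶠ r in 𝓝 s, (r, x r) ∈ S.interface := by
  obtain ⟨ψ, hψ, hg, hmem⟩ := hS.geometry.hypersurface _ hsI
  have hψ0 : ψ (s, x s) = 0 := hmem.self_of_nhds.2.1.1 hsI
  have hd : fderiv ℝ ψ (s, x s) ≠ 0 := by
    intro h0
    refine hg (ext_inner_right ℝ fun w => ?_)
    rw [grad_inner, spaceDeriv_eq (hψ.differentiableAt two_ne_zero), h0, inner_zero_left]
    rfl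
  have hfd : ContDiffAt ℝ 1 (fderiv ℝ ψ) (s, x s) := hψ.fderiv_right (by norm_num)
  have hq : ∀ i, ∃ C, 0 ≤ C ∧
      ∀ᶠ y in 𝓝 (s, x s), |fderiv ℝ ψ y (1, S.velocity i y)| ≤ C * |ψ y| := fun i =>
    exists_abs_le_mul_abs (hψ.of_le one_le_two)
      (hfd.clm_apply (contDiffAt_const.prodMk (hS.smooth.velocity i _ (Or.inr hsI)))) hψ0 hd
      (hS.fderiv_eq_zero hψ hg hmem i)
  choose C hC0 hC using hq
  set K := C 0 + C 1 with hK
  have hK0 : 0 ≤ K := add_nonneg (hC0 0) (hC0 1)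
  have hCK : ∀ i, C i ≤ K := fun i => by
    fin_cases i
    · exact le_add_of_nonneg_right (hC0 1)
    · exact le_add_of_nonneg_left (hC0 0)
  have hxc : ContinuousAt (fun r => (r, x r)) s :=
    continuousAt_id.prodMk (hx s hs).2.continuousAt
  have e1 : ∀ᶠ y in 𝓝 (s, x s), DifferentiableAt ℝ ψ y :=
    (hψ.eventually (by simp)).mono fun y hy => hy.differentiableAt two_ne_zero
  have e2 := hxc.eventually ((eventually_all.2 hC).and (e1.and hmem))
  obtain ⟨δ₀, hδ₀, hball⟩ := Metric.eventually_nhds_iff.1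
    (e2.and (hS.geometry.isOpen_times.mem_nhds hs))
  set δ := min (δ₀ / 2) (1 / (2 * (K + 1))) with hδdef
  have hδ : 0 < δ := by positivity
  have hball' : ∀ r, |r - s| ≤ δ → _ := fun r hr => hball (y := r) (by
    rw [Real.dist_eq]
    exact (hr.trans (min_le_left _ _)).trans_lt (half_lt_self hδ₀))
  have hKδ : K * δ ≤ 1 / 2 := by
    calc K * δ ≤ (K + 1) * (1 / (2 * (K + 1))) := by
          gcongr
          · linarith
          · exact min_le_right _ _
      _ = _ := by field_simp
  have h := norm_le_two_mul_of_norm_deriv_le (g := fun r => ψ (r, x r))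
    (g' := fun r => fderiv ℝ ψ (r, x r) (1, S.fluidVelocity (r, x r))) (t := s) hK0 hKδ
    (fun r hr => by
      obtain ⟨⟨-, h1, -⟩, h2⟩ := hball' r hr
      exact (h1.hasFDerivAt (x := (r, x r))).comp_hasDerivAt r
        ((hasDerivAt_id r).prodMk (hx r h2).2))
    (fun r hr => by
      obtain ⟨⟨h1, -⟩, h2⟩ := hball' r hr
      obtain ⟨i, hi⟩ := S.fluidVelocity_eq_or (r, x r)
      rw [hi]
      exact (h1 i).trans (mul_le_mul_of_nonneg_right (hCK i) (abs_nonneg _)))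
  filter_upwards [Metric.ball_mem_nhds s hδ] with r hr
  rw [Metric.mem_ball, Real.dist_eq] at hr
  have h1 := h r hr.le
  simp only [hψ0, norm_zero, mul_zero, norm_le_zero_iff] at h1
  exact (hball' r hr.le).1.2.2.2.1.2 h1

theorem IsTrajectory.eventually_mem_phase (hS : S.IsSharpInterfaceModel) {x : ℝ → Space d}
    (hx : S.IsTrajectory x) {s : ℝ} (hs : s ∈ S.times) {i : Fin 2} (hsI : (s, x s) ∈ S.phase i) :
    ∀ᶠ r in 𝓝 s, (r, x r) ∈ S.phase i :=
  (continuousAt_id.prodMk (hx s hs).2.continuousAt).eventually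
    ((hS.geometry.isOpen_phase i).mem_nhds hsI)

/-- One of two complementary conditions, each of which persists for a while in time, persists on a
connected set of times. -/
theorem forall_of_eventually {P Q : ℝ → Prop} {I : Set ℝ} (hI : IsPreconnected I)
    (hP : ∀ s ∈ I, P s → ∀ᶠ r in 𝓝 s, P r) (hQ : ∀ s ∈ I, Q s → ∀ᶠ r in 𝓝 s, Q r)
    (hor : ∀ s ∈ I, P s ∨ Q s) (hPQ : ∀ s, P s → ¬Q s) {s : ℝ} (hs : s ∈ I) (hPs : P s) :
    ∀ r ∈ I, P r := by
  have h := hI.subset_left_of_subset_union (u := interior {s | P s}) (v := interior {s | Q s})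
    isOpen_interior isOpen_interior
    (disjoint_left.2 fun r h1 h2 => hPQ r (interior_subset (s := {s | P s}) h1)
      (interior_subset (s := {s | Q s}) h2))
    (fun r hr => (hor r hr).imp (fun h => mem_interior_iff_mem_nhds.2 (hP r hr h))
      fun h => mem_interior_iff_mem_nhds.2 (hQ r hr h))
    ⟨s, hs, mem_interior_iff_mem_nhds.2 (hP s hs hPs)⟩
  exact fun r hr => interior_subset (s := {s | P s}) (h hr)

theorem IsEvolvingInterface.mem_or (hS : S.IsEvolvingInterface) {z : SpaceTime d}
    (hz : z.1 ∈ S.times) (hz' : z.2 ∈ S.domain) :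
    z ∈ S.phase 0 ∨ z ∈ S.phase 1 ∨ z ∈ S.interface := by
  have h : z ∈ S.phase 0 ∪ S.phase 1 ∪ S.interface := by rw [hS.cover]; exact ⟨hz, hz'⟩
  rcases h with (h | h) | h
  exacts [Or.inl h, Or.inr (Or.inl h), Or.inr (Or.inr h)]

/-- A fluid particle never leaves its phase. -/
theorem IsTrajectory.mem_phase (hS : S.IsSharpInterfaceModel) {x : ℝ → Space d}
    (hx : S.IsTrajectory x) {i : Fin 2} {s r : ℝ} (hs : s ∈ S.times) (hr : r ∈ S.times)
    (h : (s, x s) ∈ S.phase i) : (r, x r) ∈ S.phase i := by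
  have hc := hS.geometry.ordConnected_times.isPreconnected
  have hd := disjoint_left.1 hS.geometry.disjoint_phases
  have hdI := fun i => disjoint_left.1 (hS.geometry.disjoint_interface i)
  fin_cases i
  · refine forall_of_eventually (P := fun s => (s, x s) ∈ S.phase 0)
      (Q := fun s => (s, x s) ∈ S.phase 1 ∨ (s, x s) ∈ S.interface) hc
      (fun s hs h => hx.eventually_mem_phase hS hs h) (fun s hs h => ?_)
      (fun s hs => hS.geometry.mem_or hs (hx s hs).1)
      (fun s h h' => h'.elim (hd h) (hdI 0 h)) hs h r hr
    rcases h with h | h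
    · exact (hx.eventually_mem_phase hS hs h).mono fun _ => Or.inl
    · exact (hx.eventually_mem_interface hS hs h).mono fun _ => Or.inr
  · refine forall_of_eventually (P := fun s => (s, x s) ∈ S.phase 1)
      (Q := fun s => (s, x s) ∈ S.phase 0 ∨ (s, x s) ∈ S.interface) hc
      (fun s hs h => hx.eventually_mem_phase hS hs h) (fun s hs h => ?_)
      (fun s hs => ?_)
      (fun s h h' => h'.elim (fun h' => hd h' h) (hdI 1 h)) hs h r hr
    · rcases h with h | h
      · exact (hx.eventually_mem_phase hS hs h).mono fun _ => Or.inl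
      · exact (hx.eventually_mem_interface hS hs h).mono fun _ => Or.inr
    · rcases hS.geometry.mem_or (z := (s, x s)) hs (hx s hs).1 with h | h | h
      exacts [Or.inr (Or.inl h), Or.inl h, Or.inr (Or.inr h)]

/-- A fluid particle on the interface stays there at all times. -/
theorem IsTrajectory.mem_interface (hS : S.IsSharpInterfaceModel) {x : ℝ → Space d}
    (hx : S.IsTrajectory x) {s r : ℝ} (hs : s ∈ S.times) (hr : r ∈ S.times)
    (h : (s, x s) ∈ S.interface) : (r, x r) ∈ S.interface := by
  have hdI := fun i => disjoint_left.1 (hS.geometry.disjoint_interface i)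
  rcases hS.geometry.mem_or (z := (r, x r)) hr (hx r hr).1 with h' | h' | h'
  · exact (hdI 0 (hx.mem_phase hS hr hs h') h).elim
  · exact (hdI 1 (hx.mem_phase hS hr hs h') h).elim
  · exact h'

/-- A material volume is transported phase by phase. -/
theorem IsMaterialVolume.exists_flow (hS : S.IsSharpInterfaceModel) {V : ℝ → Set (Space d)}
    (hV : S.IsMaterialVolume V) {t : ℝ} (ht : t ∈ S.times) :
    ∃ X : ℝ → Space d → Space d,
      (∀ i, IsFlowOn (S.velocity i) X (V t ∩ slice (S.phase i) t) t S.times) ∧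
      IsFlowOn (S.velocity 0) X (V t ∩ slice S.interface t) t S.times ∧
      ∀ s ∈ S.times,
        (∀ i, V s ∩ slice (S.phase i) s = X s '' (V t ∩ slice (S.phase i) t)) ∧
        V s ∩ slice S.interface s = X s '' (V t ∩ slice S.interface t) := by
  obtain ⟨X, hX, hXV⟩ := hV t ht
  have htn := hS.geometry.isOpen_times.mem_nhds ht
  have htraj : ∀ x ∈ V t, S.IsTrajectory fun s => X s x := fun x hx s hs => (hX x hx).2 s hs
  have h0 : ∀ x ∈ V t, X t x = x := fun x hx => (hX x hx).1
  refine ⟨X, fun i => ⟨htn, fun x hx => h0 x hx.1, fun x hx s hs => ?_⟩,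
    ⟨htn, fun x hx => h0 x hx.1, fun x hx s hs => ?_⟩, fun s hs => ⟨fun i => ?_, ?_⟩⟩
  · have h1 := (htraj x hx.1 s hs).2
    have h2 : (s, X s x) ∈ S.phase i := (htraj x hx.1).mem_phase hS ht hs (by
      simp only [h0 x hx.1]; exact hx.2)
    have h3 : S.fluidVelocity (s, X s x) = S.velocity i (s, X s x) := by
      unfold fluidVelocity
      fin_cases i
      · exact if_pos h2
      · exact if_neg fun h => disjoint_left.1 hS.geometry.disjoint_phases h h2
    rwa [h3] at h1
  · have h1 := (htraj x hx.1 s hs).2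
    have h2 : (s, X s x) ∈ S.interface := (htraj x hx.1).mem_interface hS ht hs (by
      simp only [h0 x hx.1]; exact hx.2)
    -- both one-sided velocities agree on the interface
    have h3 : S.fluidVelocity (s, X s x) = S.velocity 0 (s, X s x) := by
      unfold fluidVelocity
      rw [if_neg fun h => disjoint_left.1 (hS.geometry.disjoint_interface 0) h h2]
      exact (hS.balance.no_slip _ h2).symm
    rwa [h3] at h1
  · rw [hXV s hs]
    ext y
    constructor
    · rintro ⟨⟨x, hx, rfl⟩, hy⟩
      refine ⟨x, ⟨hx, ?_⟩, rfl⟩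
      have := (htraj x hx).mem_phase hS hs ht hy
      simp only [h0 x hx] at this
      exact this
    · rintro ⟨x, ⟨hx, hxi⟩, rfl⟩
      refine ⟨⟨x, hx, rfl⟩, (htraj x hx).mem_phase hS ht hs ?_⟩
      simp only [h0 x hx]; exact hxi
  · rw [hXV s hs]
    ext y
    constructor
    · rintro ⟨⟨x, hx, rfl⟩, hy⟩
      refine ⟨x, ⟨hx, ?_⟩, rfl⟩
      have := (htraj x hx).mem_interface hS hs ht hy
      simp only [h0 x hx] at this
      exact this
    · rintro ⟨x, ⟨hx, hxi⟩, rfl⟩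
      refine ⟨⟨x, hx, rfl⟩, (htraj x hx).mem_interface hS ht hs ?_⟩
      simp only [h0 x hx]; exact hxi

end TwoPhaseSystem

end SurfactantFlow

namespace SurfactantFlow

/-! ### The shape of a test volume at the interface -/

section LinearAlgebra

theorem linearIndependent_fderiv_iff {d n : ℕ} {ψ : Fin n → Space d → ℝ} {x : Space d} :
    LinearIndependent ℝ (fun j => fderiv ℝ (ψ j) x) ↔ LinearIndependent ℝ fun j => ∇ (ψ j) x := by
  rw [Fintype.linearIndependent_iff, Fintype.linearIndependent_iff]
  refine forall_congr' fun c => ?_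
  have h : ∑ j, c j • fderiv ℝ (ψ j) x = 0 ↔ ∑ j, c j • ∇ (ψ j) x = 0 := by
    rw [ContinuousLinearMap.ext_iff]
    constructor
    · intro h
      refine ext_inner_right ℝ fun v => ?_
      rw [sum_inner, inner_zero_left]
      simpa [inner_smul_left, inner_gradient, sum_apply] using h v
    · intro h v
      have h2 := congrArg (fun w => ⟪w, v⟫_ℝ) h
      simp only [sum_inner, inner_zero_left] at h2
      simpa [inner_smul_left, inner_gradient, sum_apply] using h2
  rw [h]

theorem gradient_smul_eq {d : ℕ} (c : ℝ) (ψ : Space d → ℝ) (x : Space d) :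
    ∇ (fun y => c * ψ y) x = c • ∇ ψ x := by
  refine ext_inner_right ℝ fun v => ?_
  rw [inner_gradient, inner_smul_left, inner_gradient]
  have : fderiv ℝ (fun y => c * ψ y) x = c • fderiv ℝ ψ x :=
    congrFun (fderiv_const_smul_field (𝕜 := ℝ) (f := ψ) c) x
  rw [this]
  rfl

theorem linearIndependent_cons_smul {d n : ℕ} {v : Space d} {w : Fin n → Space d} {c : ℝ}
    (hc : c ≠ 0) (h : LinearIndependent ℝ (Fin.cons v w : Fin (n + 1) → Space d)) :
    LinearIndependent ℝ (Fin.cons (c • v) w : Fin (n + 1) → Space d) := by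
  rw [Fintype.linearIndependent_iff] at h ⊢
  intro g hg
  have h1 := h (Fin.cons (g 0 * c) fun j => g j.succ) (by
    rw [Fin.sum_univ_succ] at hg ⊢
    simpa [mul_smul] using hg)
  intro i
  refine Fin.cases ?_ (fun j => ?_) i
  · have := h1 0
    simp only [Fin.cons_zero] at this
    exact (mul_eq_zero.1 this).resolve_right hc
  · simpa using h1 j.succ

end LinearAlgebra

namespace TwoPhaseSystem

open Set

variable {d : ℕ} {S : TwoPhaseSystem d} {t : ℝ}

/-- The sign `(-1) ^ i` of phase `i`: the exterior normal of the phase at the interface is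
`(-1) ^ i` times the normal of the interface. -/
def sign (i : Fin 2) : ℝ := (-1) ^ (i : ℕ)

theorem sign_zero : sign 0 = 1 := by simp [sign]

theorem sign_one : sign 1 = -1 := by simp [sign]

theorem sign_mul_sign (i : Fin 2) : sign i * sign i = 1 := by
  fin_cases i <;> simp [sign]

theorem sign_ne_zero (i : Fin 2) : sign i ≠ 0 := fun h => by
  have := sign_mul_sign i
  simp [h] at this

/-- The interface at a fixed time is a `C²` hypersurface, and the phases lie on its two sides. -/
theorem IsEvolvingInterface.exists_isHypersurfaceAt (hS : S.IsEvolvingInterface) {x : Space d}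
    (hx : x ∈ slice S.interface t) : ∃ ψ : Space d → ℝ,
      IsHypersurfaceAt (slice S.interface t) (fun y => S.normal (t, y)) x ψ ∧
      ∀ i, ∀ᶠ y in 𝓝 x, (y ∈ slice (S.phase i) t ↔ sign i * ψ y < 0) := by
  obtain ⟨ψ, hψ, hg, hmem⟩ := hS.hypersurface _ hx
  have hmk : ContinuousAt (fun y : Space d => (t, y)) x := by fun_prop
  have hev := hmk.eventually hmem
  refine ⟨fun y => ψ (t, y), ⟨ContDiffAt.comp x hψ (contDiffAt_const.prodMk contDiffAt_id), hg, hx,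
    hev.mono fun y hy => ⟨hy.2.1, fun h => (hy.2.2.2 h).1⟩⟩, fun i => hev.mono fun y hy => ?_⟩
  fin_cases i
  · simpa [sign, slice] using hy.1
  · simpa [sign, slice] using hy.2.2.1

theorem IsEvolvingInterface.isOpen_slice (hS : S.IsEvolvingInterface) (i : Fin 2) :
    IsOpen (slice (S.phase i) t) :=
  (hS.isOpen_phase i).preimage (by fun_prop : Continuous fun x : Space d => (t, x))

theorem IsEvolvingInterface.disjoint_slice (hS : S.IsEvolvingInterface) {i j : Fin 2}
    (hij : i ≠ j) {x : Space d} (hi : x ∈ slice (S.phase i) t) : x ∉ slice (S.phase j) t := by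
  intro hj
  have h := disjoint_left.1 hS.disjoint_phases
  fin_cases i <;> fin_cases j
  · exact hij rfl
  · exact h hi hj
  · exact h hj hi
  · exact hij rfl

theorem IsEvolvingInterface.notMem_interface (hS : S.IsEvolvingInterface) {i : Fin 2}
    {x : Space d} (hi : x ∈ slice (S.phase i) t) : x ∉ slice S.interface t :=
  fun h => disjoint_left.1 (hS.disjoint_interface i) hi h

/-- A point of the domain is in the closed phase `i` unless it is in the other phase. -/
theorem IsEvolvingInterface.mem_closedPhase_iff (hS : S.IsEvolvingInterface) (ht : t ∈ S.times)
    {i : Fin 2} {x : Space d} (hx : x ∈ S.domain) :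
    x ∈ slice (S.closedPhase i) t ↔ x ∉ slice (S.phase (1 - i)) t := by
  have hne : i ≠ 1 - i := by fin_cases i <;> decide
  constructor
  · rintro (h | h) h'
    · exact hS.disjoint_slice hne h h'
    · exact hS.notMem_interface h' h
  · intro h
    rcases hS.mem_or (z := (t, x)) ht hx with h' | h' | h'
    · fin_cases i
      · exact Or.inl h'
      · exact (h h').elim
    · fin_cases i
      · exact (h h').elim
      · exact Or.inl h'
    · exact Or.inr h'

theorem IsEvolvingInterface.mem_interface_iff (hS : S.IsEvolvingInterface) (ht : t ∈ S.times)
    {x : Space d} (hx : x ∈ S.domain) :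
    x ∈ slice S.interface t ↔ ∀ i, x ∉ slice (S.phase i) t := by
  refine ⟨fun h i hi => hS.notMem_interface hi h, fun h => ?_⟩
  rcases hS.mem_or (z := (t, x)) ht hx with h' | h' | h'
  exacts [(h 0 h').elim, (h 1 h').elim, h']

section Regular

variable {V : Set (Space d)}

theorem IsRegularTestVolume.isCompact_closure (hV : S.IsRegularTestVolume t V) :
    IsCompact (closure V) :=
  hV.isBounded.isCompact_closure

theorem IsRegularTestVolume.isCompact_closedPhase (hV : S.IsRegularTestVolume t V)
    (hS : S.IsEvolvingInterface) (ht : t ∈ S.times) (i : Fin 2) :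
    IsCompact (closure V ∩ slice (S.closedPhase i) t) := by
  have h : closure V ∩ slice (S.closedPhase i) t = closure V \ slice (S.phase (1 - i)) t := by
    ext x
    exact ⟨fun h => ⟨h.1, (hS.mem_closedPhase_iff ht (hV.closure_subset h.1)).1 h.2⟩,
      fun h => ⟨h.1, (hS.mem_closedPhase_iff ht (hV.closure_subset h.1)).2 h.2⟩⟩
  rw [h]
  exact hV.isCompact_closure.diff (hS.isOpen_slice _)

theorem IsRegularTestVolume.isCompact_interface (hV : S.IsRegularTestVolume t V)
    (hS : S.IsEvolvingInterface) (ht : t ∈ S.times) :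
    IsCompact (closure V ∩ slice S.interface t) := by
  have h : closure V ∩ slice S.interface t
      = (closure V \ slice (S.phase 0) t) \ slice (S.phase 1) t := by
    ext x
    constructor
    · intro h
      have := (hS.mem_interface_iff ht (hV.closure_subset h.1)).1 h.2
      exact ⟨⟨h.1, this 0⟩, this 1⟩
    · intro h
      refine ⟨h.1.1, (hS.mem_interface_iff ht (hV.closure_subset h.1.1)).2 fun i => ?_⟩
      fin_cases i
      exacts [h.1.2, h.2]
  rw [h]
  exact (hV.isCompact_closure.diff (hS.isOpen_slice _)).diff (hS.isOpen_slice _)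

theorem IsEvolvingInterface.measurableSet_slice (hS : S.IsEvolvingInterface) (ht : t ∈ S.times) :
    MeasurableSet (slice S.interface t) := by
  have h : slice S.interface t = (S.domain \ slice (S.phase 0) t) \ slice (S.phase 1) t := by
    ext x
    constructor
    · intro h
      have hd : (t, x) ∈ S.times ×ˢ S.domain := by rw [← hS.cover]; exact Or.inr h
      have := (hS.mem_interface_iff ht hd.2).1 h
      exact ⟨⟨hd.2, this 0⟩, this 1⟩
    · intro h
      refine (hS.mem_interface_iff ht h.1.1).2 fun i => ?_
      fin_cases i
      exacts [h.1.2, h.2]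
  rw [h]
  exact (hS.isOpen_domain.measurableSet.diff (hS.isOpen_slice _).measurableSet).diff
    (hS.isOpen_slice _).measurableSet

theorem IsRegularTestVolume.closure_inter_subset (hV : S.IsRegularTestVolume t V)
    (hS : S.IsEvolvingInterface) (ht : t ∈ S.times) (i : Fin 2) :
    closure (V ∩ slice (S.phase i) t) ⊆ closure V ∩ slice (S.closedPhase i) t := by
  have hsub : V ∩ slice (S.phase i) t ⊆ closure V ∩ slice (S.closedPhase i) t :=
    fun x hx => ⟨subset_closure hx.1, Or.inl hx.2⟩
  exact closure_minimal hsub (hV.isCompact_closedPhase hS ht i).isClosed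

theorem sign_gradient_eq {x : Space d} {ψ : Space d → ℝ}
    (hψ : IsHypersurfaceAt (slice S.interface t) (fun y => S.normal (t, y)) x ψ) (i : Fin 2) :
    ∇ (fun y => sign i * ψ y) x = (sign i * ‖∇ ψ x‖) • S.normal (t, x) := by
  have hn : S.normal (t, x) = ‖∇ ψ x‖⁻¹ • ∇ ψ x := hψ.mem_iff.self_of_nhds.2 hψ.mem
  have h0 : ‖∇ ψ x‖ ≠ 0 := norm_ne_zero_iff.2 hψ.gradient_ne_zero
  rw [gradient_smul_eq, hn, smul_smul, mul_assoc, mul_inv_cancel₀ h0, mul_one]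

/-- Inside the test volume, each phase is bounded by the interface. -/
theorem IsRegularTestVolume.isDefiningFunction (hV : S.IsRegularTestVolume t V) {x : Space d}
    {ψ : Space d → ℝ}
    (hψ : IsHypersurfaceAt (slice S.interface t) (fun y => S.normal (t, y)) x ψ) {i : Fin 2}
    (hside : ∀ᶠ y in 𝓝 x, (y ∈ slice (S.phase i) t ↔ sign i * ψ y < 0)) (hxV : x ∈ V) :
    IsDefiningFunction (V ∩ slice (S.phase i) t) x fun y => sign i * ψ y where
  contDiffAt := contDiffAt_const.mul (hψ.contDiffAt.of_le one_le_two)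
  eq_zero := by rw [hψ.mem_iff.self_of_nhds.1.1 hψ.mem, mul_zero]
  fderiv_ne_zero := by
    rw [Ne, ← gradient_eq_zero_iff, gradient_smul_eq, smul_eq_zero]
    exact not_or.2 ⟨sign_ne_zero i, hψ.gradient_ne_zero⟩
  mem_iff := by
    filter_upwards [hside, hV.isOpen.mem_nhds hxV] with y hy hyV
    exact ⟨fun h => hy.1 h.2, fun h => ⟨hyV, hy.2 h⟩⟩

/-- On the interface the external normal of phase `i` is `± ν`. -/
theorem IsRegularTestVolume.outerNormal_eq (hV : S.IsRegularTestVolume t V)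
    (hS : S.IsEvolvingInterface) {x : Space d} (hx : x ∈ V ∩ slice S.interface t) (i : Fin 2) :
    outerNormal (V ∩ slice (S.phase i) t) x = sign i • S.normal (t, x) := by
  obtain ⟨ψ, hψ, hside⟩ := hS.exists_isHypersurfaceAt hx.2
  rw [(hV.isDefiningFunction hψ (hside i) hx.1).outerNormal_eq, gradient_smul_eq]
  have hn : S.normal (t, x) = ‖∇ ψ x‖⁻¹ • ∇ ψ x := hψ.mem_iff.self_of_nhds.2 hψ.mem
  have h1 : |sign i| = 1 := by fin_cases i <;> simp [sign]
  rw [hn, norm_smul, Real.norm_eq_abs, h1, one_mul, smul_comm]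

/-- The part of the test volume in phase `i` is a region with corners. -/
theorem IsRegularTestVolume.exists_isCorner (hV : S.IsRegularTestVolume t V)
    (hS : S.IsEvolvingInterface) (ht : t ∈ S.times) {i : Fin 2} {x : Space d}
    (hx : x ∈ frontier (V ∩ slice (S.phase i) t)) :
    ∃ (n : ℕ) (ψ : Fin n → Space d → ℝ), IsCorner (V ∩ slice (S.phase i) t) x ψ := by
  have hWo : IsOpen (V ∩ slice (S.phase i) t) := hV.isOpen.inter (hS.isOpen_slice i)
  rw [hWo.frontier_eq] at hx
  obtain ⟨hxc, hxi⟩ := hV.closure_inter_subset hS ht i hx.1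
  rcases hxi with hxi | hxΓ
  · -- a boundary point inside the phase
    have hxV : x ∈ frontier V := by
      rw [hV.isOpen.frontier_eq]
      exact ⟨hxc, fun h => hx.2 ⟨h, hxi⟩⟩
    obtain ⟨n, ψ, h1, h2, h3⟩ := hV.boundary_bulk i x ⟨hxV, hxi⟩
    refine ⟨n, ψ, fun j => (h1 j).1.of_le one_le_two, fun j => (h1 j).2,
      linearIndependent_fderiv_iff.2 h2, ?_⟩
    filter_upwards [h3, (hS.isOpen_slice i).mem_nhds hxi] with y hy hyi
    exact ⟨fun h => hy.1 h.1, fun h => ⟨hy.2 h, hyi⟩⟩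
  · -- a boundary point on the interface, which adds a defining function of the phase to those of `V`
    obtain ⟨ψΓ, hψΓ, hside⟩ := hS.exists_isHypersurfaceAt hxΓ
    have hgpos : sign i * ‖∇ ψΓ x‖ ≠ 0 :=
      mul_ne_zero (sign_ne_zero i) (norm_ne_zero_iff.2 hψΓ.gradient_ne_zero)
    have hdef1 : ContDiffAt ℝ 1 (fun y => sign i * ψΓ y) x :=
      contDiffAt_const.mul (hψΓ.contDiffAt.of_le one_le_two)
    have hdef2 : sign i * ψΓ x = 0 := by rw [hψΓ.mem_iff.self_of_nhds.1.1 hψΓ.mem, mul_zero]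
    by_cases hxV : x ∈ V
    · have hdf := hV.isDefiningFunction hψΓ (hside i) hxV
      refine ⟨1, fun _ y => sign i * ψΓ y, fun _ => hdf.contDiffAt, fun _ => hdf.eq_zero, ?_, ?_⟩
      · exact linearIndependent_unique_iff.2 hdf.fderiv_ne_zero
      · filter_upwards [hdf.mem_iff] with y hy
        rw [hy]; simp
    · have hxf : x ∈ frontier V := by
        rw [hV.isOpen.frontier_eq]
        exact ⟨hxc, hxV⟩
      obtain ⟨n, ψ, h1, h2, h3⟩ := hV.boundary_interface i x ⟨hxf, hxΓ⟩
      refine ⟨n + 1, Fin.cons (fun y => sign i * ψΓ y) ψ, fun j => ?_, fun j => ?_, ?_, ?_⟩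
      · refine Fin.cases ?_ (fun j => ?_) j
        · exact hdef1
        · exact (h1 j).1.of_le one_le_two
      · refine Fin.cases ?_ (fun j => ?_) j
        · exact hdef2
        · exact (h1 j).2
      · rw [linearIndependent_fderiv_iff]
        have h4 := linearIndependent_cons_smul hgpos h2
        rw [← sign_gradient_eq hψΓ i] at h4
        convert h4 using 1
        ext1 j
        refine Fin.cases ?_ (fun j => ?_) j
        · rfl
        · rfl
      · rw [eventually_nhdsWithin_iff] at h3
        filter_upwards [hside i, h3] with y hy hy3
        rw [Fin.forall_fin_succ]
        simp only [Fin.cons_zero, Fin.cons_succ]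
        rw [← hy]
        exact ⟨fun h => ⟨h.2, (hy3 (Or.inl h.2)).1 h.1⟩, fun h => ⟨(hy3 (Or.inl h.1)).2 h.2, h.1⟩⟩

/-- The trace of the test volume on the interface has corners relative to the interface. -/
theorem IsRegularTestVolume.exists_isSurfaceCorner (hV : S.IsRegularTestVolume t V) {x : Space d}
    (hx : x ∈ frontier V ∩ slice S.interface t) :
    ∃ (n : ℕ) (ψ : Fin n → Space d → ℝ),
      IsSurfaceCorner (slice S.interface t) V (S.normal (t, x)) x ψ := by
  obtain ⟨n, ψ, h1, h2, h3⟩ := hV.boundary_interface 0 x hx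
  refine ⟨n, ψ, fun j => (h1 j).1.of_le one_le_two, fun j => (h1 j).2, fun c a hca => ?_,
    h3.filter_mono (nhdsWithin_mono x fun y hy => Or.inr hy)⟩
  rw [Fintype.linearIndependent_iff] at h2
  have h4 := h2 (Fin.cons (-a) c) (by
    rw [Fin.sum_univ_succ]
    simp only [Fin.cons_zero, Fin.cons_succ]
    rw [Finsupp.sum_fintype _ _ (by simp)] at hca
    rw [hca, neg_smul, neg_add_cancel])
  ext j
  simpa using h4 j.succ

end Regular

end TwoPhaseSystem

end SurfactantFlow

namespace SurfactantFlow

/-! ### Divergence theorems in a test volume -/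

namespace TwoPhaseSystem

open Set

variable {k : ℕ} {S : TwoPhaseSystem (k + 1)} {t : ℝ} {V : Set (Space (k + 1))}

/-- The boundary of a test volume meets the interface in a negligible set, by transversality. -/
theorem IsRegularTestVolume.measure_frontier_inter (hV : S.IsRegularTestVolume t V)
    (hS : S.IsEvolvingInterface) (ht : t ∈ S.times) :
    (μHE[k] : Measure (Space (k + 1))) (frontier V ∩ slice S.interface t) = 0 := by
  refine measure_null_of_locally_null _ fun x hx => ?_
  obtain ⟨ψΓ, hψΓ, hside⟩ := hS.exists_isHypersurfaceAt hx.2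
  have hcor : ∀ i, ∃ (n : ℕ) (ψ : Fin n → Space (k + 1) → ℝ),
      (∀ j, ContDiffAt ℝ 2 (ψ j) x ∧ ψ j x = 0) ∧
      LinearIndependent ℝ (Fin.cons (S.normal (t, x)) (fun j => ∇ (ψ j) x) :
        Fin (n + 1) → Space (k + 1)) ∧
      ∀ᶠ y in 𝓝[slice (S.closedPhase i) t] x, (y ∈ V ↔ ∀ j, ψ j y < 0) :=
    fun i => hV.boundary_interface i x hx
  choose n ψ h1 h2 h3 using hcor
  -- by transversality the gradient of `ψ i j` is not normal to the interface
  have hnull : ∀ i, ∀ j : Fin (n i), ∃ O ∈ 𝓝 x, (μHE[k] : Measure (Space (k + 1)))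
      (slice S.interface t ∩ O ∩ {y | ψ i j y = 0}) = 0 := fun i j => by
    refine hψΓ.exists_measure_zeroSet_eq_zero ((h1 i j).1.of_le one_le_two) fun a ha => ?_
    have h4 := Fintype.linearIndependent_iff.1 (h2 i) (Fin.cons (-a) (Pi.single j 1)) (by
      rw [Fin.sum_univ_succ]
      simp only [Fin.cons_zero, Fin.cons_succ]
      rw [Finset.sum_eq_single j (fun l _ hl => by simp [hl]) (by simp)]
      simp [ha]) j.succ
    simp at h4
  choose O hO hO0 using hnull
  -- a boundary point is a limit of points of `V` from one of the two closed phases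
  have hsub : ∀ᶠ y in 𝓝 x, y ∈ frontier V ∩ slice S.interface t → ∃ i j, ψ i j y = 0 := by
    have e1 : ∀ᶠ y in 𝓝 x, ∀ i, ∀ j, ContinuousAt (ψ i j) y := by
      rw [eventually_all]
      intro i
      rw [eventually_all]
      intro j
      exact ((h1 i j).1.eventually (by simp)).mono fun y hy => hy.continuousAt
    have e2 : ∀ᶠ y in 𝓝 x, ∀ i, y ∈ slice (S.closedPhase i) t → (y ∈ V ↔ ∀ j, ψ i j y < 0) := by
      rw [eventually_all]
      exact fun i => eventually_nhdsWithin_iff.1 (h3 i)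
    filter_upwards [e1, e2.eventually_nhds] with y hy1 hy2 hy
    obtain ⟨hyf, hyΓ⟩ := hy
    rw [hV.isOpen.frontier_eq] at hyf
    have hydom := hV.closure_subset hyf.1
    have hfr : ∃ i, ∃ᶠ z in 𝓝 y, z ∈ V ∧ z ∈ slice (S.closedPhase i) t := by
      have h4 : ∃ᶠ z in 𝓝 y, z ∈ V := mem_closure_iff_frequently.1 hyf.1
      have h5 : ∃ᶠ z in 𝓝 y, (z ∈ V ∧ z ∈ slice (S.closedPhase 0) t) ∨
          (z ∈ V ∧ z ∈ slice (S.closedPhase 1) t) := by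
        refine (h4.and_eventually (hS.isOpen_domain.mem_nhds hydom)).mono fun z hz => ?_
        rcases hS.mem_or (z := (t, z)) ht hz.2 with h | h | h
        exacts [Or.inl ⟨hz.1, Or.inl h⟩, Or.inr ⟨hz.1, Or.inl h⟩, Or.inl ⟨hz.1, Or.inr h⟩]
      rcases frequently_or_distrib.1 h5 with h | h
      exacts [⟨0, h⟩, ⟨1, h⟩]
    obtain ⟨i, hi⟩ := hfr
    have hle : ∀ j, ψ i j y ≤ 0 := fun j => by
      by_contra! hpos
      obtain ⟨z, ⟨hz1, hz2⟩, hz3⟩ := (hi.and_eventually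
        (((hy1 i j).eventually (lt_mem_nhds hpos)).and hy2)).exists
      exact absurd ((hz3.2 i hz2).1 hz1 j) (not_lt.2 hz3.1.le)
    have hnot : ¬∀ j, ψ i j y < 0 := fun h => hyf.2 ((hy2.self_of_nhds i (Or.inr hyΓ)).2 h)
    push Not at hnot
    obtain ⟨j, hj⟩ := hnot
    exact ⟨i, j, le_antisymm (hle j) hj⟩
  have hOall : ⋂ i, ⋂ j, O i j ∈ 𝓝 x := by
    rw [iInter_mem]
    intro i
    rw [iInter_mem]
    exact fun j => hO i j
  refine ⟨_, inter_mem self_mem_nhdsWithin (mem_nhdsWithin_of_mem_nhds (inter_mem hOall hsub)), ?_⟩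
  refine measure_mono_null (t := ⋃ i, ⋃ j, slice S.interface t ∩ O i j ∩ {y | ψ i j y = 0}) ?_
    (measure_iUnion_null fun i => measure_iUnion_null fun j => hO0 i j)
  rintro y ⟨hy, hyO, hyψ⟩
  obtain ⟨i, j, hij⟩ := hyψ hy
  exact mem_iUnion₂.2 ⟨i, j, ⟨hy.2, mem_iInter₂.1 hyO i j⟩, hij⟩

/-- The divergence theorem in the part of the test volume in phase `i`. -/
theorem IsRegularTestVolume.integral_div_eq (hV : S.IsRegularTestVolume t V)
    (hS : S.IsEvolvingInterface) (ht : t ∈ S.times) (i : Fin 2)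
    {w : Space (k + 1) → Space (k + 1)}
    (hw : ∀ x ∈ closure V ∩ slice (S.closedPhase i) t, ContDiffAt ℝ 1 w x) :
    IntegrableOn (fun x => ⟪w x, outerNormal (V ∩ slice (S.phase i) t) x⟫_ℝ)
      (S.outerBoundary i V t) μHE[k] ∧
    IntegrableOn (fun x => ⟪w x, S.normal (t, x)⟫_ℝ) (V ∩ slice S.interface t) μHE[k] ∧
    IntegrableOn (fun x => LinearMap.trace ℝ (Space (k + 1)) (fderiv ℝ w x))
      (V ∩ slice (S.phase i) t) ∧
    ∫ x in V ∩ slice (S.phase i) t, LinearMap.trace ℝ (Space (k + 1)) (fderiv ℝ w x)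
      = ∫ x in S.outerBoundary i V t, ⟪w x, outerNormal (V ∩ slice (S.phase i) t) x⟫_ℝ ∂μHE[k]
        + sign i * ∫ x in V ∩ slice S.interface t, ⟪w x, S.normal (t, x)⟫_ℝ ∂μHE[k] := by
  set W := V ∩ slice (S.phase i) t with hW
  have hWo : IsOpen W := hV.isOpen.inter (hS.isOpen_slice i)
  obtain ⟨h1, h2, h3⟩ := integral_trace_fderiv_eq_integral_frontier hWo
    (hV.isBounded.subset inter_subset_left) (fun x hx => hV.exists_isCorner hS ht hx)
    (fun x hx => hw x (hV.closure_inter_subset hS ht i hx))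
  have hΓm := hS.measurableSet_slice ht
  have hVΓm : MeasurableSet (V ∩ slice S.interface t) := hV.isOpen.measurableSet.inter hΓm
  have hVΓ : V ∩ slice S.interface t ⊆ frontier W ∩ slice S.interface t := fun x hx => by
    refine ⟨?_, hx.2⟩
    rw [hWo.frontier_eq]
    refine ⟨?_, fun h => hS.notMem_interface h.2 hx.2⟩
    obtain ⟨ψ, hψ, hside⟩ := hS.exists_isHypersurfaceAt hx.2
    have hdf := hV.isDefiningFunction hψ (hside i) hx.1
    -- the defining function is negative at points arbitrarily close to `x`
    rw [mem_closure_iff_frequently]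
    intro hcon
    have hmin : IsLocalMin (fun y => sign i * ψ y) x := by
      filter_upwards [hcon, hdf.mem_iff] with y hy1 hy2
      rw [hdf.eq_zero]
      exact not_lt.1 fun h => hy1 (hy2.2 h)
    exact hdf.fderiv_ne_zero hmin.fderiv_eq_zero
  have hdiff : (frontier W ∩ slice S.interface t) \ (V ∩ slice S.interface t)
      ⊆ frontier V ∩ slice S.interface t := by
    rintro x ⟨⟨hx1, hx2⟩, hx3⟩
    rw [hWo.frontier_eq] at hx1
    refine ⟨?_, hx2⟩
    rw [hV.isOpen.frontier_eq]
    exact ⟨(hV.closure_inter_subset hS ht i hx1.1).1, fun h => hx3 ⟨h, hx2⟩⟩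
  -- the part of the boundary on the interface is `V ∩ Γ` up to a null set
  have hae : (frontier W ∩ slice S.interface t : Set (Space (k + 1)))
      =ᵐ[(μHE[k] : Measure (Space (k + 1)))] (V ∩ slice S.interface t : Set (Space (k + 1))) := by
    refine ae_eq_set.2 ⟨measure_mono_null hdiff (hV.measure_frontier_inter hS ht), ?_⟩
    rw [sdiff_eq_empty.2 hVΓ]
    exact measure_empty
  have hsplit : frontier W = (frontier W \ slice S.interface t) ∪ (frontier W ∩ slice S.interface t) :=
    (sdiff_union_inter _ _).symm
  have hdis : Disjoint (frontier W \ slice S.interface t) (frontier W ∩ slice S.interface t) :=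
    disjoint_left.2 fun x hx hx' => hx.2 hx'.2
  have i1 : IntegrableOn (fun x => ⟪w x, outerNormal W x⟫_ℝ) (S.outerBoundary i V t) μHE[k] :=
    h1.mono_set sdiff_subset
  have i2 : IntegrableOn (fun x => ⟪w x, outerNormal W x⟫_ℝ) (frontier W ∩ slice S.interface t)
      μHE[k] := h1.mono_set inter_subset_left
  have i3 := (integrableOn_congr_set_ae hae).1 i2
  have hon : ∀ x ∈ V ∩ slice S.interface t,
      ⟪w x, outerNormal W x⟫_ℝ = sign i * ⟪w x, S.normal (t, x)⟫_ℝ := fun x hx => by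
    rw [hV.outerNormal_eq hS hx i, inner_smul_right]
  have i4 : IntegrableOn (fun x => sign i * ⟪w x, S.normal (t, x)⟫_ℝ) (V ∩ slice S.interface t)
      μHE[k] := i3.congr_fun hon hVΓm
  have i5 : IntegrableOn (fun x => ⟪w x, S.normal (t, x)⟫_ℝ) (V ∩ slice S.interface t) μHE[k] := by
    refine (i4.const_mul (sign i)).congr (Eventually.of_forall fun x => ?_)
    simp only
    rw [← mul_assoc, sign_mul_sign, one_mul]
  refine ⟨i1, i5, h2, ?_⟩
  rw [h3]
  conv_lhs => rw [hsplit]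
  rw [setIntegral_union hdis (isClosed_frontier.measurableSet.inter hΓm) i1 i2,
    setIntegral_congr_set hae, setIntegral_congr_fun hVΓm hon, integral_const_mul]
  rfl

end TwoPhaseSystem

end SurfactantFlow

namespace SurfactantFlow

/-! ### Balance of energy, pointwise -/

section ProductRules

variable {d : ℕ}

theorem differentiableAt_mk {F : Type*} [NormedAddCommGroup F] [NormedSpace ℝ F]
    {f : SpaceTime d → F} {z : SpaceTime d} (hf : DifferentiableAt ℝ f z) :
    DifferentiableAt ℝ (fun y => f (z.1, y)) z.2 :=
  (hasFDerivAt_comp_mk (t := z.1) (x := z.2) hf).differentiableAt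

theorem contDiffAt_mk {F : Type*} [NormedAddCommGroup F] [NormedSpace ℝ F]
    {f : SpaceTime d → F} {t : ℝ} {x : Space d} (hf : ContDiffAt ℝ 1 f (t, x)) :
    ContDiffAt ℝ 1 (fun y => f (t, y)) x :=
  hf.comp x (contDiffAt_const.prodMk contDiffAt_id)

theorem div_smul {f : SpaceTime d → ℝ} {w : SpaceTime d → Space d} {z : SpaceTime d}
    (hf : DifferentiableAt ℝ f z) (hw : DifferentiableAt ℝ w z) :
    div (fun y => f y • w y) z = f z * div w z + ⟪w z, grad f z⟫_ℝ := by
  rw [real_inner_comm, grad_inner]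
  exact trace_fderiv_smul (differentiableAt_mk hf) (differentiableAt_mk hw)

theorem spaceDeriv_sub {w w' : SpaceTime d → Space d} {z : SpaceTime d}
    (hw : DifferentiableAt ℝ w z) (hw' : DifferentiableAt ℝ w' z) :
    spaceDeriv (fun y => w y - w' y) z = spaceDeriv w z - spaceDeriv w' z :=
  fderiv_fun_sub (differentiableAt_mk hw) (differentiableAt_mk hw')

theorem spaceDeriv_add {w w' : SpaceTime d → Space d} {z : SpaceTime d}
    (hw : DifferentiableAt ℝ w z) (hw' : DifferentiableAt ℝ w' z) :
    spaceDeriv (fun y => w y + w' y) z = spaceDeriv w z + spaceDeriv w' z :=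
  fderiv_fun_add (differentiableAt_mk hw) (differentiableAt_mk hw')

theorem div_sub {w w' : SpaceTime d → Space d} {z : SpaceTime d}
    (hw : DifferentiableAt ℝ w z) (hw' : DifferentiableAt ℝ w' z) :
    div (fun y => w y - w' y) z = div w z - div w' z := by
  simp only [div]
  rw [spaceDeriv_sub hw hw', ContinuousLinearMap.toLinearMap_sub, map_sub]

/-- The adjoint as a real continuous linear map. -/
noncomputable def adjointL (d : ℕ) :
    (Space d →L[ℝ] Space d) →L[ℝ] (Space d →L[ℝ] Space d) :=
  LinearMap.toContinuousLinearMap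
    { toFun := fun A => ContinuousLinearMap.adjoint A
      map_add' := fun A B => map_add _ A B
      map_smul' := fun c A => by simp }

theorem adjointL_apply (A : Space d →L[ℝ] Space d) :
    adjointL d A = ContinuousLinearMap.adjoint A := rfl

theorem contDiffAt_adjoint_apply {T : SpaceTime d → Space d →L[ℝ] Space d}
    {v : SpaceTime d → Space d} {n : WithTop ℕ∞} {z : SpaceTime d} (hT : ContDiffAt ℝ n T z)
    (hv : ContDiffAt ℝ n v z) :
    ContDiffAt ℝ n (fun y => ContinuousLinearMap.adjoint (T y) (v y)) z :=
  ((adjointL d).contDiff.contDiffAt.comp z hT).clm_apply hv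

/-- The divergence of `Tᵀ v`. -/
theorem div_adjoint_apply {T : SpaceTime d → Space d →L[ℝ] Space d} {v : SpaceTime d → Space d}
    {z : SpaceTime d} (hT : DifferentiableAt ℝ T z) (hv : DifferentiableAt ℝ v z) :
    div (fun y => ContinuousLinearMap.adjoint (T y) (v y)) z
      = ⟪tensorDiv T z, v z⟫_ℝ + doubleContraction (T z) (spaceDeriv v z) := by
  have h1 : HasFDerivAt (fun y => adjointL d (T (z.1, y)))
      (adjointL d ∘L spaceDeriv T z) z.2 :=
    (adjointL d).hasFDerivAt.comp z.2 (differentiableAt_mk hT).hasFDerivAt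
  have h2 := h1.clm_apply (differentiableAt_mk hv).hasFDerivAt
  have h3 : spaceDeriv (fun y => ContinuousLinearMap.adjoint (T y) (v y)) z = _ := h2.fderiv
  rw [div, h3, doubleContraction, LinearMap.trace_eq_sum_inner _ (EuclideanSpace.basisFun (Fin d) ℝ),
    LinearMap.trace_eq_sum_inner _ (EuclideanSpace.basisFun (Fin d) ℝ), tensorDiv, sum_inner,
    ← Finset.sum_add_distrib]
  refine Finset.sum_congr rfl fun j _ => ?_
  simp only [EuclideanSpace.basisFun_apply, ContinuousLinearMap.coe_coe, add_apply,
    ContinuousLinearMap.comp_apply, ContinuousLinearMap.flip_apply, inner_add_right, adjointL_apply,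
    ContinuousLinearMap.adjoint_inner_right]
  rw [add_comm]
  rfl

theorem surfDiv_eq (ν w : SpaceTime d → Space d) (t : ℝ) (x : Space d) :
    surfDiv ν w (t, x) = tangentialTrace (ν (t, x)) (fderiv ℝ (fun y => w (t, y)) x) := rfl

theorem surfDiv_add {ν w w' : SpaceTime d → Space d} {z : SpaceTime d}
    (hw : DifferentiableAt ℝ w z) (hw' : DifferentiableAt ℝ w' z) :
    surfDiv ν (fun y => w y + w' y) z = surfDiv ν w z + surfDiv ν w' z := by
  simp only [surfDiv, div]
  rw [spaceDeriv_add hw hw', ContinuousLinearMap.toLinearMap_add, map_add, add_apply, inner_add_left]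
  ring

/-- The product rule for the surface divergence of a multiple of a tangential field. -/
theorem surfDiv_smul {f : SpaceTime d → ℝ} {ν w : SpaceTime d → Space d} {z : SpaceTime d}
    (hf : DifferentiableAt ℝ f z) (hw : DifferentiableAt ℝ w z) (hwν : ⟪w z, ν z⟫_ℝ = 0) :
    surfDiv ν (fun y => f y • w y) z = f z * surfDiv ν w z + ⟪w z, grad f z⟫_ℝ := by
  rw [real_inner_comm, grad_inner]
  exact tangentialTrace_fderiv_smul (differentiableAt_mk hf) (differentiableAt_mk hw) hwν

/-- The product rule for the surface divergence of a multiple of the unit normal. -/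
theorem surfDiv_smul_normal {f : SpaceTime d → ℝ} {ν : SpaceTime d → Space d} {z : SpaceTime d}
    (hf : DifferentiableAt ℝ f z) (hν : DifferentiableAt ℝ ν z) (hνz : ⟪ν z, ν z⟫_ℝ = 1) :
    surfDiv ν (fun y => f y • ν y) z = -(f z * meanCurvature ν z) := by
  have h1 : spaceDeriv (fun y => f y • ν y) z
      = f z • spaceDeriv ν z + (spaceDeriv f z).smulRight (ν z) :=
    fderiv_fun_smul (differentiableAt_mk hf) (differentiableAt_mk hν)
  simp only [meanCurvature, surfDiv]
  rw [div_smul hf hν, h1, real_inner_comm, grad_inner]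
  simp only [add_apply, smul_apply, ContinuousLinearMap.smulRight_apply, inner_add_left,
    inner_smul_left, hνz, conj_trivial]
  ring

theorem inner_tangentialPart_left (n w v : Space d) :
    ⟪tangentialPart n w, v⟫_ℝ = ⟪w, tangentialPart n v⟫_ℝ := by
  simp only [tangentialPart, inner_sub_left, inner_sub_right, inner_smul_left, inner_smul_right,
    conj_trivial]
  rw [real_inner_comm v n]
  ring

theorem tangentialPart_eq_self {n w : Space d} (h : ⟪w, n⟫_ℝ = 0) : tangentialPart n w = w := by
  rw [tangentialPart, h, zero_smul, sub_zero]

end ProductRules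

namespace TwoPhaseSystem

variable {d : ℕ} {S : TwoPhaseSystem d}

theorem contDiffAt_deriv {g : ℝ → ℝ} {A : Set ℝ} (hA : IsOpen A) (hg : ContDiffOn ℝ 2 g A) {s : ℝ}
    (hs : s ∈ A) : ContDiffAt ℝ 1 (deriv g) s := by
  have h1 : ContDiffAt ℝ 1 (fderiv ℝ g) s :=
    (hg.contDiffAt (hA.mem_nhds hs)).fderiv_right (by norm_num)
  exact h1.clm_apply contDiffAt_const

theorem IsSharpInterfaceModel.contDiffAt_bulkPotential (hS : S.IsSharpInterfaceModel) {i : Fin 2}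
    {z : SpaceTime d} (hz : z ∈ S.closedPhase i) : ContDiffAt ℝ 1 (S.bulkPotential i) z :=
  (contDiffAt_deriv (hS.energies.isOpen_bulkRange i) (hS.energies.bulk_smooth i)
    (hS.energies.conc_mem i z hz)).comp z (hS.smooth.conc i z hz)

theorem IsSharpInterfaceModel.contDiffAt_surfPotential (hS : S.IsSharpInterfaceModel)
    {z : SpaceTime d} (hz : z ∈ S.interface) : ContDiffAt ℝ 1 S.surfPotential z :=
  (contDiffAt_deriv hS.energies.isOpen_surfRange hS.energies.surf_smooth
    (hS.energies.surfConc_mem z hz)).comp z (hS.smooth.surfConc z hz)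

theorem IsSharpInterfaceModel.contDiffAt_bulkEnergy (hS : S.IsSharpInterfaceModel) {i : Fin 2}
    {z : SpaceTime d} (hz : z ∈ S.closedPhase i) :
    ContDiffAt ℝ 2 (S.bulkEnergy i) (S.conc i z) :=
  (hS.energies.bulk_smooth i).contDiffAt
    ((hS.energies.isOpen_bulkRange i).mem_nhds (hS.energies.conc_mem i z hz))

theorem IsSharpInterfaceModel.contDiffAt_surfEnergy (hS : S.IsSharpInterfaceModel)
    {z : SpaceTime d} (hz : z ∈ S.interface) : ContDiffAt ℝ 2 S.surfEnergy (S.surfConc z) :=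
  hS.energies.surf_smooth.contDiffAt
    (hS.energies.isOpen_surfRange.mem_nhds (hS.energies.surfConc_mem z hz))

theorem IsSharpInterfaceModel.contDiffAt_bulkEnergyDensity (hS : S.IsSharpInterfaceModel)
    {i : Fin 2} {z : SpaceTime d} (hz : z ∈ S.closedPhase i) :
    ContDiffAt ℝ 1 (S.bulkEnergyDensity i) z :=
  (contDiffAt_const.mul ((hS.smooth.velocity i z hz).norm_sq ℝ)).add
    (((hS.contDiffAt_bulkEnergy hz).of_le one_le_two).comp z (hS.smooth.conc i z hz))

theorem IsSharpInterfaceModel.contDiffAt_surfEnergyDensity (hS : S.IsSharpInterfaceModel)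
    {z : SpaceTime d} (hz : z ∈ S.interface) :
    ContDiffAt ℝ 1 (fun y => S.surfEnergy (S.surfConc y)) z :=
  ((hS.contDiffAt_surfEnergy hz).of_le one_le_two).comp z (hS.smooth.surfConc z hz)

theorem IsSharpInterfaceModel.contDiffAt_surfaceTension (hS : S.IsSharpInterfaceModel)
    {z : SpaceTime d} (hz : z ∈ S.interface) :
    ContDiffAt ℝ 1 (fun y => S.surfaceTension (S.surfConc y)) z :=
  (hS.contDiffAt_surfEnergyDensity hz).sub
    ((hS.smooth.surfConc z hz).mul (hS.contDiffAt_surfPotential hz))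

/-- The negative of the energy flux relative to the fluid, `Tᵀ v - G'(c) J`. -/
noncomputable def bulkPower (S : TwoPhaseSystem d) (i : Fin 2) (z : SpaceTime d) : Space d :=
  ContinuousLinearMap.adjoint (S.stress i z) (S.velocity i z) - S.bulkPotential i z • S.flux i z

/-- The negative of the energy flux along the interface, `-γ'(c) J_Γ + σ(c) v_τ`. -/
noncomputable def surfPower (S : TwoPhaseSystem d) (z : SpaceTime d) : Space d :=
  -S.surfPotential z • S.surfFlux z
    + S.surfaceTension (S.surfConc z) • tangentialPart (S.normal z) (S.velocity 0 z)

theorem IsSharpInterfaceModel.contDiffAt_bulkPower (hS : S.IsSharpInterfaceModel) {i : Fin 2}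
    {z : SpaceTime d} (hz : z ∈ S.closedPhase i) : ContDiffAt ℝ 1 (S.bulkPower i) z :=
  (contDiffAt_adjoint_apply (hS.smooth.stress i z hz) (hS.smooth.velocity i z hz)).sub
    ((hS.contDiffAt_bulkPotential hz).smul (hS.smooth.flux i z hz))

theorem IsSharpInterfaceModel.contDiffAt_tangentialVelocity (hS : S.IsSharpInterfaceModel)
    {z : SpaceTime d} (hz : z ∈ S.interface) :
    ContDiffAt ℝ 1 (fun y => tangentialPart (S.normal y) (S.velocity 0 y)) z :=
  (hS.smooth.velocity 0 z (Or.inr hz)).sub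
    (((hS.smooth.velocity 0 z (Or.inr hz)).inner ℝ (hS.geometry.smooth_normal z hz)).smul
      (hS.geometry.smooth_normal z hz))

theorem IsSharpInterfaceModel.contDiffAt_surfPower (hS : S.IsSharpInterfaceModel)
    {z : SpaceTime d} (hz : z ∈ S.interface) : ContDiffAt ℝ 1 S.surfPower z :=
  ((hS.contDiffAt_surfPotential hz).neg.smul (hS.smooth.surfFlux z hz)).add
    ((hS.contDiffAt_surfaceTension hz).smul (hS.contDiffAt_tangentialVelocity hz))

theorem IsEvolvingInterface.inner_normal_self (hS : S.IsEvolvingInterface) {z : SpaceTime d}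
    (hz : z ∈ S.interface) : ⟪S.normal z, S.normal z⟫_ℝ = 1 := by
  obtain ⟨ψ, -, hg, hmem⟩ := hS.hypersurface z hz
  rw [(hmem.self_of_nhds.2.2.2 hz).1, inner_smul_left, inner_smul_right, real_inner_self_eq_norm_sq,
    conj_trivial]
  have := norm_ne_zero_iff.2 hg
  field_simp

/-- Local balance of energy in a phase: energy is produced only by the flux of power, up to
dissipation. -/
theorem IsSharpInterfaceModel.materialDeriv_bulkEnergyDensity (hS : S.IsSharpInterfaceModel)
    {i : Fin 2} {z : SpaceTime d} (hz : z ∈ S.phase i) :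
    materialDeriv (S.velocity i) (S.bulkEnergyDensity i) z
      = div (S.bulkPower i) z - doubleContraction (S.stress i z) (spaceDeriv (S.velocity i) z)
        + ⟪S.flux i z, grad (S.bulkPotential i) z⟫_ℝ := by
  have hz' : z ∈ S.closedPhase i := Or.inl hz
  have hv := (hS.smooth.velocity i z hz').differentiableAt one_ne_zero
  have hc := (hS.smooth.conc i z hz').differentiableAt one_ne_zero
  have hT := (hS.smooth.stress i z hz').differentiableAt one_ne_zero
  have hJ := (hS.smooth.flux i z hz').differentiableAt one_ne_zero
  have hG := (hS.contDiffAt_bulkPotential hz').differentiableAt one_ne_zero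
  have hTv := (contDiffAt_adjoint_apply (hS.smooth.stress i z hz')
    (hS.smooth.velocity i z hz')).differentiableAt one_ne_zero
  have h1 : HasFDerivAt (S.bulkEnergyDensity i) _ z :=
    ((hv.hasFDerivAt.norm_sq).const_mul (S.density i / 2)).add
      (((hS.contDiffAt_bulkEnergy hz').differentiableAt two_ne_zero).hasDerivAt.comp_hasFDerivAt z
        hc.hasFDerivAt)
  have h2 : div (S.bulkPower i) z = _ := div_sub hTv (hG.smul hJ)
  rw [h2, div_adjoint_apply hT hv, div_smul hG hJ, ← hS.balance.momentum i z hz,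
    materialDeriv_eq _ h1.differentiableAt, h1.fderiv, materialDeriv_eq _ hv]
  have h3 := hS.balance.bulk_surfactant i z hz
  rw [materialDeriv_eq _ hc] at h3
  have h4 : div (S.flux i) z = -fderiv ℝ (S.conc i) z (1, S.velocity i z) := by linarith
  rw [h4]
  simp only [add_apply, smul_apply, ContinuousLinearMap.comp_apply, innerSL_apply_apply,
    inner_smul_left, conj_trivial, smul_eq_mul, nsmul_eq_mul, bulkPotential]
  rw [real_inner_comm (fderiv ℝ (S.velocity i) z (1, S.velocity i z))]
  push_cast
  ring

/-- Local balance of energy on the interface. -/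
theorem IsSharpInterfaceModel.materialDeriv_surfEnergyDensity (hS : S.IsSharpInterfaceModel)
    {z : SpaceTime d} (hz : z ∈ S.interface) :
    materialDeriv (S.velocity 0) (fun y => S.surfEnergy (S.surfConc y)) z
        + surfDiv S.normal (S.velocity 0) z * S.surfEnergy (S.surfConc z)
      = surfDiv S.normal S.surfPower z + ⟪S.surfFlux z, surfGrad S.normal S.surfPotential z⟫_ℝ
        - ⟪(S.surfaceTension (S.surfConc z) * meanCurvature S.normal z) • S.normal z
            + surfGrad S.normal (fun y => S.surfaceTension (S.surfConc y)) z, S.velocity 0 z⟫_ℝ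
        - S.surfPotential z * ⟪S.flux 1 z - S.flux 0 z, S.normal z⟫_ℝ := by
  have hνν := hS.geometry.inner_normal_self hz
  have hv := (hS.smooth.velocity 0 z (Or.inr hz)).differentiableAt one_ne_zero
  have hν := (hS.geometry.smooth_normal z hz).differentiableAt one_ne_zero
  have hc := (hS.smooth.surfConc z hz).differentiableAt one_ne_zero
  have hJ := (hS.smooth.surfFlux z hz).differentiableAt one_ne_zero
  have hG := (hS.contDiffAt_surfPotential hz).differentiableAt one_ne_zero
  have hσ := (hS.contDiffAt_surfaceTension hz).differentiableAt one_ne_zero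
  have hvτ := (hS.contDiffAt_tangentialVelocity hz).differentiableAt one_ne_zero
  have hvν := hv.inner ℝ hν
  -- split the velocity into its tangential and normal parts
  have h1 : surfDiv S.normal (S.velocity 0) z
      = surfDiv S.normal (fun y => tangentialPart (S.normal y) (S.velocity 0 y)) z
        - ⟪S.velocity 0 z, S.normal z⟫_ℝ * meanCurvature S.normal z := by
    have h2 := surfDiv_add (ν := S.normal)
      (w' := fun y => ⟪S.velocity 0 y, S.normal y⟫_ℝ • S.normal y) hvτ (hvν.smul hν)
    have h3 : (fun y => tangentialPart (S.normal y) (S.velocity 0 y)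
        + ⟪S.velocity 0 y, S.normal y⟫_ℝ • S.normal y) = S.velocity 0 := by
      funext y
      rw [tangentialPart, sub_add_cancel]
    have h4 := surfDiv_smul_normal hvν hν hνν
    rw [h3, h4] at h2
    rw [h2]
    ring
  have h2 : surfDiv S.normal S.surfPower z = _ :=
    surfDiv_add (ν := S.normal) (hG.neg.smul hJ) (hσ.smul hvτ)
  have h3 := surfDiv_smul (ν := S.normal) hG.neg hJ (hS.balance.surfFlux_tangential z hz)
  have h4 := surfDiv_smul (ν := S.normal) hσ hvτ (inner_tangentialPart_self hνν _)
  have h5 : grad (-S.surfPotential) z = -grad S.surfPotential z := by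
    refine ext_inner_right ℝ fun w => ?_
    rw [inner_neg_left, grad_inner, grad_inner]
    have : spaceDeriv (-S.surfPotential) z = -spaceDeriv S.surfPotential z :=
      fderiv_fun_neg
    rw [this, neg_apply]
  have h6 : materialDeriv (S.velocity 0) (fun y => S.surfEnergy (S.surfConc y)) z
      = S.surfPotential z * materialDeriv (S.velocity 0) S.surfConc z := by
    have h7 := ((hS.contDiffAt_surfEnergy hz).differentiableAt two_ne_zero).hasDerivAt.comp_hasFDerivAt
      z hc.hasFDerivAt
    have h8 : materialDeriv (S.velocity 0) (fun y => S.surfEnergy (S.surfConc y)) z = _ :=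
      materialDeriv_eq _ h7.differentiableAt
    rw [h8, materialDeriv_eq _ hc]
    change fderiv ℝ (S.surfEnergy ∘ S.surfConc) z _ = _
    rw [h7.fderiv]
    rfl
  have h7 := hS.balance.surf_surfactant z hz
  have h8 : materialDeriv (S.velocity 0) S.surfConc z
      = -surfDiv S.normal S.surfFlux z - ⟪S.flux 1 z - S.flux 0 z, S.normal z⟫_ℝ
        - S.surfConc z * surfDiv S.normal (S.velocity 0) z := by linarith
  have h9 : ⟪S.surfFlux z, surfGrad S.normal S.surfPotential z⟫_ℝ
      = ⟪S.surfFlux z, grad S.surfPotential z⟫_ℝ := by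
    rw [surfGrad, ← inner_tangentialPart_left,
      tangentialPart_eq_self (hS.balance.surfFlux_tangential z hz)]
  have h10 : ⟪surfGrad S.normal (fun y => S.surfaceTension (S.surfConc y)) z, S.velocity 0 z⟫_ℝ
      = ⟪tangentialPart (S.normal z) (S.velocity 0 z),
          grad (fun y => S.surfaceTension (S.surfConc y)) z⟫_ℝ := by
    rw [surfGrad, inner_tangentialPart_left, real_inner_comm]
  simp only [Pi.neg_apply] at h3
  rw [h6, h8, h2, h3, h4, h5, h9, inner_add_left, h10, h1, inner_neg_right, inner_smul_left,
    conj_trivial, real_inner_comm (S.velocity 0 z) (S.normal z)]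
  simp only [surfaceTension, surfPotential]
  ring

end TwoPhaseSystem

end SurfactantFlow

namespace SurfactantFlow

/-! ### The energy inequality -/

namespace TwoPhaseSystem

open Set

section Transport

variable {d : ℕ} {S : TwoPhaseSystem d} {t : ℝ} {V : ℝ → Set (Space d)}

/-- The transport theorem in a phase; the flow preserves volume. -/
theorem IsMaterialVolume.hasDerivAt_integral_phase (hS : S.IsSharpInterfaceModel)
    (hV : S.IsMaterialVolume V) (ht : t ∈ S.times) (hreg : S.IsRegularTestVolume t (V t))
    (i : Fin 2) {f : SpaceTime d → ℝ} (hf : ∀ z ∈ S.closedPhase i, ContDiffAt ℝ 1 f z) :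
    (∀ᶠ s in 𝓝 t, IntegrableOn (fun x => f (s, x)) (V s ∩ slice (S.phase i) s)) ∧
    IntegrableOn (fun x => materialDeriv (S.velocity i) f (t, x)) (V t ∩ slice (S.phase i) t) ∧
    HasDerivAt (fun s => ∫ x in V s ∩ slice (S.phase i) s, f (s, x))
      (∫ x in V t ∩ slice (S.phase i) t, materialDeriv (S.velocity i) f (t, x)) t := by
  obtain ⟨X, hX, -, hXV⟩ := hV.exists_flow hS ht
  have hWo : IsOpen (V t ∩ slice (S.phase i) t) := hreg.isOpen.inter (hS.geometry.isOpen_slice i)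
  have hT := isTransportable_of_isOpen (u := S.velocity i) (t := t) hWo
    (hreg.isCompact_closedPhase hS.geometry ht i)
    (fun x hx => ⟨subset_closure hx.1, Or.inl hx.2⟩)
    (fun x hx => hS.smooth.velocity i (t, x) hx.2)
  obtain ⟨h1, h2, h3⟩ := (hX i).hasDerivAt_integral_image hT (f := f) fun x hx => hf (t, x) hx.2
  rw [InnerProductSpace.euclideanHausdorffMeasure_eq_volume] at h2 h3
  simp only [InnerProductSpace.euclideanHausdorffMeasure_eq_volume] at h1
  have htn := hS.geometry.isOpen_times.mem_nhds ht
  have heq : ∀ x ∈ V t ∩ slice (S.phase i) t,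
      fderiv ℝ f (t, x) (1, S.velocity i (t, x))
        + LinearMap.trace ℝ (Space d) (fderiv ℝ (fun z => S.velocity i (t, z)) x) * f (t, x)
        = materialDeriv (S.velocity i) f (t, x) := fun x hx => by
    have h4 : LinearMap.trace ℝ (Space d) (fderiv ℝ (fun z => S.velocity i (t, z)) x) = 0 :=
      hS.balance.incompressible i (t, x) hx.2
    rw [h4, zero_mul, add_zero, materialDeriv_eq _ ((hf (t, x) (Or.inl hx.2)).differentiableAt
      one_ne_zero)]
  refine ⟨?_, h2.congr_fun heq hWo.measurableSet, ?_⟩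
  · filter_upwards [h1, htn] with s hs hst
    rwa [(hXV s hst).1 i]
  · rw [setIntegral_congr_fun hWo.measurableSet heq] at h3
    refine h3.congr_of_eventuallyEq ?_
    filter_upwards [htn] with s hst
    rw [(hXV s hst).1 i]

end Transport

variable {k : ℕ} {S : TwoPhaseSystem (k + 1)} {t : ℝ}

/-- The transport theorem on the interface. -/
theorem IsMaterialVolume.hasDerivAt_integral_interface {V : ℝ → Set (Space (k + 1))}
    (hS : S.IsSharpInterfaceModel) (hV : S.IsMaterialVolume V) (ht : t ∈ S.times)
    (hreg : S.IsRegularTestVolume t (V t)) {f : SpaceTime (k + 1) → ℝ}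
    (hf : ∀ z ∈ S.interface, ContDiffAt ℝ 1 f z) :
    (∀ᶠ s in 𝓝 t, IntegrableOn (fun x => f (s, x)) (V s ∩ slice S.interface s) μHE[k]) ∧
    IntegrableOn (fun x => materialDeriv (S.velocity 0) f (t, x)
      + surfDiv S.normal (S.velocity 0) (t, x) * f (t, x)) (V t ∩ slice S.interface t) μHE[k] ∧
    HasDerivAt (fun s => ∫ x in V s ∩ slice S.interface s, f (s, x) ∂μHE[k])
      (∫ x in V t ∩ slice S.interface t, (materialDeriv (S.velocity 0) f (t, x)
        + surfDiv S.normal (S.velocity 0) (t, x) * f (t, x)) ∂μHE[k]) t := by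
  obtain ⟨X, -, hX, hXV⟩ := hV.exists_flow hS ht
  have hm := hS.geometry.measurableSet_slice ht
  have hAm : MeasurableSet (V t ∩ slice S.interface t) := hreg.isOpen.measurableSet.inter hm
  have hmk : ∀ x : Space (k + 1), ContinuousAt (fun y : Space (k + 1) => (t, y)) x :=
    fun x => by fun_prop
  have hT := isTransportable_inter_hypersurface (u := S.velocity 0) (t := t)
    (ν := fun x => S.normal (t, x)) hreg.isOpen hm
    (hreg.isCompact_interface hS.geometry ht)
    (fun x hx => by
      obtain ⟨ψ, hψ, -⟩ := hS.geometry.exists_isHypersurfaceAt hx.2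
      exact ⟨ψ, hψ⟩)
    (fun x hx => ContinuousAt.comp (f := fun y : Space (k + 1) => (t, y))
      (hS.geometry.smooth_normal (t, x) hx.2).continuousAt (hmk x))
    (fun x hx => hS.smooth.velocity 0 (t, x) (Or.inr hx.2))
  obtain ⟨h1, h2, h3⟩ := hX.hasDerivAt_integral_image hT (f := f) fun x hx => hf (t, x) hx.2
  rw [finrank_euclideanSpace_fin] at h2 h3
  simp only [finrank_euclideanSpace_fin] at h1
  have htn := hS.geometry.isOpen_times.mem_nhds ht
  have heq : ∀ x ∈ V t ∩ slice S.interface t,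
      fderiv ℝ f (t, x) (1, S.velocity 0 (t, x))
        + tangentialTrace (S.normal (t, x)) (fderiv ℝ (fun z => S.velocity 0 (t, z)) x) * f (t, x)
        = materialDeriv (S.velocity 0) f (t, x)
          + surfDiv S.normal (S.velocity 0) (t, x) * f (t, x) := fun x hx => by
    rw [materialDeriv_eq _ ((hf (t, x) hx.2).differentiableAt one_ne_zero)]
    rfl
  refine ⟨?_, h2.congr_fun heq hAm, ?_⟩
  · filter_upwards [h1, htn] with s hs hst
    rwa [(hXV s hst).2]
  · rw [setIntegral_congr_fun hAm heq] at h3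
    refine h3.congr_of_eventuallyEq ?_
    filter_upwards [htn] with s hst
    rw [(hXV s hst).2]

/-- In dimension one the interface consists of isolated points, so that its parts have no
boundary. -/
theorem IsEvolvingInterface.interfaceBoundary_eq_empty {S : TwoPhaseSystem (0 + 1)}
    (hS : S.IsEvolvingInterface) (V : Set (Space (0 + 1))) : S.interfaceBoundary V t = ∅ := by
  rw [eq_empty_iff_forall_notMem]
  rintro x ⟨⟨hx, hx1⟩, hx2⟩
  obtain ⟨ψ, hψ, -⟩ := hS.exists_isHypersurfaceAt hx
  obtain ⟨P, -, g, hgx, hch⟩ := hψ.exists_isChart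
  obtain ⟨r, O, hc, hxO, -, -⟩ := hch univ univ_mem univ univ_mem
  have hO : ∀ y ∈ O, y ∈ slice S.interface t → y = x := fun y hy hyM => by
    rw [← (hc.mem_iff y hy).1 hyM, Subsingleton.elim (P.proj y) (P.proj x), hgx]
  rw [mem_closure_iff_nhds] at hx1 hx2
  obtain ⟨y, hyO, hy⟩ := hx1 O (hc.isOpen.mem_nhds hxO)
  obtain ⟨z, hzO, hz⟩ := hx2 O (hc.isOpen.mem_nhds hxO)
  rw [hO y hyO hy.2] at hy
  rw [hO z hzO hz.1] at hz
  exact hz.2 hy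

/-- The divergence theorem on the interface. -/
theorem IsRegularTestVolume.integral_surfDiv_eq {V : Set (Space (k + 1))}
    (hV : S.IsRegularTestVolume t V) (hS : S.IsEvolvingInterface) (ht : t ∈ S.times)
    {w : SpaceTime (k + 1) → Space (k + 1)} (hw : ∀ z ∈ S.interface, ContDiffAt ℝ 1 w z)
    (hwν : ∀ z ∈ S.interface, ⟪w z, S.normal z⟫_ℝ = 0) :
    IntegrableOn (fun x => ⟪w (t, x), outerConormal (slice S.interface t) (S.normal (t, x)) V x⟫_ℝ)
      (S.interfaceBoundary V t) μHE[k - 1] ∧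
    IntegrableOn (fun x => surfDiv S.normal w (t, x)) (V ∩ slice S.interface t) μHE[k] ∧
    ∫ x in V ∩ slice S.interface t, surfDiv S.normal w (t, x) ∂μHE[k]
      = ∫ x in S.interfaceBoundary V t,
          ⟪w (t, x), outerConormal (slice S.interface t) (S.normal (t, x)) V x⟫_ℝ ∂μHE[k - 1] := by
  cases k with
  | zero =>
    -- in dimension one the surface divergence is a sum over an empty basis
    have h0 : ∀ x ∈ V ∩ slice S.interface t, surfDiv S.normal w (t, x) = 0 := fun x hx => by
      have hνν := hS.inner_normal_self hx.2
      obtain ⟨ψ, hψ, -⟩ := hS.exists_isHypersurfaceAt hx.2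
      obtain ⟨P, hP, -⟩ := hψ.exists_isChart
      rw [surfDiv_eq, show S.normal (t, x) = P.dir from hP.symm,
        P.tangentialTrace_dir_eq _ (EuclideanSpace.basisFun (Fin 0) ℝ)]
      simp
    have hm : MeasurableSet (V ∩ slice S.interface t) :=
      hV.isOpen.measurableSet.inter (hS.measurableSet_slice ht)
    rw [hS.interfaceBoundary_eq_empty, setIntegral_congr_fun hm h0]
    refine ⟨integrableOn_empty, ?_, by simp⟩
    exact integrableOn_zero.congr_fun (fun x hx => (h0 x hx).symm) hm
  | succ m =>
    refine integral_tangentialTrace_eq_integral_relBoundary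
      (ν := fun x => S.normal (t, x)) (w := fun x => w (t, x)) hV.isOpen hV.isBounded
      (hS.measurableSet_slice ht) (fun x hx hxM => ?_) (fun x hx => ?_)
      (fun x hx => hV.exists_isSurfaceCorner hx) (fun x hx => contDiffAt_mk (hw (t, x) hx.2))
      fun x hx => hwν (t, x) hx
    · rw [hS.mem_interface_iff ht (hV.closure_subset hx)] at hxM
      push Not at hxM
      obtain ⟨i, hi⟩ := hxM
      filter_upwards [(hS.isOpen_slice i).mem_nhds hi] with y hy using hS.notMem_interface hy
    · obtain ⟨ψ, hψ, -⟩ := hS.exists_isHypersurfaceAt hx.2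
      exact ⟨ψ, hψ⟩

/-- The energy flux along the interface is tangential. -/
theorem IsSharpInterfaceModel.inner_surfPower_normal {d : ℕ} {S : TwoPhaseSystem d}
    (hS : S.IsSharpInterfaceModel) {z : SpaceTime d} (hz : z ∈ S.interface) :
    ⟪S.surfPower z, S.normal z⟫_ℝ = 0 := by
  rw [surfPower, inner_add_left, inner_smul_left, inner_smul_left,
    hS.balance.surfFlux_tangential z hz,
    inner_tangentialPart_self (hS.geometry.inner_normal_self hz)]
  simp

/-- On the interface, the power supplied by the two fluids does not exceed what the surface energy
absorbs. -/
theorem SignConditions.interface_le {d : ℕ} {S : TwoPhaseSystem d} (hS : S.IsSharpInterfaceModel)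
    (hC : S.SignConditions) {z : SpaceTime d} (hz : z ∈ S.interface) :
    ⟪S.bulkPower 0 z, S.normal z⟫_ℝ - ⟪S.bulkPower 1 z, S.normal z⟫_ℝ
      + (materialDeriv (S.velocity 0) (fun y => S.surfEnergy (S.surfConc y)) z
        + surfDiv S.normal (S.velocity 0) z * S.surfEnergy (S.surfConc z))
      ≤ surfDiv S.normal S.surfPower z := by
  have h1 := hC.surf_diffusion z hz
  have h2 := hC.adsorption 0 z hz
  have h3 := hC.adsorption 1 z hz
  have h4 := hC.stress_jump z hz
  rw [hS.materialDeriv_surfEnergyDensity hz]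
  simp only [bulkPower, inner_sub_left, inner_smul_left, conj_trivial,
    ContinuousLinearMap.adjoint_inner_left, ← hS.balance.no_slip z hz, stressJump, inner_neg_left,
    inner_add_left] at h4 ⊢
  rw [real_inner_comm (S.velocity 0 z), real_inner_comm (S.velocity 0 z)] at h4
  simp at h2 h3
  linarith

/-- The energy inequality follows from the sign conditions. -/
theorem SignConditions.energyInequality (hS : S.IsSharpInterfaceModel) (hC : S.SignConditions) :
    S.EnergyInequality := by
  intro V hV t ht hreg
  have hB := fun i => hV.hasDerivAt_integral_phase hS ht hreg i
    (fun z hz => hS.contDiffAt_bulkEnergyDensity (i := i) hz)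
  obtain ⟨hΓ1, hΓ2, hΓ3⟩ := hV.hasDerivAt_integral_interface hS ht hreg
    (fun z hz => hS.contDiffAt_surfEnergyDensity hz)
  have hD := fun i => hreg.integral_div_eq hS.geometry ht i (w := fun x => S.bulkPower i (t, x))
    fun x hx => contDiffAt_mk (hS.contDiffAt_bulkPower hx.2)
  obtain ⟨hE1, hE2, hE3⟩ := hreg.integral_surfDiv_eq hS.geometry ht
    (fun z hz => hS.contDiffAt_surfPower hz) fun z hz => hS.inner_surfPower_normal hz
  have hsurf : ∀ x, ⟪S.surfPower (t, x),
      outerConormal (slice S.interface t) (S.normal (t, x)) (V t) x⟫_ℝ = S.surfWorking (V t) t x :=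
    fun x => by
    simp only [surfPower, surfWorking, inner_add_left, inner_smul_left, conj_trivial]
    ring
  simp only [hsurf] at hE1 hE3
  refine ⟨?_, ⟨fun i => (hD i).1, hE1⟩, _, (HasDerivAt.fun_sum fun i _ => (hB i).2.2).add hΓ3, ?_⟩
  · have h1 : ∀ᶠ s in 𝓝 t, ∀ i,
        IntegrableOn (fun x => S.bulkEnergyDensity i (s, x)) (V s ∩ slice (S.phase i) s) :=
      eventually_all.2 fun i => (hB i).1
    filter_upwards [h1, hΓ1] with s hs1 hs2 using ⟨hs1, hs2⟩
  -- in the phases, the dissipation is dropped and the power is integrated by parts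
  have hbulk : ∀ i, ∫ x in V t ∩ slice (S.phase i) t,
      materialDeriv (S.velocity i) (S.bulkEnergyDensity i) (t, x)
      ≤ ∫ x in S.outerBoundary i (V t) t, S.bulkWorking i (V t) t x ∂μHE[k]
        + sign i * ∫ x in V t ∩ slice S.interface t,
            ⟪S.bulkPower i (t, x), S.normal (t, x)⟫_ℝ ∂μHE[k] := fun i => by
    refine le_trans ?_ (le_of_eq (hD i).2.2.2)
    refine setIntegral_mono_on (hB i).2.1 (hD i).2.2.1
      (hreg.isOpen.inter (hS.geometry.isOpen_slice i)).measurableSet fun x hx => ?_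
    rw [hS.materialDeriv_bulkEnergyDensity hx.2]
    have h1 := hC.stress_power i (t, x) hx.2
    have h2 := hC.bulk_diffusion i (t, x) hx.2
    have h3 : div (S.bulkPower i) (t, x)
        = LinearMap.trace ℝ (Space (k + 1)) (fderiv ℝ (fun x => S.bulkPower i (t, x)) x) := rfl
    linarith
  have hm : MeasurableSet (V t ∩ slice S.interface t) :=
    hreg.isOpen.measurableSet.inter (hS.geometry.measurableSet_slice ht)
  -- on the interface, the power from both sides is collected together with the surface energy
  have hint := setIntegral_mono_on ((((hD 0).2.1).sub (hD 1).2.1).add hΓ2) hE2 hm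
    fun x hx => hC.interface_le hS hx.2
  have e1 := integral_add ((hD 0).2.1.sub (hD 1).2.1) hΓ2
  have e2 := integral_sub (hD 0).2.1 (hD 1).2.1
  have hb0 := hbulk 0
  have hb1 := hbulk 1
  rw [sign_zero, one_mul] at hb0
  rw [sign_one, neg_one_mul] at hb1
  rw [working, Fin.sum_univ_two, Fin.sum_univ_two]
  simp only [Pi.add_apply, Pi.sub_apply] at hint e1 e2
  rw [e1, e2, hE3] at hint
  have hk : k + 1 - 2 = k - 1 := by omega
  rw [hk]
  simp only [Nat.add_sub_cancel]
  linarith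

theorem doubleContraction_eq_sum {d : ℕ} (A B : Space d →L[ℝ] Space d) :
    doubleContraction A B = ∑ j, ⟪A (EuclideanSpace.basisFun (Fin d) ℝ j),
      B (EuclideanSpace.basisFun (Fin d) ℝ j)⟫_ℝ := by
  rw [doubleContraction, LinearMap.trace_eq_sum_inner _ (EuclideanSpace.basisFun (Fin d) ℝ)]
  refine Finset.sum_congr rfl fun j _ => ?_
  rw [ContinuousLinearMap.coe_coe, ContinuousLinearMap.comp_apply,
    ContinuousLinearMap.adjoint_inner_right]

theorem doubleContraction_adjoint {d : ℕ} (A : Space d →L[ℝ] Space d) :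
    doubleContraction (ContinuousLinearMap.adjoint A) (ContinuousLinearMap.adjoint A)
      = doubleContraction A A := by
  have h := LinearMap.trace_mul_comm ℝ (A : Space d →ₗ[ℝ] Space d)
    (ContinuousLinearMap.adjoint A : Space d →ₗ[ℝ] Space d)
  rw [doubleContraction, doubleContraction, ContinuousLinearMap.adjoint_adjoint]
  exact h

/-- The stress power of an incompressible Newtonian fluid is `2 η |D(v)|²`: the pressure does no
work, and `D(v) : ∇v = |D(v)|²`. -/
theorem doubleContraction_newtonian {d : ℕ} {v : SpaceTime d → Space d} {z : SpaceTime d}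
    (hv : div v z = 0) {p η : ℝ} :
    doubleContraction (-(p • ContinuousLinearMap.id ℝ (Space d)) + (2 * η) • rateOfDeformation v z)
        (spaceDeriv v z)
      = 2 * η * ∑ j, ⟪rateOfDeformation v z (EuclideanSpace.basisFun (Fin d) ℝ j),
          rateOfDeformation v z (EuclideanSpace.basisFun (Fin d) ℝ j)⟫_ℝ := by
  set L := spaceDeriv v z with hL
  set e := EuclideanSpace.basisFun (Fin d) ℝ with he
  have htr : ∑ j, ⟪e j, L (e j)⟫_ℝ = 0 := by
    rw [div, LinearMap.trace_eq_sum_inner _ e] at hv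
    exact hv
  have hsymm : ∑ j, ⟪ContinuousLinearMap.adjoint L (e j), ContinuousLinearMap.adjoint L (e j)⟫_ℝ
      = ∑ j, ⟪L (e j), L (e j)⟫_ℝ := by
    rw [← doubleContraction_eq_sum, ← doubleContraction_eq_sum, doubleContraction_adjoint]
  have hrd : ∀ j, rateOfDeformation v z (e j)
      = (1 / 2 : ℝ) • (L (e j) + ContinuousLinearMap.adjoint L (e j)) := fun j => rfl
  have h1 : ∀ j, ⟪(-(p • ContinuousLinearMap.id ℝ (Space d))
      + (2 * η) • rateOfDeformation v z) (e j), L (e j)⟫_ℝ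
      = -p * ⟪e j, L (e j)⟫_ℝ + η * (⟪L (e j), L (e j)⟫_ℝ
        + ⟪ContinuousLinearMap.adjoint L (e j), L (e j)⟫_ℝ) := fun j => by
    rw [add_apply, neg_apply, smul_apply, smul_apply, hrd, ContinuousLinearMap.id_apply]
    simp only [inner_add_left, inner_neg_left, inner_smul_left, conj_trivial]
    ring
  have h2 : ∀ j, ⟪rateOfDeformation v z (e j), rateOfDeformation v z (e j)⟫_ℝ
      = 1 / 4 * (⟪L (e j), L (e j)⟫_ℝ + 2 * ⟪ContinuousLinearMap.adjoint L (e j), L (e j)⟫_ℝ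
        + ⟪ContinuousLinearMap.adjoint L (e j), ContinuousLinearMap.adjoint L (e j)⟫_ℝ) :=
    fun j => by
    rw [hrd]
    simp only [inner_add_left, inner_add_right, inner_smul_left, inner_smul_right, conj_trivial]
    rw [real_inner_comm (ContinuousLinearMap.adjoint L (e j)) (L (e j))]
    ring
  rw [doubleContraction_eq_sum, Finset.sum_congr rfl fun j _ => h1 j,
    Finset.sum_congr rfl fun j _ => h2 j, Finset.sum_add_distrib, ← Finset.mul_sum,
    ← Finset.mul_sum, ← Finset.mul_sum, htr, Finset.sum_add_distrib, Finset.sum_add_distrib,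
    Finset.sum_add_distrib, hsymm, ← Finset.mul_sum]
  ring

/-- The constitutive laws imply the sign conditions. -/
theorem ConstitutiveLaws.signConditions {d : ℕ} {S : TwoPhaseSystem d}
    (hS : S.IsSharpInterfaceModel) {p : Fin 2 → SpaceTime d → ℝ} {η : Fin 2 → ℝ}
    {M : Fin 2 → ℝ → ℝ} {MΓ : ℝ → ℝ} {α : Fin 2 → ℝ → ℝ → ℝ}
    (h : S.ConstitutiveLaws p η M MΓ α) : S.SignConditions where
  bulk_diffusion i z hz := by
    rw [h.bulk_flux i z hz, inner_neg_left, inner_smul_left, conj_trivial]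
    have := (h.mobility_pos i _ (hS.energies.conc_mem i z (Or.inl hz))).le
    have h2 : 0 ≤ ⟪grad (S.bulkPotential i) z, grad (S.bulkPotential i) z⟫_ℝ :=
      real_inner_self_nonneg
    linarith [mul_nonneg this h2]
  stress_power i z hz := by
    rw [h.newtonian i z hz, doubleContraction_newtonian (hS.balance.incompressible i z hz)]
    exact mul_nonneg (mul_nonneg zero_le_two (h.viscosity_nonneg i))
      (Finset.sum_nonneg fun j _ => real_inner_self_nonneg)
  surf_diffusion z hz := by
    rw [h.surf_flux z hz, inner_neg_left, inner_smul_left, conj_trivial]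
    have := (h.surfMobility_pos _ (hS.energies.surfConc_mem z hz)).le
    have h2 : 0 ≤ ⟪surfGrad S.normal S.surfPotential z, surfGrad S.normal S.surfPotential z⟫_ℝ :=
      real_inner_self_nonneg
    linarith [mul_nonneg this h2]
  adsorption i z hz := by
    have h1 := h.adsorption i z hz
    have h2 := h.kinetic_nonneg i _ (hS.energies.surfConc_mem z hz) _
      (hS.energies.conc_mem i z (Or.inr hz))
    have h3 : S.surfPotential z - S.bulkPotential i z
        = -(α i (S.surfConc z) (S.conc i z) * ((-1) ^ (i : ℕ) * ⟪S.flux i z, S.normal z⟫_ℝ)) := by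
      rw [← mul_assoc, h1, neg_neg]
    rw [h3]
    nlinarith [mul_nonneg h2 (mul_self_nonneg ((-1) ^ (i : ℕ) * ⟪S.flux i z, S.normal z⟫_ℝ))]
  stress_jump z hz := by
    rw [h.stress_balance z hz]
    simp

end TwoPhaseSystem

end SurfactantFlow

theorem mainTheorem3 (d : ℕ) (hd_pos : 1 ≤ d) (hd_le : d ≤ 3)
    (S : SurfactantFlow.TwoPhaseSystem d) (hS : S.IsSharpInterfaceModel) :
    (S.SignConditions → S.EnergyInequality) ∧
    (∀ (p : Fin 2 → SurfactantFlow.SpaceTime d → ℝ) (η : Fin 2 → ℝ) (M : Fin 2 → ℝ → ℝ)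
        (MΓ : ℝ → ℝ) (α : Fin 2 → ℝ → ℝ → ℝ),
      S.ConstitutiveLaws p η M MΓ α → S.SignConditions ∧ S.EnergyInequality) := by
  obtain ⟨k, rfl⟩ := Nat.exists_eq_add_of_le' hd_pos
  have h : S.SignConditions → S.EnergyInequality := fun hC => hC.energyInequality hS
  exact ⟨h, fun p η M MΓ α hlaws =>
    ⟨hlaws.signConditions hS, h (hlaws.signConditions hS)⟩⟩
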